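/- **Setting.** Let $p$ be a prime, $K\subset\overline{\mathbf Q}_p$ a finite extension of $\mathbf Q_p$, $\chi$ the $p$-adic cyclotomic character, $H_K=\ker(\chi|_{G_K})$ and $\Gamma_K=G_K/H_K$. Let $v$ be the valuation of $\mathbf C_p^\flat$ with $v(p^\flat)=1$, let $\varepsilon=(1,\zeta_p,\zeta_{p^2},\dots)\in\mathcal O_{\mathbf C_p}^\flat$ be given by a compatible system of primitive $p$-power roots of unity, and put $\widetilde{\mathbf A}=W(\mathbf C_p^\flat)$ and $\pi=[\varepsilon]-1$. Let $\mathbf A\subset\widetilde{\mathbf A}$ be the $p$-adic completion of the maximal unramified extension of $\mathbf A_{\mathbf Q_p}=\mathbf Z_p[\![\pi]\!][1/\pi]^\wedge_p$ in $\widetilde{\mathbf A}$, $\mathbf A_K=\mathbf A^{H_K}$, $\mathbf E_K=\mathbf A_K/p\subset\mathbf C_p^\flat$, and $\mathbf E_{\mathbf Q_p}=\mathbf A_{\mathbf Q_p}/p=\mathbf F_p(\!(\varepsilon-1)\!)$. Let $\mathfrak d$ be the different of $\mathbf E_K/\mathbf E_{\mathbf Q_p}$, and $r_K=(2v(\mathfrak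 d))^{-1}$ if this extension is ramified, $r_K=1$ otherwise. Fix a uniformizer $\overline\pi_K$ of $\mathbf E_K$ and a lift $\pi_K\in\mathbf A_K$ of it which, for each $0<r<r_K$, is a unit of the ring $\Lambda_{[0,r],K}$ defined below and has $\mathrm{val}^{[0,r]}(\pi_K)=-\mathrm{val}^{[0,r]}(\pi_K^{-1})=v(\overline\pi_K)$. For $r>0$ put $$\Lambda_{[0,r],K}=\Big\{x=\sum_{k\ge0}p^k[x_k]\in\mathbf A_K:\ v(x_k)+k/r\to\infty\Big\},\qquad \mathrm{val}^{[0,r]}(x)=\inf_k\,(v(x_k)+k/r),$$ and let $\Lambda_{[0,r],K}^\circ$ be its subring $\{\mathrm{val}^{[0,r]}\ge0\}$. Let $m,m'\ge1$ be coprime, $\lambda=m'/m$, and $D_\lambda^\circ=\mathbf Z_p[\![u]\!]\langle p^m/u^{m'}\rangle$. Let $R_0$ be a quotient of some $D_\lambda^\circ\langle X_1,\dots,X_N\rangle$ in which (the image of) $u$ is not a zero divisor. Let $0<b<r_K\lambda$ be such that $s:=1/(b\,v(\overline\pi_K))$ is an integer. For $n\ge0$, let $\Lambda_{R_0,[0,b/p^n],K}$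 be the Tate ring $$\Lambda_{R_0,[0,b/p^n],K}=\Big(\big(R_0\widehat\otimes_{\mathbf Z_p}\Lambda^\circ_{[0,b/(\lambda p^n)],K}\big)\Big\langle \frac{u}{\pi_K^{sp^n}}\Big\rangle\Big)\Big[\frac1{\pi_K}\Big],$$ that is: take the subring of $R_0\otimes_{\mathbf Z_p}\widetilde{\mathbf A}$ generated by $R_0$, $\Lambda^\circ_{[0,b/(\lambda p^n)],K}$ and $u/\pi_K^{sp^n}$, complete it $\pi_K$-adically, and invert $\pi_K$. The maps induced by $\widetilde{\mathbf A}$ are: the restriction maps $\Lambda_{R_0,[0,b/p^m],K}\to\Lambda_{R_0,[0,b/p^n],K}$ for $m\le n$, the action of $\Gamma_K$ on each $\Lambda_{R_0,[0,b/p^n],K}$, and the Frobenius $\varphi:\Lambda_{R_0,[0,b/p^n],K}\to\Lambda_{R_0,[0,b/p^{n+1}],K}$. Let $D$ be a $(\varphi,\Gamma_K)$-module over $\Lambda_{R_0,[0,b],K}$, that is, a finite $\Lambda_{R_0,[0,b],K}$-module with its canonical topology, equipped with a continuous semilinear action of $\Gamma_K$ and a $\varphi$-semilinear map $\varphi_D:D\to\Lambda_{R_0,[0,b/p],K}\otimes_{\Lambda_{R_0,[0,b],K}}D$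 which commutes with $\Gamma_K$ and whose linearization $\Lambda_{R_0,[0,b/p],K}\otimes_{\varphi,\Lambda_{R_0,[0,b],K}}D\to\Lambda_{R_0,[0,b/p],K}\otimes_{\Lambda_{R_0,[0,b],K}}D$ is an isomorphism. Write $D_n=\Lambda_{R_0,[0,b/p^n],K}\otimes_{\Lambda_{R_0,[0,b],K}}D$, with its canonical topology. Then $\Gamma_K$ acts on $D_n$, there are induced maps $\varphi:D_n\to D_{n+1}$, every element of $D_{n+1}$ is uniquely of the form $\sum_{j=0}^{p-1}[\varepsilon]^j\varphi(c_j)$ with $c_j\in D_n$, and $\psi:D_{n+1}\to D_n$ is the map $\sum_j[\varepsilon]^j\varphi(c_j)\mapsto c_0$. **Proposition.** For every $\gamma\in\Gamma_K$ of infinite order there is an $n\ge1$ such that $\gamma-1$ acts bijectively on $D_n^{\psi=0}$, with continuous inverse. More precisely, there is an $n_0$, depending only on the $(\varphi,\Gamma_K)$-module $D$, such that for every $\gamma\in\Gamma_K$ of infinite order and every $n\ge \max(n_0+1,\,v_p(\chi(\gamma)^{2(p-1)}-1))$, the operator $\gamma-1$ acts bijectively on $D_n^{\psi=0}$, with continuous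 inverse. -/

import Mathlib

open scoped NNReal TensorProduct

noncomputable section

namespace PseudoPhiGamma

/-! ### The tilt of `ℂ_p`, its absolute value, and the Galois action -/

section Tilt

variable (p : ℕ) [Fact p.Prime]

theorem valuation_eq_nnnorm (x : ℂ_[p]) : (Valued.v x : ℝ≥0) = ‖x‖₊ := by
  ext
  rw [coe_nnnorm, PadicComplex.norm_eq_norm, Valuation.norm_def, PadicComplex.RankOne.hom_eq_embedding]
  rw [Valuation.embedding_restrict]

theorem not_isUnit_natCast : ¬ IsUnit (p : 𝓞_ℂ_[p]) := by
  intro h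
  have h1 := (PadicComplexInt.integers p).one_of_isUnit h
  rw [map_natCast, PadicComplex.valuation_p] at h1
  have hp : (1 : ℝ≥0) < p := by exact_mod_cast (Fact.out : p.Prime).one_lt
  rw [one_div] at h1
  exact hp.ne' (inv_eq_one.mp h1)

instance : Fact (¬ IsUnit (p : 𝓞_ℂ_[p])) := ⟨not_isUnit_natCast p⟩

/-- `𝒪_{ℂ_p}^♭`. -/
abbrev OFlat : Type := PreTilt 𝓞_ℂ_[p] p

instance : IsDomain (OFlat p) :=
  PreTilt.isDomain ℂ_[p] (PadicComplex.valued p).v 𝓞_ℂ_[p] (PadicComplexInt.integers p) p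

/-- The multiplicative absolute value `x ↦ |x^{(0)}|` of `𝒪_{ℂ_p}^♭`, normalized by `|p| = 1/p`. -/
def oFlatVal : Valuation (OFlat p) ℝ≥0 :=
  PreTilt.val ℂ_[p] (PadicComplex.valued p).v 𝓞_ℂ_[p] (PadicComplexInt.integers p) p

/-- The field `ℂ_p^♭`, the fraction field of `𝒪_{ℂ_p}^♭`. -/
abbrev CFlat : Type := FractionRing (OFlat p)

instance : CharP (CFlat p) p :=
  charP_of_injective_algebraMap (IsFractionRing.injective (OFlat p) (CFlat p)) p

theorem nonZeroDivisors_le_primeCompl :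
    nonZeroDivisors (OFlat p) ≤ (oFlatVal p).supp.primeCompl := by
  intro x hx h
  have h0 : oFlatVal p x = 0 := h
  exact nonZeroDivisors.ne_zero hx ((PreTilt.map_eq_zero (PadicComplexInt.integers p)).mp h0)

/-- The multiplicative absolute value of `ℂ_p^♭`; it is `p ^ (-v(x))`, with `v(p^♭) = 1`. -/
def flatVal : Valuation (CFlat p) ℝ≥0 :=
  (oFlatVal p).extendToLocalization (nonZeroDivisors_le_primeCompl p) (CFlat p)

/-- The additive valuation of `ℂ_p^♭` on nonzero elements, normalized by `v(p^♭) = 1`. -/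
def flatOrd (x : CFlat p) : ℝ := - Real.logb p (flatVal p x)

/-- The absolute Galois group of `ℚ_p`. -/
abbrev GalQp : Type := PadicAlgCl p ≃ₐ[ℚ_[p]] PadicAlgCl p

variable {p}

theorem norm_galQp (σ : GalQp p) (x : PadicAlgCl p) : ‖σ x‖ = ‖x‖ := by
  rw [← PadicAlgCl.spectralNorm_eq, ← PadicAlgCl.spectralNorm_eq]
  exact (spectralNorm_eq_of_equiv σ x).symm

theorem continuous_galQp (σ : GalQp p) : Continuous (σ : PadicAlgCl p →+* PadicAlgCl p) :=
  (AddMonoidHomClass.isometry_of_norm (σ : PadicAlgCl p →+* PadicAlgCl p)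
    (fun x => norm_galQp σ x)).continuous

/-- The continuous extension to `ℂ_p` of a Galois automorphism. -/
def galC (σ : GalQp p) : ℂ_[p] →+* ℂ_[p] :=
  UniformSpace.Completion.mapRingHom (σ : PadicAlgCl p →+* PadicAlgCl p) (continuous_galQp σ)

theorem continuous_galC (σ : GalQp p) : Continuous (galC σ) :=
  UniformSpace.Completion.continuous_map

theorem galC_coe (σ : GalQp p) (x : PadicAlgCl p) : galC σ (x : ℂ_[p]) = (σ x : PadicAlgCl p) :=
  UniformSpace.Completion.mapRingHom_coe _ _

theorem norm_galC (σ : GalQp p) (x : ℂ_[p]) : ‖galC σ x‖ = ‖x‖ := by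
  refine UniformSpace.Completion.induction_on x ?_ ?_
  · exact isClosed_eq (continuous_galC σ).norm continuous_norm
  · intro a
    rw [galC_coe, PadicComplex.norm_extends, PadicComplex.norm_extends, norm_galQp]

theorem galC_mul (σ τ : GalQp p) (x : ℂ_[p]) : galC (σ * τ) x = galC σ (galC τ x) := by
  refine UniformSpace.Completion.induction_on x ?_ ?_
  · exact isClosed_eq (continuous_galC _) ((continuous_galC σ).comp (continuous_galC τ))
  · intro a
    rw [galC_coe, galC_coe, galC_coe]; rfl

theorem galC_one (x : ℂ_[p]) : galC (1 : GalQp p) x = x := by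
  refine UniformSpace.Completion.induction_on x ?_ ?_
  · exact isClosed_eq (continuous_galC _) continuous_id
  · intro a
    rw [galC_coe]; rfl

theorem valuation_galC (σ : GalQp p) (x : ℂ_[p]) : (Valued.v (galC σ x) : ℝ≥0) = Valued.v x := by
  rw [valuation_eq_nnnorm, valuation_eq_nnnorm]
  ext
  exact norm_galC σ x

/-- The Galois action on `𝒪_{ℂ_p}`. -/
def galO (σ : GalQp p) : 𝓞_ℂ_[p] →+* 𝓞_ℂ_[p] :=
  (galC σ).restrict 𝓞_ℂ_[p].toSubring 𝓞_ℂ_[p].toSubring (fun x hx => by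
    change (Valued.v (galC σ x) : ℝ≥0) ≤ 1
    rw [valuation_galC]; exact hx)

theorem coe_galO (σ : GalQp p) (x : 𝓞_ℂ_[p]) : ((galO σ x : 𝓞_ℂ_[p]) : ℂ_[p]) = galC σ x := rfl

/-- The Galois action on `𝒪_{ℂ_p} / p`. -/
def galModP (σ : GalQp p) : ModP 𝓞_ℂ_[p] p →+* ModP 𝓞_ℂ_[p] p :=
  Ideal.quotientMap _ (galO σ) (by
    rw [Ideal.span_singleton_le_iff_mem, Ideal.mem_comap, map_natCast]
    exact Ideal.mem_span_singleton_self _)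

/-- The Galois action on `𝒪_{ℂ_p}^♭`. -/
def galOFlat (σ : GalQp p) : OFlat p →+* OFlat p := Perfection.map p (galModP σ)

theorem coeff_galOFlat (σ : GalQp p) (x : OFlat p) (n : ℕ) :
    PreTilt.coeff n (galOFlat σ x) = galModP σ (PreTilt.coeff n x) := rfl

theorem galModP_mul (σ τ : GalQp p) (x) : galModP (σ * τ) x = galModP σ (galModP τ x) := by
  obtain ⟨x, rfl⟩ := Ideal.Quotient.mk_surjective x
  simp only [galModP, Ideal.quotientMap_mk]
  congr 1
  exact Subtype.ext (galC_mul σ τ x)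

theorem galModP_one (x) : galModP (1 : GalQp p) x = x := by
  obtain ⟨x, rfl⟩ := Ideal.Quotient.mk_surjective x
  simp only [galModP, Ideal.quotientMap_mk]
  congr 1
  exact Subtype.ext (galC_one (x : ℂ_[p]))

theorem galOFlat_mul (σ τ : GalQp p) (x) : galOFlat (σ * τ) x = galOFlat σ (galOFlat τ x) :=
  Perfection.ext fun n => galModP_mul σ τ (PreTilt.coeff n x)

theorem galOFlat_one (x) : galOFlat (1 : GalQp p) x = x :=
  Perfection.ext fun n => galModP_one (PreTilt.coeff n x)

theorem galOFlat_injective (σ : GalQp p) : Function.Injective (galOFlat σ) :=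
  Function.LeftInverse.injective (g := galOFlat σ⁻¹) fun x => by
    rw [← galOFlat_mul, inv_mul_cancel, galOFlat_one]

theorem preVal_galModP (σ : GalQp p) (x : ModP 𝓞_ℂ_[p] p) (hx : x ≠ 0) (hx' : galModP σ x ≠ 0) :
    ModP.preVal ℂ_[p] (PadicComplex.valued p).v 𝓞_ℂ_[p] p (galModP σ x) =
      ModP.preVal ℂ_[p] (PadicComplex.valued p).v 𝓞_ℂ_[p] p x := by
  obtain ⟨x, rfl⟩ := Ideal.Quotient.mk_surjective x
  have e : galModP σ (Ideal.Quotient.mk _ x) = Ideal.Quotient.mk _ (galO σ x) := rfl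
  rw [e] at hx' ⊢
  rw [ModP.preVal_mk (PadicComplexInt.integers p) hx, ModP.preVal_mk (PadicComplexInt.integers p) hx']
  exact valuation_galC σ _

theorem oFlatVal_galOFlat (σ : GalQp p) (x : OFlat p) :
    oFlatVal p (galOFlat σ x) = oFlatVal p x := by
  by_cases h : x = 0
  · rw [h, map_zero]
  have h' : galOFlat σ x ≠ 0 := fun h0 => h (galOFlat_injective σ (by rw [h0, map_zero]))
  obtain ⟨n, hn⟩ : ∃ n, PreTilt.coeff n (galOFlat σ x) ≠ 0 :=
    not_forall.1 fun h0 => h' <| Perfection.ext h0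
  have hn' : PreTilt.coeff n x ≠ 0 := fun h0 => hn (by rw [coeff_galOFlat, h0, map_zero])
  change PreTilt.valAux _ _ _ _ _ = PreTilt.valAux _ _ _ _ _
  rw [PreTilt.valAux_eq (PadicComplexInt.integers p) hn,
    PreTilt.valAux_eq (PadicComplexInt.integers p) hn', coeff_galOFlat, preVal_galModP σ _ hn' hn]

/-- The Galois action on `ℂ_p^♭`. -/
def galFlat (σ : GalQp p) : CFlat p →+* CFlat p :=
  IsFractionRing.map (galOFlat_injective σ)

theorem galFlat_algebraMap (σ : GalQp p) (x : OFlat p) :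
    galFlat σ (algebraMap (OFlat p) (CFlat p) x) = algebraMap _ _ (galOFlat σ x) :=
  IsLocalization.map_eq (M := nonZeroDivisors (OFlat p)) (S := CFlat p)
    (nonZeroDivisors_le_comap_nonZeroDivisors_of_injective (galOFlat σ) (galOFlat_injective σ)) x

theorem flatVal_algebraMap (x : OFlat p) :
    flatVal p (algebraMap (OFlat p) (CFlat p) x) = oFlatVal p x :=
  Valuation.extendToLocalization_apply_map_apply _ _ _ _

theorem galFlat_mul (σ τ : GalQp p) (x : CFlat p) :
    galFlat (σ * τ) x = galFlat σ (galFlat τ x) := by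
  obtain ⟨a, b, -, rfl⟩ := IsFractionRing.div_surjective (OFlat p) x
  simp only [map_div₀, galFlat_algebraMap, galOFlat_mul]

theorem galFlat_one (x : CFlat p) : galFlat (1 : GalQp p) x = x := by
  obtain ⟨a, b, -, rfl⟩ := IsFractionRing.div_surjective (OFlat p) x
  simp only [map_div₀, galFlat_algebraMap, galOFlat_one]

theorem flatVal_galFlat (σ : GalQp p) (x : CFlat p) : flatVal p (galFlat σ x) = flatVal p x := by
  obtain ⟨a, b, -, rfl⟩ := IsFractionRing.div_surjective (OFlat p) x
  simp only [map_div₀, galFlat_algebraMap, flatVal_algebraMap, oFlatVal_galOFlat]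

end Tilt

/-! ### The ring `Ã = W(ℂ_p^♭)` with its Frobenius and Galois action -/

section Witt

variable (p : ℕ) [Fact p.Prime]

/-- The ring `Ã` of Witt vectors of `ℂ_p^♭`. -/
abbrev ATilde : Type := WittVector p (CFlat p)

instance : Algebra (ZMod p) (CFlat p) := ZMod.algebra (CFlat p) p

/-- The structure map `ℤ_p = W(𝔽_p) → W(ℂ_p^♭)`. -/
instance : Algebra ℤ_[p] (ATilde p) :=
  ((WittVector.map (algebraMap (ZMod p) (CFlat p))).comp
    ((WittVector.equiv p).symm : ℤ_[p] →+* WittVector p (ZMod p))).toAlgebra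

theorem algebraMap_aTilde (c : ℤ_[p]) : algebraMap ℤ_[p] (ATilde p) c =
    WittVector.map (algebraMap (ZMod p) (CFlat p)) ((WittVector.equiv p).symm c) := rfl

/-- The Witt vector Frobenius `φ` of `Ã`. -/
def frobW : ATilde p →ₐ[ℤ_[p]] ATilde p where
  __ := (WittVector.frobenius : ATilde p →+* ATilde p)
  commutes' c := by
    change WittVector.frobenius (algebraMap ℤ_[p] (ATilde p) c) = _
    rw [algebraMap_aTilde]
    ext n
    rw [WittVector.coeff_frobenius_charP, WittVector.map_coeff, ← map_pow, ZMod.pow_card]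

theorem coeff_frobW (x : ATilde p) (n : ℕ) : (frobW p x).coeff n = x.coeff n ^ p :=
  WittVector.coeff_frobenius_charP p x n

variable {p}

/-- The Galois action on `Ã`. -/
def galW (σ : GalQp p) : ATilde p →ₐ[ℤ_[p]] ATilde p where
  __ := WittVector.map (galFlat σ)
  commutes' c := by
    change WittVector.map (galFlat σ) (algebraMap ℤ_[p] (ATilde p) c) = _
    rw [algebraMap_aTilde]
    ext n
    rw [WittVector.map_coeff, WittVector.map_coeff, ← RingHom.comp_apply]
    exact DFunLike.congr_fun (Subsingleton.elim _ _) _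

theorem coeff_galW (σ : GalQp p) (x : ATilde p) (n : ℕ) :
    (galW σ x).coeff n = galFlat σ (x.coeff n) :=
  WittVector.map_coeff _ _ _

theorem galW_mul (σ τ : GalQp p) (x : ATilde p) : galW (σ * τ) x = galW σ (galW τ x) := by
  ext n
  rw [coeff_galW, coeff_galW, coeff_galW, galFlat_mul]

theorem galW_one (x : ATilde p) : galW (1 : GalQp p) x = x := by
  ext n
  rw [coeff_galW, galFlat_one]

theorem galW_frobW (σ : GalQp p) (x : ATilde p) : galW σ (frobW p x) = frobW p (galW σ x) := by
  ext n
  rw [coeff_galW, coeff_frobW, coeff_frobW, coeff_galW, map_pow]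

theorem galW_teichmuller (σ : GalQp p) (x : CFlat p) :
    galW σ (WittVector.teichmuller p x) = WittVector.teichmuller p (galFlat σ x) :=
  WittVector.map_teichmuller p (galFlat σ) x

theorem frobW_teichmuller (x : CFlat p) :
    frobW p (WittVector.teichmuller p x) = WittVector.teichmuller p (x ^ p) := by
  have h : WittVector.map (_root_.frobenius (CFlat p) p) (WittVector.teichmuller p x) =
      WittVector.teichmuller p (x ^ p) :=
    WittVector.map_teichmuller p (_root_.frobenius (CFlat p) p) x
  rw [← h, ← WittVector.frobenius_eq_map_frobenius]
  rfl

end Witt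

/-! ### Cyclotomic elements, `𝐀` and `𝐀_K` -/

section Cyclotomic

variable (p : ℕ) [Fact p.Prime]

/-- The elements `(1, ζ_1, ζ_2, …)` of `𝒪_{ℂ_p}^♭` attached to compatible systems of `p`-power
roots of unity; these are the `ε ^ a` with `a ∈ ℤ_p`. -/
def cycl : Set (CFlat p) :=
  {e | ∃ x : OFlat p, algebraMap (OFlat p) (CFlat p) x = e ∧ ∃ ζ : ℕ → 𝓞_ℂ_[p], ζ 0 = 1 ∧
    (∀ n, ζ (n + 1) ^ p = ζ n) ∧ ∀ n, PreTilt.coeff n x = Ideal.Quotient.mk _ (ζ n)}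

/-- `ε` comes from a compatible system of primitive `p`-power roots of unity. -/
def IsEps (ε : CFlat p) : Prop :=
  ∃ x : OFlat p, algebraMap (OFlat p) (CFlat p) x = ε ∧ ∃ ζ : ℕ → 𝓞_ℂ_[p], ζ 0 = 1 ∧ ζ 1 ≠ 1 ∧
    (∀ n, ζ (n + 1) ^ p = ζ n) ∧ ∀ n, PreTilt.coeff n x = Ideal.Quotient.mk _ (ζ n)

variable {p}

theorem IsEps.mem_cycl {ε : CFlat p} (h : IsEps p ε) : ε ∈ cycl p := by
  obtain ⟨x, hx, ζ, h0, -, h1, h2⟩ := h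
  exact ⟨x, hx, ζ, h0, h1, h2⟩

theorem galFlat_mem_cycl (σ : GalQp p) {e : CFlat p} (h : e ∈ cycl p) : galFlat σ e ∈ cycl p := by
  obtain ⟨x, rfl, ζ, h0, h1, h2⟩ := h
  refine ⟨galOFlat σ x, (galFlat_algebraMap σ x).symm, fun n => galO σ (ζ n), ?_, fun n => ?_,
    fun n => ?_⟩
  · simp only [h0, map_one]
  · simp only [← map_pow, h1]
  · rw [coeff_galOFlat, h2]; rfl

theorem pow_mem_cycl {e : CFlat p} (h : e ∈ cycl p) : e ^ p ∈ cycl p := by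
  obtain ⟨x, rfl, ζ, h0, h1, h2⟩ := h
  refine ⟨x ^ p, map_pow _ _ _, fun n => ζ n ^ p, ?_, fun n => ?_, fun n => ?_⟩
  · simp only [h0, one_pow]
  · simp only [h1]
  · rw [map_pow, h2, map_pow]

/-- The closure of a subset of `Ã = W(ℂ_p^♭)` for the weak topology, that is, for the product
topology on the Witt vector coordinates. -/
def weakClosure (S : Set (ATilde p)) : Set (ATilde p) :=
  {x | ∀ N : ℕ, ∃ y ∈ S, ∀ i < N, flatVal p ((x - y).coeff i) ≤ ((p : ℝ≥0) ^ N)⁻¹}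

/-- The `p`-adic closure of a subset of `Ã`. -/
def padicClosure (S : Set (ATilde p)) : Set (ATilde p) :=
  {x | ∀ N : ℕ, ∃ y ∈ S, ∃ z, x - y = (p : ATilde p) ^ N * z}

variable (p) in
/-- `𝐀_{ℚ_p} = ℤ_p⟦π⟧[1/π]^∧` inside `Ã`, with `π = [ε] - 1`: the weak closure of the ring
generated by all `[ε]^a` and all `1 / ([ε]^a - 1)`, `0 ≠ a ∈ ℤ_p`. -/
def AQp : Set (ATilde p) :=
  weakClosure (Subring.closure ({x | ∃ e ∈ cycl p, x = WittVector.teichmuller p e} ∪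
    {x | ∃ e ∈ cycl p, e ≠ 1 ∧ x * (WittVector.teichmuller p e - 1) = 1}) : Subring (ATilde p))

variable (p) in
/-- The maximal unramified (that is, ind-étale) extension of `𝐀_{ℚ_p}` inside `Ã`, generated by
the simple roots of monic polynomials. -/
def AUnr : Subring (ATilde p) :=
  Subring.closure (AQp p ∪ {y | ∃ f : Polynomial (ATilde p), f.Monic ∧ (∀ i, f.coeff i ∈ AQp p) ∧
    f.eval y = 0 ∧ IsUnit (f.derivative.eval y)})

variable (p) in
/-- The ring `𝐀`, the `p`-adic completion of the maximal unramified extension of `𝐀_{ℚ_p}`. -/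
def ABig : Set (ATilde p) := padicClosure (AUnr p)

section Stability

/-- The properties of `φ` and of the Galois action that make them preserve `𝐀`. -/
structure CyclStable (F : ATilde p →ₐ[ℤ_[p]] ATilde p) (f : CFlat p →+* CFlat p) : Prop where
  teichmuller : ∀ x, F (WittVector.teichmuller p x) = WittVector.teichmuller p (f x)
  mem_cycl : ∀ e ∈ cycl p, f e ∈ cycl p
  small : ∀ (x : ATilde p) (i N : ℕ), flatVal p (x.coeff i) ≤ ((p : ℝ≥0) ^ N)⁻¹ →
    flatVal p ((F x).coeff i) ≤ ((p : ℝ≥0) ^ N)⁻¹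

variable {F : ATilde p →ₐ[ℤ_[p]] ATilde p} {f : CFlat p →+* CFlat p}

theorem CyclStable.map_mem_AQp (h : CyclStable F f) {x : ATilde p} (hx : x ∈ AQp p) : F x ∈ AQp p := by
  intro N
  obtain ⟨y, hy, hxy⟩ := hx N
  refine ⟨F y, ?_, fun i hi => ?_⟩
  · have := Subring.mem_map.mpr ⟨y, hy, (rfl : (F : ATilde p →+* ATilde p) y = _)⟩
    rw [RingHom.map_closure] at this
    refine Subring.closure_mono ?_ this
    rintro _ ⟨z, (⟨e, he, rfl⟩ | ⟨e, he, he1, hz⟩), rfl⟩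
    · exact Or.inl ⟨f e, h.mem_cycl e he, h.teichmuller e⟩
    · refine Or.inr ⟨f e, h.mem_cycl e he, fun h => he1 (f.injective (h.trans (map_one f).symm)), ?_⟩
      have := congrArg F hz
      rwa [map_mul, map_sub, h.teichmuller, map_one] at this
  · rw [← map_sub]
    exact h.small _ _ _ (hxy i hi)

theorem CyclStable.map_mem_AUnr (h : CyclStable F f) {x : ATilde p} (hx : x ∈ AUnr p) : F x ∈ AUnr p := by
  have := Subring.mem_map.mpr ⟨x, hx, (rfl : (F : ATilde p →+* ATilde p) x = _)⟩
  rw [AUnr, RingHom.map_closure] at this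
  refine Subring.closure_mono ?_ this
  rintro _ ⟨y, (hy | ⟨g, hg, hg1, hg2, hg3⟩), rfl⟩
  · exact Or.inl (h.map_mem_AQp hy)
  · refine Or.inr ⟨g.map (F : ATilde p →+* ATilde p), hg.map _, fun i => ?_, ?_, ?_⟩
    · rw [Polynomial.coeff_map]
      exact h.map_mem_AQp (hg1 i)
    · rw [Polynomial.eval_map, Polynomial.eval₂_hom, hg2, map_zero]
    · rw [Polynomial.derivative_map, Polynomial.eval_map, Polynomial.eval₂_hom]
      exact hg3.map _

theorem CyclStable.map_mem_ABig (h : CyclStable F f) {x : ATilde p} (hx : x ∈ ABig p) : F x ∈ ABig p := by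
  intro N
  obtain ⟨y, hy, z, hz⟩ := hx N
  refine ⟨F y, h.map_mem_AUnr hy, F z, ?_⟩
  rw [← map_sub, hz, map_mul, map_pow, map_natCast]

end Stability

theorem galW_mem_ABig (σ : GalQp p) {x : ATilde p} (hx : x ∈ ABig p) : galW σ x ∈ ABig p :=
  CyclStable.map_mem_ABig (f := galFlat σ) ⟨galW_teichmuller σ, fun _ => galFlat_mem_cycl σ,
    fun x i N h => by rwa [coeff_galW, flatVal_galFlat]⟩ hx

theorem frobW_mem_ABig {x : ATilde p} (hx : x ∈ ABig p) : frobW p x ∈ ABig p := by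
  refine CyclStable.map_mem_ABig (f := _root_.frobenius (CFlat p) p)
    ⟨frobW_teichmuller, fun _ => pow_mem_cycl, fun x i N h => ?_⟩ hx
  rw [coeff_frobW, map_pow]
  refine (pow_le_of_le_one zero_le ?_ (Fact.out : p.Prime).ne_zero).trans h
  refine h.trans (inv_le_one_of_one_le₀ (one_le_pow₀ ?_))
  exact_mod_cast (Fact.out : p.Prime).one_le

theorem teichmuller_cycl_mem_ABig {e : CFlat p} (he : e ∈ cycl p) :
    WittVector.teichmuller p e ∈ ABig p := by
  intro N
  refine ⟨WittVector.teichmuller p e, Subring.subset_closure (Or.inl fun M => ?_), 0, by simp⟩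
  refine ⟨_, Subring.subset_closure (Or.inl ⟨e, he, rfl⟩), fun i _ => ?_⟩
  rw [sub_self, WittVector.zero_coeff, map_zero]
  exact zero_le

end Cyclotomic

/-! ### The groups `G_K`, `H_K`, `Γ_K` and the ring `𝐀_K` -/

section Gamma

variable {p : ℕ} [Fact p.Prime]

variable (p) in
/-- The cyclotomic character `χ : Gal(ℚ_p^alg / ℚ_p) → ℤ_p^×`. -/
def chi : GalQp p →* ℤ_[p]ˣ :=
  (cyclotomicCharacter (PadicAlgCl p) p).comp
    { toFun := fun σ => (σ : PadicAlgCl p ≃+* PadicAlgCl p)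
      map_one' := rfl
      map_mul' := fun _ _ => rfl }

variable (K : IntermediateField ℚ_[p] (PadicAlgCl p))

/-- `G_K`. -/
abbrev GK : Subgroup (GalQp p) := K.fixingSubgroup

/-- `H_K`, as a subgroup of `G_K`: the kernel of the cyclotomic character. -/
def HK : Subgroup (GK K) := ((chi p).comp (GK K).subtype).ker

instance : (HK K).Normal := inferInstanceAs ((chi p).comp (GK K).subtype).ker.Normal

/-- `Γ_K = G_K / H_K`, with the quotient topology of the Krull topology. -/
abbrev GammaK : Type := GK K ⧸ HK K

/-- The cyclotomic character on `Γ_K`. -/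
def chiK : GammaK K →* ℤ_[p]ˣ := QuotientGroup.kerLift ((chi p).comp (GK K).subtype)

/-- `n(γ) = v_p(χ(γ) - 1)`; it is used only when `χ(γ) ≠ 1`. -/
def depth (γ : GammaK K) : ℕ := ((chiK K γ : ℤ_[p]) - 1).valuation

/-- `𝐀_K = 𝐀 ^ {H_K}`. -/
def AK : Set (ATilde p) := {x | x ∈ ABig p ∧ ∀ σ ∈ HK K, galW (σ : GalQp p) x = x}

variable {K}

theorem galW_mem_AK (τ : GK K) {x : ATilde p} (hx : x ∈ AK K) : galW (τ : GalQp p) x ∈ AK K := by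
  refine ⟨galW_mem_ABig _ hx.1, fun σ hσ => ?_⟩
  have h := hx.2 _ ((inferInstance : (HK K).Normal).conj_mem σ hσ τ⁻¹)
  rw [← galW_mul]
  conv_rhs => rw [← h, ← galW_mul]
  congr 2
  simp [mul_assoc]

theorem frobW_mem_AK {x : ATilde p} (hx : x ∈ AK K) : frobW p x ∈ AK K :=
  ⟨frobW_mem_ABig hx.1, fun σ hσ => by rw [galW_frobW, hx.2 σ hσ]⟩

end Gamma

/-! ### The field `𝐄_K` and the constant `r_K` -/

section EK

variable {p : ℕ} [Fact p.Prime]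

variable (p) in
/-- `𝐄_{ℚ_p} = 𝔽_p((ε - 1))`: the closure in `ℂ_p^♭` of the field generated by the
elements `ε ^ a`. -/
def EQp : Subfield (CFlat p) :=
  Subfield.closure {x | ∀ N : ℕ, ∃ y ∈ Subfield.closure (cycl p),
    flatVal p (x - y) ≤ ((p : ℝ≥0) ^ N)⁻¹}

variable (K : IntermediateField ℚ_[p] (PadicAlgCl p))

/-- `𝐄_K = (𝐄_{ℚ_p}^sep) ^ {H_K}`. -/
def EK : IntermediateField (EQp p) (CFlat p) :=
  IntermediateField.adjoin (EQp p) {x | IsSeparable (EQp p) x ∧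
    ∀ σ ∈ HK K, galFlat (σ : GalQp p) x = x}

/-- The inverse different of `𝐄_K / 𝐄_{ℚ_p}`. -/
def invDifferent : Set (EK K) :=
  {x | ∀ y : EK K, flatVal p (y : CFlat p) ≤ 1 →
    flatVal p (Algebra.trace (EQp p) (EK K) (x * y) : CFlat p) ≤ 1}

/-- The valuation of the different of `𝐄_K / 𝐄_{ℚ_p}`. -/
def vDifferent : ℝ := sSup {t | ∃ x ∈ invDifferent K, x ≠ 0 ∧ t = - flatOrd p (x : CFlat p)}

open Classical in
/-- The constant `r_K`. It is `1` if `𝐄_K / 𝐄_{ℚ_p}` is unramified and `1 / (2 v(𝔡))`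
otherwise. -/
def rK : ℝ := if vDifferent K = 0 then 1 else (2 * vDifferent K)⁻¹

/-- `ϖ` is a uniformizer of `𝐄_K`. -/
def IsUniformizerEK (ϖ : CFlat p) : Prop :=
  ϖ ∈ EK K ∧ ϖ ≠ 0 ∧ flatVal p ϖ < 1 ∧ ∀ x ∈ EK K, flatVal p x < 1 → flatVal p x ≤ flatVal p ϖ

end EK

/-! ### The rings `Λ_{[0,r],K}` -/

section Fil

variable {p : ℕ} [Fact p.Prime]

/-- For `x = ∑ p ^ k [x_k]` this is `p ^ (-(v(x_k) + k ρ))`; note that the `k`-th Witt coordinate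
of `x` is `x_k ^ (p ^ k)`. -/
def gaussTerm (ρ : ℝ≥0) (x : ATilde p) (k : ℕ) : ℝ :=
  (flatVal p (x.coeff k) : ℝ) ^ (1 / (p : ℝ) ^ k) * (p : ℝ) ^ (-(k * (ρ : ℝ)))

/-- With `ρ = 1 / r`, the elements of `Λ_{[0,r],K}` of valuation `val^{[0,r]} ≥ c`. In particular
`c = 0` gives `Λ_{[0,r],K}^∘`. -/
def Fil (K : IntermediateField ℚ_[p] (PadicAlgCl p)) (ρ : ℝ≥0) (c : ℝ) : Set (ATilde p) :=
  {x | x ∈ AK K ∧ Filter.Tendsto (gaussTerm ρ x) Filter.atTop (nhds 0) ∧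
    ∀ k, gaussTerm ρ x k ≤ (p : ℝ) ^ (-c)}

theorem gaussTerm_nonneg (ρ : ℝ≥0) (x : ATilde p) (k : ℕ) : 0 ≤ gaussTerm ρ x k := by
  unfold gaussTerm; positivity

theorem gaussTerm_anti {ρ ρ' : ℝ≥0} (h : ρ ≤ ρ') (x : ATilde p) (k : ℕ) :
    gaussTerm ρ' x k ≤ gaussTerm ρ x k := by
  have hp : (1 : ℝ) ≤ p := by exact_mod_cast (Fact.out : p.Prime).one_le
  unfold gaussTerm
  gcongr

theorem gaussTerm_galW (σ : GalQp p) (ρ : ℝ≥0) (x : ATilde p) :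
    gaussTerm ρ (galW σ x) = gaussTerm ρ x := by
  funext k
  unfold gaussTerm
  rw [coeff_galW, flatVal_galFlat]

theorem gaussTerm_frobW (ρ : ℝ≥0) (x : ATilde p) (k : ℕ) :
    gaussTerm (ρ * p) (frobW p x) k = gaussTerm ρ x k ^ p := by
  unfold gaussTerm
  have hp : (0 : ℝ) ≤ p := Nat.cast_nonneg p
  have e1 : ∀ a t : ℝ, 0 ≤ a → (a ^ t) ^ p = a ^ (t * p) := fun a t ha => by
    rw [Real.rpow_mul ha, Real.rpow_natCast]
  have e2 : ∀ a t : ℝ, 0 ≤ a → (a ^ p) ^ t = a ^ (t * p) := fun a t ha => by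
    rw [← Real.rpow_natCast, ← Real.rpow_mul ha, mul_comm]
  rw [coeff_frobW, map_pow, mul_pow, NNReal.coe_pow, e1 _ _ hp, e1 _ _ (NNReal.coe_nonneg _),
    e2 _ _ (NNReal.coe_nonneg _)]
  congr 2
  push_cast
  ring

variable {K : IntermediateField ℚ_[p] (PadicAlgCl p)}

theorem Fil_mono_left {ρ ρ' : ℝ≥0} (h : ρ ≤ ρ') {c : ℝ} : Fil K ρ c ⊆ Fil K ρ' c :=
  fun x hx => ⟨hx.1, squeeze_zero (gaussTerm_nonneg ρ' x) (gaussTerm_anti h x) hx.2.1,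
    fun k => (gaussTerm_anti h x k).trans (hx.2.2 k)⟩

theorem Fil_anti_right {ρ : ℝ≥0} {c c' : ℝ} (h : c' ≤ c) : Fil K ρ c ⊆ Fil K ρ c' := by
  have hp : (1 : ℝ) ≤ p := by exact_mod_cast (Fact.out : p.Prime).one_le
  refine fun x hx => ⟨hx.1, hx.2.1, fun k => (hx.2.2 k).trans ?_⟩
  gcongr

theorem galW_mem_Fil (σ : GK K) {ρ : ℝ≥0} {c : ℝ} {x : ATilde p} (hx : x ∈ Fil K ρ c) :
    galW (σ : GalQp p) x ∈ Fil K ρ c := by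
  refine ⟨galW_mem_AK σ hx.1, ?_, ?_⟩
  · rw [gaussTerm_galW]; exact hx.2.1
  · rw [gaussTerm_galW]; exact hx.2.2

theorem frobW_mem_Fil {ρ : ℝ≥0} {c : ℝ} {x : ATilde p} (hx : x ∈ Fil K ρ c) :
    frobW p x ∈ Fil K (ρ * p) (c * p) := by
  refine ⟨frobW_mem_AK hx.1, ?_, fun k => ?_⟩
  · have h : gaussTerm (ρ * p) (frobW p x) = fun k => gaussTerm ρ x k ^ p :=
      funext (gaussTerm_frobW ρ x)
    rw [h]
    have := hx.2.1.pow p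
    rwa [zero_pow (Fact.out : p.Prime).ne_zero] at this
  · rw [gaussTerm_frobW]
    refine (pow_le_pow_left₀ (gaussTerm_nonneg ρ x k) (hx.2.2 k) p).trans_eq ?_
    rw [← Real.rpow_natCast, ← Real.rpow_mul (by positivity), neg_mul]

end Fil

/-! ### Functoriality of adic completions -/

section Adic

variable {A B C : Type*} [CommRing A] [CommRing B] [CommRing C]

theorem exists_evalₐ_eq_of_le (I : Ideal A) {m n : ℕ} (h : m ≤ n) (x : AdicCompletion I A) :
    ∃ a : A, AdicCompletion.evalₐ I n x = Ideal.Quotient.mk _ a ∧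
      AdicCompletion.evalₐ I m x = Ideal.Quotient.mk _ a := by
  obtain ⟨a, rfl⟩ := AdicCompletion.mk_surjective I A x
  refine ⟨a n, AdicCompletion.evalₐ_mk I n a, ?_⟩
  rw [AdicCompletion.evalₐ_mk]
  exact (AdicCompletion.Ideal.mk_eq_mk I h a).symm

/-- The map `Â → B / J ^ n` induced by a ring homomorphism `f` with `f(I) ⊆ J`. -/
def adicMapAux (I : Ideal A) (J : Ideal B) (f : A →+* B) (h : I ≤ J.comap f) (n : ℕ) :
    AdicCompletion I A →+* B ⧸ J ^ n :=
  (Ideal.quotientMap (J ^ n) f ((Ideal.pow_right_mono h n).trans (Ideal.le_comap_pow f n))).comp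
    (AdicCompletion.evalₐ I n : AdicCompletion I A →+* A ⧸ I ^ n)

theorem adicMapAux_compat (I : Ideal A) (J : Ideal B) (f : A →+* B) (h : I ≤ J.comap f)
    {m n : ℕ} (hle : m ≤ n) :
    (Ideal.Quotient.factorPow J hle).comp (adicMapAux I J f h n) = adicMapAux I J f h m :=
  RingHom.ext fun x => by
    obtain ⟨a, hn, hm⟩ := exists_evalₐ_eq_of_le I hle x
    simp only [adicMapAux, RingHom.comp_apply, RingHom.coe_coe]
    rw [hn, hm]
    simp only [Ideal.quotientMap_mk]
    rfl

/-- The map of adic completions induced by a ring homomorphism `f` with `f(I) ⊆ J`. -/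
def adicMap (I : Ideal A) (J : Ideal B) (f : A →+* B) (h : I ≤ J.comap f) :
    AdicCompletion I A →+* AdicCompletion J B :=
  AdicCompletion.liftRingHom J (adicMapAux I J f h) (adicMapAux_compat I J f h)

theorem evalₐ_adicMap (I : Ideal A) (J : Ideal B) (f : A →+* B) (h : I ≤ J.comap f) (n : ℕ)
    (x : AdicCompletion I A) (a : A) (ha : AdicCompletion.evalₐ I n x = Ideal.Quotient.mk _ a) :
    AdicCompletion.evalₐ J n (adicMap I J f h x) = Ideal.Quotient.mk _ (f a) := by
  rw [adicMap, AdicCompletion.evalₐ_liftRingHom J _ (adicMapAux_compat I J f h), adicMapAux,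
    RingHom.comp_apply, RingHom.coe_coe, ha, Ideal.quotientMap_mk]

theorem exists_evalₐ_eq (I : Ideal A) (n : ℕ) (x : AdicCompletion I A) :
    ∃ a : A, AdicCompletion.evalₐ I n x = Ideal.Quotient.mk _ a := by
  obtain ⟨a, ha⟩ := Ideal.Quotient.mk_surjective (AdicCompletion.evalₐ I n x)
  exact ⟨a, ha.symm⟩

theorem adicMap_comp (I : Ideal A) (J : Ideal B) (L : Ideal C) (f : A →+* B) (g : B →+* C)
    (k : A →+* C) (hf : I ≤ J.comap f) (hg : J ≤ L.comap g) (hk : I ≤ L.comap k)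
    (e : ∀ a, g (f a) = k a) (x : AdicCompletion I A) :
    adicMap J L g hg (adicMap I J f hf x) = adicMap I L k hk x := by
  refine AdicCompletion.ext_evalₐ fun n => ?_
  obtain ⟨a, ha⟩ := exists_evalₐ_eq I n x
  rw [evalₐ_adicMap J L g hg n _ _ (evalₐ_adicMap I J f hf n x a ha),
    evalₐ_adicMap I L k hk n x a ha, e]

theorem adicMap_id (I : Ideal A) (f : A →+* A) (hf : I ≤ I.comap f) (e : ∀ a, f a = a)
    (x : AdicCompletion I A) : adicMap I I f hf x = x := by
  refine AdicCompletion.ext_evalₐ fun n => ?_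
  obtain ⟨a, ha⟩ := exists_evalₐ_eq I n x
  rw [evalₐ_adicMap I I f hf n x a ha, e, ha]

theorem adicMap_of (I : Ideal A) (J : Ideal B) (f : A →+* B) (h : I ≤ J.comap f) (a : A) :
    adicMap I J f h (AdicCompletion.of I A a) = AdicCompletion.of J B (f a) := by
  refine AdicCompletion.ext_evalₐ fun n => ?_
  rw [evalₐ_adicMap I J f h n _ a (AdicCompletion.evalₐ_of I n a), AdicCompletion.evalₐ_of]

end Adic

/-! ### The rings `Λ_{R₀,[0,b],K}` -/

section Lam

variable {p : ℕ} [Fact p.Prime] (K : IntermediateField ℚ_[p] (PadicAlgCl p))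
  {R₀ : Type*} [CommRing R₀] [Algebra ℤ_[p] R₀] (u : R₀) (ρ β : ℝ≥0)

/-- The subring of `R₀ ⊗ Ã` generated by `R₀`, by `Λ_{[0,r],K}^∘` and by all `u x` for
`x ∈ Λ_{[0,r],K}` of valuation at least `-1/b`; here `ρ = 1/r` and `β = 1/b`. When `1/b` is the
valuation of `π_K ^ s` this is the image of `(R₀ ⊗ Λ_{[0,r],K}^∘)[u / π_K ^ s]`. -/
def lamPre : Subalgebra R₀ (R₀ ⊗[ℤ_[p]] ATilde p) :=
  Algebra.adjoin R₀ ({y | ∃ x ∈ Fil K ρ 0, y = 1 ⊗ₜ[ℤ_[p]] x} ∪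
    {y | ∃ x ∈ Fil K ρ (-(β : ℝ)), y = u ⊗ₜ[ℤ_[p]] x})

/-- The ideal generated by the elements of `Λ_{[0,r],K}` of valuation at least `1`; it defines
the `π_K`-adic topology. -/
def lamIdeal : Ideal (lamPre K u ρ β) :=
  Ideal.span {y | ∃ x ∈ Fil K ρ 1, (y : R₀ ⊗[ℤ_[p]] ATilde p) = 1 ⊗ₜ[ℤ_[p]] x}

/-- The ring of definition of `Λ_{R₀,[0,b],K}`: the `π_K`-adic completion
`(R₀ ⊗̂ Λ_{[0,r],K}^∘)⟨u / π_K ^ s⟩`. -/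
abbrev Lam0 : Type _ := AdicCompletion (lamIdeal K u ρ β) (lamPre K u ρ β)

/-- The multiplicative set generated by the elements of `Λ_{[0,r],K}^∘` that are invertible in
`Λ_{[0,r],K} = Λ_{[0,r],K}^∘[1/π_K]`, that is, by the divisors of the powers of `π_K`. -/
def lamUnits : Submonoid (Lam0 K u ρ β) :=
  Submonoid.closure {y | ∃ (b : lamPre K u ρ β) (x z : ATilde p) (c : ℝ), x ∈ Fil K ρ 0 ∧
    z ∈ Fil K ρ c ∧ x * z = 1 ∧ (b : R₀ ⊗[ℤ_[p]] ATilde p) = 1 ⊗ₜ[ℤ_[p]] x ∧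
      y = AdicCompletion.of _ _ b}

/-- The ring `Λ_{R₀,[0,b],K}`, with `ρ = 1/r` and `β = 1/b`. -/
def Lam : Type _ := Localization (lamUnits K u ρ β)

instance : CommRing (Lam K u ρ β) := inferInstanceAs (CommRing (Localization (lamUnits K u ρ β)))

instance : Algebra (Lam0 K u ρ β) (Lam K u ρ β) :=
  inferInstanceAs (Algebra (Lam0 K u ρ β) (Localization (lamUnits K u ρ β)))

instance : IsLocalization (lamUnits K u ρ β) (Lam K u ρ β) :=
  inferInstanceAs (IsLocalization (lamUnits K u ρ β) (Localization (lamUnits K u ρ β)))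

/-- The Tate topology: the images of the ideals `ker(Λ₀ → Λ₀ / J ^ k)` are a basis of
neighbourhoods of `0`. -/
instance : TopologicalSpace (Lam K u ρ β) :=
  TopologicalSpace.generateFrom {U | ∃ (x : Lam K u ρ β) (k : ℕ), U = {z | ∃ y : Lam0 K u ρ β,
    AdicCompletion.evalₐ (lamIdeal K u ρ β) k y = 0 ∧ z = x + algebraMap _ _ y}}

/-- The conditions under which an endomorphism of `Ã` induces a map between two of the
rings `Λ_{R₀,[0,b],K}`. -/
structure LamCompat (ρ β ρ' β' : ℝ≥0) (F : ATilde p →ₐ[ℤ_[p]] ATilde p) : Prop where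
  zero : ∀ x ∈ Fil K ρ 0, F x ∈ Fil K ρ' 0
  one : ∀ x ∈ Fil K ρ 1, F x ∈ Fil K ρ' 1
  neg : ∀ x ∈ Fil K ρ (-(β : ℝ)), F x ∈ Fil K ρ' (-(β' : ℝ))
  all : ∀ c, ∀ x ∈ Fil K ρ c, ∃ c', F x ∈ Fil K ρ' c'

variable {K} {ρ β}
variable {ρ' β' ρ'' β'' : ℝ≥0} {F G H : ATilde p →ₐ[ℤ_[p]] ATilde p}

variable (R₀) in
/-- `1 ⊗ F`. -/
def tensorEnd (F : ATilde p →ₐ[ℤ_[p]] ATilde p) :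
    (R₀ ⊗[ℤ_[p]] ATilde p) →ₐ[R₀] (R₀ ⊗[ℤ_[p]] ATilde p) :=
  Algebra.TensorProduct.map (AlgHom.id R₀ R₀) F

theorem tensorEnd_tmul (F : ATilde p →ₐ[ℤ_[p]] ATilde p) (r : R₀) (x : ATilde p) :
    tensorEnd R₀ F (r ⊗ₜ x) = r ⊗ₜ F x := rfl

theorem tensorEnd_mem (hF : LamCompat K ρ β ρ' β' F) {y : R₀ ⊗[ℤ_[p]] ATilde p}
    (hy : y ∈ lamPre K u ρ β) : tensorEnd R₀ F y ∈ lamPre K u ρ' β' := by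
  have h : (lamPre K u ρ β).map (tensorEnd R₀ F) ≤ lamPre K u ρ' β' := by
    rw [lamPre, AlgHom.map_adjoin]
    refine Algebra.adjoin_mono ?_
    rintro _ ⟨_, (⟨x, hx, rfl⟩ | ⟨x, hx, rfl⟩), rfl⟩
    · exact Or.inl ⟨F x, hF.zero x hx, rfl⟩
    · exact Or.inr ⟨F x, hF.neg x hx, rfl⟩
  exact h ⟨y, hy, rfl⟩

/-- The map induced by `F` on the rings before completion. -/
def lamPreMap (hF : LamCompat K ρ β ρ' β' F) : lamPre K u ρ β →+* lamPre K u ρ' β' :=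
  (((tensorEnd R₀ F).comp (lamPre K u ρ β).val).codRestrict (lamPre K u ρ' β')
    (fun y => tensorEnd_mem u hF y.2)).toRingHom

theorem coe_lamPreMap (hF : LamCompat K ρ β ρ' β' F) (y : lamPre K u ρ β) :
    (lamPreMap u hF y : R₀ ⊗[ℤ_[p]] ATilde p) = tensorEnd R₀ F y := rfl

theorem lamIdeal_le (hF : LamCompat K ρ β ρ' β' F) :
    lamIdeal K u ρ β ≤ (lamIdeal K u ρ' β').comap (lamPreMap u hF) := by
  rw [lamIdeal, Ideal.span_le]
  intro y hy
  obtain ⟨x, hx, hxy⟩ := hy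
  rw [SetLike.mem_coe, Ideal.mem_comap]
  have h : (lamPreMap u hF y : R₀ ⊗[ℤ_[p]] ATilde p) = 1 ⊗ₜ[ℤ_[p]] F x := by
    rw [coe_lamPreMap, hxy, tensorEnd_tmul]
  exact Ideal.subset_span ⟨F x, hF.one x hx, h⟩

/-- The map induced by `F` on the rings of definition. -/
def lam0Map (hF : LamCompat K ρ β ρ' β' F) : Lam0 K u ρ β →+* Lam0 K u ρ' β' :=
  adicMap _ _ (lamPreMap u hF) (lamIdeal_le u hF)

theorem lamUnits_le (hF : LamCompat K ρ β ρ' β' F) :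
    lamUnits K u ρ β ≤ (lamUnits K u ρ' β').comap (lam0Map u hF) := by
  rw [lamUnits, Submonoid.closure_le]
  intro y hy
  obtain ⟨b, x, z, c, hx, hz, hxz, hb, hy⟩ := hy
  obtain ⟨c', hc'⟩ := hF.all c z hz
  rw [SetLike.mem_coe, Submonoid.mem_comap]
  have h1 : F x * F z = 1 := by rw [← map_mul, hxz, map_one]
  have h2 : (lamPreMap u hF b : R₀ ⊗[ℤ_[p]] ATilde p) = 1 ⊗ₜ[ℤ_[p]] F x := by
    rw [coe_lamPreMap, hb, tensorEnd_tmul]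
  have h3 : lam0Map u hF y = AdicCompletion.of _ _ (lamPreMap u hF b) := by
    rw [hy]
    exact adicMap_of _ _ _ _ b
  exact Submonoid.subset_closure ⟨lamPreMap u hF b, F x, F z, c', hF.zero x hx, hc', h1, h2, h3⟩

/-- The map `Λ_{R₀,[0,b],K} → Λ_{R₀,[0,b'],K}` induced by `F`. -/
def lamMap (hF : LamCompat K ρ β ρ' β' F) : Lam K u ρ β →+* Lam K u ρ' β' :=
  IsLocalization.map (Lam K u ρ' β') (lam0Map u hF) (lamUnits_le u hF)

theorem lamMap_algebraMap (hF : LamCompat K ρ β ρ' β' F) (y : Lam0 K u ρ β) :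
    lamMap u hF (algebraMap _ _ y) = algebraMap _ _ (lam0Map u hF y) :=
  IsLocalization.map_eq (M := lamUnits K u ρ β) _ y

end Lam

section LamMaps

variable {p : ℕ} [Fact p.Prime] {K : IntermediateField ℚ_[p] (PadicAlgCl p)}
  {R₀ : Type*} [CommRing R₀] [Algebra ℤ_[p] R₀] (u : R₀) {ρ β ρ' β' ρ'' β'' : ℝ≥0}
  {F G H : ATilde p →ₐ[ℤ_[p]] ATilde p}

theorem tensorEnd_eq_of_eqOn (h : ∀ x ∈ AK K, G (F x) = H x) {y : R₀ ⊗[ℤ_[p]] ATilde p}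
    (hy : y ∈ lamPre K u ρ β) : tensorEnd R₀ G (tensorEnd R₀ F y) = tensorEnd R₀ H y := by
  have hle : lamPre K u ρ β ≤
      AlgHom.equalizer ((tensorEnd R₀ G).comp (tensorEnd R₀ F)) (tensorEnd R₀ H) := by
    rw [lamPre, Algebra.adjoin_le_iff]
    intro y hy
    rw [SetLike.mem_coe, AlgHom.mem_equalizer, AlgHom.comp_apply]
    rcases hy with ⟨x, hx, rfl⟩ | ⟨x, hx, rfl⟩
    · rw [tensorEnd_tmul, tensorEnd_tmul, tensorEnd_tmul, h x hx.1]
    · rw [tensorEnd_tmul, tensorEnd_tmul, tensorEnd_tmul, h x hx.1]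
  exact hle hy

theorem lamPreMap_comp (hF : LamCompat K ρ β ρ' β' F) (hG : LamCompat K ρ' β' ρ'' β'' G)
    (hH : LamCompat K ρ β ρ'' β'' H) (h : ∀ x ∈ AK K, G (F x) = H x) (y : lamPre K u ρ β) :
    lamPreMap u hG (lamPreMap u hF y) = lamPreMap u hH y :=
  Subtype.ext (tensorEnd_eq_of_eqOn u h y.2)

theorem lamMap_comp (hF : LamCompat K ρ β ρ' β' F) (hG : LamCompat K ρ' β' ρ'' β'' G)
    (hH : LamCompat K ρ β ρ'' β'' H) (h : ∀ x ∈ AK K, G (F x) = H x) (y : Lam K u ρ β) :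
    lamMap u hG (lamMap u hF y) = lamMap u hH y := by
  have e : (lamMap u hG).comp (lamMap u hF) = lamMap u hH := by
    refine IsLocalization.ringHom_ext (lamUnits K u ρ β) (RingHom.ext fun x => ?_)
    rw [RingHom.comp_apply, RingHom.comp_apply, RingHom.comp_apply, lamMap_algebraMap,
      lamMap_algebraMap, lamMap_algebraMap]
    exact congrArg _ (adicMap_comp _ _ _ _ _ _ _ _ _ (lamPreMap_comp u hF hG hH h) x)
  exact RingHom.congr_fun e y

theorem tensorEnd_id (y : R₀ ⊗[ℤ_[p]] ATilde p) :
    tensorEnd R₀ (AlgHom.id ℤ_[p] (ATilde p)) y = y := by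
  rw [tensorEnd, Algebra.TensorProduct.map_id, AlgHom.id_apply]

theorem lamPreMap_id (h : LamCompat K ρ β ρ β (AlgHom.id ℤ_[p] (ATilde p)))
    (y : lamPre K u ρ β) : lamPreMap u h y = y :=
  Subtype.ext ((coe_lamPreMap u h y).trans (tensorEnd_id _))

theorem lamMap_id (h : LamCompat K ρ β ρ β (AlgHom.id ℤ_[p] (ATilde p))) (y : Lam K u ρ β) :
    lamMap u h y = y := by
  have e : lamMap u h = RingHom.id _ := by
    refine IsLocalization.ringHom_ext (lamUnits K u ρ β) (RingHom.ext fun x => ?_)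
    rw [RingHom.comp_apply, RingHom.comp_apply, lamMap_algebraMap, RingHom.id_apply]
    exact congrArg _ (adicMap_id _ _ _ (lamPreMap_id u h) x)
  exact RingHom.congr_fun e y

theorem LamCompat.comp (hF : LamCompat K ρ β ρ' β' F) (hG : LamCompat K ρ' β' ρ'' β'' G) :
    LamCompat K ρ β ρ'' β'' (G.comp F) where
  zero x hx := hG.zero _ (hF.zero x hx)
  one x hx := hG.one _ (hF.one x hx)
  neg x hx := hG.neg _ (hF.neg x hx)
  all c x hx := by
    obtain ⟨c', h⟩ := hF.all c x hx
    exact hG.all c' _ h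

theorem lamCompat_id (hρ : ρ ≤ ρ') (hβ : β ≤ β') :
    LamCompat K ρ β ρ' β' (AlgHom.id ℤ_[p] (ATilde p)) where
  zero _ hx := Fil_mono_left hρ hx
  one _ hx := Fil_mono_left hρ hx
  neg _ hx := Fil_anti_right (neg_le_neg (by exact_mod_cast hβ)) (Fil_mono_left hρ hx)
  all c _ hx := ⟨c, Fil_mono_left hρ hx⟩

theorem lamCompat_galW (σ : GK K) : LamCompat K ρ β ρ β (galW (σ : GalQp p)) where
  zero _ hx := galW_mem_Fil σ hx
  one _ hx := galW_mem_Fil σ hx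
  neg _ hx := galW_mem_Fil σ hx
  all c _ hx := ⟨c, galW_mem_Fil σ hx⟩

theorem lamCompat_frobW (hρ : ρ' = ρ * p) (hβ : β' = β * p) :
    LamCompat K ρ β ρ' β' (frobW p) where
  zero _ hx := by simpa [hρ] using frobW_mem_Fil hx
  one _ hx := by
    have hp : (1 : ℝ) ≤ 1 * p := by rw [one_mul]; exact_mod_cast (Fact.out : p.Prime).one_le
    exact hρ ▸ Fil_anti_right hp (frobW_mem_Fil hx)
  neg _ hx := by
    have := frobW_mem_Fil hx
    rw [hρ, hβ]
    simpa using this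
  all c _ hx := ⟨c * p, hρ ▸ frobW_mem_Fil hx⟩

end LamMaps

/-! ### The rings `Λ_{R₀,[0,b/p^n],K}`, Frobenius, `Γ_K` and `[ε]` -/

section Level

variable {p : ℕ} [Fact p.Prime] (K : IntermediateField ℚ_[p] (PadicAlgCl p))
  {R₀ : Type*} [CommRing R₀] [Algebra ℤ_[p] R₀] (u : R₀) (lam b : ℝ≥0)

/-- The ring `Λ_{R₀,[0,b/p^n],K}`. -/
abbrev LamL (n : ℕ) : Type _ := Lam K u (lam * p ^ n / b) (p ^ n / b)

theorem level_mono {p : ℕ} [Fact p.Prime] (c b : ℝ≥0) {m n : ℕ} (h : m ≤ n) :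
    c * (p : ℝ≥0) ^ m / b ≤ c * p ^ n / b := by
  have hp : (1 : ℝ≥0) ≤ p := by exact_mod_cast (Fact.out : p.Prime).one_le
  gcongr

theorem level_succ {p : ℕ} (c b : ℝ≥0) (n : ℕ) :
    c * (p : ℝ≥0) ^ (n + 1) / b = c * p ^ n / b * p := by
  rw [pow_succ, ← mul_assoc, div_mul_eq_mul_div]

/-- The restriction map `Λ_{R₀,[0,b/p^m],K} → Λ_{R₀,[0,b/p^n],K}`, for `m ≤ n`. -/
def res {m n : ℕ} (h : m ≤ n) : LamL K u lam b m →+* LamL K u lam b n :=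
  lamMap u (lamCompat_id (level_mono (p := p) lam b h) (by simpa using level_mono (p := p) 1 b h))

/-- The Frobenius `φ : Λ_{R₀,[0,b/p^n],K} → Λ_{R₀,[0,b/p^(n+1)],K}`. -/
def frob (n : ℕ) : LamL K u lam b n →+* LamL K u lam b (n + 1) :=
  lamMap u (lamCompat_frobW (level_succ (p := p) lam b n) (by simpa using level_succ (p := p) 1 b n))

/-- The action of `G_K` on `Λ_{R₀,[0,b/p^n],K}`. -/
def galL (n : ℕ) : GK K →* (LamL K u lam b n →+* LamL K u lam b n) where
  toFun σ := lamMap u (lamCompat_galW σ)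
  map_one' := RingHom.ext fun y => by
    have h := lamMap_comp u (lamCompat_id (K := K) le_rfl le_rfl) (lamCompat_galW 1)
      (lamCompat_id (ρ := lam * p ^ n / b) (β := p ^ n / b) le_rfl le_rfl)
      (fun x _ => galW_one x) y
    rw [lamMap_id] at h
    exact h
  map_mul' σ τ := RingHom.ext fun y =>
    (lamMap_comp u (lamCompat_galW τ) (lamCompat_galW σ) (lamCompat_galW (σ * τ))
      (fun x _ => (galW_mul (σ : GalQp p) τ x).symm) y).symm

theorem HK_le_ker_galL (n : ℕ) : HK K ≤ (galL K u lam b n).ker := by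
  intro σ hσ
  refine RingHom.ext fun y => ?_
  have h := lamMap_comp u (lamCompat_id (K := K) le_rfl le_rfl) (lamCompat_galW σ)
    (lamCompat_id (ρ := lam * p ^ n / b) (β := p ^ n / b) le_rfl le_rfl)
    (fun x hx => hx.2 σ hσ) y
  rw [lamMap_id] at h
  exact h

/-- The action of `Γ_K` on `Λ_{R₀,[0,b/p^n],K}`. -/
def gam (n : ℕ) : GammaK K →* (LamL K u lam b n →+* LamL K u lam b n) :=
  QuotientGroup.lift (HK K) (galL K u lam b n) (HK_le_ker_galL K u lam b n)

theorem gam_res {m n : ℕ} (h : m ≤ n) (γ : GammaK K) (x : LamL K u lam b m) :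
    gam K u lam b n γ (res K u lam b h x) = res K u lam b h (gam K u lam b m γ x) := by
  obtain ⟨σ, rfl⟩ := QuotientGroup.mk_surjective γ
  have hc := lamCompat_galW (ρ := lam * p ^ m / b) (β := p ^ m / b) σ
  have hi := lamCompat_id (K := K) (level_mono (p := p) lam b h)
    (by simpa using level_mono (p := p) 1 b h : (p : ℝ≥0) ^ m / b ≤ p ^ n / b)
  exact (lamMap_comp u hi (lamCompat_galW σ) (hc.comp hi) (fun _ _ => rfl) x).trans
    (lamMap_comp u hc hi (hc.comp hi) (fun _ _ => rfl) x).symm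

theorem frob_res {m n : ℕ} (h : m ≤ n) (x : LamL K u lam b m) :
    frob K u lam b n (res K u lam b h x) =
      res K u lam b (Nat.succ_le_succ h) (frob K u lam b m x) := by
  have hi := lamCompat_id (K := K) (level_mono (p := p) lam b h)
    (by simpa using level_mono (p := p) 1 b h : (p : ℝ≥0) ^ m / b ≤ p ^ n / b)
  have hi' := lamCompat_id (K := K) (level_mono (p := p) lam b (Nat.succ_le_succ h))
    (by simpa using level_mono (p := p) 1 b (Nat.succ_le_succ h) :
      (p : ℝ≥0) ^ (m + 1) / b ≤ p ^ (n + 1) / b)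
  have hf := lamCompat_frobW (K := K) (level_succ (p := p) lam b m)
    (by simpa using level_succ (p := p) 1 b m : (p : ℝ≥0) ^ (m + 1) / b = p ^ m / b * p)
  have hf' := lamCompat_frobW (K := K) (level_succ (p := p) lam b n)
    (by simpa using level_succ (p := p) 1 b n : (p : ℝ≥0) ^ (n + 1) / b = p ^ n / b * p)
  exact (lamMap_comp u hi hf' (hf.comp hi') (fun _ _ => rfl) x).trans
    (lamMap_comp u hf hi' (hf.comp hi') (fun _ _ => rfl) x).symm

theorem res_res {l m n : ℕ} (h : l ≤ m) (h' : m ≤ n) (x : LamL K u lam b l) :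
    res K u lam b h' (res K u lam b h x) = res K u lam b (h.trans h') x :=
  lamMap_comp u _ _ _ (fun _ _ => rfl) x

end Level

section Eps

variable {p : ℕ} [Fact p.Prime]

theorem galQp_fixed {σ : GalQp p} (hσ : chi p σ = 1) {t : PadicAlgCl p} {n : ℕ}
    (ht : t ^ p ^ n = 1) : σ t = t := by
  have h := cyclotomicCharacter.spec p (σ : PadicAlgCl p ≃+* PadicAlgCl p) t ht
  have h1 : cyclotomicCharacter (PadicAlgCl p) p (σ : PadicAlgCl p ≃+* PadicAlgCl p) = 1 := hσ
  rw [h1] at h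
  refine h.trans ?_
  rw [Units.val_one, map_one]
  rcases n with _ | n
  · rw [pow_zero, pow_one] at ht
    rw [ht, one_pow]
  · have : Fact (1 < p ^ (n + 1)) :=
      ⟨Nat.one_lt_pow (Nat.succ_ne_zero n) (Fact.out : p.Prime).one_lt⟩
    rw [ZMod.val_one, pow_one]

theorem galC_fixed {σ : GalQp p} (hσ : chi p σ = 1) {z : ℂ_[p]} {n : ℕ}
    (hz : z ^ p ^ n = 1) : galC σ z = z := by
  have : NeZero (p ^ n) := ⟨pow_ne_zero n (Fact.out : p.Prime).ne_zero⟩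
  obtain ⟨η, hη⟩ := HasEnoughRootsOfUnity.exists_primitiveRoot (PadicAlgCl p) (p ^ n)
  have hη' := hη.map_of_injective
    (f := (UniformSpace.Completion.coeRingHom : PadicAlgCl p →+* ℂ_[p]))
    (UniformSpace.Completion.coeRingHom : PadicAlgCl p →+* ℂ_[p]).injective
  obtain ⟨i, -, hi⟩ := hη'.eq_pow_of_pow_eq_one hz
  rw [← hi, map_pow]
  congr 1
  exact (galC_coe σ η).trans (congrArg _ (galQp_fixed hσ hη.pow_eq_one))

theorem galFlat_cycl_fixed {σ : GalQp p} (hσ : chi p σ = 1) {e : CFlat p} (he : e ∈ cycl p) :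
    galFlat σ e = e := by
  obtain ⟨x, rfl, ζ, h0, h1, h2⟩ := he
  have hζ : ∀ n, ζ n ^ p ^ n = 1 := fun n => by
    induction n with
    | zero => rw [pow_zero, pow_one, h0]
    | succ n ih => rw [pow_succ', pow_mul, h1, ih]
  rw [galFlat_algebraMap]
  congr 1
  refine Perfection.ext fun n => ?_
  refine (coeff_galOFlat σ x n).trans ?_
  rw [h2]
  change Ideal.Quotient.mk _ (galO σ (ζ n)) = _
  have h3 : ((ζ n : 𝓞_ℂ_[p]) : ℂ_[p]) ^ p ^ n = 1 := congrArg Subtype.val (hζ n)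
  have h4 : galO σ (ζ n) = ζ n := Subtype.ext (galC_fixed hσ h3)
  rw [h4]
  exact (h2 n).symm

theorem oFlatVal_le_one (x : OFlat p) : oFlatVal p x ≤ 1 := by
  by_cases h : x = 0
  · rw [h, map_zero]; exact zero_le_one
  obtain ⟨n, hn⟩ : ∃ n, PreTilt.coeff n x ≠ 0 :=
    not_forall.1 fun h0 => h <| Perfection.ext h0
  change PreTilt.valAux _ _ _ _ _ ≤ 1
  rw [PreTilt.valAux_eq (PadicComplexInt.integers p) hn]
  refine pow_le_one₀ zero_le ?_
  obtain ⟨r, hr⟩ := Ideal.Quotient.mk_surjective (PreTilt.coeff n x)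
  rw [← hr] at hn ⊢
  rw [ModP.preVal_mk (PadicComplexInt.integers p) hn]
  exact (PadicComplexInt.integers p).map_le_one r

theorem flatVal_cycl_le {e : CFlat p} (he : e ∈ cycl p) : flatVal p e ≤ 1 := by
  obtain ⟨x, rfl, -⟩ := he
  rw [flatVal_algebraMap]
  exact oFlatVal_le_one x

variable {K : IntermediateField ℚ_[p] (PadicAlgCl p)}

theorem teichmuller_cycl_mem_AK {e : CFlat p} (he : e ∈ cycl p) :
    WittVector.teichmuller p e ∈ AK K :=
  ⟨teichmuller_cycl_mem_ABig he, fun σ hσ => by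
    rw [galW_teichmuller]
    exact congrArg _ (galFlat_cycl_fixed (σ := (σ : GalQp p)) hσ he)⟩

theorem teichmuller_cycl_mem_Fil {e : CFlat p} (he : e ∈ cycl p) (ρ : ℝ≥0) :
    WittVector.teichmuller p e ∈ Fil K ρ 0 := by
  have h : ∀ k, k ≠ 0 → gaussTerm ρ (WittVector.teichmuller p e) k = 0 := fun k hk => by
    have h1 : 1 / (p : ℝ) ^ k ≠ 0 :=
      one_div_ne_zero (pow_ne_zero k (Nat.cast_ne_zero.2 (Fact.out : p.Prime).ne_zero))
    rw [gaussTerm, WittVector.teichmuller_coeff_pos p e k (Nat.pos_of_ne_zero hk), map_zero,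
      NNReal.coe_zero, Real.zero_rpow h1, zero_mul]
  refine ⟨teichmuller_cycl_mem_AK he, ?_, fun k => ?_⟩
  · refine tendsto_const_nhds.congr' ?_
    filter_upwards [Filter.eventually_ne_atTop 0] with k hk
    exact (h k hk).symm
  · rw [neg_zero, Real.rpow_zero]
    rcases eq_or_ne k 0 with rfl | hk
    · simpa [gaussTerm] using flatVal_cycl_le he
    · rw [h k hk]; exact zero_le_one

variable (K) {R₀ : Type*} [CommRing R₀] [Algebra ℤ_[p] R₀] (u : R₀) (lam b : ℝ≥0)

/-- The element `[e]` of `Λ_{R₀,[0,b/p^n],K}`. -/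
def teichL {e : CFlat p} (he : e ∈ cycl p) (n : ℕ) : LamL K u lam b n :=
  algebraMap (Lam0 K u (lam * p ^ n / b) (p ^ n / b)) (LamL K u lam b n) (AdicCompletion.of _ _
    (⟨1 ⊗ₜ WittVector.teichmuller p e,
      Algebra.subset_adjoin (Or.inl ⟨_, teichmuller_cycl_mem_Fil he _, rfl⟩)⟩ :
        lamPre K u (lam * p ^ n / b) (p ^ n / b)))

end Eps

/-! ### Rings strictly topologically of finite type over `D_λ^∘` -/

section Coefficients

variable (p : ℕ) [Fact p.Prime] (m m' : ℕ)

/-- `ℤ_p[u, T] / (u ^ m' T - p ^ m)`. -/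
abbrev DPoly : Type :=
  MvPolynomial (Fin 2) ℤ_[p] ⧸ Ideal.span {(MvPolynomial.X 0 ^ m' * MvPolynomial.X 1 -
    MvPolynomial.C ((p : ℤ_[p]) ^ m) : MvPolynomial (Fin 2) ℤ_[p])}

/-- The element `u` of `ℤ_p[u, T] / (u ^ m' T - p ^ m)`. -/
def dPolyU : DPoly p m m' := Ideal.Quotient.mk _ (MvPolynomial.X 0)

/-- The ring `D_λ^∘ = ℤ_p⟦u⟧⟨p ^ m / u ^ m'⟩`, with `λ = m' / m`: the `u`-adic completion of
`ℤ_p[u, T] / (u ^ m' T - p ^ m)`. -/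
abbrev DCirc : Type := AdicCompletion (Ideal.span {dPolyU p m m'}) (DPoly p m m')

/-- The element `u` of `D_λ^∘`. -/
def dCircU : DCirc p m m' := AdicCompletion.of _ _ (dPolyU p m m')

/-- The ring `D_λ^∘⟨X_1, …, X_N⟩` of strictly convergent power series. -/
abbrev DCircTate (N : ℕ) : Type :=
  AdicCompletion (Ideal.span {(MvPolynomial.C (dCircU p m m') :
    MvPolynomial (Fin N) (DCirc p m m'))}) (MvPolynomial (Fin N) (DCirc p m m'))

/-- `R₀`, with its `u`-adic topology, is complete and strictly topologically of finite type over
`D_λ^∘`, with `λ = m' / m`, where the variable `u` of `D_λ^∘` maps to the given `u ∈ R₀`. -/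
def IsStrictlyTFT {R₀ : Type*} [CommRing R₀] [Algebra ℤ_[p] R₀] (u : R₀) : Prop :=
  IsAdicComplete (Ideal.span {u}) R₀ ∧ ∃ (N : ℕ) (g : DCircTate p m m' N →ₐ[ℤ_[p]] R₀),
    Function.Surjective g ∧ g (AdicCompletion.of _ _ (MvPolynomial.C (dCircU p m m'))) = u

end Coefficients

/-! ### Base change and semilinear maps -/

section BaseChange

variable {A B B' : Type*} [CommRing A] [CommRing B] [CommRing B']

/-- The base change `B ⊗_A M` of a module along a ring homomorphism `f : A → B`. -/
def BaseChange (f : A →+* B) (M : Type*) [AddCommGroup M] [Module A M] : Type _ :=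
  letI := f.toAlgebra
  B ⊗[A] M

variable (f : A →+* B) {M : Type*} [AddCommGroup M] [Module A M]

instance : AddCommGroup (BaseChange f M) :=
  letI := f.toAlgebra
  (TensorProduct.addCommGroup : AddCommGroup (B ⊗[A] M))

instance : Module B (BaseChange f M) :=
  letI := f.toAlgebra
  (TensorProduct.leftModule : Module B (B ⊗[A] M))

/-- The pure tensor `b ⊗ m`. -/
def BaseChange.mk (b : B) (m : M) : BaseChange f M :=
  letI := f.toAlgebra
  (b ⊗ₜ[A] m : B ⊗[A] M)

theorem BaseChange.smul_mk (b c : B) (m : M) :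
    b • BaseChange.mk f c m = BaseChange.mk f (b * c) m := rfl

theorem BaseChange.mk_smul (a : A) (m : M) :
    BaseChange.mk f 1 (a • m) = f a • BaseChange.mk f 1 m := by
  let _ := f.toAlgebra
  change (1 ⊗ₜ[A] (a • m) : B ⊗[A] M) = (f a * 1) ⊗ₜ[A] m
  rw [TensorProduct.tmul_smul, TensorProduct.smul_tmul', Algebra.smul_def]
  rfl

theorem BaseChange.mk_add (b : B) (m m' : M) :
    BaseChange.mk f b (m + m') = BaseChange.mk f b m + BaseChange.mk f b m' := by
  let _ := f.toAlgebra
  exact TensorProduct.tmul_add b m m'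

theorem BaseChange.induction {P : BaseChange f M → Prop} (h0 : P 0)
    (h1 : ∀ b m, P (BaseChange.mk f b m)) (h2 : ∀ x y, P x → P y → P (x + y))
    (x : BaseChange f M) : P x := by
  let _ := f.toAlgebra
  exact TensorProduct.induction_on (motive := P) x h0 h1 h2

variable {N : Type*} [AddCommGroup N] [Module B' N]

/-- The additive map underlying `BaseChange.lift`. -/
def BaseChange.liftAdd (β : B →+* B') (h : M →+ N) (hh : ∀ a m, h (a • m) = β (f a) • h m) :
    BaseChange f M →+ N :=
  letI := f.toAlgebra
  TensorProduct.liftAddHom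
    (((AddMonoidHom.smul : B' →+ N →+ N).comp (β : B →+ B')).compl₂ h)
    (fun a b m => by
      change β (f a * b) • h m = β b • h (a • m)
      rw [hh, smul_smul, map_mul, mul_comm])

theorem BaseChange.liftAdd_mk (β : B →+* B') (h : M →+ N)
    (hh : ∀ a m, h (a • m) = β (f a) • h m) (b : B) (m : M) :
    BaseChange.liftAdd f β h hh (BaseChange.mk f b m) = β b • h m := rfl

/-- For `h : M → N` additive with `h(a m) = β(f(a)) h(m)`, the `β`-semilinear map
`B ⊗_A M → N`, `b ⊗ m ↦ β(b) h(m)`. -/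
def BaseChange.lift (β : B →+* B') (h : M →+ N) (hh : ∀ a m, h (a • m) = β (f a) • h m) :
    BaseChange f M →ₛₗ[β] N where
  __ := BaseChange.liftAdd f β h hh
  map_smul' b x := by
    change BaseChange.liftAdd f β h hh (b • x) = β b • BaseChange.liftAdd f β h hh x
    refine BaseChange.induction f
      (P := fun x => BaseChange.liftAdd f β h hh (b • x) = β b • BaseChange.liftAdd f β h hh x)
      ?_ (fun c m => ?_) (fun x y hx hy => ?_) x
    · rw [smul_zero, map_zero, smul_zero]
    · rw [BaseChange.smul_mk, BaseChange.liftAdd_mk, BaseChange.liftAdd_mk, map_mul, mul_smul]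
    · rw [smul_add, map_add, hx, hy, map_add, smul_add]

theorem BaseChange.lift_mk (β : B →+* B') (h : M →+ N)
    (hh : ∀ a m, h (a • m) = β (f a) • h m) (b : B) (m : M) :
    BaseChange.lift f β h hh (BaseChange.mk f b m) = β b • h m := rfl

end BaseChange

/-! ### `(φ, Γ_K)`-modules -/

section Modules

variable {p : ℕ} [Fact p.Prime] (K : IntermediateField ℚ_[p] (PadicAlgCl p))
  {R₀ : Type*} [CommRing R₀] [Algebra ℤ_[p] R₀] (u : R₀) (lam b : ℝ≥0)
  (D : Type*) [AddCommGroup D] [Module (LamL K u lam b 0) D]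

/-- `Λ_{R₀,[0,b/p^n],K} ⊗ D` for a module `D` over `Λ_{R₀,[0,b],K}`. -/
abbrev DL (n : ℕ) : Type _ := BaseChange (res K u lam b (Nat.zero_le n)) D

instance (n : ℕ) : TopologicalSpace (DL K u lam b D n) :=
  moduleTopology (LamL K u lam b n) (DL K u lam b D n)

variable {D}

/-- The map `d ↦ 1 ⊗ d`. -/
def toDL (n : ℕ) : D →+ DL K u lam b D n where
  toFun d := BaseChange.mk _ 1 d
  map_zero' := by
    have h := BaseChange.mk_smul (res K u lam b (Nat.zero_le n)) 0 (0 : D)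
    rwa [map_zero, zero_smul, zero_smul] at h
  map_add' := BaseChange.mk_add _ 1

theorem toDL_smul (n : ℕ) (a : LamL K u lam b 0) (d : D) :
    toDL K u lam b n (a • d) = res K u lam b (Nat.zero_le n) a • toDL K u lam b n d :=
  BaseChange.mk_smul _ a d

/-- The restriction map `Λ_{R₀,[0,b/p^m],K} ⊗ D → Λ_{R₀,[0,b/p^n],K} ⊗ D` for `m ≤ n`. -/
def resD {m n : ℕ} (h : m ≤ n) : DL K u lam b D m →ₛₗ[res K u lam b h] DL K u lam b D n :=
  BaseChange.lift _ (res K u lam b h) (toDL K u lam b n) (fun a d => by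
    rw [toDL_smul, res_res])

variable (D) in
/-- The structure of a `(φ, Γ_K)`-module on a module `D` over `Λ_{R₀,[0,b],K}`: a continuous
semilinear action of `Γ_K` and a semilinear map `φ : D → Λ_{R₀,[0,b/p],K} ⊗ D`, commuting with
each other, such that the linearization `φ^* D → Λ_{R₀,[0,b/p],K} ⊗ D` is an isomorphism. -/
structure PhiGammaStr [TopologicalSpace D] where
  /-- the action of `Γ_K` -/
  gamma : GammaK K →* AddMonoid.End D
  gamma_smul : ∀ γ a d, gamma γ (a • d) = gam K u lam b 0 γ a • gamma γ d
  continuous_gamma : Continuous fun x : GammaK K × D => gamma x.1 x.2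
  /-- the Frobenius -/
  phi : D →ₛₗ[frob K u lam b 0] DL K u lam b D 1
  phi_bijective : Function.Bijective
    (BaseChange.lift (frob K u lam b 0) (RingHom.id _) phi.toAddMonoidHom
      (fun a d => phi.map_smulₛₗ a d))
  phi_gamma : ∀ γ d, phi (gamma γ d) =
    BaseChange.lift (res K u lam b (Nat.zero_le 1)) (gam K u lam b 1 γ)
      ((toDL K u lam b 1).comp (gamma γ))
      (fun a d => by
        change toDL K u lam b 1 (gamma γ (a • d)) = _
        rw [gamma_smul, toDL_smul, gam_res]; rfl) (phi d)

variable {K u lam b} [TopologicalSpace D] (P : PhiGammaStr K u lam b D)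

/-- The action of `γ ∈ Γ_K` on `Λ_{R₀,[0,b/p^n],K} ⊗ D`. -/
def PhiGammaStr.gammaL (n : ℕ) (γ : GammaK K) :
    DL K u lam b D n →ₛₗ[gam K u lam b n γ] DL K u lam b D n :=
  BaseChange.lift (res K u lam b (Nat.zero_le n)) (gam K u lam b n γ)
    ((toDL K u lam b n).comp (P.gamma γ))
    (fun a d => by
      change toDL K u lam b n (P.gamma γ (a • d)) = _
      rw [P.gamma_smul, toDL_smul, gam_res]; rfl)

/-- The Frobenius `Λ_{R₀,[0,b/p^n],K} ⊗ D → Λ_{R₀,[0,b/p^(n+1)],K} ⊗ D`. -/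
def PhiGammaStr.phiL (n : ℕ) :
    DL K u lam b D n →ₛₗ[frob K u lam b n] DL K u lam b D (n + 1) :=
  BaseChange.lift (res K u lam b (Nat.zero_le n)) (frob K u lam b n)
    ((resD K u lam b (D := D) (m := 1) (n := n + 1)
      (Nat.succ_le_succ (Nat.zero_le n))).toAddMonoidHom.comp P.phi.toAddMonoidHom)
    (fun a d => by
      rw [frob_res]
      change resD K u lam b (m := 1) (n := n + 1) _ (P.phi (a • d)) = _
      rw [LinearMap.map_smulₛₗ, LinearMap.map_smulₛₗ]
      rfl)

open Classical in
/-- The left inverse `ψ : Λ_{R₀,[0,b/p^(n+1)],K} ⊗ D → Λ_{R₀,[0,b/p^n],K} ⊗ D` of `φ`, given by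
`ψ(∑_{0 ≤ j < p} [ε]^j φ(c_j)) = c_0`. -/
def PhiGammaStr.psi {ε : CFlat p} (hε : IsEps p ε) (n : ℕ) (x : DL K u lam b D (n + 1)) :
    DL K u lam b D n :=
  if h : ∃ c : Fin p → DL K u lam b D n,
    x = ∑ j : Fin p, teichL K u lam b hε.mem_cycl (n + 1) ^ (j : ℕ) • PhiGammaStr.phiL P n (c j)
  then h.choose ⟨0, (Fact.out : p.Prime).pos⟩ else 0

end Modules

/-- `f` maps `S` bijectively onto `S`, and the inverse is continuous for the subspace topology. -/
def HasContinuousInverseOn {X : Type*} [TopologicalSpace X] (f : X → X) (S : Set X) : Prop :=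
  Set.MapsTo f S S ∧ ∃ g : X → X, Set.MapsTo g S S ∧ Set.InvOn g f S S ∧ ContinuousOn g S

end PseudoPhiGamma

end

open PseudoPhiGamma

noncomputable section

namespace PseudoPhiGamma

open Filter Topology

open PreTilt (coeff coeff_pow_p)
open PadicComplexInt (integers)
open PadicComplex (valuation_p norm_extends)
open Ideal.Quotient (mk_surjective mk_eq_mk_iff_sub_mem eq_zero_iff_mem mkₐ)
open Finset (sum_insert range sum_eq_single mem_range mul_sum sum_mul sum_nonneg single_le_sum mem_insert mem_image mem_erase dvd_sum sum_sub_distrib sum_range_succ sum_add_distrib univ sum_congr sum_comm sum_range mem_univ smul_sum mem_Ico)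
open IsFractionRing (div_surjective)
open Real (dist_0_eq_abs rpow_natCast rpow_mul)
open Nat (cast_succ lt_succ_self mod_lt cast_one one_lt_pow)
open MvPolynomial (aeval induction_on)
open WittVector (init select tail constantCoeff teichmuller teichmuller_coeff_pos one_coeff_zero teichmuller_coeff_zero zero_coeff)
open Function (Injective iterate_succ_apply' Bijective)
open Ideal (mem_span_singleton span mul_top)
open UniformSpace.Completion (coeRingHom)
open IntermediateField (adjoin mem_adjoin_simple_self adjoin_simple_eq_bot_iff subset_adjoin adjoin_le_iff)
open IntermediateField.adjoin (finiteDimensional finrank)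
open Int (castRingHom)
open Pi (single)
open Polynomial (aeval_C mem_degreeLT finsetSum_coeff coeff_zero derivative_map monomial eval_map_algebraMap hom_eval₂ eval_prod eval_sub eval_pow eval_X eval_C X coeff_map eval_map)
open Units (val_pow_eq_pow_val val_mul val_one)
open Algebra (smul_def ofId trace)
open HasEnoughRootsOfUnity (exists_primitiveRoot)
open MulMemClass (coe_mul)
open Submodule (smul_mem subset_span)
open Subring (subset_closure)
open SubmonoidClass (coe_pow)
open AdicCompletion (of evalₐ evalₐ_mk ext_evalₐ evalₐ_of evalOneₐ)
open Algebra.TensorProduct (tmul_mul_tmul one_def tmul_pow)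
open LinearMap (mulLeft proj lTensor_tmul)
open TopologicalSpace (generateFrom)
open LinearEquiv (ofBijective)
open IsModuleTopology (toContinuousAdd toContinuousSMul)

variable {p : ℕ} [Fact p.Prime] {K : IntermediateField ℚ_[p] (PadicAlgCl p)} {R₀ : Type*} [CommRing R₀] [Algebra ℤ_[p] R₀] {u : R₀} {ε ϖ : CFlat p} {lam b ρ β : ℝ≥0}

local notation "Ã" => ATilde p
local notation "ω" => teichmuller p
local notation "Λ" => LamL K u lam b
local notation "DΛ" => DL K u lam b
local notation "ιD" => toDL K u lam b
local notation "rD" => resD K u lam b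
local notation "γΛ" => gam K u lam b
local notation "ΛR" => Lam K u ρ β
local notation "ΛP" => lamPre K u ρ β
local notation "ΛI" => lamIdeal K u ρ β
local notation "Ĉ" => CFlat p

variable (p) in
theorem prm : p.Prime := Fact.out
section FlatNorm
lemma one_lt_p : (1 : ℝ) < p := by exact_mod_cast (prm p).one_lt

lemma p_pos : (0 : ℝ) < p := by exact_mod_cast (prm p).pos

lemma exists_coeff_ne_zero {x : OFlat p} (hx : x ≠ 0) : ∃ n, coeff n x ≠ 0 := not_forall.1 fun h0 => hx <| Perfection.ext h0

lemma coeff_pow_iter (x : OFlat p) (n k : ℕ) : coeff (n + k) x ^ p ^ k = coeff n x := by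
  induction k with
  | zero => simp
  | succ k ih => rw [pow_succ', pow_mul, ← add_assoc, coeff_pow_p, ih]

lemma mk_ne_zero_iff {a : 𝓞_ℂ_[p]} : (Ideal.Quotient.mk _ a : ModP 𝓞_ℂ_[p] p) ≠ 0 ↔ (1 / p : ℝ≥0) < (Valued.v (a : ℂ_[p]) : ℝ≥0) := by
  rw [← ModP.v_p_lt_val (integers p), valuation_p]
  rfl

lemma oFlatVal_eq {x : OFlat p} {n : ℕ} {a : 𝓞_ℂ_[p]} (ha : coeff n x = Ideal.Quotient.mk _ a) (h : (1 / p : ℝ≥0) < (Valued.v (a : ℂ_[p]) : ℝ≥0)) :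
    oFlatVal p x = (Valued.v (a : ℂ_[p]) : ℝ≥0) ^ p ^ n := by
  have h0 := mk_ne_zero_iff.2 h
  change PreTilt.valAux _ _ _ _ _ = _
  rw [PreTilt.valAux_eq (integers p) (ha ▸ h0), ha, ModP.preVal_mk (integers p) h0]
  rfl

lemma coeff_eq_zero_iff {x : OFlat p} {n : ℕ} : coeff n x = 0 ↔ oFlatVal p x ≤ (1 / p : ℝ≥0) ^ p ^ n := by
  constructor
  · intro h; by_cases hx : x = 0
    · simp_all
    obtain ⟨m, hm⟩ := exists_coeff_ne_zero hx; have hnm : n ≤ m := by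
      by_contra! hlt
      exact Perfection.coeff_ne_zero_of_le hm hlt.le h
    obtain ⟨k, rfl⟩ := Nat.exists_eq_add_of_le hnm; obtain ⟨a, ha⟩ := mk_surjective (coeff (n + k) x)
    rw [oFlatVal_eq ha.symm (mk_ne_zero_iff.1 (ha ▸ hm)), pow_add, mul_comm, pow_mul]; gcongr; rw [← coeff_pow_iter x n k, ← ha, ← map_pow] at h
    have := mt mk_ne_zero_iff.2 (not_not.2 h)
    rw [not_lt] at this; simpa using this
  · intro h; by_contra h0; obtain ⟨a, ha⟩ := mk_surjective (coeff n x); have h1 := mk_ne_zero_iff.1 (ha ▸ h0); rw [oFlatVal_eq ha.symm h1] at h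
    exact absurd h (not_le.2 (pow_lt_pow_left₀ h1 zero_le (pow_ne_zero _ (prm p).ne_zero)))

/-- An element of the inverse limit over Frobenius with given coefficients. -/
def ofCoeffs (c : ℕ → ModP 𝓞_ℂ_[p] p) (hc : ∀ n, c (n + 1) ^ p = c n) : OFlat p := (⟨c, hc⟩ : Perfection (ModP 𝓞_ℂ_[p] p) p)

lemma coeff_ofCoeffs (c : ℕ → ModP 𝓞_ℂ_[p] p) (hc : ∀ n, c (n + 1) ^ p = c n) (n : ℕ) : coeff n (ofCoeffs c hc) = c n := rfl

lemma mk_eq_mk_iff {a b : 𝓞_ℂ_[p]} : (Ideal.Quotient.mk _ a : ModP 𝓞_ℂ_[p] p) = Ideal.Quotient.mk _ b ↔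
      (Valued.v ((a : ℂ_[p]) - b) : ℝ≥0) ≤ 1 / p := by
  rw [← sub_eq_zero, ← map_sub, ← not_lt]
  exact not_iff_not.1 (by rw [not_not]; exact mk_ne_zero_iff)

lemma mk_pow_eq_mk_pow {a b : 𝓞_ℂ_[p]} (h : (Valued.v ((a : ℂ_[p]) - b) : ℝ≥0) ^ 2 ≤ 1 / p) :
    (Ideal.Quotient.mk _ (a ^ p) : ModP 𝓞_ℂ_[p] p) = Ideal.Quotient.mk _ (b ^ p) := by
  have e : (Ideal.Quotient.mk _ ((a - b) ^ p) : ModP 𝓞_ℂ_[p] p) = 0 := by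
    by_contra h0
    have h1 := mk_ne_zero_iff.1 h0
    have h2 : (Valued.v ((a : ℂ_[p]) - b) : ℝ≥0) ≤ 1 := (a - b).2
    have h3 : (Valued.v (((a - b) ^ p : 𝓞_ℂ_[p]) : ℂ_[p]) : ℝ≥0) = (Valued.v ((a : ℂ_[p]) - b) : ℝ≥0) ^ p := by push_cast; rw [map_pow]
    rw [h3] at h1; exact absurd (h1.trans_le ((pow_le_pow_of_le_one zero_le h2
      (prm p).two_le).trans h)) (lt_irrefl _)
  rw [map_pow, map_sub, sub_pow_char (R := ModP 𝓞_ℂ_[p] p), sub_eq_zero] at e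
  simp_all

lemma dvd_of_oFlatVal_le_aux {a b : OFlat p} (hb : (1 / p : ℝ≥0) < oFlatVal p b ^ 2) (h : oFlatVal p a ≤ oFlatVal p b) : b ∣ a := by
  have hp1 : (1 / p : ℝ≥0) ≤ 1 := by
    rw [one_div]; exact inv_le_one_of_one_le₀ (by exact_mod_cast (prm p).one_le)
  have hb0 : (1 / p : ℝ≥0) < oFlatVal p b :=
    hb.trans_le (pow_le_of_le_one zero_le (oFlatVal_le_one b) two_ne_zero)
  choose α hα using fun n => mk_surjective (coeff n a)
  choose β hβ using fun n => mk_surjective (coeff n b)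
  have hp0 : ∀ n, p ^ n ≠ 0 := fun n => pow_ne_zero n (prm p).ne_zero
  have hbn : ∀ n, coeff n b ≠ 0 := fun n hn => by
    have := coeff_eq_zero_iff.1 hn
    exact absurd (hb0.trans_le (this.trans (pow_le_of_le_one zero_le hp1 (hp0 n)))) (lt_irrefl _)
  have hβv : ∀ n, oFlatVal p b = (Valued.v (β n : ℂ_[p]) : ℝ≥0) ^ p ^ n := fun n =>
    oFlatVal_eq (hβ n).symm (mk_ne_zero_iff.1 ((hβ n).symm ▸ hbn n))
  have hβb : ∀ n, oFlatVal p b ≤ (Valued.v (β n : ℂ_[p]) : ℝ≥0) := fun n => by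
    rw [hβv n]; exact pow_le_of_le_one zero_le (β n).2 (hp0 n)
  have hβ0 : ∀ n, (Valued.v (β n : ℂ_[p]) : ℝ≥0) ≠ 0 := fun n =>
    ((zero_le.trans_lt hb0).trans_le (hβb n)).ne'
  have hαβ : ∀ n, (Valued.v (α n : ℂ_[p]) : ℝ≥0) ≤ Valued.v (β n : ℂ_[p]) := fun n => by
    by_cases ha : (1 / p : ℝ≥0) < (Valued.v (α n : ℂ_[p]) : ℝ≥0)
    · rw [oFlatVal_eq (hα n).symm ha, hβv n] at h; exact (pow_le_pow_iff_left₀ zero_le zero_le (hp0 n)).1 h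
    · exact (not_lt.1 ha).trans (hb0.le.trans (hβb n))
  choose γ hγ using fun n => (integers p).dvd_of_le (hαβ n)
  have hγ' : ∀ n, ((α n : 𝓞_ℂ_[p]) : ℂ_[p]) = (β n : ℂ_[p]) * (γ n : ℂ_[p]) := fun n => by
    rw [hγ n]; push_cast; rfl
  have key : ∀ n, (Valued.v (((γ (n + 1) ^ p : 𝓞_ℂ_[p]) : ℂ_[p]) - (γ n : ℂ_[p])) : ℝ≥0) * oFlatVal p b ≤ 1 / p := fun n => by
    refine (mul_le_mul_right (hβb n) _).trans ?_; rw [← map_mul, sub_mul]; have e : (Ideal.Quotient.mk _ (γ (n + 1) ^ p * β n) : ModP 𝓞_ℂ_[p] p) =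
        Ideal.Quotient.mk _ (γ n * β n) := by
      rw [map_mul, hβ n, ← coeff_pow_p, ← hβ (n + 1), ← map_pow, ← map_mul, ← mul_pow,
        mul_comm (γ (n + 1)), ← hγ (n + 1), mul_comm (γ n), ← hγ n, map_pow, hα, hα, coeff_pow_p]
    have := mk_eq_mk_iff.1 e
    omega
  have key2 : ∀ n, (Valued.v (((γ (n + 1) ^ p : 𝓞_ℂ_[p]) : ℂ_[p]) - (γ n : ℂ_[p])) : ℝ≥0) ^ 2 ≤ 1 / p := fun n => by
    by_contra! hlt
    have h1 := mul_lt_mul'' hlt hb zero_le zero_le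
    rw [← mul_pow, ← pow_two] at h1; exact absurd (h1.trans_le (pow_le_pow_left₀ zero_le (key n) 2)) (lt_irrefl _)
  refine ⟨ofCoeffs (fun n => Ideal.Quotient.mk _ (γ (n + 1) ^ p)) (fun n => ?_), ?_⟩
  · rw [← map_pow]; exact mk_pow_eq_mk_pow (key2 (n + 1))
  · refine Perfection.ext fun n => ?_
    change coeff n a = coeff n (b * _); rw [map_mul, coeff_ofCoeffs, map_pow, ← coeff_pow_p, ← coeff_pow_p b, ← mul_pow, ← hβ, ← map_mul, ← hγ, hα]

lemma dvd_of_oFlatVal_le {a b : OFlat p} (h : oFlatVal p a ≤ oFlatVal p b) : b ∣ a := by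
  by_cases hb : b = 0
  · rw [hb, map_zero, nonpos_iff_eq_zero] at h; have : a = 0 := (PreTilt.map_eq_zero (integers p)).mp h; simp_all
  obtain ⟨n, hn⟩ := exists_coeff_ne_zero hb
  have hn1 : coeff (n + 1) b ≠ 0 := Perfection.coeff_ne_zero_of_le hn (Nat.le_succ n)
  set F := (frobeniusEquiv (OFlat p) p).symm^[n + 1] with hF
  have hpow : ∀ x, F x ^ p ^ (n + 1) = x := fun x => by
    rw [hF]; exact iterate_frobeniusEquiv_symm_pow_p_pow (R := OFlat p) (p := p) x (n + 1)
  have hne := pow_ne_zero (n + 1) (prm p).ne_zero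
  have h2 : F b ∣ F a := by
    apply dvd_of_oFlatVal_le_aux
    · have h3 : coeff 0 (F b ^ p) ≠ 0 := by
        rw [hF, map_pow]; have := PreTilt.coeff_iterate_frobeniusEquiv_symm 0 (n + 1) b; rw [this, zero_add, coeff_pow_p]; exact hn
      have h4 := mt coeff_eq_zero_iff.2 h3
      rw [not_le, pow_zero, pow_one, map_pow] at h4; exact h4.trans_le (pow_le_pow_of_le_one zero_le (oFlatVal_le_one _) (prm p).two_le)
    · rw [← hpow a, ← hpow b, map_pow, map_pow] at h; exact (pow_le_pow_iff_left₀ zero_le zero_le hne).1 h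
  rw [← hpow a, ← hpow b]
  exact pow_dvd_pow_of_dvd h2 _

/-- The absolute value of `ℂ_p^♭` as a real number. -/
def fn (x : Ĉ) : ℝ := flatVal p x

lemma fn_nonneg (x : Ĉ) : 0 ≤ fn x := NNReal.coe_nonneg _
@[simp] lemma fn_zero : fn (0 : Ĉ) = 0 := by simp [fn]
@[simp] lemma fn_one : fn (1 : Ĉ) = 1 := by simp [fn]
lemma fn_mul (x y : Ĉ) : fn (x * y) = fn x * fn y := by simp [fn]
lemma fn_pow (x : Ĉ) (n : ℕ) : fn (x ^ n) = fn x ^ n := by simp [fn]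
lemma fn_zpow (x : Ĉ) (n : ℤ) : fn (x ^ n) = fn x ^ n := by simp [fn]
lemma fn_inv (x : Ĉ) : fn x⁻¹ = (fn x)⁻¹ := by simp [fn]
lemma fn_div (x y : Ĉ) : fn (x / y) = fn x / fn y := by simp [fn]
lemma fn_neg (x : Ĉ) : fn (-x) = fn x := by simp [fn, Valuation.map_neg]
lemma fn_sub_comm (x y : Ĉ) : fn (x - y) = fn (y - x) := by rw [← fn_neg, neg_sub]
lemma fn_add_le (x y : Ĉ) : fn (x + y) ≤ max (fn x) (fn y) := by
  have := (flatVal p).map_add x y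
  unfold fn
  linarith
lemma fn_sub_le (x y : Ĉ) : fn (x - y) ≤ max (fn x) (fn y) := by
  rw [sub_eq_add_neg, ← fn_neg y]; exact fn_add_le _ _
lemma fn_add_le_of {x y : Ĉ} {B : ℝ} (hx : fn x ≤ B) (hy : fn y ≤ B) : fn (x + y) ≤ B := (fn_add_le x y).trans (max_le hx hy)
lemma fn_sub_le_of {x y : Ĉ} {B : ℝ} (hx : fn x ≤ B) (hy : fn y ≤ B) : fn (x - y) ≤ B := (fn_sub_le x y).trans (max_le hx hy)

lemma fn_sum_le {ι : Type*} (s : Finset ι) (f : ι → Ĉ) {B : ℝ} (hB : 0 ≤ B) (h : ∀ i ∈ s, fn (f i) ≤ B) : fn (∑ i ∈ s, f i) ≤ B := by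
  classical
  induction s using Finset.induction_on with
  | empty => simpa
  | insert a s ha ih =>
    rw [sum_insert ha]; exact fn_add_le_of (h a (by simp)) (ih fun i hi => h i (by simp [hi]))

lemma fn_sum_lt {ι : Type*} (s : Finset ι) (f : ι → Ĉ) {B : ℝ} (hB : 0 < B) (h : ∀ i ∈ s, fn (f i) < B) : fn (∑ i ∈ s, f i) < B := by
  classical
  induction s using Finset.induction_on with
  | empty => simpa
  | insert a s ha ih =>
    rw [sum_insert ha]; exact (fn_add_le _ _).trans_lt (max_lt (h a (by simp)) (ih fun i hi => h i (by simp [hi])))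

lemma fn_algebraMap (x : OFlat p) : fn (algebraMap (OFlat p) Ĉ x) = oFlatVal p x := by
  rw [fn, flatVal_algebraMap]

@[simp] lemma fn_eq_zero {x : Ĉ} : fn x = 0 ↔ x = 0 := by
  constructor
  · intro h; obtain ⟨a, b, hb, rfl⟩ := div_surjective (OFlat p) x; rw [fn_div, div_eq_zero_iff, fn_algebraMap, fn_algebraMap] at h
    have hz : ∀ c : OFlat p, ((oFlatVal p c : ℝ≥0) : ℝ) = 0 → c = 0 := fun c hc =>
      (PreTilt.map_eq_zero (integers p)).mp (NNReal.coe_eq_zero.1 hc)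
    rcases h with h | h
    · simp_all
    simp_all
  simp_all

lemma fn_pos {x : Ĉ} : 0 < fn x ↔ x ≠ 0 := by
  rw [(fn_nonneg x).lt_iff_ne, ne_comm, Ne, fn_eq_zero]

lemma fn_eq_of_sub_lt {x y : Ĉ} (h : fn (x - y) < fn y) : fn x = fn y := by
  have h1 : fn x ≤ fn y := by
    have := fn_add_le (x - y) y
    rw [sub_add_cancel] at this; exact this.trans (max_le h.le le_rfl)
  refine le_antisymm h1 ?_
  have := fn_sub_le x (x - y)
  rw [sub_sub_cancel] at this
  grind

lemma exists_algebraMap_eq {x : Ĉ} (h : fn x ≤ 1) : ∃ y : OFlat p, algebraMap (OFlat p) Ĉ y = x := by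
  obtain ⟨a, b, hb, rfl⟩ := div_surjective (OFlat p) x
  have hb0 : algebraMap (OFlat p) Ĉ b ≠ 0 :=
    by simp_all
  rw [fn_div, div_le_one (fn_pos.2 hb0), fn_algebraMap, fn_algebraMap] at h
  obtain ⟨c, rfl⟩ := dvd_of_oFlatVal_le (by exact_mod_cast h)
  exact ⟨c, by rw [map_mul, mul_div_cancel_left₀ _ hb0]⟩

instance : PerfectRing Ĉ p := by
  refine PerfectRing.ofSurjective Ĉ p fun x => ?_
  obtain ⟨a, b, hb, rfl⟩ := div_surjective (OFlat p) x
  obtain ⟨a', ha'⟩ := (PerfectRing.bijective_frobenius (R := OFlat p) (p := p)).2 a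
  obtain ⟨b', hb'⟩ := (PerfectRing.bijective_frobenius (R := OFlat p) (p := p)).2 b
  refine ⟨algebraMap _ _ a' / algebraMap _ _ b', ?_⟩
  aesop

lemma exists_lim (x : ℕ → Ĉ) (hx : Tendsto (fun n => fn (x (n + 1) - x n)) atTop (𝓝 0)) : ∃ y, Tendsto (fun n => fn (x n - y)) atTop (𝓝 0) := by
  have hev : ∀ ε > 0, ∃ N, ∀ n ≥ N, fn (x n - x N) ≤ ε := by
    intro ε hε; obtain ⟨N, hN⟩ := eventually_atTop.1 (hx.eventually (ge_mem_nhds hε)); refine ⟨N, fun n hn => ?_⟩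
    induction n, hn using Nat.le_induction with
    | base => simpa using hε.le
    | succ n hn ih =>
      rw [← sub_add_sub_cancel _ (x n)]; exact fn_add_le_of (hN n hn) ih
  obtain ⟨N₀, hN₀⟩ := hev 1 one_pos
  have hO : ∀ n, ∃ y : OFlat p, algebraMap (OFlat p) Ĉ y = x (N₀ + n) - x N₀ := fun n =>
    exists_algebraMap_eq (hN₀ _ (Nat.le_add_right _ _))
  choose y hy using hO
  have hc : ∀ k, ∃ N, ∀ n ≥ N, coeff k (y n) = coeff k (y N) := by
    intro k; have hpos : (0 : ℝ) < ((1 / p : ℝ≥0) ^ p ^ k : ℝ≥0) := by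
      have := (prm p).pos
      positivity
    obtain ⟨N, hN⟩ := hev _ hpos; refine ⟨N, fun n hn => ?_⟩
    rw [← sub_eq_zero, ← map_sub, coeff_eq_zero_iff]; have : fn (algebraMap (OFlat p) Ĉ (y n - y N)) ≤ ((1 / p : ℝ≥0) ^ p ^ k : ℝ≥0) := by
      rw [map_sub, hy, hy, sub_sub_sub_cancel_right, ← sub_sub_sub_cancel_right _ _ (x N)]; exact fn_sub_le_of (hN _ (by omega)) (hN _ (by omega))
    rw [fn_algebraMap] at this; exact_mod_cast this
  choose N hN using hc
  have hcoh : ∀ k n, n ≥ N k → coeff k (y n) = coeff k (y (N k)) := hN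
  let z : OFlat p := ofCoeffs (fun k => coeff k (y (N k))) (fun k => by
    rw [← hcoh (k + 1) (max (N k) (N (k + 1))) (le_max_right _ _), coeff_pow_p, hcoh k _ (le_max_left _ _)])
  refine ⟨algebraMap _ _ z + x N₀, ?_⟩
  rw [Metric.tendsto_atTop]
  intro ε hε
  obtain ⟨k, hk⟩ : ∃ k : ℕ, (1 / p : ℝ) ^ p ^ k < ε := by
    obtain ⟨k, hk⟩ := exists_pow_lt_of_lt_one hε (y := (1 / p : ℝ)) (by
      rw [div_lt_one p_pos]; exact one_lt_p)
    refine ⟨k, lt_of_le_of_lt (pow_le_pow_of_le_one (by positivity) ?_ ?_) hk⟩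
    · rw [div_le_one p_pos]; exact one_lt_p.le
    · exact (Nat.lt_pow_self (prm p).one_lt).le
  refine ⟨N₀ + N k, fun n hn => ?_⟩
  obtain ⟨j, rfl⟩ := Nat.exists_eq_add_of_le (show N₀ ≤ n by omega)
  rw [dist_0_eq_abs, abs_of_nonneg (fn_nonneg _), ← sub_sub, sub_right_comm, ← hy, ← map_sub, fn_algebraMap]
  refine lt_of_le_of_lt ?_ hk
  have : coeff k (y j - z) = 0 := by
    rw [map_sub, coeff_ofCoeffs, hcoh k j (by omega), sub_self]
  have := coeff_eq_zero_iff.1 this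
  linarith

end FlatNorm
section Gauss
lemma pp_ne_zero (k : ℕ) : p ^ k ≠ 0 := pow_ne_zero k (prm p).ne_zero

lemma fn_intCast_le (a : ℤ) : fn (a : Ĉ) ≤ 1 := by
  have h : ∀ n : ℕ, fn (n : Ĉ) ≤ 1 := fun n => by
    induction n with
    | zero => simp
    | succ n ih =>
      rw [cast_succ]; exact fn_add_le_of ih fn_one.le
  obtain ⟨n, rfl | rfl⟩ := a.eq_nat_or_neg
  · simpa using h n
  · simpa [fn_neg] using h n

lemma fn_aeval_sub_le {σ : Type*} (Φ : MvPolynomial σ ℤ) (a b : σ → Ĉ) {δ : ℝ} (hδ : 0 ≤ δ)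
    (ha : ∀ i, fn (a i) ≤ 1) (hb : ∀ i, fn (b i) ≤ 1) (hab : ∀ i, fn (a i - b i) ≤ δ) :
    fn (aeval a Φ - aeval b Φ) ≤ δ := by
  suffices h : fn (aeval a Φ) ≤ 1 ∧ fn (aeval a Φ - aeval b Φ) ≤ δ from h.2
  induction Φ using induction_on with
  | C n => simp [fn_intCast_le, hδ]
  | add f g hf hg =>
    rw [map_add, map_add, add_sub_add_comm]; exact ⟨fn_add_le_of hf.1 hg.1, fn_add_le_of hf.2 hg.2⟩
  | mul_X f i hf =>
    rw [map_mul, map_mul, MvPolynomial.aeval_X, MvPolynomial.aeval_X, fn_mul]; refine ⟨mul_le_one₀ hf.1 (fn_nonneg _) (ha i), ?_⟩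
    have e : (aeval a) f * a i - (aeval b) f * b i = (aeval a) f * (a i - b i) + ((aeval a) f - (aeval b) f) * b i := by ring
    rw [e]; refine fn_add_le_of ?_ ?_
    · rw [fn_mul]; exact (mul_le_of_le_one_left (fn_nonneg _) hf.1).trans (hab i)
    · rw [fn_mul]; exact (mul_le_of_le_one_right (fn_nonneg _) (hb i)).trans hf.2

lemma coeff_init {x : Ã} {n k : ℕ} (h : k < n) : (init n x).coeff k = x.coeff k := by
  simp [init, select, h]

lemma coeff_init_ge {x : Ã} {n k : ℕ} (h : n ≤ k) : (init n x).coeff k = 0 := by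
  simp [init, select, not_lt.2 h]

lemma fn_coeff_sub_sub_le {x x' y y' : Ã} {k : ℕ} {δ : ℝ} (hδ : 0 ≤ δ) (hx : ∀ i ≤ k, fn (x.coeff i) ≤ 1) (hx' : ∀ i ≤ k, fn (x'.coeff i) ≤ 1)
    (hy : ∀ i ≤ k, fn (y.coeff i) ≤ 1) (hy' : ∀ i ≤ k, fn (y'.coeff i) ≤ 1)
    (hxx' : ∀ i ≤ k, fn (x.coeff i - x'.coeff i) ≤ δ) (hyy' : ∀ i ≤ k, fn (y.coeff i - y'.coeff i) ≤ δ) :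
    fn ((x - y).coeff k - (x' - y').coeff k) ≤ δ := by
  have e : ∀ x y : Ã, (x - y).coeff k = aeval (Function.uncurry ![(init (k + 1) x).coeff,
        (init (k + 1) y).coeff]) (WittVector.wittSub p k) := fun x y => by
    rw [← coeff_init (x := x - y) (lt_succ_self k), Nat.succ_eq_add_one, WittVector.init_sub,
      coeff_init (lt_succ_self k), WittVector.sub_coeff, WittVector.peval]
    simp only [MvPolynomial.aeval_def]; exact congrArg (fun f => MvPolynomial.eval₂ f _ _) (RingHom.ext_int _ _)
  have h1 : ∀ x : Ã, (∀ i ≤ k, fn (x.coeff i) ≤ 1) → ∀ i, fn ((init (k + 1) x).coeff i) ≤ 1 :=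
    fun x h i => by
      rcases lt_or_ge i (k + 1) with hi | hi
      · rw [coeff_init hi]; simp_all
      · rw [coeff_init_ge hi]; simp
  have h2 : ∀ x x' : Ã, (∀ i ≤ k, fn (x.coeff i - x'.coeff i) ≤ δ) → ∀ i, fn ((init (k + 1) x).coeff i - (init (k + 1) x').coeff i) ≤ δ :=
    fun x x' h i => by
      rcases lt_or_ge i (k + 1) with hi | hi
      · rw [coeff_init hi, coeff_init hi]; simp_all
      · rw [coeff_init_ge hi, coeff_init_ge hi]; simpa
  rw [e, e]
  refine fn_aeval_sub_le _ _ _ hδ ?_ ?_ ?_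
  · simp_all
  · simp_all
  simp_all

lemma fn_coeff_sub_le {x y : Ã} {k : ℕ} {δ : ℝ} (hδ : 0 ≤ δ) (hδ1 : δ ≤ 1) (hx : ∀ i ≤ k, fn (x.coeff i) ≤ δ) (hy : ∀ i ≤ k, fn (y.coeff i) ≤ δ) :
    fn ((x - y).coeff k) ≤ δ := by
  have := fn_coeff_sub_sub_le (x := x) (x' := 0) (y := y) (y' := 0) hδ (fun i hi => (hx i hi).trans hδ1)
    (by simp) (fun i hi => (hy i hi).trans hδ1) (by simp) (by simpa using hx) (by simpa using hy)
  simpa using this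

/-- The `k`-th Teichmüller digit `x_k` of `x = ∑ p ^ k [x_k]`. -/
def dg (x : Ã) (k : ℕ) : Ĉ := ((frobeniusEquiv Ĉ p).symm ^ k) (x.coeff k)

lemma symm_pow_pow (y : Ĉ) (k : ℕ) : ((frobeniusEquiv Ĉ p).symm ^ k) y ^ p ^ k = y := by
  simp

lemma dg_pow (x : Ã) (k : ℕ) : dg x k ^ p ^ k = x.coeff k := symm_pow_pow _ _

lemma fn_dg_pow (x : Ã) (k : ℕ) : fn (dg x k) ^ p ^ k = fn (x.coeff k) := by
  rw [← fn_pow, dg_pow]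

@[simp] lemma dg_zero_right (x : Ã) : dg x 0 = x.coeff 0 := by simp [dg]

lemma pow_pp_injective (k : ℕ) : Injective fun x : Ĉ => x ^ p ^ k := fun a b h => by
  have := iterateFrobenius_inj Ĉ p k
  exact this h

lemma fn_dg_eq (x : Ã) (k : ℕ) : fn (dg x k) = fn (x.coeff k) ^ (1 / (p : ℝ) ^ k) := by
  rw [← fn_dg_pow, ← rpow_natCast, ← rpow_mul (fn_nonneg _)]
  simp

lemma fn_dg_le_iff {x : Ã} {k : ℕ} {B : ℝ} (hB : 0 ≤ B) : fn (dg x k) ≤ B ↔ fn (x.coeff k) ≤ B ^ p ^ k := by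
  rw [← fn_dg_pow]
  exact (pow_le_pow_iff_left₀ (fn_nonneg _) hB (pp_ne_zero k)).symm

lemma coeff_eq_of_dvd {x y : Ã} {n k : ℕ} (h : (p : Ã) ^ n ∣ x - y) (hk : k < n) : x.coeff k = y.coeff k := by
  rw [← mem_span_singleton, WittVector.mem_span_p_pow_iff_le_coeff_eq_zero, ← WittVector.le_coeff_eq_iff_le_sub_coeff_eq_zero] at h
  exact h k hk

lemma dg_eq_of_dvd {x y : Ã} {n k : ℕ} (h : (p : Ã) ^ n ∣ x - y) (hk : k < n) : dg x k = dg y k := by rw [dg, dg, coeff_eq_of_dvd h hk]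

lemma p_dvd_iff {x : Ã} : (p : Ã) ∣ x ↔ x.coeff 0 = 0 := by
  rw [← WittVector.mem_span_p_iff_coeff_zero_eq_zero, mem_span_singleton]

lemma p_ne_zero_aTilde : (p : Ã) ≠ 0 := WittVector.p_nonzero p Ĉ

instance : CharZero Ã := by
  refine charZero_of_inj_zero fun n hn => ?_
  by_contra h0
  obtain ⟨k, m, hm, rfl⟩ := Nat.exists_eq_pow_mul_and_not_dvd h0 p (prm p).ne_one
  push_cast at hn
  rcases mul_eq_zero.1 hn with h | h
  · exact p_ne_zero_aTilde (eq_zero_of_pow_eq_zero h)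
  · have := congrArg constantCoeff h
    rw [map_natCast, map_zero, CharP.cast_eq_zero_iff Ĉ p] at this; exact hm this

lemma dvd_sub_sum (x : Ã) (n : ℕ) : (p : Ã) ^ n ∣ x - ∑ i ∈ range n, ω (dg x i) * (p : Ã) ^ i := by
  rcases n with _ | n
  · simp
  · have := WittVector.dvd_sub_sum_teichmuller_iterateFrobeniusEquiv_coeff x n
    rwa [show Finset.Iic n = range (n + 1) by ext; simp] at this

lemma coeff_sum_teichmuller (c : ℕ → Ĉ) {n k : ℕ} (hk : k < n) : (∑ i ∈ range n, ω (c i) * (p : Ã) ^ i).coeff k = c k ^ p ^ k := by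
  rw [WittVector.sum_coeff_eq_coeff_sum]
  · rw [sum_eq_single k, WittVector.teichmuller_mul_pow_coeff]
    · exact fun b _ hb => WittVector.teichmuller_mul_pow_coeff_of_ne _ hb.symm
    simp_all
  · refine fun m => ⟨fun ⟨a, _, ha⟩ ⟨b, _, hb⟩ => Subtype.ext ?_⟩
    have h1 : a = m := by
      by_contra h; exact ha (WittVector.teichmuller_mul_pow_coeff_of_ne _ (Ne.symm h))
    have h2 : b = m := by
      by_contra h; exact hb (WittVector.teichmuller_mul_pow_coeff_of_ne _ (Ne.symm h))
    simp_all

lemma dg_sum_teichmuller (c : ℕ → Ĉ) {n k : ℕ} (hk : k < n) : dg (∑ i ∈ range n, ω (c i) * (p : Ã) ^ i) k = c k :=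
  pow_pp_injective k (by simp only [dg_pow]; exact coeff_sum_teichmuller c hk)

lemma dg_teichmuller_mul (t : Ĉ) (x : Ã) (k : ℕ) : dg (ω t * x) k = t * dg x k := by
  have h := (dvd_sub_sum x (k + 1)).mul_left (ω t)
  rw [mul_sub, mul_sum] at h
  rw [dg_eq_of_dvd h (lt_succ_self k)]
  simp only [← mul_assoc, ← map_mul]
  exact dg_sum_teichmuller (fun i => t * dg x i) (lt_succ_self k)

lemma dg_zero (k : ℕ) : dg (0 : Ã) k = 0 := by simp [dg]

lemma dg_teichmuller_pos (t : Ĉ) {k : ℕ} (hk : 0 < k) : dg (ω t) k = 0 := by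
  rw [dg, teichmuller_coeff_pos p t k hk, map_zero]

lemma dg_p_mul_zero (x : Ã) : dg ((p : Ã) * x) 0 = 0 := by
  rw [dg_zero_right, mul_comm, WittVector.mul_charP_coeff_zero]

lemma dg_p_mul_succ (x : Ã) (k : ℕ) : dg ((p : Ã) * x) (k + 1) = dg x k := by
  refine pow_pp_injective (k + 1) ?_
  simp only [dg_pow]
  rw [pow_succ p, pow_mul, dg_pow, mul_comm, WittVector.mul_charP_coeff_succ]

lemma dg_frobW (x : Ã) (k : ℕ) : dg (frobW p x) k = dg x k ^ p := by
  refine pow_pp_injective k ?_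
  simp only [dg_pow]
  rw [coeff_frobW, ← pow_mul, mul_comm, pow_mul, dg_pow]

lemma dg_galW (σ : GalQp p) (x : Ã) (k : ℕ) : dg (galW σ x) k = galFlat σ (dg x k) := by
  refine pow_pp_injective k ?_
  simp only [dg_pow]
  rw [coeff_galW, ← map_pow, dg_pow]

lemma fn_galFlat (σ : GalQp p) (x : Ĉ) : fn (galFlat σ x) = fn x := by
  rw [fn, flatVal_galFlat, fn]

lemma fn_dg_sub_le {x y : Ã} {k : ℕ} {B : ℝ} (hx : ∀ i ≤ k, fn (dg x i) ≤ B) (hy : ∀ i ≤ k, fn (dg y i) ≤ B) : fn (dg (x - y) k) ≤ B := by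
  let f : ℕ ⊕ ℕ → Ĉ := Sum.elim (dg x) (dg y)
  let s : Finset (ℕ ⊕ ℕ) := (range (k + 1)).disjSum (range (k + 1))
  have hs : s.Nonempty := ⟨Sum.inl 0, by simp [s]⟩
  obtain ⟨j, hj, hmax⟩ := s.exists_max_image (fun i => fn (f i)) hs
  have hjB : fn (f j) ≤ B := by
    rcases j with j | j
    · aesop
    · aesop
  have hx' : ∀ i ≤ k, fn (dg x i) ≤ fn (f j) := by aesop
  have hy' : ∀ i ≤ k, fn (dg y i) ≤ fn (f j) := by aesop
  refine le_trans ?_ hjB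
  generalize f j = b at hx' hy'
  rcases eq_or_ne b 0 with rfl | hb
  · rw [fn_zero] at hx' hy' ⊢; rw [fn_dg_le_iff le_rfl, zero_pow (pp_ne_zero k)]
    refine fn_coeff_sub_le le_rfl zero_le_one (fun i hi => ?_) (fun i hi => ?_)
    · have := hx' i hi
      rwa [fn_dg_le_iff le_rfl, zero_pow (pp_ne_zero i)] at this
    · have := hy' i hi
      rwa [fn_dg_le_iff le_rfl, zero_pow (pp_ne_zero i)] at this
  · have h1 : ∀ z : Ã, ∀ i, fn (dg z i) ≤ fn b ↔ fn ((ω b⁻¹ * z).coeff i) ≤ 1 := fun z i => by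
      have h := fn_dg_le_iff (x := ω b⁻¹ * z) (k := i) (zero_le_one)
      rw [one_pow, dg_teichmuller_mul, fn_mul, fn_inv, inv_mul_le_one₀ (fn_pos.2 hb)] at h; exact h
    rw [h1, mul_sub]; exact fn_coeff_sub_le zero_le_one le_rfl (fun i hi => (h1 x i).1 (hx' i hi))
      (fun i hi => (h1 y i).1 (hy' i hi))

/-- `GB θ B x`: every term of `x = ∑ p ^ k [x_k]` satisfies `|x_k| θ ^ k ≤ B`. -/
def GB (θ B : ℝ) (x : Ã) : Prop := ∀ k, fn (dg x k) * θ ^ k ≤ B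

variable {θ B B' : ℝ} {x y : ATilde p}

lemma GB.mono_right (h : GB θ B x) (hB : B ≤ B') : GB θ B' x := fun k => (h k).trans hB

lemma GB.mono_left {θ' : ℝ} (h : GB θ B x) (h0 : 0 ≤ θ') (hθ : θ' ≤ θ) : GB θ' B x := fun k =>
  (mul_le_mul_of_nonneg_left (pow_le_pow_left₀ h0 hθ k) (fn_nonneg _)).trans (h k)

lemma GB.nonneg (h : GB θ B x) : 0 ≤ B := by
  have := h 0
  rw [pow_zero, mul_one] at this
  exact (fn_nonneg _).trans this

lemma fn_dg_le_div (h0 : 0 < θ) (h1 : θ ≤ 1) (h : GB θ B x) {i k : ℕ} (hik : i ≤ k) : fn (dg x i) ≤ B / θ ^ k := by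
  rw [le_div_iff₀ (pow_pos h0 k)]
  exact (mul_le_mul_of_nonneg_left (pow_le_pow_of_le_one h0.le h1 hik) (fn_nonneg _)).trans (h i)

lemma GB.sub (h0 : 0 < θ) (h1 : θ ≤ 1) (hx : GB θ B x) (hy : GB θ B y) : GB θ B (x - y) := fun k => by
  rw [← le_div_iff₀ (pow_pos h0 k)]
  exact fn_dg_sub_le (fun i hi => fn_dg_le_div h0 h1 hx hi) (fun i hi => fn_dg_le_div h0 h1 hy hi)

lemma GB_zero (hB : 0 ≤ B) : GB θ B (0 : Ã) := fun k => by simpa [dg_zero] using hB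

lemma GB.neg (h0 : 0 < θ) (h1 : θ ≤ 1) (hx : GB θ B x) : GB θ B (-x) := by
  rw [← zero_sub]; exact (GB_zero hx.nonneg).sub h0 h1 hx

lemma GB.add (h0 : 0 < θ) (h1 : θ ≤ 1) (hx : GB θ B x) (hy : GB θ B y) : GB θ B (x + y) := by
  rw [← sub_neg_eq_add]; exact hx.sub h0 h1 (hy.neg h0 h1)

lemma GB.sum (h0 : 0 < θ) (h1 : θ ≤ 1) (hB : 0 ≤ B) {ι : Type*} (s : Finset ι) (f : ι → Ã) (h : ∀ i ∈ s, GB θ B (f i)) : GB θ B (∑ i ∈ s, f i) := by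
  classical
  induction s using Finset.induction_on with
  | empty => exact GB_zero hB
  | insert a s ha ih =>
    rw [sum_insert ha]; exact (h a (by simp)).add h0 h1 (ih fun i hi => h i (by simp [hi]))

lemma GB_teichmuller (t : Ĉ) : GB θ (fn t) (ω t) := fun k => by
  rcases Nat.eq_zero_or_pos k with rfl | hk
  · simp
  · rw [dg_teichmuller_pos t hk]; simpa using fn_nonneg t

lemma GB.p_mul (h0 : 0 < θ) (hx : GB θ B x) : GB θ (θ * B) ((p : Ã) * x) := fun k => by
  rcases k with _ | k
  · rw [dg_p_mul_zero]; simpa using mul_nonneg h0.le hx.nonneg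
  · rw [dg_p_mul_succ, pow_succ, ← mul_assoc, mul_comm]; aesop

lemma GB.p_pow_mul (h0 : 0 < θ) (hx : GB θ B x) (n : ℕ) : GB θ (θ ^ n * B) ((p : Ã) ^ n * x) := by
  induction n with
  | zero => simpa
  | succ n ih =>
    rw [pow_succ', pow_succ', mul_assoc, mul_assoc]; exact ih.p_mul h0

lemma GB.of_dvd {θ' : ℝ} (h0 : 0 < θ') (h : θ' ≤ θ) (hx : GB θ B x) {n : ℕ} (hn : (p : Ã) ^ n ∣ x) : GB θ' ((θ' / θ) ^ n * B) x := fun k => by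
  have hθ := h0.trans_le h
  have hB := hx.nonneg
  rcases lt_or_ge k n with hk | hk
  · have : dg x k = 0 := by
      rw [dg_eq_of_dvd (y := 0) (by simpa using hn) hk, dg_zero]
    rw [this, fn_zero, zero_mul]; positivity
  · have e : θ' ^ k = (θ' / θ) ^ k * θ ^ k := by rw [div_pow, div_mul_cancel₀]; positivity
    rw [e, mul_left_comm]; refine mul_le_mul (pow_le_pow_of_le_one (by positivity) ((div_le_one hθ).2 h) hk) (hx k) ?_ (by positivity)
    have := fn_nonneg (dg x k)
    positivity

lemma GB.of_approx (h : ∀ n, ∃ y, GB θ B y ∧ (p : Ã) ^ n ∣ x - y) : GB θ B x := fun k => by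
  obtain ⟨y, hy, hxy⟩ := h (k + 1)
  rw [dg_eq_of_dvd hxy (lt_succ_self k)]
  exact hy k

lemma GB.teichmuller_mul (t : Ĉ) (hx : GB θ B x) : GB θ (fn t * B) (ω t * x) := fun k => by
    rw [dg_teichmuller_mul, fn_mul, mul_assoc]; exact mul_le_mul_of_nonneg_left (hx k) (fn_nonneg _)

lemma GB.mul (h0 : 0 < θ) (h1 : θ ≤ 1) (hx : GB θ B x) (hy : GB θ B' y) : GB θ (B * B') (x * y) := by
  refine GB.of_approx fun n => ⟨_, ?_, (dvd_sub_sum x n).mul_right y |>.trans (dvd_of_eq (sub_mul _ _ _))⟩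
  rw [sum_mul]
  refine GB.sum h0 h1 (mul_nonneg hx.nonneg hy.nonneg) _ _ fun i _ => ?_
  rw [mul_assoc]
  refine ((hy.p_pow_mul h0 i).teichmuller_mul _).mono_right ?_
  rw [← mul_assoc]
  exact mul_le_mul_of_nonneg_right (hx i) hy.nonneg

lemma GB_one : GB θ 1 (1 : Ã) := by
  have := GB_teichmuller (p := p) (θ := θ) 1
  simp_all

lemma GB.pow (h0 : 0 < θ) (h1 : θ ≤ 1) (hx : GB θ B x) (n : ℕ) : GB θ (B ^ n) (x ^ n) := by
  induction n with
  | zero => simpa using GB_one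
  | succ n ih => rw [pow_succ, pow_succ]; exact ih.mul h0 h1 hx

lemma GB_natCast (h0 : 0 < θ) (h1 : θ ≤ 1) (n : ℕ) : GB θ 1 (n : Ã) := by
  induction n with
  | zero => simpa using GB_zero zero_le_one
  | succ n ih => rw [cast_succ]; exact ih.add h0 h1 GB_one

lemma GB.galW (σ : GalQp p) (hx : GB θ B x) : GB θ B (galW σ x) := fun k => by
  rw [dg_galW, fn_galFlat]; exact hx k

lemma GB.frobW (hθ : 0 ≤ θ) (hx : GB θ B x) : GB (θ ^ p) (B ^ p) (frobW p x) := fun k => by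
  rw [dg_frobW, fn_pow, ← pow_mul, mul_comm p k, pow_mul, ← mul_pow]
  exact pow_le_pow_left₀ (mul_nonneg (fn_nonneg _) (pow_nonneg hθ k)) (hx k) p

lemma exists_scale (s : Finset Ĉ) : ∃ t : Ĉ, t ≠ 0 ∧ fn t ≤ 1 ∧ ∀ a ∈ s, fn t * fn a ≤ 1 := by
  classical
  obtain ⟨m, -, hm⟩ := (insert 1 s).exists_max_image fn ⟨1, by simp⟩
  have h1 := hm 1 (by simp)
  rw [fn_one] at h1
  have h0 := fn_pos.1 (one_pos.trans_le h1)
  refine ⟨m⁻¹, inv_ne_zero h0, by rw [fn_inv]; exact inv_le_one_of_one_le₀ h1, fun a ha => ?_⟩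
  rw [fn_inv, inv_mul_le_one₀ (fn_pos.2 h0)]; exact hm a (Finset.mem_insert_of_mem ha)

lemma fn_coeff_sub_sub_le_of_scale {t : Ĉ} (ht : fn t ≤ 1) {x x' y y' : Ã} {k : ℕ} {δ : ℝ} (hδ : 0 ≤ δ) (hδ1 : δ ≤ 1) (hy : ∀ i ≤ k, fn t * fn (dg y i) ≤ 1)
    (hy' : ∀ i ≤ k, fn t * fn (dg y' i) ≤ 1) (h : ∀ i ≤ k, fn (x.coeff i - y.coeff i) ≤ δ) (h' : ∀ i ≤ k, fn (x'.coeff i - y'.coeff i) ≤ δ) :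
    fn t ^ p ^ k * fn ((x - x').coeff k - (y - y').coeff k) ≤ δ := by
  have htc : ∀ (z : Ã) (i : ℕ), (ω t * z).coeff i = t ^ p ^ i * z.coeff i := fun z i => by rw [← dg_pow, dg_teichmuller_mul, mul_pow, dg_pow]
  have hd : ∀ a b : Ã, (∀ i ≤ k, fn (a.coeff i - b.coeff i) ≤ δ) → ∀ i ≤ k, fn ((ω t * a).coeff i - (ω t * b).coeff i) ≤ δ := fun a b h i hi => by
    rw [htc, htc, ← mul_sub, fn_mul, fn_pow]; exact (mul_le_of_le_one_left (fn_nonneg _) (pow_le_one₀ (fn_nonneg _) ht)).trans (h i hi)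
  have hi : ∀ b : Ã, (∀ i ≤ k, fn t * fn (dg b i) ≤ 1) → ∀ i ≤ k, fn ((ω t * b).coeff i) ≤ 1 := fun b h i hi => by
    rw [← dg_pow, fn_pow, dg_teichmuller_mul, fn_mul]; exact pow_le_one₀ (mul_nonneg (fn_nonneg _) (fn_nonneg _)) (h i hi)
  have hi' : ∀ a b : Ã, (∀ i ≤ k, fn t * fn (dg b i) ≤ 1) → (∀ i ≤ k, fn (a.coeff i - b.coeff i) ≤ δ) → ∀ i ≤ k, fn ((ω t * a).coeff i) ≤ 1 := fun a b hb h i hik => by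
    rw [← sub_add_cancel ((ω t * a).coeff i) ((ω t * b).coeff i)]; exact fn_add_le_of ((hd a b h i hik).trans hδ1) (hi b hb i hik)
  have key := fn_coeff_sub_sub_le hδ (hi' x y hy h) (hi y hy) (hi' x' y' hy' h') (hi y' hy') (hd x y h) (hd x' y' h')
  rwa [← mul_sub, ← mul_sub, htc, htc, ← mul_sub, fn_mul, fn_pow] at key

lemma tendsto_of_scale {ι : Type*} {l : Filter ι} {f : ι → Ĉ} {c : ℝ} (hc : 0 < c) (h : ∀ δ, 0 < δ → δ ≤ 1 → ∀ᶠ n in l, c * fn (f n) ≤ δ) : Tendsto (fun n => fn (f n)) l (𝓝 0) := by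
  rw [Metric.tendsto_nhds]
  intro δ hδ
  have hδc := mul_pos hδ hc
  filter_upwards [h (min 1 (δ * c / 2)) (by positivity) (min_le_left _ _)] with n hn
  rw [dist_0_eq_abs, abs_of_nonneg (fn_nonneg _)]
  have := hn.trans (min_le_right _ _)
  exact lt_of_mul_lt_mul_left (by linarith) hc.le

lemma GB_of_tendsto (h0 : 0 < θ) (hB : 0 < B) (x : ℕ → Ã) (y : Ã) (hxy : ∀ k, Tendsto (fun n => fn ((x n).coeff k - y.coeff k)) atTop (𝓝 0))
    (hx : ∀ n, GB θ B (x n)) : GB θ B y := by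
  intro k
  rw [← le_div_iff₀ (pow_pos h0 k), fn_dg_le_iff (by positivity)]
  obtain ⟨n, hn⟩ := ((hxy k).eventually (ge_mem_nhds
    (show 0 < (B / θ ^ k) ^ p ^ k by positivity))).exists
  rw [← sub_sub_cancel ((x n).coeff k) (y.coeff k)]
  exact fn_sub_le_of ((fn_dg_le_iff (by positivity)).1 ((le_div_iff₀ (pow_pos h0 k)).2 (hx n k))) hn

lemma tendsto_coeff_sub {ι : Type*} {l : Filter ι} {x x' : ι → Ã} {y y' : Ã} (hxy : ∀ k, Tendsto (fun n => fn ((x n).coeff k - y.coeff k)) l (𝓝 0))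
    (hxy' : ∀ k, Tendsto (fun n => fn ((x' n).coeff k - y'.coeff k)) l (𝓝 0)) (k : ℕ) :
    Tendsto (fun n => fn ((x n - x' n).coeff k - (y - y').coeff k)) l (𝓝 0) := by
  classical
  have hm : ∀ {i}, i ≤ k → i ∈ range (k + 1) := by simp
  obtain ⟨t, h0, h1, ht⟩ := exists_scale ((range (k + 1)).image (dg y) ∪ (range (k + 1)).image (dg y'))
  refine tendsto_of_scale (pow_pos (fn_pos.2 h0) (p ^ k)) fun δ hδ hδ1 => ?_
  filter_upwards [(Finset.eventually_all (range (k + 1))).2 fun i _ => (hxy i).eventually (ge_mem_nhds hδ), (Finset.eventually_all (range (k + 1))).2 fun i _ => (hxy' i).eventually (ge_mem_nhds hδ)] with n hn hn'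
  exact fn_coeff_sub_sub_le_of_scale h1 hδ.le hδ1 (fun i hi => ht _ (Finset.mem_union_left _ (Finset.mem_image_of_mem _ (hm hi))))
    (fun i hi => ht _ (Finset.mem_union_right _ (Finset.mem_image_of_mem _ (hm hi)))) (fun i hi => hn i (hm hi)) (fun i hi => hn' i (hm hi))

lemma exists_gauss_lim (h0 : 0 < θ) (h1 : θ ≤ 1) (x : ℕ → Ã) (B : ℕ → ℝ) (hB : ∀ n, 0 < B n)
    (hanti : Antitone B) (hlim : Tendsto B atTop (𝓝 0)) (hx : ∀ n, GB θ (B n) (x (n + 1) - x n)) :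
    ∃ y, (∀ k, Tendsto (fun n => fn ((x n).coeff k - y.coeff k)) atTop (𝓝 0)) ∧ ∀ n, GB θ (B n) (y - x n) := by
  have hmn : ∀ n m, n ≤ m → GB θ (B n) (x m - x n) := fun n m h => by
    induction m, h using Nat.le_induction with
    | base => rw [sub_self]; exact GB_zero (hB n).le
    | succ m h ih =>
      rw [← sub_add_sub_cancel _ (x m)]; exact ((hx m).mono_right (hanti h)).add h0 h1 ih
  have hd : ∀ k, Tendsto (fun n => fn ((x (n + 1) - x n).coeff k)) atTop (𝓝 0) := fun k => by
    refine squeeze_zero (fun _ => fn_nonneg _) (g := fun n => (B n / θ ^ k) ^ p ^ k) (fun n => ?_) ?_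
    · rw [← fn_dg_le_iff (div_nonneg (hB n).le (pow_nonneg h0.le k)), le_div_iff₀ (pow_pos h0 k)]; exact hx n k
    · have := (hlim.div_const (θ ^ k)).pow (p ^ k)
      rwa [zero_div, zero_pow (pp_ne_zero k)] at this
  have hc : ∀ k, Tendsto (fun n => fn ((x (n + 1)).coeff k - (x n).coeff k)) atTop (𝓝 0) := by
    classical
    intro k
    have hm : ∀ {i}, i ≤ k → i ∈ range (k + 1) := by simp
    obtain ⟨N, hN⟩ := (hlim.eventually (ge_mem_nhds (pow_pos h0 k))).exists
    obtain ⟨t, ht0, ht1, ht⟩ := exists_scale ((range (k + 1)).image (dg (x N)))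
    have ht' := fn_pos.2 ht0
    have hs : ∀ n, N ≤ n → ∀ i ≤ k, fn t * fn (dg (x n) i) ≤ 1 := fun n hn i hi => by
      rw [mul_comm, ← le_div_iff₀ ht', ← sub_sub_cancel (x N) (x n)]
      refine fn_dg_sub_le (fun j hj => ?_) (fun j hj => ?_)
      · rw [le_div_iff₀ ht', mul_comm]; exact ht _ (Finset.mem_image_of_mem _ (hm (hj.trans hi)))
      · rw [← neg_sub (x n)]
        exact (fn_dg_le_div h0 h1 ((hmn N n hn).neg h0 h1) (hj.trans hi)).trans (((div_le_one (pow_pos h0 k)).2 hN).trans ((one_le_div ht').2 ht1))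
    refine tendsto_of_scale (pow_pos ht' (p ^ k)) fun δ hδ hδ1 => ?_
    filter_upwards [(Finset.eventually_all (range (k + 1))).2 fun i _ => (hd i).eventually (ge_mem_nhds hδ), eventually_ge_atTop N] with n hn hnN
    have := fn_coeff_sub_sub_le_of_scale (x := x (n + 1)) (x' := x (n + 1) - x n) (y := x (n + 1)) (y' := 0) ht1 hδ.le hδ1 (hs _ (by lia))
      (fun i _ => by simp [dg_zero]) (fun i _ => by simpa using hδ.le) (fun i hi => by simp_all)
    rwa [sub_sub_cancel, sub_zero, fn_sub_comm] at this
  choose c hcl using fun k => exists_lim (fun n => (x n).coeff k) (hc k)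
  refine ⟨WittVector.mk p c, hcl, fun n => ?_⟩
  refine GB_of_tendsto h0 (hB n) (fun m => x (n + m) - x n) _ (fun k => ?_)
    (fun m => hmn n _ (Nat.le_add_right _ _))
  refine tendsto_coeff_sub (x := fun m => x (n + m)) (x' := fun _ => x n) (fun j => ?_) (fun j => by simp) k
  have := (tendsto_add_atTop_iff_nat n).2 (hcl j)
  simpa [add_comm] using this

end Gauss
section Overconvergent
variable {θ B : ℝ} {x y : ATilde p}

/-- `x = ∑ p ^ k [x_k]` with `|x_k| ≤ H k`. -/
def DB (H : ℕ → ℝ) (x : Ã) : Prop := ∀ k, fn (dg x k) ≤ H k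

variable {H : ℕ → ℝ}

lemma DB.sub (hH : Monotone H) (hx : DB H x) (hy : DB H y) : DB H (x - y) := fun _ =>
  fn_dg_sub_le (fun i hi => (hx i).trans (hH hi)) (fun i hi => (hy i).trans (hH hi))

lemma DB_zero (hH : ∀ i, 0 ≤ H i) : DB H (0 : Ã) := fun k => by
  simpa [dg_zero] using hH k

lemma DB.nonneg (hx : DB H x) (k : ℕ) : 0 ≤ H k := (fn_nonneg _).trans (hx k)

lemma DB.neg (hH : Monotone H) (hx : DB H x) : DB H (-x) := by
  rw [← zero_sub]; exact (DB_zero hx.nonneg).sub hH hx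

lemma DB.add (hH : Monotone H) (hx : DB H x) (hy : DB H y) : DB H (x + y) := by
  rw [← sub_neg_eq_add]; exact hx.sub hH (hy.neg hH)

lemma dg_p_pow_mul (x : Ã) (n k : ℕ) : dg ((p : Ã) ^ n * x) k = if k < n then 0 else dg x (k - n) := by
  induction n generalizing k with
  | zero => simp
  | succ n ih =>
    rw [pow_succ', mul_assoc]; rcases k with _ | k
    · simp only [dg_p_mul_zero]; simp
    · rw [dg_p_mul_succ, ih]; simp

lemma isUnit_of_coeff_ne_zero (h : x.coeff 0 ≠ 0) : IsUnit x := WittVector.isUnit_of_coeff_zero_ne_zero x h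

lemma coeff_zero_mul (x y : Ã) : (x * y).coeff 0 = x.coeff 0 * y.coeff 0 := WittVector.mul_coeff_zero x y

lemma coeff_zero_sub (x y : Ã) : (x - y).coeff 0 = x.coeff 0 - y.coeff 0 := map_sub (constantCoeff (p := p) (R := Ĉ)) x y

lemma coeff_zero_add (x y : Ã) : (x + y).coeff 0 = x.coeff 0 + y.coeff 0 := map_add (constantCoeff (p := p) (R := Ĉ)) x y

lemma exists_inv_one_add (h0 : 0 < θ) (h1 : θ ≤ 1) {w : Ã} (hw : (p : Ã) ∣ w) (hw1 : GB θ 1 w) : ∃ v, (1 + w) * v = 1 ∧ GB θ 1 v := by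
  have hu : IsUnit (1 + w) := isUnit_of_coeff_ne_zero (by
    rw [coeff_zero_add, p_dvd_iff.1 hw, add_zero, one_coeff_zero]; exact one_ne_zero)
  obtain ⟨v, hv⟩ := hu.exists_right_inv
  refine ⟨v, hv, GB.of_approx fun n => ⟨∑ i ∈ range n, (-w) ^ i, ?_, ?_⟩⟩
  · refine GB.sum h0 h1 zero_le_one _ _ fun i _ => ?_
    simpa using (hw1.neg h0 h1).pow h0 h1 i
  · have e : v - ∑ i ∈ range n, (-w) ^ i = v * (-w) ^ n := by
      have h2 := mul_neg_geom_sum (-w) n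
      rw [sub_neg_eq_add] at h2
      calc v - ∑ i ∈ range n, (-w) ^ i
          = v - ((1 + w) * v) * ∑ i ∈ range n, (-w) ^ i := by rw [hv, one_mul]
        _ = v * (1 - (1 + w) * ∑ i ∈ range n, (-w) ^ i) := by ring
        _ = _ := by simp_all
    rw [e]; exact (pow_dvd_pow_of_dvd (hw.neg_right) n).mul_left v

lemma exists_inv_GB (h0 : 0 < θ) (h1 : θ ≤ 1) (hx : x.coeff 0 ≠ 0) (hx1 : GB θ (fn (x.coeff 0)) x) : ∃ y, x * y = 1 ∧ GB θ (fn (x.coeff 0))⁻¹ y := by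
  set t := x.coeff 0
  have ht := fn_pos.2 hx
  have htt : ω t * ω t⁻¹ = 1 := by
    rw [← map_mul, mul_inv_cancel₀ hx, map_one]
  obtain ⟨v, hv, hv1⟩ := exists_inv_one_add h0 h1 (w := ω t⁻¹ * x - 1)
    (p_dvd_iff.2 (by
      rw [coeff_zero_sub, coeff_zero_mul, teichmuller_coeff_zero, one_coeff_zero, inv_mul_cancel₀ hx, sub_self]))
    ((by simpa [fn_inv, ht.ne'] using hx1.teichmuller_mul t⁻¹ : GB θ 1 _).sub h0 h1 GB_one)
  refine ⟨ω t⁻¹ * v, ?_, ?_⟩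
  · rw [← hv]; ring
  · simpa [fn_inv] using hv1.teichmuller_mul t⁻¹

lemma GB.exists_dominant {θ' : ℝ} (h0 : 0 < θ) (h : θ ≤ θ') (hx : GB θ' B x)
    (hB : θ / θ' * B ≤ fn (x.coeff 0)) : GB θ (fn (x.coeff 0)) x := fun k => by
  rcases k with _ | k
  · simp
  · have h' := h0.trans_le h
    refine le_trans ?_ hB; have e : θ ^ (k + 1) = (θ / θ') ^ (k + 1) * θ' ^ (k + 1) := by
      rw [div_pow, div_mul_cancel₀]; positivity
    rw [e, mul_left_comm]; refine mul_le_mul (pow_le_of_le_one (by positivity) ((div_le_one h').2 h) (Nat.succ_ne_zero k))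
      (hx _) (mul_nonneg (fn_nonneg _) (by positivity)) (by positivity)

variable (p) in
/-- The ring of overconvergent elements. -/
def Odag : Subring Ã where
  carrier := {x | ∃ θ : ℝ, 0 < θ ∧ θ ≤ 1 ∧ ∃ B, GB θ B x}
  mul_mem' := by
    rintro x y ⟨θ, h0, h1, B, hx⟩ ⟨θ', h0', h1', B', hy⟩; have hm : 0 < min θ θ' := lt_min h0 h0'
    exact ⟨min θ θ', hm, (min_le_left _ _).trans h1, _, (hx.mono_left hm.le (min_le_left _ _)).mul hm
      ((min_le_left _ _).trans h1) (hy.mono_left hm.le (min_le_right _ _))⟩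
  add_mem' := by
    rintro x y ⟨θ, h0, h1, B, hx⟩ ⟨θ', h0', h1', B', hy⟩; have hm : 0 < min θ θ' := lt_min h0 h0'
    exact ⟨min θ θ', hm, (min_le_left _ _).trans h1, max B B', ((hx.mono_left hm.le (min_le_left _ _)).mono_right (le_max_left _ _)).add hm
      ((min_le_left _ _).trans h1)
      ((hy.mono_left hm.le (min_le_right _ _)).mono_right (le_max_right _ _))⟩
  zero_mem' := ⟨1, one_pos, le_rfl, 0, GB_zero le_rfl⟩
  one_mem' := ⟨1, one_pos, le_rfl, 1, GB_one⟩
  neg_mem' := by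
    rintro x ⟨θ, h0, h1, B, hx⟩; exact ⟨θ, h0, h1, B, hx.neg h0 h1⟩

lemma teichmuller_mem_Odag (t : Ĉ) : ω t ∈ Odag p := ⟨1, one_pos, le_rfl, _, GB_teichmuller t⟩

lemma Odag_common (s : Finset Ã) (hs : ∀ x ∈ s, x ∈ Odag p) : ∃ θ : ℝ, 0 < θ ∧ θ ≤ 1 ∧ ∃ B, 1 ≤ B ∧ ∀ x ∈ s, GB θ B x := by
  classical
  induction s using Finset.induction_on with
  | empty => aesop
  | insert a s ha ih =>
    obtain ⟨θ, h0, h1, B, hB, hx⟩ := ih fun x hx => hs x (by simp [hx])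
    obtain ⟨θ', h0', h1', B', ha⟩ := hs a (by simp)
    have hm : 0 < min θ θ' := lt_min h0 h0'
    refine ⟨min θ θ', hm, (min_le_left _ _).trans h1, max B B', hB.trans (le_max_left _ _), fun x h => ?_⟩
    rcases mem_insert.1 h with rfl | h
    · exact (ha.mono_left hm.le (min_le_right _ _)).mono_right (le_max_right _ _)
    · exact ((hx x h).mono_left hm.le (min_le_left _ _)).mono_right (le_max_left _ _)

lemma exists_dominant (hx : x ∈ Odag p) (hx0 : x.coeff 0 ≠ 0) : ∃ θ : ℝ, 0 < θ ∧ θ ≤ 1 ∧ GB θ (fn (x.coeff 0)) x := by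
  obtain ⟨θ, h0, h1, B, hx⟩ := hx
  have ht := fn_pos.2 hx0
  have hB : 0 < max B 1 := by simp
  have hm : 0 < min 1 (fn (x.coeff 0) / max B 1) := by positivity
  have hle : θ * min 1 (fn (x.coeff 0) / max B 1) ≤ θ := by simp_all
  refine ⟨_, mul_pos h0 hm, hle.trans h1, (hx.mono_right (le_max_left B 1)).exists_dominant (mul_pos h0 hm) hle ?_⟩
  rw [mul_div_cancel_left₀ _ h0.ne', ← le_div_iff₀ hB]
  simp

lemma inv_mem_Odag (hx : x ∈ Odag p) (hx0 : x.coeff 0 ≠ 0) (hxy : x * y = 1) : y ∈ Odag p := by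
  obtain ⟨θ, h0, h1, h⟩ := exists_dominant hx hx0
  obtain ⟨z, hz, hz1⟩ := exists_inv_GB h0 h1 hx0 h
  have : y = z := by
    calc y = y * (x * z) := by rw [hz, mul_one]
      _ = (x * y) * z := by ring
      _ = z := by rw [hxy, one_mul]
  rw [this]
  exact ⟨θ, h0, h1, _, hz1⟩

lemma root_mem_Odag {f : Polynomial Ã} (hf : ∀ i, f.coeff i ∈ Odag p) {y : Ã}
    (hy : f.eval y = 0) (hy' : (f.derivative.eval y).coeff 0 ≠ 0) : y ∈ Odag p := by
  classical
  set a : Ã := ω (y.coeff 0) with ha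
  have hpz : (p : Ã) ∣ y - a := p_dvd_iff.2 (by
    rw [coeff_zero_sub, ha, teichmuller_coeff_zero, sub_self])
  set z := y - a with hz
  set g := Polynomial.taylor a f with hg
  have hgO : ∀ i, g.coeff i ∈ Odag p := fun i => by
    have hco : (f.coeffs : Set Ã) ⊆ Odag p := fun c hc => by
      obtain ⟨n, -, rfl⟩ := Polynomial.mem_coeffs_iff.1 (Finset.mem_coe.1 hc); exact hf n
    have e : g = ((f.toSubring (Odag p) hco).taylor (⟨a, teichmuller_mem_Odag _⟩ : Odag p)).map
        (Odag p).subtype := by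
      rw [Polynomial.map_taylor, Polynomial.map_toSubring]; rfl
    rw [e, coeff_map]; simp
  have hgz : g.eval z = 0 := by rw [hg, hz, Polynomial.taylor_eval_sub, hy]
  have hcong : ∀ q : Polynomial Ã, (q.eval a).coeff 0 = (q.eval y).coeff 0 := fun q => by
    have h1 := (hpz.trans (q.sub_dvd_eval_sub y a))
    have h2 := p_dvd_iff.1 h1
    rw [coeff_zero_sub, sub_eq_zero] at h2; exact h2.symm
  have hg1 : (g.coeff 1).coeff 0 ≠ 0 := by
    rwa [hg, Polynomial.taylor_coeff_one, hcong]
  have hg0 : (g.coeff 0).coeff 0 = 0 := by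
    rw [hg, Polynomial.taylor_coeff_zero, hcong, hy, zero_coeff]
  obtain ⟨t, ht⟩ := (isUnit_of_coeff_ne_zero hg1).exists_right_inv
  have htO := inv_mem_Odag (hgO 1) hg1 ht
  obtain ⟨θ, h0, h1, B, hB, hs⟩ := Odag_common
    ((range (g.natDegree + 1)).image fun i => t * g.coeff i) (fun x hx => by
      obtain ⟨i, -, rfl⟩ := mem_image.1 hx; exact mul_mem htO (hgO i))
  have hs : ∀ i, i ∈ range (g.natDegree + 1) → GB θ B (t * g.coeff i) := by simp_all
  have hB0 : 0 < B := one_pos.trans_le hB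
  have hsum : z = - ∑ i ∈ (range (g.natDegree + 1)).erase 1, t * g.coeff i * z ^ i := by
    rw [Polynomial.eval_eq_sum_range] at hgz; have h2 : ∑ i ∈ range (g.natDegree + 1), t * g.coeff i * z ^ i = 0 := by
      simp_rw [mul_assoc]
      rw [← mul_sum, hgz, mul_zero]
    have h3 : 1 ∈ range (g.natDegree + 1) := by
      rw [mem_range, Nat.lt_succ_iff]; by_contra h; rw [Polynomial.coeff_eq_zero_of_natDegree_lt (not_le.1 h)] at hg1; exact hg1 (zero_coeff _ _ _)
    rw [← Finset.add_sum_erase _ _ h3, pow_one, mul_comm t, ht, one_mul] at h2; exact eq_neg_of_add_eq_zero_left h2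
  set θ' : ℝ := θ / (B * B) with hθ'
  have hθ'0 : 0 < θ' := by positivity
  have hθ'θ : θ' ≤ θ := div_le_self h0.le (one_le_mul_of_one_le_of_one_le hB hB)
  have hδ : θ' / θ * B = B⁻¹ := by rw [hθ']; field_simp
  have hB1 : B⁻¹ ≤ 1 := inv_le_one_of_one_le₀ hB
  have key : ∀ n : ℕ, ∃ v, GB θ' B⁻¹ v ∧ (p : Ã) ∣ v ∧ (p : Ã) ^ (n + 1) ∣ z - v := by
    intro n; induction n with
    | zero => exact ⟨0, GB_zero (by positivity), dvd_zero _, by simpa using hpz⟩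
    | succ n ih =>
      obtain ⟨v, hv, hpv, hzv⟩ := ih; have hd0 : ∀ i, i ≠ 1 → (p : Ã) ∣ t * g.coeff i * v ^ i := fun i hi => by
        rcases Nat.eq_zero_or_pos i with rfl | hi0
        · rw [pow_zero, mul_one]; exact (p_dvd_iff.2 hg0).mul_left t
        · exact (hpv.trans (dvd_pow_self v hi0.ne')).mul_left _
      refine ⟨- ∑ i ∈ (range (g.natDegree + 1)).erase 1, t * g.coeff i * v ^ i, ?_, ?_, ?_⟩
      · refine GB.neg hθ'0 (hθ'θ.trans h1) (GB.sum hθ'0 (hθ'θ.trans h1) (by positivity) _ _ fun i hi => ?_)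
        obtain ⟨hi1, hi⟩ := mem_erase.1 hi; rcases Nat.eq_zero_or_pos i with rfl | hi0
        · rw [pow_zero, mul_one, ← hδ]; simpa using (hs 0 hi).of_dvd hθ'0 hθ'θ (n := 1)
            (by rw [pow_one]; exact (p_dvd_iff.2 hg0).mul_left t)
        · have h2 := ((hs i hi).mono_left hθ'0.le hθ'θ).mul hθ'0 (hθ'θ.trans h1)
            (hv.pow hθ'0 (hθ'θ.trans h1) i)
          refine h2.mono_right ?_; have h3 : B⁻¹ ^ i ≤ B⁻¹ ^ 2 := pow_le_pow_of_le_one (by positivity) hB1 (by omega)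
          calc B * B⁻¹ ^ i ≤ B * B⁻¹ ^ 2 := by gcongr
            _ = B⁻¹ := by field_simp
      · exact (dvd_sum fun i hi => hd0 i (mem_erase.1 hi).1).neg_right
      · conv_lhs => rw [pow_succ]
        rw [hsum, neg_sub_neg, ← sum_sub_distrib]; refine dvd_sum fun i hi => ?_
        rw [← mul_sub]; refine Dvd.dvd.mul_left ?_ _; have hi1 := (mem_erase.1 hi).1; rw [← (Commute.all v z).mul_geom_sum₂ i]
        refine mul_dvd_mul (by rw [← neg_sub]; exact hzv.neg_right) (dvd_sum fun j hj => ?_)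
        have hj := mem_range.1 hj
        rcases Nat.eq_zero_or_pos j with rfl | hj0
        · exact (hpz.trans (dvd_pow_self z (by omega))).mul_left _
        · exact (hpv.trans (dvd_pow_self v hj0.ne')).mul_right _
  have hzO : z ∈ Odag p := ⟨θ', hθ'0, hθ'θ.trans h1, B⁻¹, GB.of_approx fun n => by
    obtain ⟨v, hv, -, h⟩ := key n; exact ⟨v, hv, (pow_dvd_pow _ (Nat.le_succ n)).trans h⟩⟩
  simpa [hz, ha] using add_mem hzO (teichmuller_mem_Odag (y.coeff 0))

lemma tendsto_galFlat_algebraMap (x : OFlat p) : Tendsto (fun σ : GalQp p => fn (galFlat σ (algebraMap _ _ x) - algebraMap _ _ x)) (𝓝 1) (𝓝 0) := by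
  have hlim : Tendsto (fun N : ℕ => ((p : ℝ)⁻¹) ^ p ^ N) atTop (𝓝 0) :=
    (tendsto_pow_atTop_nhds_zero_of_lt_one (inv_nonneg.2 p_pos.le)
      (inv_lt_one_of_one_lt₀ (one_lt_p (p := p)))).comp
      (tendsto_pow_atTop_atTop_of_one_lt (prm p).one_lt)
  rw [Metric.tendsto_nhds]
  intro ε hε
  obtain ⟨N, hN⟩ := (hlim.eventually (gt_mem_nhds hε)).exists
  obtain ⟨r, hr⟩ := mk_surjective (coeff N x)
  obtain ⟨a, ha⟩ : ∃ a : PadicAlgCl p, ‖(r : ℂ_[p]) - (a : ℂ_[p])‖ < (p : ℝ)⁻¹ := by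
    have h := (UniformSpace.Completion.denseRange_coe (α := PadicAlgCl p))
    obtain ⟨a, ha⟩ := Metric.denseRange_iff.1 h (r : ℂ_[p]) (p : ℝ)⁻¹ (inv_pos.2 p_pos); exact ⟨a, by rwa [← dist_eq_norm]⟩
  have hrn : ‖(r : ℂ_[p])‖ ≤ 1 := by
    have : (Valued.v (r : ℂ_[p]) : ℝ≥0) ≤ 1 := r.2
    rw [valuation_eq_nnnorm] at this; exact_mod_cast this
  have han : ‖(a : ℂ_[p])‖ ≤ 1 := by
    have h2 := Valuation.map_sub (Valued.v : Valuation ℂ_[p] ℝ≥0) (r : ℂ_[p]) ((r : ℂ_[p]) - (a : ℂ_[p]))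
    rw [sub_sub_cancel, valuation_eq_nnnorm, valuation_eq_nnnorm, valuation_eq_nnnorm] at h2
    have h3 : ‖(a : ℂ_[p])‖ ≤ max ‖(r : ℂ_[p])‖ ‖(r : ℂ_[p]) - (a : ℂ_[p])‖ := by exact_mod_cast h2
    exact h3.trans (max_le hrn (ha.le.trans (inv_le_one_of_one_le₀ one_lt_p.le)))
  let a' : 𝓞_ℂ_[p] := ⟨(a : ℂ_[p]), by
    change (Valued.v ((a : PadicAlgCl p) : ℂ_[p]) : ℝ≥0) ≤ 1; aesop⟩
  have hra : coeff N x = Ideal.Quotient.mk _ a' := by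
    rw [← hr, mk_eq_mk_iff, valuation_eq_nnnorm, ← NNReal.coe_le_coe, coe_nnnorm]; push_cast; rw [one_div]; exact ha.le
  have hfin : FiniteDimensional ℚ_[p] (adjoin ℚ_[p] {a}) :=
    adjoin.finiteDimensional (Algebra.IsIntegral.isIntegral a)
  have hopen := (IntermediateField.fixingSubgroup_isOpen (adjoin ℚ_[p] {a})).mem_nhds
    (one_mem _)
  filter_upwards [hopen] with σ hσ
  have hσa : σ a = a := (IntermediateField.mem_fixingSubgroup_iff _ _).1 hσ a
    (mem_adjoin_simple_self _ a)
  have h0 : coeff N (galOFlat σ x - x) = 0 := by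
    rw [map_sub, coeff_galOFlat, hra, sub_eq_zero]; change Ideal.Quotient.mk _ (galO σ a') = _; congr 1; refine Subtype.ext ?_; rw [coe_galO]
    exact (galC_coe σ a).trans (by rw [hσa])
  rw [coeff_eq_zero_iff] at h0
  rw [galFlat_algebraMap, ← map_sub, fn_algebraMap, dist_0_eq_abs, abs_of_nonneg (NNReal.coe_nonneg _)]
  refine lt_of_le_of_lt ?_ hN
  have : ((oFlatVal p (galOFlat σ x - x) : ℝ≥0) : ℝ) ≤ ((1 / p : ℝ≥0) ^ p ^ N : ℝ≥0) := by exact_mod_cast h0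
  simpa using this

lemma tendsto_galFlat (x : Ĉ) : Tendsto (fun σ : GalQp p => fn (galFlat σ x - x)) (𝓝 1) (𝓝 0) := by
  obtain ⟨a, b, hb, rfl⟩ := div_surjective (OFlat p) x
  set α := algebraMap (OFlat p) Ĉ a
  set β := algebraMap (OFlat p) Ĉ b
  have hβ : β ≠ 0 := by aesop
  have hlim : Tendsto (fun σ : GalQp p => (fn (galFlat σ α - α) * fn β + fn α * fn (galFlat σ β - β)) / fn (β * β))
      (𝓝 1) (𝓝 0) := by
    have := (((tendsto_galFlat_algebraMap a).mul_const (fn β)).add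
      ((tendsto_galFlat_algebraMap b).const_mul (fn α))).div_const (fn (β * β))
    simpa using this
  refine squeeze_zero (fun _ => fn_nonneg _) (fun σ => ?_) hlim
  have hσβ : galFlat σ β ≠ 0 := by simp_all
  have e : galFlat σ (α / β) - α / β = ((galFlat σ α - α) * β - α * (galFlat σ β - β)) / (galFlat σ β * β) := by
    rw [map_div₀]; field_simp; ring
  rw [e, fn_div, fn_mul (galFlat σ β), fn_galFlat, fn_mul β]
  refine div_le_div_of_nonneg_right ((fn_sub_le _ _).trans ?_) (mul_nonneg (fn_nonneg _) (fn_nonneg _))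
  rw [fn_mul, fn_mul]
  have h1 := mul_nonneg (fn_nonneg (galFlat σ α - α)) (fn_nonneg β)
  have h2 := mul_nonneg (fn_nonneg α) (fn_nonneg (galFlat σ β - β))
  exact max_le (by linarith) (by linarith)

lemma eventually_GB_galW_sub {θ' : ℝ} (h0 : 0 < θ) (h : θ < θ') (h1 : θ' ≤ 1) (hx : GB θ' B x) {C : ℝ} (hC : 0 < C) :
    ∀ᶠ σ : GalQp p in 𝓝 1, GB θ C (galW σ x - x) := by
  have hθ' := h0.trans h
  have h2 : ∀ k, Tendsto (fun σ : GalQp p => fn ((galW σ x).coeff k - x.coeff k)) (𝓝 1) (𝓝 0) := fun k => by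
    simpa only [coeff_galW] using tendsto_galFlat (x.coeff k)
  have h3 : ∀ k, Tendsto (fun σ : GalQp p => fn ((galW σ x - x).coeff k)) (𝓝 1) (𝓝 0) := fun k => by
    simpa using tendsto_coeff_sub h2 (x' := fun _ => x) (y' := x) (fun k => by simp) k
  obtain ⟨K, hK⟩ : ∃ K, ∀ k ≥ K, B * (θ / θ') ^ k ≤ C := by
    have hlim : Tendsto (fun k => B * (θ / θ') ^ k) atTop (𝓝 0) := by
      simpa using (tendsto_pow_atTop_nhds_zero_of_lt_one (by positivity) ((div_lt_one hθ').2 h)).const_mul B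
    exact eventually_atTop.1 (hlim.eventually (ge_mem_nhds hC))
  have hev : ∀ᶠ σ : GalQp p in 𝓝 1, ∀ k ∈ range K, fn ((galW σ x - x).coeff k) ≤ (C / θ ^ k) ^ p ^ k :=
    (Finset.eventually_all (range K)).2 fun k _ => (h3 k).eventually (ge_mem_nhds (by positivity))
  filter_upwards [hev] with σ hσ k
  rcases lt_or_ge k K with hk | hk
  · rw [← le_div_iff₀ (pow_pos h0 k), fn_dg_le_iff (by positivity)]
    exact hσ k (mem_range.2 hk)
  · refine le_trans ?_ (hK k hk); rw [div_pow, ← mul_div_assoc, le_div_iff₀ (pow_pos hθ' k), mul_right_comm]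
    exact mul_le_mul_of_nonneg_right (((hx.galW σ).sub hθ' h1 hx) k) (pow_nonneg h0.le k)

end Overconvergent
section CyclotomicValues
lemma sysroot_pow {ζ : ℕ → 𝓞_ℂ_[p]} (h0 : ζ 0 = 1) (h1 : ∀ n, ζ (n + 1) ^ p = ζ n) (n : ℕ) : ζ n ^ p ^ n = 1 := by
  induction n with
  | zero => simp_all
  | succ n ih => rw [pow_succ', pow_mul, h1, ih]

lemma sysroot_pow_sub {ζ : ℕ → 𝓞_ℂ_[p]} (h1 : ∀ n, ζ (n + 1) ^ p = ζ n) (m n : ℕ) : ζ (m + n) ^ p ^ n = ζ m := by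
  induction n with
  | zero => simp
  | succ n ih => rw [pow_succ', pow_mul, ← add_assoc, h1, ih]

lemma sysroot_primitive {ζ : ℕ → 𝓞_ℂ_[p]} (h0 : ζ 0 = 1) (h1 : ∀ n, ζ (n + 1) ^ p = ζ n) (h : ζ 1 ≠ 1) (n : ℕ) : IsPrimitiveRoot (ζ n) (p ^ n) := by
  rcases n with _ | n
  · simp_all
  · have h2 : ¬ ζ (n + 1) ^ p ^ n = 1 := by rw [add_comm, sysroot_pow_sub h1]; exact h
    rw [← orderOf_eq_prime_pow h2 (sysroot_pow h0 h1 (n + 1))]; exact IsPrimitiveRoot.orderOf _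

/-- The norm of an integer of `ℂ_p`. -/
def nO (x : 𝓞_ℂ_[p]) : ℝ := ‖(x : ℂ_[p])‖

lemma nO_eq (x : 𝓞_ℂ_[p]) : nO x = ((Valued.v (x : ℂ_[p]) : ℝ≥0) : ℝ) := by
  rw [valuation_eq_nnnorm]; rfl

lemma nO_le_one (x : 𝓞_ℂ_[p]) : nO x ≤ 1 := by
  rw [nO_eq]; exact_mod_cast x.2

lemma nO_mul (x y : 𝓞_ℂ_[p]) : nO (x * y) = nO x * nO y := norm_mul _ _

lemma nO_pow (x : 𝓞_ℂ_[p]) (n : ℕ) : nO (x ^ n) = nO x ^ n := norm_pow _ _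

lemma nO_nonneg (x : 𝓞_ℂ_[p]) : 0 ≤ nO x := norm_nonneg _

lemma nO_add_le (x y : 𝓞_ℂ_[p]) : nO (x + y) ≤ max (nO x) (nO y) := by
  rw [nO_eq, nO_eq, nO_eq]
  simp

lemma nO_p : nO (p : 𝓞_ℂ_[p]) = (p : ℝ)⁻¹ := by
  rw [nO_eq]
  have h := valuation_p p
  simp_all

lemma nO_prod {ι : Type*} (s : Finset ι) (f : ι → 𝓞_ℂ_[p]) : nO (∏ i ∈ s, f i) = ∏ i ∈ s, nO (f i) := by
  classical
  induction s using Finset.induction_on with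
  | empty => simp [nO]
  | insert a s ha ih => rw [Finset.prod_insert ha, Finset.prod_insert ha, nO_mul, ih]

lemma le_nO_one_sub {z : 𝓞_ℂ_[p]} (hz : IsPrimitiveRoot z p) : (p : ℝ)⁻¹ ≤ nO (z - 1) ^ (p - 1) := by
  have hp := prm p
  have h1 : nO (1 - z) = nO (z - 1) := by
    have : 1 - z = (-1) * (z - 1) := by ring
    rw [this, nO_mul]; simp [nO]
  obtain ⟨n, hn⟩ : ∃ n, p = n + 1 := ⟨p - 1, (Nat.sub_add_cancel hp.one_le).symm⟩
  have hz' : IsPrimitiveRoot z (n + 1) := hn ▸ hz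
  have h2 := hz'.prod_one_sub_pow_eq_order
  have h3 : ((n : 𝓞_ℂ_[p]) + 1) = (p : 𝓞_ℂ_[p]) := by
    rw [← cast_succ]; exact congrArg _ hn.symm
  rw [h3] at h2
  have h4 : p - 1 = n := by omega
  rw [← nO_p, ← h2, nO_prod, h4]
  calc ∏ i ∈ range n, nO (1 - z ^ (i + 1)) ≤ ∏ _i ∈ range n, nO (z - 1) := by
        refine Finset.prod_le_prod (fun _ _ => nO_nonneg _) fun i _ => ?_
        rw [← h1, ← mul_neg_geom_sum z (i + 1), nO_mul]; exact mul_le_of_le_one_right (nO_nonneg _) (nO_le_one _)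
    _ = _ := by simp

lemma IsEps.le_fn {e : Ĉ} (he : IsEps p e) : (p : ℝ)⁻¹ ^ p ≤ fn (e - 1) ^ (p - 1) := by
  have hp := prm p
  obtain ⟨x, rfl, ζ, h0, h, h1, h2⟩ := he
  have hζ1 := sysroot_primitive h0 h1 h 1
  rw [pow_one] at hζ1
  have b1 := le_nO_one_sub hζ1
  have hp0 : (0 : ℝ) < (p : ℝ)⁻¹ := inv_pos.2 p_pos
  have hp1 : (p : ℝ)⁻¹ < 1 := inv_lt_one_of_one_lt₀ one_lt_p
  have hle : (p : ℝ)⁻¹ ≤ nO (ζ 1 - 1) :=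
    b1.trans (pow_le_of_le_one (nO_nonneg _) (nO_le_one _) (Nat.sub_ne_zero_of_lt hp.one_lt))
  -- the second root
  have b2 : nO (ζ 1 - 1) ≤ nO (ζ 2 - 1) ^ p := by
    by_contra! hlt
    have hlt1 : nO (ζ 2 - 1) < 1 := by
      by_contra! h3
      exact (hlt.trans_le (nO_le_one _)).not_ge (one_le_pow₀ h3)
    obtain ⟨r, hr⟩ := exists_add_pow_prime_eq hp (ζ 2 - 1) 1; rw [sub_add_cancel, h1 1, one_pow] at hr
    have e : ζ 1 - 1 = (ζ 2 - 1) ^ p + p * ((ζ 2 - 1) * 1 * r) := by rw [hr]; ring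
    have h4 := nO_add_le ((ζ 2 - 1) ^ p) ((p : 𝓞_ℂ_[p]) * ((ζ 2 - 1) * 1 * r))
    rw [← e, nO_pow, nO_mul, mul_one, nO_mul, nO_p] at h4; rcases le_max_iff.1 h4 with h5 | h5
    · linarith
    · have h6 : (p : ℝ)⁻¹ * (nO (ζ 2 - 1) * nO r) < (p : ℝ)⁻¹ := by
        refine mul_lt_of_lt_one_right hp0 ?_; exact (mul_le_of_le_one_right (nO_nonneg _) (nO_le_one _)).trans_lt hlt1
      linarith
  have b3 : (p : ℝ)⁻¹ ≤ nO (ζ 2 - 1) ^ (p * (p - 1)) := by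
    rw [pow_mul]; exact b1.trans (pow_le_pow_left₀ (nO_nonneg _) b2 _)
  have b4 : (p : ℝ)⁻¹ < nO (ζ 2 - 1) := by
    by_contra! h3
    have h4 : 2 ≤ p * (p - 1) := by
      have := hp.two_le
      calc 2 = 2 * 1 := rfl
        _ ≤ p * (p - 1) := Nat.mul_le_mul this (by omega)
    have h5 : nO (ζ 2 - 1) ^ (p * (p - 1)) ≤ (p : ℝ)⁻¹ ^ 2 :=
      (pow_le_pow_of_le_one (nO_nonneg _) (nO_le_one _) h4).trans (pow_le_pow_left₀ (nO_nonneg _) h3 2)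
    have h6 : (p : ℝ)⁻¹ ^ 2 < (p : ℝ)⁻¹ := by
      rw [pow_two]; exact mul_lt_of_lt_one_right hp0 hp1
    exact ((b3.trans h5).trans_lt h6).false
  have hval := oFlatVal_eq (x := x - 1) (n := 2) (a := ζ 2 - 1)
    (by rw [map_sub, map_sub, h2, map_one, map_one]) (by
      rw [← NNReal.coe_lt_coe]; push_cast; rw [one_div]; have := nO_eq (ζ 2 - 1); simp_all)
  have e1 : fn (algebraMap (OFlat p) Ĉ x - 1) = nO (ζ 2 - 1) ^ p ^ 2 := by
    rw [← map_one (algebraMap (OFlat p) Ĉ), ← map_sub, fn_algebraMap, hval, nO_eq]; push_cast; rfl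
  rw [e1, ← pow_mul]
  have e2 : p ^ 2 * (p - 1) = (p * (p - 1)) * p := by ring
  rw [e2, pow_mul]
  exact pow_le_pow_left₀ hp0.le b3 _

lemma fn_cycl_sub_one_le {e : Ĉ} (he : e ∈ cycl p) : fn (e - 1) ≤ (p : ℝ)⁻¹ := by
  obtain ⟨x, rfl, ζ, h0, h1, h2⟩ := he
  have h : coeff 0 (x - 1) = 0 := by rw [map_sub, h2, h0, map_one, map_one, sub_self]
  rw [coeff_eq_zero_iff, pow_zero, pow_one] at h
  rw [← map_one (algebraMap (OFlat p) Ĉ), ← map_sub, fn_algebraMap]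
  aesop

lemma IsEps.sub_one_ne_zero {e : Ĉ} (he : IsEps p e) : e - 1 ≠ 0 := fun h => by
  have h1 := he.le_fn
  rw [h, fn_zero, zero_pow (Nat.sub_ne_zero_of_lt (prm p).one_lt)] at h1
  have : (0 : ℝ) < (p : ℝ)⁻¹ ^ p := pow_pos (inv_pos.2 p_pos) _
  linarith

lemma fn_of_mem_cycl {e : Ĉ} (he : e ∈ cycl p) : fn e = 1 := by
  have h := fn_cycl_sub_one_le he
  have := fn_eq_of_sub_lt (x := e) (y := 1) (by
    rw [fn_one]; exact h.trans_lt (inv_lt_one_of_one_lt₀ one_lt_p))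
  simp_all

lemma teichmuller_sub_one_coeff_le {c : Ĉ} (hc : fn (c - 1) ≤ 1) (k : ℕ) : fn ((ω c - 1).coeff k) ≤ fn (c - 1) := by
  have hc1 : fn c ≤ 1 := by
    rw [← sub_add_cancel c 1]; exact fn_add_le_of hc fn_one.le
  have hco : ∀ (d : Ĉ), fn d ≤ 1 → ∀ i, fn ((ω d).coeff i) ≤ 1 := fun d hd i => by
    rcases Nat.eq_zero_or_pos i with rfl | hi
    · simpa using hd
    simp_all
  have key := fn_coeff_sub_sub_le (x := ω c) (x' := 1) (y := 1) (y' := 1) (k := k)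
    (fn_nonneg (c - 1)) (fun i _ => hco c hc1 i)
    (fun i _ => by rw [← map_one (ω)]; exact hco 1 fn_one.le i)
    (fun i _ => by rw [← map_one (ω)]; exact hco 1 fn_one.le i)
    (fun i _ => by rw [← map_one (ω)]; exact hco 1 fn_one.le i)
    (fun i _ => by
      rcases Nat.eq_zero_or_pos i with rfl | hi
      · simp
      · rw [← map_one (ω), teichmuller_coeff_pos p c i hi, teichmuller_coeff_pos p 1 i hi]; simpa using fn_nonneg _)
    (fun i _ => by simpa using fn_nonneg _)
  simpa using key

lemma IsEps.GB_teichmuller_sub_one {e : Ĉ} (he : IsEps p e) {θ : ℝ} (h0 : 0 < θ) (h : θ ≤ (p : ℝ)⁻¹) :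
    GB θ (fn (e - 1)) (ω e - 1) := fun k => by
  have hp := prm p
  have hp0 : (0 : ℝ) < (p : ℝ)⁻¹ := inv_pos.2 p_pos
  have hp1 : (p : ℝ)⁻¹ < 1 := inv_lt_one_of_one_lt₀ one_lt_p
  have hle := he.le_fn
  have hup := fn_cycl_sub_one_le he.mem_cycl
  have hf := fn_nonneg (e - 1)
  have hθ1 := h.trans hp1.le
  rcases k with _ | _ | k
  · simp [coeff_zero_sub]
  · rw [zero_add, pow_one, ← le_div_iff₀ h0, fn_dg_le_iff (by positivity), pow_one]
    refine (teichmuller_sub_one_coeff_le (hup.trans hp1.le) 1).trans ?_; rw [div_pow, le_div_iff₀ (by positivity)]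
    obtain ⟨n, hn⟩ : ∃ n, p = n + 1 := ⟨p - 1, (Nat.sub_add_cancel hp.one_le).symm⟩
    have h3 : fn (e - 1) ^ p = fn (e - 1) * fn (e - 1) ^ (p - 1) := by
      rw [← pow_succ', Nat.sub_add_cancel hp.one_le]
    rw [h3]; exact mul_le_mul_of_nonneg_left ((pow_le_pow_left₀ h0.le h p).trans hle) hf
  · have h1 : fn (dg (ω e - 1) (k + 1 + 1)) ≤ 1 := by
      rw [fn_dg_le_iff zero_le_one, one_pow]; exact (teichmuller_sub_one_coeff_le (hup.trans hp1.le) _).trans (hup.trans hp1.le)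
    have h2 : θ ^ (k + 1 + 1) ≤ (p : ℝ)⁻¹ ^ 2 :=
      (pow_le_pow_of_le_one h0.le hθ1 (by omega)).trans (pow_le_pow_left₀ h0.le h 2)
    have h3 : (p : ℝ)⁻¹ ^ 2 ≤ fn (e - 1) := by
      by_contra! h4
      have h5 : fn (e - 1) ^ (p - 1) < ((p : ℝ)⁻¹ ^ 2) ^ (p - 1) :=
        pow_lt_pow_left₀ h4 hf (Nat.sub_ne_zero_of_lt hp.one_lt)
      rw [← pow_mul] at h5; have h6 : (p : ℝ)⁻¹ ^ (2 * (p - 1)) ≤ (p : ℝ)⁻¹ ^ p :=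
        pow_le_pow_of_le_one hp0.le hp1.le (by have := hp.two_le; omega)
      exact (hle.trans_lt (h5.trans_le h6)).false
    calc fn (dg (ω e - 1) (k + 1 + 1)) * θ ^ (k + 1 + 1) ≤ 1 * θ ^ (k + 1 + 1) := by gcongr
      _ ≤ _ := by linarith

lemma IsEps.exists_pow {ε : Ĉ} (hε : IsEps p ε) {e : Ĉ} (he : e ∈ cycl p) (N : ℕ) : ∃ a : ℕ, fn (e - ε ^ a) ≤ (p : ℝ)⁻¹ ^ p ^ N := by
  obtain ⟨x, rfl, ζ, h0, h, h1, h2⟩ := hε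
  obtain ⟨x', rfl, ζ', h0', h1', h2'⟩ := he
  have : NeZero (p ^ N) := ⟨pp_ne_zero N⟩
  obtain ⟨a, -, ha⟩ := (sysroot_primitive h0 h1 h N).eq_pow_of_pow_eq_one (sysroot_pow h0' h1' N)
  refine ⟨a, ?_⟩
  have h3 : coeff N (x' - x ^ a) = 0 := by
    rw [map_sub, map_pow, h2, h2', ← map_pow, ha, sub_self]
  rw [coeff_eq_zero_iff] at h3
  rw [← map_pow, ← map_sub, fn_algebraMap]
  have h4 : ((oFlatVal p (x' - x ^ a) : ℝ≥0) : ℝ) ≤ (((1 / p : ℝ≥0) ^ p ^ N : ℝ≥0) : ℝ) := by exact_mod_cast h3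
  simpa using h4

end CyclotomicValues
section ClosedSets
/-- Closed subsets of `ℂ_p^♭`. -/
def FlatClosed (T : Set Ĉ) : Prop := ∀ x, (∀ δ > 0, ∃ y ∈ T, fn (x - y) ≤ δ) → x ∈ T

lemma FlatClosed.mem_of_tendsto {T : Set Ĉ} (hT : FlatClosed T) {y : ℕ → Ĉ} {x : Ĉ}
    (hy : ∀ n, y n ∈ T) (h : Tendsto (fun n => fn (y n - x)) atTop (𝓝 0)) : x ∈ T := by
  refine hT x fun δ hδ => ?_
  obtain ⟨n, hn⟩ := (h.eventually (ge_mem_nhds hδ)).exists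
  exact ⟨y n, hy n, by rwa [fn_sub_comm]⟩

lemma fn_le_of_tendsto {y : ℕ → Ĉ} {x : Ĉ} {B : ℝ} (hB : 0 ≤ B) (hy : ∀ n, fn (y n) ≤ B)
    (h : Tendsto (fun n => fn (y n - x)) atTop (𝓝 0)) : fn x ≤ B := by
  by_contra! hlt
  obtain ⟨n, hn⟩ := (h.eventually (gt_mem_nhds (hB.trans_lt hlt))).exists
  exact hlt.not_ge (fn_eq_of_sub_lt hn ▸ hy n)

lemma successive_approx {ι : Type*} (T A : Set Ĉ) (hA0 : 0 ∈ A) (hAadd : ∀ a ∈ A, ∀ b ∈ A, a + b ∈ A) (hA : FlatClosed A) (F : (ι → Ĉ) →+ Ĉ)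
    (hF : ∀ a : ℕ → ι → Ĉ, (∀ i, Tendsto (fun n => fn (a n i)) atTop (𝓝 0)) → Tendsto (fun n => fn (F (a n))) atTop (𝓝 0))
    (e : ℕ) (he : e ≠ 0) (c : ι → ℝ) (hc : ∀ i, 0 ≤ c i) (q : ℝ) (hq0 : 0 ≤ q) (hq : q < 1)
    (step : ∀ t ∈ T, ∃ a : ι → Ĉ, (∀ i, a i ∈ A) ∧ t - F a ∈ T ∧ fn (t - F a) ≤ q * fn t ∧ ∀ i, fn (a i) ^ e ≤ c i * fn t) (t : Ĉ) (ht : t ∈ T) :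
    ∃ b : ι → Ĉ, (∀ i, b i ∈ A) ∧ F b = t ∧ ∀ i, fn (b i) ^ e ≤ c i * fn t := by
  choose! a haA haT haq hac using step
  let τ : ℕ → Ĉ := fun n => (fun s => s - F (a s))^[n] t
  have hτs : ∀ n, τ (n + 1) = τ n - F (a (τ n)) := fun n => iterate_succ_apply' _ _ _
  have hτT : ∀ n, τ n ∈ T := fun n => by
    induction n with
    | zero => exact ht
    | succ n ih => simp_all
  have hτq : ∀ n, fn (τ n) ≤ q ^ n * fn t := fun n => by
    induction n with
    | zero => aesop
    | succ n ih =>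
      rw [hτs, pow_succ', mul_assoc]; exact (haq _ (hτT n)).trans (mul_le_mul_of_nonneg_left ih hq0)
  have hτt : ∀ n, fn (τ n) ≤ fn t := fun n =>
    (hτq n).trans (mul_le_of_le_one_left (fn_nonneg _) (pow_le_one₀ hq0 hq.le))
  have hτ0 : Tendsto (fun n => fn (τ n)) atTop (𝓝 0) := by
    refine squeeze_zero (fun _ => fn_nonneg _) hτq ?_
    simpa using (tendsto_pow_atTop_nhds_zero_of_lt_one hq0 hq).mul_const (fn t)
  let b : ℕ → ι → Ĉ := fun n => ∑ l ∈ range n, a (τ l)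
  have hbs : ∀ n, b (n + 1) = b n + a (τ n) := fun n => sum_range_succ _ _
  have hFb : ∀ n, F (b n) = t - τ n := fun n => by
    induction n with
    | zero => simp [b, τ]
    | succ n ih => rw [hbs, map_add, ih, hτs]; ring
  have ha0 : ∀ i, Tendsto (fun n => fn (a (τ n) i)) atTop (𝓝 0) := fun i => by
    have h1 : Tendsto (fun n => fn (a (τ n) i) ^ e) atTop (𝓝 0) :=
      squeeze_zero (fun _ => pow_nonneg (fn_nonneg _) _) (fun n => hac _ (hτT n) i)
        (by simpa using hτ0.const_mul (c i))
    rw [Metric.tendsto_nhds] at h1 ⊢; intro δ hδ; filter_upwards [h1 (δ ^ e) (pow_pos hδ e)] with n hn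
    rw [dist_0_eq_abs, abs_of_nonneg (pow_nonneg (fn_nonneg _) _)] at hn; rw [dist_0_eq_abs, abs_of_nonneg (fn_nonneg _)]
    exact lt_of_pow_lt_pow_left₀ e hδ.le hn
  choose β hβ using fun i => exists_lim (fun n => b n i) (by
    simp_all)
  have hbA : ∀ n i, b n i ∈ A := fun n i => by
    induction n with
    | zero => simpa [b] using hA0
    | succ n ih => simp_all
  refine ⟨β, fun i => hA.mem_of_tendsto (fun n => hbA n i) (hβ i), ?_, fun i => ?_⟩
  · have h1 : Tendsto (fun n => fn (F (b n - β))) atTop (𝓝 0) := hF _ fun i => by simpa using hβ i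
    have h2 : Tendsto (fun n => max (fn (F (b n - β))) (fn (τ n))) atTop (𝓝 0) := by
      simpa using h1.max hτ0
    have h3 : fn (F β - t) ≤ 0 := ge_of_tendsto' h2 fun n => by
      have : F β - t = - (F (b n - β)) - τ n := by rw [map_sub, hFb]; ring
      rw [this]; refine (fn_sub_le _ _).trans ?_; rw [fn_neg]
    exact sub_eq_zero.1 (fn_eq_zero.1 (h3.antisymm (fn_nonneg _)))
  · have hct : 0 ≤ c i * fn t := mul_nonneg (hc i) (fn_nonneg _)
    have hroot : ∃ r : ℝ, 0 ≤ r ∧ r ^ e = c i * fn t :=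
      ⟨(c i * fn t) ^ (1 / (e : ℝ)), by positivity, by
        rw [one_div, Real.rpow_inv_natCast_pow hct he]⟩
    obtain ⟨r, hr, hre⟩ := hroot; rw [← hre]; refine pow_le_pow_left₀ (fn_nonneg _) (fn_le_of_tendsto hr (fun n => ?_) (hβ i)) e
    induction n with
    | zero => simpa [b] using hr
    | succ n ih =>
      rw [hbs]; refine fn_add_le_of ih (le_of_pow_le_pow_left₀ he hr ?_); rw [hre]
      exact (hac _ (hτT n) i).trans (mul_le_mul_of_nonneg_left (hτt n) (hc i))

lemma fn_zmod {c : ZMod p} (hc : c ≠ 0) : fn (algebraMap (ZMod p) Ĉ c) = 1 := by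
  have h1 := congrArg (fun c => fn (algebraMap (ZMod p) Ĉ c)) (ZMod.pow_card_sub_one_eq_one hc)
  simp only [map_pow, map_one, fn_pow, fn_one] at h1
  exact (pow_eq_one_iff_of_nonneg (fn_nonneg _) (Nat.sub_ne_zero_of_lt (prm p).one_lt)).1 h1

lemma natCast_pow_card (m : ℕ) : (m : Ĉ) ^ p = m := by
  have := congrArg (algebraMap (ZMod p) Ĉ) (ZMod.pow_card (m : ZMod p))
  rwa [map_pow, map_natCast] at this

end ClosedSets

section BaseField
/-- `x` has a leading term in the powers of `t`. -/
def HasLead (t x : Ĉ) : Prop := ∃ c : ZMod p, c ≠ 0 ∧ ∃ n : ℤ, fn (x - algebraMap _ Ĉ c * t ^ n) < fn t ^ n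

lemma fn_lead (t : Ĉ) {c : ZMod p} (hc : c ≠ 0) (n : ℤ) : fn (algebraMap _ Ĉ c * t ^ n) = fn t ^ n := by
  rw [fn_mul, fn_zmod hc, one_mul, fn_zpow]

lemma HasLead.fn_eq {t x : Ĉ} {c : ZMod p} (hc : c ≠ 0) {n : ℤ} (hx : fn (x - algebraMap _ Ĉ c * t ^ n) < fn t ^ n) : fn x = fn t ^ n := by
  rw [← fn_lead t hc] at hx ⊢; exact fn_eq_of_sub_lt hx

lemma HasLead.div {t x y : Ĉ} (ht : t ≠ 0) (hx : HasLead t x) (hy : HasLead t y) : HasLead t (x / y) := by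
  obtain ⟨c, hc, n, hn⟩ := hx
  obtain ⟨d, hd, k, hk⟩ := hy
  have hf := fn_pos.2 ht
  have hy := HasLead.fn_eq hd hk
  have hy0 : y ≠ 0 := fn_pos.1 (hy ▸ zpow_pos hf k)
  have hd' : algebraMap _ Ĉ d ≠ 0 := fn_pos.1 (by rw [fn_zmod hd]; exact one_pos)
  refine ⟨c / d, div_ne_zero hc hd, n - k, ?_⟩
  have e : x / y - algebraMap _ Ĉ (c / d) * t ^ (n - k) = ((x - algebraMap _ Ĉ c * t ^ n) -
      algebraMap _ Ĉ c * t ^ n * (y - algebraMap _ Ĉ d * t ^ k) / (algebraMap _ Ĉ d * t ^ k)) / y := by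
    rw [map_div₀, zpow_sub₀ ht]; field_simp; ring
  rw [e, fn_div, hy, zpow_sub₀ hf.ne']
  refine div_lt_div_of_pos_right ((fn_sub_le _ _).trans_lt (max_lt hn ?_)) (zpow_pos hf k)
  rw [fn_div, fn_mul, fn_lead t hc, fn_lead t hd, div_lt_iff₀ (zpow_pos hf k)]; exact mul_lt_mul_of_pos_left hk (zpow_pos hf n)

/-- Evaluation of integral polynomials. -/
def evZ (t : Ĉ) : Polynomial ℤ →+* Ĉ := Polynomial.eval₂RingHom (castRingHom _) t

lemma hasLead_aeval {t : Ĉ} (ht0 : t ≠ 0) (ht : fn t < 1) (P : Polynomial (ZMod p)) :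
    (fn (P.aeval t) ≤ 1 ∧ (P.coeff 0 = 0 → fn (P.aeval t) < 1)) ∧ (P.aeval t = 0 ∨ HasLead t (P.aeval t)) := by
  induction P using Polynomial.recOnHorner with
  | M0 => simp
  | MC P a h0 ha ih =>
    have h1 := ih.1.2 h0
    rw [map_add, aeval_C]
    exact ⟨⟨fn_add_le_of h1.le (fn_zmod ha).le, fun h => absurd (by simpa [h0] using h) ha⟩, Or.inr ⟨a, ha, 0, by simpa using h1⟩⟩
  | MX P _ ih =>
    rw [map_mul, Polynomial.aeval_X]; have h1 : fn (P.aeval t * t) < 1 := by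
      rw [fn_mul]; exact (mul_le_of_le_one_left (fn_nonneg _) ih.1.1).trans_lt ht
    refine ⟨⟨h1.le, fun _ => h1⟩, ?_⟩
    rcases ih.2 with h | ⟨c, hc, n, hn⟩
    · simp_all
    · refine Or.inr ⟨c, hc, n + 1, ?_⟩; rw [zpow_add_one₀ ht0, ← mul_assoc, ← sub_mul, fn_mul, zpow_add_one₀ (fn_pos.2 ht0).ne']
      exact mul_lt_mul_of_pos_right hn (fn_pos.2 ht0)

lemma hasLead_of_mem_closure {t : Ĉ} (ht0 : t ≠ 0) (ht : fn t < 1) {x : Ĉ} (hx : x ∈ Subfield.closure {t}) (hx0 : x ≠ 0) : HasLead t x := by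
  have h : ∀ y ∈ Subring.closure {t}, y = 0 ∨ HasLead t y := fun y hy => by
    obtain ⟨P, rfl⟩ := (Subring.closure_le (t := (Polynomial.aeval (R := ZMod p) t).toRingHom.range)).2 (by simpa using ⟨X, Polynomial.aeval_X t⟩) hy
    exact (hasLead_aeval ht0 ht P).2
  obtain ⟨y, hy, z, hz, rfl⟩ := Subfield.mem_closure_iff.1 hx
  rw [div_ne_zero_iff] at hx0
  exact ((h y hy).resolve_left hx0.1).div ht0 ((h z hz).resolve_left hx0.2)

/-- The closure of a subfield. -/
def flatClosure (M : Subfield Ĉ) : Subfield Ĉ where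
  carrier := {x | ∀ δ > 0, ∃ y ∈ M, fn (x - y) ≤ δ}
  mul_mem' := by
    intro x x' hx hx' δ hδ
    have h : ∀ z : Ĉ, 0 < fn z + 1 := fun z => by linarith [fn_nonneg z]
    have hb : ∀ {a z : Ĉ}, fn a ≤ δ / (fn z + 1) → fn (a * z) ≤ δ := fun {a z} ha => by
      rw [fn_mul]; exact (mul_le_mul ha (le_add_of_nonneg_right zero_le_one) (fn_nonneg _) (div_pos hδ (h z)).le).trans (div_mul_cancel₀ _ (h z).ne').le
    obtain ⟨y, hy, hxy⟩ := hx _ (div_pos hδ (h x')); obtain ⟨y', hy', hxy'⟩ := hx' _ (div_pos hδ (h y)); refine ⟨y * y', mul_mem hy hy', ?_⟩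
    rw [show x * x' - y * y' = (x - y) * x' + (x' - y') * y by ring]; exact fn_add_le_of (hb hxy) (hb hxy')
  add_mem' := by
    intro x x' hx hx' δ hδ; obtain ⟨y, hy, hxy⟩ := hx _ hδ; obtain ⟨y', hy', hxy'⟩ := hx' _ hδ
    exact ⟨y + y', add_mem hy hy', by rw [add_sub_add_comm]; exact fn_add_le_of hxy hxy'⟩
  zero_mem' := fun δ hδ => ⟨0, zero_mem _, by simpa using hδ.le⟩
  one_mem' := fun δ hδ => ⟨1, one_mem _, by simpa using hδ.le⟩
  neg_mem' := by
    intro x hx δ hδ; obtain ⟨y, hy, hxy⟩ := hx _ hδ; exact ⟨-y, neg_mem hy, by rw [neg_sub_neg, fn_sub_comm]; exact hxy⟩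
  inv_mem' := by
    intro x hx δ hδ
    rcases eq_or_ne x 0 with rfl | h0
    · exact ⟨0, zero_mem _, by simpa using hδ.le⟩
    have hf := fn_pos.2 h0
    obtain ⟨y, hy, hxy⟩ := hx (min (δ * (fn x * fn x)) (fn x / 2)) (by positivity)
    have hyx : fn y = fn x := fn_eq_of_sub_lt (by rw [fn_sub_comm]; linarith [hxy.trans (min_le_right _ _)])
    refine ⟨y⁻¹, inv_mem hy, ?_⟩
    rw [inv_sub_inv h0 (fn_pos.1 (hyx ▸ hf)), fn_div, fn_mul, hyx, fn_sub_comm, div_le_iff₀ (by positivity)]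
    exact hxy.trans (min_le_left _ _)

lemma flatClosure_closed (M : Subfield Ĉ) : FlatClosed (flatClosure M : Set Ĉ) := by
  intro x hx δ hδ
  obtain ⟨y, hy, hxy⟩ := hx δ hδ
  obtain ⟨z, hz, hyz⟩ := hy δ hδ
  exact ⟨z, hz, by rw [← sub_add_sub_cancel x y z]; exact fn_add_le_of hxy hyz⟩

lemma hasLead_of_mem_flatClosure {t : Ĉ} (ht0 : t ≠ 0) (ht : fn t < 1) {x : Ĉ} (hx : x ∈ flatClosure (Subfield.closure {t})) (hx0 : x ≠ 0) : HasLead t x := by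
  have hfx := fn_pos.2 hx0
  obtain ⟨y, hy, hxy⟩ := hx (fn x / 2) (by positivity)
  have hlt : fn (x - y) < fn x := by linarith
  have hyx : fn y = fn x := fn_eq_of_sub_lt (by rwa [fn_sub_comm])
  obtain ⟨c, hc, n, hn⟩ := hasLead_of_mem_closure ht0 ht hy (fn_pos.1 (hyx ▸ hfx))
  refine ⟨c, hc, n, ?_⟩
  have hyn := HasLead.fn_eq hc hn
  rw [← sub_add_sub_cancel x y]
  exact (fn_add_le _ _).trans_lt (max_lt (by simp_all) hn)

lemma IsEps.fn_sub_one_lt (hε : IsEps p ε) : fn (ε - 1) < 1 := (fn_cycl_sub_one_le hε.mem_cycl).trans_lt (inv_lt_one_of_one_lt₀ one_lt_p)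

lemma IsEps.cycl_subset (hε : IsEps p ε) : cycl p ⊆ flatClosure (Subfield.closure {ε - 1}) := by
  intro e he δ hδ
  have hlim : Tendsto (fun N : ℕ => ((p : ℝ)⁻¹) ^ p ^ N) atTop (𝓝 0) :=
    (tendsto_pow_atTop_nhds_zero_of_lt_one (inv_nonneg.2 p_pos.le) (inv_lt_one_of_one_lt₀ one_lt_p)).comp (tendsto_pow_atTop_atTop_of_one_lt (prm p).one_lt)
  obtain ⟨N, hN⟩ := (hlim.eventually (ge_mem_nhds hδ)).exists
  obtain ⟨a, ha⟩ := hε.exists_pow he N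
  exact ⟨ε ^ a, pow_mem (by simpa using add_mem (Subfield.subset_closure (Set.mem_singleton (ε - 1))) (one_mem (Subfield.closure {ε - 1}))) a, ha.trans hN⟩

lemma IsEps.EQp_eq (hε : IsEps p ε) : EQp p = flatClosure (Subfield.closure {ε - 1}) := by
  have hconv : ∀ (x y : Ĉ) (N : ℕ), flatVal p (x - y) ≤ ((p : ℝ≥0) ^ N)⁻¹ ↔ fn (x - y) ≤ (p : ℝ)⁻¹ ^ N :=
    fun x y N => by rw [fn, ← NNReal.coe_le_coe]; simp
  refine le_antisymm (Subfield.closure_le.2 fun x hx => flatClosure_closed _ x fun δ hδ => ?_) fun x hx => Subfield.subset_closure fun N => ?_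
  · obtain ⟨N, hN⟩ := exists_pow_lt_of_lt_one hδ (inv_lt_one_of_one_lt₀ (one_lt_p (p := p))); obtain ⟨y, hy, hxy⟩ := hx N
    exact ⟨y, Subfield.closure_le.2 hε.cycl_subset hy, ((hconv x y N).1 hxy).trans hN.le⟩
  · obtain ⟨y, hy, hxy⟩ := hx ((p : ℝ)⁻¹ ^ N) (pow_pos (inv_pos.2 p_pos) N)
    exact ⟨y, Subfield.closure_le.2 (Set.singleton_subset_iff.2 (sub_mem (Subfield.subset_closure hε.mem_cycl) (one_mem _))) hy, (hconv x y N).2 hxy⟩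

lemma IsEps.EQp_closed (hε : IsEps p ε) : FlatClosed (EQp p : Set Ĉ) := by
  rw [hε.EQp_eq]; exact flatClosure_closed _

lemma IsEps.eps_mem_EQp (hε : IsEps p ε) : ε ∈ EQp p := by
  rw [hε.EQp_eq]; exact hε.cycl_subset hε.mem_cycl

/-- The additive map `b ↦ ∑ t ^ j b_j ^ p`. -/
def powSum (t : Ĉ) : (Fin p → Ĉ) →+ Ĉ where
  toFun := fun b => ∑ j : Fin p, t ^ (j : ℕ) * b j ^ p
  map_zero' := by simp [(prm p).ne_zero]
  map_add' := fun a b => by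
    simp only [Pi.add_apply, add_pow_char, mul_add, sum_add_distrib]

lemma powSum_apply (t : Ĉ) (b : Fin p → Ĉ) : powSum t b = ∑ j : Fin p, t ^ (j : ℕ) * b j ^ p := rfl

lemma powSum_single (t : Ĉ) (j : Fin p) (c : Ĉ) : powSum t (single j c) = t ^ (j : ℕ) * c ^ p := by
  rw [powSum_apply, sum_eq_single j]
  · simp
  · intro i _ hi; rw [Pi.single_eq_of_ne hi, zero_pow (prm p).ne_zero, mul_zero]
  · simp

lemma powSum_tendsto (t : Ĉ) (a : ℕ → Fin p → Ĉ) (ha : ∀ i, Tendsto (fun n => fn (a n i)) atTop (𝓝 0)) :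
    Tendsto (fun n => fn (powSum t (a n))) atTop (𝓝 0) := by
  have h1 : ∀ j ∈ univ, Tendsto (fun n => fn t ^ ((j : Fin p) : ℕ) * fn (a n j) ^ p) atTop (𝓝 0) :=
    fun j _ => by
      have h2 := ((ha j).pow p).const_mul (fn t ^ (j : ℕ))
      rwa [zero_pow (prm p).ne_zero, mul_zero] at h2
  have h := tendsto_finsetSum univ h1
  rw [Finset.sum_const_zero] at h
  refine squeeze_zero (fun _ => fn_nonneg _) (fun n => ?_) h
  have hnn : ∀ j ∈ univ, 0 ≤ fn t ^ ((j : Fin p) : ℕ) * fn (a n j) ^ p := fun j _ =>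
    mul_nonneg (pow_nonneg (fn_nonneg _) _) (pow_nonneg (fn_nonneg _) _)
  rw [powSum_apply]
  refine fn_sum_le _ _ (sum_nonneg hnn) fun j hj => ?_
  rw [fn_mul, fn_pow, fn_pow]
  exact single_le_sum hnn hj

lemma exists_powSum_eq (L : Subfield Ĉ) (hL : FlatClosed (L : Set Ĉ)) {t : Ĉ} (htL : t ∈ L) (ht0 : t ≠ 0) (ht : fn t < 1)
    (lead : ∀ x ∈ L, x ≠ 0 → ∃ c ∈ L, fn c = 1 ∧ ∃ n : ℤ, fn x = fn t ^ n ∧ fn (x - c ^ p * t ^ n) ≤ fn t * fn x)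
    {x : Ĉ} (hx : x ∈ L) :
    ∃ b : Fin p → Ĉ, (∀ j, b j ∈ L) ∧ powSum t b = x ∧ ∀ j, fn (b j) ^ p ≤ (fn t ^ (j : ℕ))⁻¹ * fn x := by
  have hp := prm p
  have hf := fn_pos.2 ht0
  refine successive_approx (L : Set Ĉ) (L : Set Ĉ)
    (zero_mem L) (fun a ha b hb => add_mem ha hb) hL (powSum t) (powSum_tendsto t) p hp.ne_zero
    (fun j => (fn t ^ (j : ℕ))⁻¹) (fun _ => by positivity) (fn t) hf.le ht (fun y hy => ?_) x hx
  rcases eq_or_ne y 0 with rfl | hy0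
  · exact ⟨0, fun _ => zero_mem L, by simp, by simp, fun _ => by simp [hp.ne_zero]⟩
  obtain ⟨c, hcL, hc, n, hyn, hn⟩ := lead y hy hy0
  have hpz : (p : ℤ) ≠ 0 := by exact_mod_cast hp.ne_zero
  have hr0 := Int.emod_nonneg n hpz
  have hr1 := Int.emod_lt_of_pos n (show (0 : ℤ) < p by omega)
  obtain ⟨j, hj⟩ : ∃ j : Fin p, ((j : ℕ) : ℤ) = n % p :=
    ⟨⟨(n % p).toNat, by omega⟩, Int.toNat_of_nonneg hr0⟩
  have hdec : n = (j : ℕ) + (n / p) * p := by rw [hj, mul_comm]; exact (Int.emod_add_mul_ediv n p).symm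
  have hpow : ∀ {R : Type} [Field R] (z : R), z ≠ 0 → z ^ n = z ^ (j : ℕ) * (z ^ (n / p)) ^ p := fun z hz => by
    conv_lhs => rw [hdec]
    rw [zpow_add₀ hz, zpow_natCast, zpow_mul, zpow_natCast]
  have hFa : powSum t (single j (c * t ^ (n / p))) = c ^ p * t ^ n := by
    rw [powSum_single, mul_pow, hpow t ht0]; ring
  have hmt : c * t ^ (n / p) ∈ L := mul_mem hcL (zpow_mem htL _)
  refine ⟨single j (c * t ^ (n / p)), fun i => ?_, ?_, ?_, fun i => ?_⟩
  · rcases eq_or_ne i j with rfl | hi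
    · rw [Pi.single_eq_same]; exact hmt
    · rw [Pi.single_eq_of_ne hi]; exact zero_mem L
  · rw [hFa]; exact sub_mem hy (mul_mem (pow_mem hcL _) (zpow_mem htL _))
  · rw [hFa]; exact hn
  · rcases eq_or_ne i j with rfl | hi
    · rw [Pi.single_eq_same, hyn, fn_mul, hc, one_mul, fn_zpow, hpow (fn t) hf.ne', inv_mul_cancel_left₀]; positivity
    · rw [Pi.single_eq_of_ne hi, fn_zero, zero_pow hp.ne_zero]; exact mul_nonneg (by positivity) (fn_nonneg _)

lemma IsEps.lead_le (hε : IsEps p ε) {x : Ĉ} (hx : x ∈ EQp p) (hx0 : x ≠ 0) : ∃ m : ℕ, 0 < m ∧ m < p ∧ ∃ n : ℤ, fn x = fn (ε - 1) ^ n ∧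
      fn (x - (m : Ĉ) * (ε - 1) ^ n) ≤ fn (ε - 1) * fn x := by
  have hf := fn_pos.2 hε.sub_one_ne_zero
  have h1 := hε.fn_sub_one_lt
  have htE : ε - 1 ∈ EQp p := sub_mem hε.eps_mem_EQp (one_mem _)
  have hL : ∀ {y}, y ∈ EQp p → y ≠ 0 → HasLead (ε - 1) y := fun hy => hasLead_of_mem_flatClosure hε.sub_one_ne_zero h1 (hε.EQp_eq ▸ hy)
  obtain ⟨c, hc, n, hn⟩ := hL hx hx0
  have hxn := HasLead.fn_eq hc hn
  have e : algebraMap _ Ĉ c = (c.val : Ĉ) := by rw [← map_natCast (algebraMap (ZMod p) Ĉ), ZMod.natCast_zmod_val]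
  rw [e] at hn
  refine ⟨c.val, Nat.pos_of_ne_zero ((ZMod.val_ne_zero c).2 hc), c.val_lt, n, hxn, ?_⟩
  rcases eq_or_ne (x - (c.val : Ĉ) * (ε - 1) ^ n) 0 with h | h
  · rw [h, fn_zero]; exact mul_nonneg hf.le (fn_nonneg _)
  · obtain ⟨d, hd, k, hk⟩ := hL (sub_mem hx (mul_mem (natCast_mem _ _) (zpow_mem htE _))) h
    rw [HasLead.fn_eq hd hk] at hn ⊢; rw [hxn, ← zpow_one_add₀ hf.ne', add_comm]
    have := (zpow_lt_zpow_iff_right_of_lt_one₀ hf h1).1 hn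
    exact (zpow_le_zpow_iff_right_of_lt_one₀ hf h1).2 (by omega)

/-- The binomial coefficients of `(ε - 1) ^ i`. -/
def binCoeff (i j : Fin p) : ℤ := (-1) ^ ((i : ℕ) + (j : ℕ)) * (i : ℕ).choose (j : ℕ)

lemma sub_one_pow_eq {R : Type*} [CommRing R] (x : R) (i : Fin p) : (x - 1) ^ (i : ℕ) = ∑ j : Fin p, x ^ (j : ℕ) * (binCoeff i j : R) := by
  have h : ∀ j : Fin p, x ^ (j : ℕ) * (binCoeff i j : R) =
      (fun j : ℕ => x ^ j * (((-1) ^ ((i : ℕ) + j) * (i : ℕ).choose j : ℤ) : R)) j := fun j => rfl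
  simp_rw [h]
  rw [Fin.sum_univ_eq_sum_range (fun j : ℕ => x ^ j * (((-1) ^ ((i : ℕ) + j) * (i : ℕ).choose j : ℤ) : R)) p,
    sub_eq_add_neg, add_pow, ← Finset.sum_subset (Finset.range_subset_range.2 (Nat.succ_le_of_lt i.2))]
  · refine sum_congr rfl fun j hj => ?_
    have hj := Nat.lt_succ_iff.1 (mem_range.1 hj)
    push_cast; rw [mul_assoc]; congr 2; obtain ⟨d, hd⟩ := Nat.exists_eq_add_of_le hj
    rw [hd, Nat.add_sub_cancel_left, show j + d + j = d + 2 * j by ring, pow_add (-1 : R) d, pow_mul]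
    simp
  · intro j _ hj; rw [mem_range, not_lt] at hj; rw [Nat.choose_eq_zero_of_lt (by omega)]
    simp

lemma intCast_pow_card (n : ℤ) : (n : Ĉ) ^ p = n := by
  have := congrArg (algebraMap (ZMod p) Ĉ) (ZMod.pow_card (n : ZMod p))
  rwa [map_pow, map_intCast] at this

lemma IsEps.exists_pow_basis (hε : IsEps p ε) {x : Ĉ} (hx : x ∈ EQp p) : ∃ b : Fin p → Ĉ, (∀ j, b j ∈ EQp p) ∧ powSum ε b = x ∧
      ∀ j, fn (b j) ^ p ≤ (fn (ε - 1) ^ p)⁻¹ * fn x := by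
  have hf := fn_pos.2 hε.sub_one_ne_zero
  have h1 := hε.fn_sub_one_lt
  obtain ⟨b, hb, hbx, hbc⟩ := exists_powSum_eq (EQp p) hε.EQp_closed
    (sub_mem hε.eps_mem_EQp (one_mem _)) hε.sub_one_ne_zero h1 (fun y hy hy0 => by
      obtain ⟨m, hm, hmp, n, hn⟩ := hε.lead_le hy hy0; exact ⟨m, natCast_mem _ m, by
        have := fn_zmod (c := (m : ZMod p)) (by rw [Ne, ZMod.natCast_eq_zero_iff]; exact fun hd => (Nat.le_of_dvd hm hd).not_gt hmp)
        rwa [map_natCast] at this, n, by rwa [natCast_pow_card]⟩) hx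
  refine ⟨fun j => ∑ i, (binCoeff i j : Ĉ) * b i, fun j => sum_mem fun i _ => mul_mem (intCast_mem _ _) (hb i), ?_, fun j => ?_⟩
  · rw [← hbx, powSum_apply, powSum_apply]; simp_rw [sub_one_pow_eq, sum_mul, sum_pow_char, mul_sum]; rw [sum_comm]
    refine sum_congr rfl fun i _ => sum_congr rfl fun j _ => ?_
    rw [mul_pow, intCast_pow_card]; ring
  · rw [← fn_pow, sum_pow_char]; refine fn_sum_le _ _ (mul_nonneg (by positivity) (fn_nonneg _)) fun i _ => ?_
    rw [fn_pow, fn_mul, mul_pow]; refine (mul_le_of_le_one_left (by have := fn_nonneg (b i); positivity)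
      (pow_le_one₀ (fn_nonneg _) (fn_intCast_le _))).trans ((hbc i).trans ?_)
    refine mul_le_mul_of_nonneg_right (inv_anti₀ (pow_pos hf p) ?_) (fn_nonneg _); exact pow_le_pow_of_le_one hf.le h1.le i.2.le

lemma IsEps.pow_ne (hε : IsEps p ε) {y : Ĉ} (hy : y ∈ EQp p) : y ^ p ≠ ε := fun h => by
  have hf := fn_pos.2 hε.sub_one_ne_zero
  have h1 := hε.fn_sub_one_lt
  have h2 : (y - 1) ^ p = ε - 1 := by rw [sub_pow_char, h, one_pow]
  have hy0 : y - 1 ≠ 0 := fun h0 => hε.sub_one_ne_zero (by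
    rw [← h2, h0, zero_pow (prm p).ne_zero])
  obtain ⟨m, hm, hmp, n, hn, -⟩ := hε.lead_le (sub_mem hy (one_mem _)) hy0
  have h3 : fn (ε - 1) ^ (n * p) = fn (ε - 1) ^ (1 : ℤ) := by
    rw [zpow_mul, ← hn, zpow_natCast, ← fn_pow, h2, zpow_one]
  have h4 := zpow_right_injective₀ hf h1.ne h3
  have h5 : (p : ℤ) ∣ 1 := ⟨n, by rw [← h4]; ring⟩
  have h6 := Int.natCast_dvd_natCast.1 (by simpa using h5 : ((p : ℕ) : ℤ) ∣ ((1 : ℕ) : ℤ))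
  exact (prm p).one_lt.ne' (Nat.dvd_one.1 h6)

end BaseField
section PBasis
variable {L : Subfield (CFlat p)}

/-- `{ε}` is a `p`-basis of the field `L`. -/
structure IsPBasis (L : Subfield Ĉ) (ε : Ĉ) : Prop where
  mem : ε ∈ L
  ne_zero : ε ≠ 0
  gen : ∀ x ∈ L, ∃ b : Fin p → Ĉ, (∀ j, b j ∈ L) ∧ powSum ε b = x
  pow_ne : ∀ y ∈ L, y ^ p ≠ ε

lemma sum_range_mul {M : Type*} [AddCommMonoid M] (f : ℕ → M) (a m : ℕ) :
    ∑ i ∈ range (a * m), f i = ∑ r ∈ range a, ∑ s ∈ range m, f (a * s + r) := by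
  rw [sum_comm]
  induction m with
  | zero => simp
  | succ m ih => rw [Nat.mul_succ, Finset.sum_range_add, ih, sum_range_succ]

lemma pow_sum_range (b : ℕ → Ĉ) (ε : Ĉ) (n : ℕ) : ∑ i ∈ range (p ^ (n + 1)), ε ^ i * b i ^ p ^ (n + 1) =
      ∑ r ∈ range p, ε ^ r * (∑ s ∈ range (p ^ n), ε ^ s * b (p * s + r) ^ p ^ n) ^ p := by
  rw [pow_succ', sum_range_mul]
  refine sum_congr rfl fun r _ => ?_
  rw [sum_pow_char, mul_sum]
  refine sum_congr rfl fun s _ => ?_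
  rw [mul_pow, ← pow_mul, ← pow_mul, pow_add, mul_comm (p ^ n) p, mul_comm s p]
  ring

lemma exists_basis_pow {f : Ĉ → ℝ} (hf : ∀ x, 0 ≤ f x) {c : ℝ} (hc : 0 ≤ c) {S : Set Ĉ}
    (hb : ∀ x ∈ S, ∃ b : Fin p → Ĉ, (∀ j, b j ∈ S) ∧ powSum ε b = x ∧ ∀ j, f (b j) ^ p ≤ c * f x)
    (n : ℕ) : ∃ A : ℝ, 0 ≤ A ∧ ∀ x ∈ S, ∃ b : ℕ → Ĉ, (∀ j < p ^ n, b j ∈ S) ∧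
      ∑ i ∈ range (p ^ n), ε ^ i * b i ^ p ^ n = x ∧ ∀ j < p ^ n, f (b j) ^ p ^ n ≤ A * f x := by
  have hp := (prm p).pos
  induction n with
  | zero => exact ⟨1, zero_le_one, fun x hx => ⟨fun _ => x, fun _ _ => hx, by simp, fun _ _ => by simp⟩⟩
  | succ n ih =>
    obtain ⟨A, hA, ih⟩ := ih; refine ⟨A ^ p * c, by positivity, fun x hx => ?_⟩
    obtain ⟨b, hbS, hbx, hbc⟩ := hb x hx; choose d hdS hdx hdc using fun j : Fin p => ih (b j) (hbS j)
    have hr : ∀ i : ℕ, i % p < p := fun i => mod_lt i hp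
    have hlt : ∀ i < p ^ (n + 1), i / p < p ^ n := fun i hi => by
      rw [Nat.div_lt_iff_lt_mul hp, ← pow_succ]; exact hi
    refine ⟨fun i => d ⟨i % p, hr i⟩ (i / p), fun i hi => hdS _ _ (hlt i hi), ?_, fun i hi => ?_⟩
    · rw [pow_sum_range, ← hbx, powSum_apply, sum_range]
      simp only [← hdx, Nat.mul_add_mod, Nat.mul_add_div hp, Nat.mod_eq_of_lt (Fin.is_lt _), Nat.div_eq_of_lt (Fin.is_lt _), add_zero]
    · rw [pow_succ, pow_mul]; refine (pow_le_pow_left₀ (pow_nonneg (hf _) _) (hdc _ _ (hlt i hi)) p).trans ?_; rw [mul_pow, mul_assoc]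
      exact mul_le_mul_of_nonneg_left (hbc _) (by positivity)

lemma IsPBasis.gen_pow (h : IsPBasis L ε) (n : ℕ) {x : Ĉ} (hx : x ∈ L) : ∃ b : ℕ → Ĉ, (∀ j < p ^ n, b j ∈ L) ∧
      ∑ i ∈ range (p ^ n), ε ^ i * b i ^ p ^ n = x := by
  obtain ⟨_, _, h1⟩ := exists_basis_pow (f := fun _ => 0) (c := 0) (fun _ => le_rfl) le_rfl (S := (L : Set Ĉ)) (fun x hx => by
    obtain ⟨b, hb, hbx⟩ := h.gen x hx; exact ⟨b, hb, hbx, fun _ => by simp [(prm p).ne_zero]⟩) n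
  obtain ⟨b, hb, hbx, -⟩ := h1 x hx
  exact ⟨b, hb, hbx⟩

lemma pow_indep (h : IsPBasis L ε) (c : ℕ → Ĉ) (hc : ∀ i, c i ∈ L) (h0 : ∑ i ∈ range p, ε ^ i * c i ^ p = 0) : ∀ i < p, c i = 0 := by
  have hp := prm p
  let M : Subfield Ĉ := L.map (_root_.frobenius Ĉ p)
  have hM : ∀ y ∈ L, y ^ p ∈ M := by aesop
  let a : M := ⟨ε ^ p, hM ε h.mem⟩
  have hirr : Irreducible (X ^ p - Polynomial.C a : Polynomial M) := by
    refine X_pow_sub_C_irreducible_of_prime hp fun b hb => ?_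
    obtain ⟨y, hy, hyb⟩ := b.2; have h1 : (b : Ĉ) ^ p = ε ^ p := congrArg Subtype.val hb; have h2 : (b : Ĉ) = ε := frobenius_inj Ĉ p h1
    exact h.pow_ne y hy (by rw [← h2, ← hyb]; rfl)
  have hmon : (X ^ p - Polynomial.C a : Polynomial M).Monic :=
    Polynomial.monic_X_pow_sub_C a hp.ne_zero
  have hroot : Polynomial.aeval ε (X ^ p - Polynomial.C a : Polynomial M) = 0 := by
    simp only [map_sub, map_pow, Polynomial.aeval_X, aeval_C]; exact sub_self _
  have hmin := minpoly.eq_of_irreducible_of_monic hirr hroot hmon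
  let g : Polynomial M := ∑ i ∈ range p, Polynomial.C (⟨c i ^ p, hM _ (hc i)⟩ : M) * X ^ i
  have hg : Polynomial.aeval ε g = 0 := by
    simp only [g, map_sum, map_mul, map_pow, Polynomial.aeval_X, aeval_C]; rw [← h0]; exact sum_congr rfl fun i _ => mul_comm _ _
  have hg0 : g = 0 := by
    refine Polynomial.eq_zero_of_dvd_of_degree_lt (minpoly.dvd M ε hg) ?_; rw [← hmin, Polynomial.degree_X_pow_sub_C hp.pos]
    refine mem_degreeLT.1 (sum_mem fun i hi => mem_degreeLT.2 ?_)
    refine (Polynomial.degree_C_mul_X_pow_le _ _).trans_lt ?_; exact_mod_cast mem_range.1 hi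
  intro i hi
  have h1 := congrArg (fun q => Polynomial.coeff q i) hg0
  simp only [g, finsetSum_coeff, Polynomial.coeff_C_mul_X_pow, coeff_zero] at h1
  rw [Finset.sum_ite_eq, if_pos (mem_range.2 hi)] at h1
  exact eq_zero_of_pow_eq_zero (congrArg Subtype.val h1 : c i ^ p = 0)

lemma IsPBasis.indep_pow (h : IsPBasis L ε) (n : ℕ) (b : ℕ → Ĉ) (hb : ∀ i, b i ∈ L)
    (h0 : ∑ i ∈ range (p ^ n), ε ^ i * b i ^ p ^ n = 0) : ∀ i < p ^ n, b i = 0 := by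
  have hp := (prm p).pos
  induction n generalizing b with
  | zero => 
    simp_all
  | succ n ih =>
    rw [pow_sum_range] at h0; have h1 := pow_indep h _ (fun r => sum_mem fun s _ => mul_mem (pow_mem h.mem _) (pow_mem (hb _) _)) h0
    intro i hi; have h2 := ih (fun s => b (p * s + i % p)) (fun s => hb _) (h1 (i % p) (mod_lt i hp)) (i / p)
      (by rw [Nat.div_lt_iff_lt_mul hp, ← pow_succ]; exact hi)
    simpa only [Nat.div_add_mod] using h2

end PBasis

section Cohen
variable (L L' : Subfield (CFlat p)) (ε : CFlat p) (n : ℕ)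

/-- The Witt vectors with coordinates in `L ^ {p ^ n}`. -/
def wittPow : Subring Ã := (WittVector.map (L.map (iterateFrobenius Ĉ p n)).subtype).range

/-- The ring `W(L ^ {p ^ n})[[ε]] + p ^ {n + 1} W(ℂ_p^♭)`. -/
def cohenAt : Subring Ã := ((Subring.closure ((wittPow L n : Set Ã) ∪ {ω ε})).map
    (Ideal.Quotient.mk (span {(p : Ã) ^ (n + 1)}))).comap
    (Ideal.Quotient.mk (span {(p : Ã) ^ (n + 1)}))

/-- The Cohen ring of `L` determined by the lift `[ε]` of the `p`-basis `ε`. -/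
def cohen : Subring Ã := ⨅ n, cohenAt L ε n

variable {L L' ε n} {x y z : ATilde p}

lemma mem_wittPow : x ∈ wittPow L n ↔ ∀ k, ∃ y ∈ L, y ^ p ^ n = x.coeff k := by
  constructor
  · rintro ⟨y, rfl⟩ k; obtain ⟨z, hz, h⟩ := (y.coeff k).2; aesop
  · intro h; choose z hz hzx using h; refine ⟨WittVector.mk p fun k => ⟨x.coeff k, z k, hz k, hzx k⟩, ?_⟩
    rfl

lemma teichmuller_mem_wittPow {t : Ĉ} (ht : t ∈ L) (n : ℕ) : ω (t ^ p ^ n) ∈ wittPow L n := by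
  refine mem_wittPow.2 fun k => ?_
  rcases Nat.eq_zero_or_pos k with rfl | hk
  · exact ⟨t, ht, (teichmuller_coeff_zero p _).symm⟩
  · exact ⟨0, zero_mem L, by rw [teichmuller_coeff_pos p _ k hk, zero_pow (pp_ne_zero n)]⟩

lemma mem_cohenAt : x ∈ cohenAt L ε n ↔ ∃ y ∈ Subring.closure ((wittPow L n : Set Ã) ∪ {ω ε}), (p : Ã) ^ (n + 1) ∣ x - y := by
  constructor
  · rintro ⟨y, hy, h⟩; refine ⟨y, hy, ?_⟩; rw [← mem_span_singleton, ← Ideal.Quotient.eq]; exact h.symm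
  · rintro ⟨y, hy, h⟩; refine ⟨y, hy, ?_⟩; rw [← mem_span_singleton, ← Ideal.Quotient.eq] at h; exact h.symm

lemma wittPow_mono (h : L ≤ L') : wittPow L n ≤ wittPow L' n := fun _ hx =>
  mem_wittPow.2 fun k => by
    obtain ⟨y, hy, e⟩ := mem_wittPow.1 hx k; exact ⟨y, h hy, e⟩

lemma cohenAt_mono (h : L ≤ L') : cohenAt L ε n ≤ cohenAt L' ε n := fun x hx => by
  obtain ⟨y, hy, hxy⟩ := mem_cohenAt.1 hx
  exact mem_cohenAt.2 ⟨y, Subring.closure_mono (Set.union_subset_union_left _ (wittPow_mono h)) hy, hxy⟩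

/-- The sums `∑ [ε] ^ j w_j` with `w_j ∈ W(L ^ {p ^ n})` and `j < p ^ n`. -/
def cohenSum (L : Subfield Ĉ) (ε : Ĉ) (n : ℕ) : AddSubgroup Ã where
  carrier := {x | ∃ w : ℕ → Ã, (∀ j, w j ∈ wittPow L n) ∧ x = ∑ j ∈ range (p ^ n), ω ε ^ j * w j}
  zero_mem' := ⟨0, fun _ => zero_mem _, by simp⟩
  add_mem' := by
    rintro _ _ ⟨w, hw, rfl⟩ ⟨w', hw', rfl⟩; exact ⟨w + w', fun j => add_mem (hw j) (hw' j), by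
      simp only [Pi.add_apply, mul_add, sum_add_distrib]⟩
  neg_mem' := by
    rintro _ ⟨w, hw, rfl⟩; exact ⟨-w, fun j => neg_mem (hw j), by simp⟩

lemma pow_mul_mem_cohenSum (hε : ε ∈ L) (m : ℕ) {w : Ã} (hw : w ∈ wittPow L n) : ω ε ^ m * w ∈ cohenSum L ε n := by
  classical
  have hlt : m % p ^ n < p ^ n := mod_lt m (pow_pos (prm p).pos n)
  refine ⟨fun j => if j = m % p ^ n then ω (ε ^ p ^ n) ^ (m / p ^ n) * w else 0, fun j => ?_, ?_⟩
  · dsimp only; split_ifs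
    · exact mul_mem (pow_mem (teichmuller_mem_wittPow hε n) _) hw
    simp
  · rw [sum_eq_single (m % p ^ n)]
    · dsimp only; rw [if_pos rfl, map_pow, ← mul_assoc, ← pow_mul, ← pow_add, Nat.mod_add_div]
    · simp_all
    simp_all

lemma mem_cohenSum_of_mem_closure (hε : ε ∈ L) (hx : x ∈ Subring.closure ((wittPow L n : Set Ã) ∪ {ω ε})) : x ∈ cohenSum L ε n := by
  induction hx using Subring.closure_induction with
  | mem x hx =>
    rcases hx with hx | rfl
    · simpa using pow_mul_mem_cohenSum hε 0 hx
    · simpa using pow_mul_mem_cohenSum (n := n) hε 1 (one_mem _)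
  | zero => exact zero_mem _
  | one => simpa using pow_mul_mem_cohenSum (n := n) hε 0 (one_mem _)
  | add x y _ _ hx hy => aesop
  | neg x _ hx => exact neg_mem hx
  | mul x y _ _ hx hy =>
    obtain ⟨w, hw, rfl⟩ := hx; obtain ⟨w', hw', rfl⟩ := hy; rw [Finset.sum_mul_sum]; refine sum_mem fun i _ => sum_mem fun j _ => ?_
    rw [mul_mul_mul_comm, ← pow_add]; exact pow_mul_mem_cohenSum hε _ (mul_mem (hw i) (hw' j))

lemma mem_closure_of_mem_cohenSum (hx : x ∈ cohenSum L ε n) : x ∈ Subring.closure ((wittPow L n : Set Ã) ∪ {ω ε}) := by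
  obtain ⟨w, hw, rfl⟩ := hx
  exact sum_mem fun j _ => mul_mem (pow_mem (subset_closure (Set.mem_union_right _ (Set.mem_singleton _))) _)
    (subset_closure (Or.inl (hw j)))

lemma mem_cohenAt' (hε : ε ∈ L) : x ∈ cohenAt L ε n ↔ ∃ y ∈ cohenSum L ε n, (p : Ã) ^ (n + 1) ∣ x - y :=
  mem_cohenAt.trans ⟨fun ⟨y, hy, h⟩ => ⟨y, mem_cohenSum_of_mem_closure hε hy, h⟩, fun ⟨y, hy, h⟩ => ⟨y, mem_closure_of_mem_cohenSum hy, h⟩⟩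

lemma coeff_zero_sum {ι : Type*} (s : Finset ι) (f : ι → Ã) : (∑ i ∈ s, f i).coeff 0 = ∑ i ∈ s, (f i).coeff 0 :=
  map_sum (constantCoeff (p := p) (R := Ĉ)) f s

lemma coeff_zero_pow (x : Ã) (m : ℕ) : (x ^ m).coeff 0 = x.coeff 0 ^ m := map_pow (constantCoeff (p := p) (R := Ĉ)) x m

lemma coeff_zero_eq_of_dvd (h : (p : Ã) ∣ x - y) : x.coeff 0 = y.coeff 0 := by
  rwa [p_dvd_iff, coeff_zero_sub, sub_eq_zero] at h

lemma coeff_zero_mem_of_cohenAt (hε : ε ∈ L) (hx : x ∈ cohenAt L ε n) : x.coeff 0 ∈ L := by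
  obtain ⟨y, ⟨w, hw, rfl⟩, h⟩ := (mem_cohenAt' hε).1 hx
  rw [coeff_zero_eq_of_dvd ((dvd_pow_self _ (Nat.succ_ne_zero n)).trans h), coeff_zero_sum]
  refine sum_mem fun j _ => ?_
  rw [coeff_zero_mul, coeff_zero_pow, teichmuller_coeff_zero]
  obtain ⟨t, ht, e⟩ := mem_wittPow.1 (hw j) 0
  rw [← e]
  exact mul_mem (pow_mem hε _) (pow_mem ht _)

/-- The standard lift of `∑ ε ^ i b_i ^ {p ^ n}`. -/
def stdLift (ε : Ĉ) (n : ℕ) (b : ℕ → Ĉ) : Ã := ∑ i ∈ range (p ^ n), ω (ε ^ i * b i ^ p ^ n)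

lemma stdLift_mem {b : ℕ → Ĉ} (hb : ∀ i < p ^ n, b i ∈ L) : stdLift ε n b ∈ Subring.closure ((wittPow L n : Set Ã) ∪ {ω ε}) := by
  refine sum_mem fun i hi => ?_
  rw [map_mul, map_pow]
  exact mul_mem (pow_mem (subset_closure (Set.mem_union_right _ (Set.mem_singleton _))) _)
    (subset_closure (Or.inl (teichmuller_mem_wittPow (hb i (mem_range.1 hi)) n)))

lemma coeff_zero_stdLift (b : ℕ → Ĉ) : (stdLift ε n b).coeff 0 = ∑ i ∈ range (p ^ n), ε ^ i * b i ^ p ^ n := by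
  rw [stdLift, coeff_zero_sum]
  rfl

lemma exists_mem_cohenAt (h : IsPBasis L ε) (n : ℕ) {t : Ĉ} (ht : t ∈ L) : ∃ x ∈ cohenAt L ε n, x.coeff 0 = t := by
  obtain ⟨b, hb, hbt⟩ := h.gen_pow n ht
  exact ⟨stdLift ε n b, mem_cohenAt.2 ⟨_, stdLift_mem hb, by simp⟩, by rw [coeff_zero_stdLift, hbt]⟩

lemma coeff_p_mul_succ (x : Ã) (k : ℕ) : ((p : Ã) * x).coeff (k + 1) = x.coeff k ^ p := by
  rw [mul_comm, WittVector.mul_charP_coeff_succ]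

lemma p_mul_mem_cohenAt (hε : ε ∈ L) (hx : x ∈ cohenAt L ε n) : (p : Ã) * x ∈ cohenAt L ε (n + 1) := by
  obtain ⟨y, ⟨w, hw, rfl⟩, h⟩ := (mem_cohenAt' hε).1 hx
  refine (mem_cohenAt' hε).2 ⟨_, ?_, by rw [pow_succ' _ (n + 1), ← mul_sub]; exact mul_dvd_mul_left _ h⟩
  · rw [mul_sum]; refine sum_mem fun j _ => ?_
    rw [mul_left_comm]; refine pow_mul_mem_cohenSum hε j (mem_wittPow.2 fun k => ?_)
    rcases k with _ | k
    · refine ⟨0, zero_mem L, ?_⟩; rw [coeff_zero_mul, zero_pow (pp_ne_zero _)]; simp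
    · obtain ⟨t, ht, e⟩ := mem_wittPow.1 (hw j) k; exact ⟨t, ht, by rw [coeff_p_mul_succ, ← e, ← pow_mul, pow_succ]⟩

lemma mem_cohenAt_of_p_mul (h : IsPBasis L ε) (hx : (p : Ã) * x ∈ cohenAt L ε (n + 1)) : x ∈ cohenAt L ε n := by
  obtain ⟨y, ⟨w, hw, rfl⟩, hd⟩ := (mem_cohenAt' h.mem).1 hx
  have h0 : (∑ j ∈ range (p ^ (n + 1)), ω ε ^ j * w j).coeff 0 = 0 := by
    rw [← coeff_zero_eq_of_dvd ((dvd_pow_self _ (Nat.succ_ne_zero _)).trans hd), coeff_zero_mul]; simp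
  choose t ht e using fun j => mem_wittPow.1 (hw j)
  rw [coeff_zero_sum] at h0
  have h1 := h.indep_pow (n + 1) (fun j => t j 0) (fun j => ht j 0) (by
    rw [← h0]; refine sum_congr rfl fun j _ => ?_
    rw [e, coeff_zero_mul, coeff_zero_pow, teichmuller_coeff_zero])
  have h2 : ∀ j < p ^ (n + 1), (p : Ã) ∣ w j := fun j hj => by
    rw [p_dvd_iff, ← e j 0, h1 j hj, zero_pow (pp_ne_zero _)]
  choose! v hv using h2
  have hvm : ∀ j < p ^ (n + 1), v j ∈ wittPow L n := fun j hj => mem_wittPow.2 fun k => by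
    refine ⟨t j (k + 1), ht j _, ?_⟩; have h3 : (t j (k + 1) ^ p ^ n) ^ p = (v j).coeff k ^ p := by
      rw [← pow_mul, ← pow_succ, e, hv j hj, coeff_p_mul_succ]
    exact frobenius_inj Ĉ p h3
  refine (mem_cohenAt' h.mem).2 ⟨∑ j ∈ range (p ^ (n + 1)), ω ε ^ j * v j,
    sum_mem fun j hj => pow_mul_mem_cohenSum h.mem j (hvm j (mem_range.1 hj)), ?_⟩
  have h4 : ∑ j ∈ range (p ^ (n + 1)), ω ε ^ j * w j = p * ∑ j ∈ range (p ^ (n + 1)), ω ε ^ j * v j := by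
    rw [mul_sum]; refine sum_congr rfl fun j hj => ?_
    conv_lhs => rw [hv j (mem_range.1 hj)]
    ring
  rw [h4, ← mul_sub, pow_succ' _ (n + 1)] at hd
  exact (mul_dvd_mul_iff_left p_ne_zero_aTilde).1 hd

lemma mem_cohenAt_of_dvd (hy : y ∈ cohenAt L ε n) (h : (p : Ã) ^ (n + 1) ∣ x - y) : x ∈ cohenAt L ε n := by
  obtain ⟨z, hz, hyz⟩ := mem_cohenAt.1 hy
  exact mem_cohenAt.2 ⟨z, hz, by rw [← sub_add_sub_cancel x y z]; exact dvd_add h hyz⟩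

lemma mem_cohen : x ∈ cohen L ε ↔ ∀ n, x ∈ cohenAt L ε n := by
  rw [cohen, Subring.mem_iInf]

lemma cohen_mono (h : L ≤ L') : cohen L ε ≤ cohen L' ε := fun _ hx =>
  mem_cohen.2 fun n => cohenAt_mono h (mem_cohen.1 hx n)

lemma mem_cohen_of_p_mul (h : IsPBasis L ε) (hx : (p : Ã) * x ∈ cohen L ε) : x ∈ cohen L ε :=
  mem_cohen.2 fun n => mem_cohenAt_of_p_mul h (mem_cohen.1 hx (n + 1))

lemma coeff_zero_mem_of_cohen (h : IsPBasis L ε) (hx : x ∈ cohen L ε) : x.coeff 0 ∈ L := coeff_zero_mem_of_cohenAt h.mem (mem_cohen.1 hx 0)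

/-- Simple roots, with residue in `L`, of polynomials over the Cohen ring lie in the Cohen ring. -/
lemma root_mem_cohen (h : IsPBasis L ε) {f : Polynomial Ã} (hf : ∀ i, f.coeff i ∈ cohen L ε)
    {y : Ã} (hy : f.eval y = 0) (hy' : (f.derivative.eval y).coeff 0 ≠ 0) (hy0 : y.coeff 0 ∈ L) :
    y ∈ cohen L ε := by
  refine mem_cohen.2 fun n => ?_
  have heval : ∀ (g : Polynomial Ã), (∀ i, g.coeff i ∈ cohenAt L ε n) → ∀ v ∈ cohenAt L ε n, g.eval v ∈ cohenAt L ε n := fun g hg v hv => by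
    rw [Polynomial.eval_eq_sum_range]; exact sum_mem fun i _ => mul_mem (hg i) (pow_mem hv i)
  have hfn : ∀ i, f.coeff i ∈ cohenAt L ε n := fun i => mem_cohen.1 (hf i) n
  obtain ⟨v₀, hv₀, h0⟩ := exists_mem_cohenAt h n hy0
  have h1 : (p : Ã) ∣ v₀ - y := by rw [p_dvd_iff, coeff_zero_sub, h0, sub_self]
  have hd : (f.derivative.eval y).coeff 0 ∈ L := by
    rw [← coeff_zero_eq_of_dvd (x := f.derivative.eval v₀) (h1.trans (f.derivative.sub_dvd_eval_sub v₀ y))]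
    refine coeff_zero_mem_of_cohenAt h.mem (heval _ (fun i => ?_) v₀ hv₀)
    rw [Polynomial.coeff_derivative]; exact mul_mem (hfn _) (by rw [← Nat.cast_add_one]; exact natCast_mem (cohenAt L ε n) _)
  obtain ⟨c, hc, hc0⟩ := exists_mem_cohenAt h n (neg_mem (inv_mem hd))
  have h2 : (p : Ã) ∣ 1 + c * f.derivative.eval y := by
    rw [p_dvd_iff, coeff_zero_add, coeff_zero_mul, hc0, one_coeff_zero, neg_mul, inv_mul_cancel₀ hy', add_neg_cancel]
  have key : ∀ k, ∃ v ∈ cohenAt L ε n, (p : Ã) ^ (k + 1) ∣ y - v := fun k => by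
    induction k with
    | zero => refine ⟨v₀, hv₀, ?_⟩; rw [zero_add, pow_one, ← neg_sub v₀, dvd_neg]; exact h1
    | succ k ih =>
      obtain ⟨v, hv, hq⟩ := ih
      obtain ⟨d, hd⟩ := f.binomExpansion y (v - y)
      rw [add_sub_cancel, hy] at hd
      refine ⟨v + c * f.eval v, add_mem hv (mul_mem hc (heval f hfn v hv)), ?_⟩
      have e : y - (v + c * f.eval v) = (y - v) * (1 + c * f.derivative.eval y - c * d * (y - v)) := by rw [hd]; ring
      rw [e, pow_succ _ (k + 1)]
      exact mul_dvd_mul hq (dvd_sub h2 (((dvd_pow_self _ k.succ_ne_zero).trans hq).mul_left _))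
  obtain ⟨v, hv, hd⟩ := key n
  exact mem_cohenAt_of_dvd hv hd

lemma inv_mem_cohen (h : IsPBasis L ε) (hx : x ∈ cohen L ε) (hx0 : x.coeff 0 ≠ 0) (hxy : x * y = 1) : y ∈ cohen L ε := by
  have hy0 : y.coeff 0 = (x.coeff 0)⁻¹ := by
    have := congrArg (fun z : Ã => z.coeff 0) hxy
    simp only [coeff_zero_mul, one_coeff_zero] at this; exact eq_inv_of_mul_eq_one_right this
  refine root_mem_cohen h (f := Polynomial.C x * X - 1) (fun i => ?_) ?_ ?_ ?_
  · aesop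
  · simp [hxy]
  · simpa using hx0
  · rw [hy0]; exact inv_mem (coeff_zero_mem_of_cohen h hx)

end Cohen
section WeakLimits
variable {ι : Type*} {l : Filter ι} {x x' : ι → ATilde p} {y y' : ATilde p}

/-- Convergence of all Witt vector coordinates. -/
def WTendsto (x : ι → Ã) (l : Filter ι) (y : Ã) : Prop := ∀ k, Tendsto (fun n => fn ((x n).coeff k - y.coeff k)) l (𝓝 0)

lemma WTendsto_const (y : Ã) (l : Filter ι) : WTendsto (fun _ => y) l y := fun k => by
  simpa using tendsto_const_nhds

lemma WTendsto.sub (h : WTendsto x l y) (h' : WTendsto x' l y') : WTendsto (fun n => x n - x' n) l (y - y') := tendsto_coeff_sub h h'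

lemma WTendsto.neg (h : WTendsto x l y) : WTendsto (fun n => -x n) l (-y) := by
  simpa using (WTendsto_const 0 l).sub h

lemma WTendsto.add (h : WTendsto x l y) (h' : WTendsto x' l y') : WTendsto (fun n => x n + x' n) l (y + y') := by
  simpa using h.sub h'.neg

lemma WTendsto.sum {κ : Type*} (s : Finset κ) {x : κ → ι → Ã} {y : κ → Ã}
    (h : ∀ i ∈ s, WTendsto (x i) l (y i)) : WTendsto (fun n => ∑ i ∈ s, x i n) l (∑ i ∈ s, y i) := by
  classical
  induction s using Finset.induction_on with
  | empty => simpa using WTendsto_const 0 l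
  | insert a s ha ih =>
    simp only [sum_insert ha]; exact (h a (Finset.mem_insert_self _ _)).add (ih fun i hi => h i (Finset.mem_insert_of_mem hi))

lemma WTendsto_teichmuller {t : ι → Ĉ} {s : Ĉ} (h : Tendsto (fun n => fn (t n - s)) l (𝓝 0)) :
    WTendsto (fun n => ω (t n)) l (ω s) := fun k => by
  rcases Nat.eq_zero_or_pos k with rfl | hk
  · simp_all
  · simp only [teichmuller_coeff_pos p _ k hk, sub_self, fn_zero]; exact tendsto_const_nhds

lemma WTendsto.galW (h : WTendsto x l y) (σ : GalQp p) : WTendsto (fun n => galW σ (x n)) l (galW σ y) := fun k => by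
  simpa only [coeff_galW, ← map_sub, fn_galFlat] using h k

lemma WTendsto.of_p_mul (h : WTendsto (fun n => (p : Ã) * x n) l ((p : Ã) * y)) : WTendsto x l y := fun k => by
  have h1 := h (k + 1)
  simp only [coeff_p_mul_succ] at h1
  have h2 : ∀ n, fn ((x n).coeff k ^ p - y.coeff k ^ p) = fn ((x n).coeff k - y.coeff k) ^ p := fun n => by
    rw [← sub_pow_char, fn_pow]
  simp only [h2] at h1
  have h3 := h1.rpow_const (p := 1 / (p : ℝ)) (Or.inr (by positivity))
  rw [Real.zero_rpow (one_div_ne_zero p_pos.ne')] at h3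
  refine h3.congr fun n => ?_
  rw [one_div, Real.pow_rpow_inv_natCast (fn_nonneg _) (prm p).ne_zero]

lemma WTendsto.unique [l.NeBot] (h : WTendsto x l y) (h' : WTendsto x l y') : y = y' := by
  ext k
  have h1 := (h.sub h' : WTendsto _ l _) k
  have h2 : Tendsto (fun n => fn ((x n).coeff k - y.coeff k) + fn ((x n).coeff k - y'.coeff k)) l (𝓝 0) := by
    simpa using (h k).add (h' k)
  have h3 : fn (y.coeff k - y'.coeff k) ≤ 0 := by
    refine ge_of_tendsto' h2 fun n => ?_
    have : y.coeff k - y'.coeff k = ((x n).coeff k - y'.coeff k) - ((x n).coeff k - y.coeff k) := by ring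
    rw [this]; refine (fn_sub_le _ _).trans (max_le ?_ ?_)
    · linarith [fn_nonneg ((x n).coeff k - y.coeff k)]
    · linarith [fn_nonneg ((x n).coeff k - y'.coeff k)]
  exact sub_eq_zero.1 (fn_eq_zero.1 (le_antisymm h3 (fn_nonneg _)))

lemma exists_WTendsto_of_mem_weakClosure {S : Set Ã} (hy : y ∈ weakClosure S) : ∃ x : ℕ → Ã, (∀ n, x n ∈ S) ∧ WTendsto x atTop y := by
  choose x hx hxy using hy
  refine ⟨x, hx, ?_⟩
  have h1 : WTendsto (fun n => y - x n) atTop 0 := fun k => by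
    refine squeeze_zero' (Eventually.of_forall fun _ => fn_nonneg _) ?_
      (tendsto_pow_atTop_nhds_zero_of_lt_one (inv_nonneg.2 p_pos.le) (inv_lt_one_of_one_lt₀ (one_lt_p (p := p))))
    aesop
  simpa using (WTendsto_const y atTop).sub h1

lemma mem_weakClosure_of_WTendsto {S : Set Ã} {x : ℕ → Ã} (hx : ∀ n, x n ∈ S) (h : WTendsto x atTop y) : y ∈ weakClosure S := by
  intro N
  have h1 := (WTendsto_const y atTop).sub h
  have h2 : ∀ᶠ n in atTop, ∀ i ∈ range N, fn ((y - x n).coeff i - (y - y).coeff i) < ((p : ℝ) ^ N)⁻¹ :=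
    (Finset.eventually_all _).2 fun i _ => (h1 i).eventually_lt_const (by have := p_pos (p := p); positivity)
  obtain ⟨n, hn⟩ := h2.exists
  refine ⟨x n, hx n, fun i hi => ?_⟩
  have h3 := (hn i (mem_range.2 hi)).le
  aesop

end WeakLimits

section CohenClosed
variable {L : Subfield (CFlat p)}

lemma stdLift_mem_cohenAt {b : ℕ → Ĉ} {n m : ℕ} (hb : ∀ i < p ^ n, b i ∈ L) (hm : m ≤ n) : stdLift ε n b ∈ cohenAt L ε m := by
  refine mem_cohenAt.2 ⟨stdLift ε n b, ?_, by simp⟩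
  refine sum_mem fun i hi => ?_
  rw [map_mul, map_pow]
  refine mul_mem (pow_mem (subset_closure (Set.mem_union_right _ (Set.mem_singleton _))) _)
    (subset_closure (Or.inl ?_))
  obtain ⟨k, rfl⟩ := Nat.exists_eq_add_of_le hm
  rw [pow_add, mul_comm, pow_mul]
  exact teichmuller_mem_wittPow (pow_mem (hb i (mem_range.1 hi)) _) m

lemma WTendsto_stdLift {ι : Type*} {l : Filter ι} (n : ℕ) (b : ℕ → Ĉ) (d : ι → ℕ → Ĉ) (hd : ∀ j < p ^ n, Tendsto (fun i => fn (d i j)) l (𝓝 0)) :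
    WTendsto (fun i => stdLift ε n (b + d i)) l (stdLift ε n b) := by
  refine WTendsto.sum _ fun j hj => WTendsto_teichmuller ?_
  have h1 : ∀ i, fn (ε ^ j * (b + d i) j ^ p ^ n - ε ^ j * b j ^ p ^ n) = fn (ε ^ j) * fn (d i j) ^ p ^ n := fun i => by
    rw [← mul_sub, ← sub_pow_char_pow, fn_mul, fn_pow _ (p ^ n), Pi.add_apply, add_sub_cancel_left]
  simp only [h1]
  have := ((hd j (mem_range.1 hj)).pow (p ^ n)).const_mul (fn (ε ^ j))
  rwa [zero_pow (pp_ne_zero n), mul_zero] at this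

lemma mem_cohenAt_of_WTendsto (h : IsPBasis L ε) (hL : FlatClosed (L : Set Ĉ)) {c : ℝ} (hc : 0 ≤ c)
    (hb : ∀ x ∈ L, ∃ b : Fin p → Ĉ, (∀ j, b j ∈ L) ∧ powSum ε b = x ∧ ∀ j, fn (b j) ^ p ≤ c * fn x)
    (n : ℕ) {y : ℕ → Ã} {x : Ã} (hy : ∀ l, y l ∈ cohenAt L ε n) (hyx : WTendsto y atTop x) :
    x ∈ cohenAt L ε n := by
  induction n generalizing y x with
  | zero =>
    have hx0 : x.coeff 0 ∈ L := hL.mem_of_tendsto (fun l => coeff_zero_mem_of_cohenAt h.mem (hy l)) (hyx 0)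
    obtain ⟨v, hv, hv0⟩ := exists_mem_cohenAt h 0 hx0; refine mem_cohenAt_of_dvd hv ?_
    rw [zero_add, pow_one, p_dvd_iff, coeff_zero_sub, hv0, sub_self]
  | succ n ih =>
    have hx0 : x.coeff 0 ∈ L := hL.mem_of_tendsto (fun l => coeff_zero_mem_of_cohenAt h.mem (hy l)) (hyx 0)
    obtain ⟨A, hA, hbas⟩ := exists_basis_pow fn_nonneg hc hb (n + 1); obtain ⟨b, hbL, hbx, -⟩ := hbas _ hx0
    choose d hdL hdx hdA using fun l => hbas ((y l).coeff 0 - x.coeff 0)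
      (sub_mem (coeff_zero_mem_of_cohenAt h.mem (hy l)) hx0)
    have hd0 : ∀ j < p ^ (n + 1), Tendsto (fun l => fn (d l j)) atTop (𝓝 0) := fun j hj => by
      have h1 : Tendsto (fun l => fn (d l j) ^ p ^ (n + 1)) atTop (𝓝 0) := by
        refine squeeze_zero (fun _ => pow_nonneg (fn_nonneg _) _) (fun l => hdA l j hj) ?_
        simpa using (hyx 0).const_mul A
      have h3 := h1.rpow_const (p := 1 / ((p ^ (n + 1) : ℕ) : ℝ)) (Or.inr (by positivity))
      rw [Real.zero_rpow (one_div_ne_zero (Nat.cast_ne_zero.2 (pp_ne_zero _)))] at h3; refine h3.congr fun l => ?_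
      rw [one_div, Real.pow_rpow_inv_natCast (fn_nonneg _) (pp_ne_zero _)]
    have hv := WTendsto_stdLift (ε := ε) (n + 1) b d hd0
    have hvx : (p : Ã) ∣ x - stdLift ε (n + 1) b := by
      rw [p_dvd_iff, coeff_zero_sub, coeff_zero_stdLift, hbx, sub_self]
    have hvy : ∀ l, (p : Ã) ∣ y l - stdLift ε (n + 1) (b + d l) := fun l => by
      rw [p_dvd_iff, coeff_zero_sub, coeff_zero_stdLift]; simp only [Pi.add_apply, add_pow_char_pow, mul_add, sum_add_distrib]; simp_all
    obtain ⟨z, hz⟩ := hvx; choose w hw using hvy; have hwz : WTendsto w atTop z := by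
      refine WTendsto.of_p_mul ?_; have := hyx.sub hv; rw [hz] at this; simpa only [hw] using this
    have hz' : z ∈ cohenAt L ε n := ih (fun l => mem_cohenAt_of_p_mul h (by
      rw [← hw]; exact sub_mem (hy l) (stdLift_mem_cohenAt (fun j hj => add_mem (hbL j hj) (hdL l j hj)) le_rfl))) hwz
    have : x = stdLift ε (n + 1) b + (p : Ã) * z := by rw [← hz]; ring
    rw [this]; exact add_mem (stdLift_mem_cohenAt hbL le_rfl) (p_mul_mem_cohenAt h.mem hz')

lemma IsEps.isPBasis_EQp (hε : IsEps p ε) : IsPBasis (EQp p) ε where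
  mem := hε.eps_mem_EQp
  ne_zero h := by
    have := fn_of_mem_cycl hε.mem_cycl
    simp_all
  gen x hx := by
    obtain ⟨b, h1, h2, -⟩ := hε.exists_pow_basis hx; aesop
  pow_ne _ hy := hε.pow_ne hy

lemma IsEps.mem_cohen_of_WTendsto (hε : IsEps p ε) {y : ℕ → Ã} {x : Ã}
    (hy : ∀ l, y l ∈ cohen (EQp p) ε) (hyx : WTendsto y atTop x) : x ∈ cohen (EQp p) ε :=
  mem_cohen.2 fun n => mem_cohenAt_of_WTendsto hε.isPBasis_EQp hε.EQp_closed
    (inv_nonneg.2 (pow_nonneg (fn_nonneg _) _)) (fun _ hx => hε.exists_pow_basis hx) n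
    (fun l => mem_cohen.1 (hy l) n) hyx

lemma teichmuller_mem_cohen : ω ε ∈ cohen L ε := mem_cohen.2 fun n => mem_cohenAt.2 ⟨ω ε,
    subset_closure (Set.mem_union_right _ (Set.mem_singleton _)), by simp⟩

lemma IsEps.teichmuller_cycl_mem_cohen (hε : IsEps p ε) {e : Ĉ} (he : e ∈ cycl p) : ω e ∈ cohen (EQp p) ε := by
  choose a ha using hε.exists_pow he
  refine hε.mem_cohen_of_WTendsto (y := fun n => ω (ε ^ a n)) (fun n => ?_)
    (WTendsto_teichmuller ?_)
  · rw [map_pow]; exact pow_mem teichmuller_mem_cohen _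
  · refine squeeze_zero (fun _ => fn_nonneg _) (fun n => (fn_sub_comm _ _).trans_le (ha n)) ?_
    have h1 := tendsto_pow_atTop_nhds_zero_of_lt_one (inv_nonneg.2 p_pos.le) (inv_lt_one_of_one_lt₀ (one_lt_p (p := p)))
    exact h1.comp (tendsto_pow_atTop_atTop_of_one_lt (prm p).one_lt)

lemma IsEps.AQp_subset_cohen (hε : IsEps p ε) : AQp p ⊆ cohen (EQp p) ε := by
  intro x hx
  obtain ⟨y, hy, hyx⟩ := exists_WTendsto_of_mem_weakClosure hx
  refine hε.mem_cohen_of_WTendsto (fun l => ?_) hyx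
  refine (Subring.closure_le.2 ?_) (hy l)
  rintro z (⟨e, he, rfl⟩ | ⟨e, he, he1, hz⟩)
  · exact hε.teichmuller_cycl_mem_cohen he
  · refine inv_mem_cohen hε.isPBasis_EQp
      (sub_mem (hε.teichmuller_cycl_mem_cohen he) (one_mem _)) ?_ ((mul_comm _ _).trans hz)
    rw [coeff_zero_sub, teichmuller_coeff_zero, one_coeff_zero]; positivity

lemma galW_AQp {σ : GalQp p} (hσ : chi p σ = 1) {x : Ã} (hx : x ∈ AQp p) : galW σ x = x := by
  obtain ⟨y, hy, hyx⟩ := exists_WTendsto_of_mem_weakClosure hx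
  have h1 : ∀ l, galW σ (y l) = y l := fun l => by
    have h2 : Subring.closure ({x | ∃ e ∈ cycl p, x = ω e} ∪
        {x | ∃ e ∈ cycl p, e ≠ 1 ∧ x * (ω e - 1) = 1}) ≤ RingHom.eqLocus (galW σ : Ã →+* Ã) (RingHom.id _) := by
      refine Subring.closure_le.2 ?_; have h3 : ∀ e ∈ cycl p, galW σ (ω e) = ω e :=
        fun e he => by rw [galW_teichmuller, galFlat_cycl_fixed hσ he]
      rintro z (⟨e, he, rfl⟩ | ⟨e, he, he1, hz⟩)
      · exact h3 e he
      · change galW σ z = z; have h4 := congrArg (galW σ) hz; rw [map_mul, map_sub, map_one, h3 e he] at h4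
        have h5 : ω e - 1 ≠ 0 := fun h => by
          simp_all
        exact mul_right_cancel₀ h5 (h4.trans hz.symm)
    exact h2 (hy l)
  have h2 := hyx.galW σ
  simp only [h1] at h2
  exact h2.unique hyx

end CohenClosed
section Lifts
variable {θ δ : ℝ}

/-- The bound `|x| ≤ B` for a unit `x` and `|x⁻¹| ≤ B⁻¹`. -/
def UB (θ B : ℝ) (x : Ãˣ) : Prop := GB θ B (x : Ã) ∧ GB θ B⁻¹ ((x⁻¹ : Ãˣ) : Ã)

lemma UB.zpow (h0 : 0 < θ) (h1 : θ ≤ 1) {B : ℝ} {x : Ãˣ} (hx : UB θ B x) (n : ℤ) : UB θ (B ^ n) (x ^ n) := by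
  have h : ∀ n : ℕ, UB θ (B ^ n) (x ^ n) := fun n => ⟨by
    rw [val_pow_eq_pow_val]; exact hx.1.pow h0 h1 n, by
    rw [← inv_pow, ← inv_pow, val_pow_eq_pow_val]; exact hx.2.pow h0 h1 n⟩
  obtain ⟨n, rfl | rfl⟩ := n.eq_nat_or_neg
  · simpa using h n
  · refine ⟨?_, ?_⟩
    · simpa using (h n).2
    · simpa using (h n).1

lemma GB_zpow_sub_one (h0 : 0 < θ) (h1 : θ ≤ 1) {x : Ãˣ} (hx : UB θ 1 x) (hx' : GB θ δ ((x : Ã) - 1)) (n : ℤ) : GB θ δ (((x ^ n : Ãˣ) : Ã) - 1) := by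
  have hδ := hx'.nonneg
  have h : ∀ (y : Ãˣ), GB θ 1 (y : Ã) → GB θ δ ((y : Ã) - 1) → ∀ n : ℕ, GB θ δ (((y ^ n : Ãˣ) : Ã) - 1) := fun y hy hy' n => by
    induction n with
    | zero => simpa using GB_zero hδ
    | succ n ih =>
      have e : ((y ^ (n + 1) : Ãˣ) : Ã) - 1 = (((y ^ n : Ãˣ) : Ã) - 1) * (y : Ã) + ((y : Ã) - 1) := by
        rw [pow_succ, val_mul]; ring
      rw [e]; exact GB.add h0 h1 (by simpa using ih.mul h0 h1 hy) hy'
  obtain ⟨n, rfl | rfl⟩ := n.eq_nat_or_neg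
  · simpa using h x hx.1 hx' n
  · have e : ((x⁻¹ : Ãˣ) : Ã) - 1 = -(((x : Ã) - 1) * ((x⁻¹ : Ãˣ) : Ã)) := by
      rw [sub_mul, Units.mul_inv, one_mul]; ring
    have := h x⁻¹ (by simpa using hx.2) (by
      rw [e]; exact GB.neg h0 h1 (by simpa using hx'.mul h0 h1 hx.2)) n
    simpa using this

lemma GB_galW_zpow_sub (h0 : 0 < θ) (h1 : θ ≤ 1) {B : ℝ} (hB : 0 < B) {x : Ãˣ} (hx : UB θ B x)
    {σ : GalQp p} (hσ : GB θ (B * δ) (galW σ (x : Ã) - (x : Ã))) (n : ℤ) :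
    GB θ (B ^ n * δ) (galW σ ((x ^ n : Ãˣ) : Ã) - ((x ^ n : Ãˣ) : Ã)) := by
  let s : Ãˣ := Units.map (galW σ : Ã →* Ã) x
  have hs : UB θ B s := ⟨hx.1.galW σ, by
    have := hx.2.galW σ
    aesop⟩
  let z : Ãˣ := s * x⁻¹
  have hB0 : B * B⁻¹ = 1 := mul_inv_cancel₀ hB.ne'
  have hz : UB θ 1 z := by
    refine ⟨?_, ?_⟩
    · have := hs.1.mul h0 h1 hx.2
      rwa [hB0] at this
    · have := hx.1.mul h0 h1 hs.2
      aesop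
  have hz' : GB θ δ ((z : Ã) - 1) := by
    have e : (z : Ã) - 1 = (galW σ (x : Ã) - (x : Ã)) * ((x⁻¹ : Ãˣ) : Ã) := by
      rw [sub_mul, Units.mul_inv]; rfl
    rw [e]; have := hσ.mul h0 h1 hx.2; rwa [mul_right_comm, hB0, one_mul] at this
  have h2 := GB_zpow_sub_one h0 h1 hz hz' n
  have e : galW σ ((x ^ n : Ãˣ) : Ã) - ((x ^ n : Ãˣ) : Ã) = ((x ^ n : Ãˣ) : Ã) * (((z ^ n : Ãˣ) : Ã) - 1) := by
    have e1 : galW σ ((x ^ n : Ãˣ) : Ã) = ((s ^ n : Ãˣ) : Ã) := by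
      rw [← map_zpow]; rfl
    rw [e1, mul_zpow, mul_sub, mul_one, ← val_mul, mul_comm (s ^ n), inv_zpow, mul_inv_cancel_left]
  rw [e]
  exact ((hx.zpow h0 h1 n).1).mul h0 h1 h2

variable (p) in
/-- The ring generated by the `[ε] ^ a` and the `1 / ([ε] ^ a - 1)`. -/
def cyclRing : Subring Ã := Subring.closure ({x | ∃ e ∈ cycl p, x = ω e} ∪
    {x | ∃ e ∈ cycl p, e ≠ 1 ∧ x * (ω e - 1) = 1})

lemma isUnit_teichmuller_sub_one (hε : IsEps p ε) : IsUnit (ω ε - 1 : Ã) := by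
  refine isUnit_of_coeff_ne_zero ?_
  rw [coeff_zero_sub, teichmuller_coeff_zero, one_coeff_zero]
  exact hε.sub_one_ne_zero

/-- The unit `π = [ε] - 1`. -/
def piU (hε : IsEps p ε) : Ãˣ := (isUnit_teichmuller_sub_one hε).unit

lemma coe_piU (hε : IsEps p ε) : (piU hε : Ã) = ω ε - 1 := rfl

lemma piU_zpow_mem (hε : IsEps p ε) (n : ℤ) : ((piU hε ^ n : Ãˣ) : Ã) ∈ cyclRing p := by
  have h1 : (piU hε : Ã) ∈ cyclRing p :=
    sub_mem (subset_closure (Or.inl ⟨ε, hε.mem_cycl, rfl⟩)) (one_mem _)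
  have h2 : ((piU hε)⁻¹ : Ãˣ).1 ∈ cyclRing p :=
    subset_closure (Or.inr ⟨ε, hε.mem_cycl, sub_ne_zero.1 hε.sub_one_ne_zero, Units.inv_mul (piU hε)⟩)
  obtain ⟨n, rfl | rfl⟩ := n.eq_nat_or_neg
  · aesop
  aesop

lemma coeff_zero_units_inv (x : Ãˣ) : ((x⁻¹ : Ãˣ) : Ã).coeff 0 = ((x : Ã).coeff 0)⁻¹ := by
  have := congrArg (fun z : Ã => z.coeff 0) (Units.mul_inv x)
  simp only [coeff_zero_mul, one_coeff_zero] at this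
  exact eq_inv_of_mul_eq_one_right this

lemma coeff_zero_units_zpow (x : Ãˣ) (n : ℤ) : ((x ^ n : Ãˣ) : Ã).coeff 0 = ((x : Ã).coeff 0) ^ n := by
  obtain ⟨n, rfl | rfl⟩ := n.eq_nat_or_neg
  · simp [coeff_zero_pow]
  · simp [coeff_zero_units_inv, coeff_zero_pow]

lemma coeff_zero_piU (hε : IsEps p ε) : (piU hε : Ã).coeff 0 = ε - 1 := by
  rw [coe_piU, coeff_zero_sub, teichmuller_coeff_zero, one_coeff_zero]

lemma UB_piU (hε : IsEps p ε) (h0 : 0 < θ) (h : θ ≤ (p : ℝ)⁻¹) : UB θ (fn (ε - 1)) (piU hε) := by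
  have h1 : θ ≤ 1 := h.trans (inv_le_one_of_one_le₀ (one_lt_p (p := p)).le)
  have h2 := hε.GB_teichmuller_sub_one h0 h
  refine ⟨h2, ?_⟩
  have h3 : (ω ε - 1 : Ã).coeff 0 = ε - 1 := by
    rw [coeff_zero_sub, teichmuller_coeff_zero, one_coeff_zero]
  obtain ⟨y, hy, hyB⟩ := exists_inv_GB h0 h1 (by rw [h3]; exact hε.sub_one_ne_zero) (by rw [h3]; exact h2)
  rw [h3] at hyB
  have hinv : (((piU hε)⁻¹ : Ãˣ) : Ã) = y := Units.inv_eq_of_mul_eq_one_right hy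
  simp_all

lemma IsEps.exists_lift (hε : IsEps p ε) (h0 : 0 < θ) (h : θ ≤ (p : ℝ)⁻¹) {c : Ĉ} (hc : c ∈ EQp p) :
    ∃ x ∈ AQp p, x.coeff 0 = c ∧ GB θ (fn c) x ∧ ∀ (σ : GalQp p) (δ : ℝ), 0 < δ →
      GB θ (fn (ε - 1) * δ) (galW σ (piU hε : Ã) - (piU hε : Ã)) → GB θ (fn c * δ) (galW σ x - x) := by
  have h1 : θ ≤ 1 := h.trans (inv_le_one_of_one_le₀ (one_lt_p (p := p)).le)
  have hpos : 0 < fn (ε - 1) := fn_pos.2 hε.sub_one_ne_zero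
  have hlt := hε.fn_sub_one_lt
  rcases eq_or_ne c 0 with rfl | hc0
  · refine ⟨0, mem_weakClosure_of_WTendsto (fun _ => zero_mem _) (WTendsto_const 0 atTop), by simp, GB_zero (by simp), fun σ δ _ _ => ?_⟩
    rw [map_zero, sub_self]; exact GB_zero (by simp)
  have step : ∀ x : Ĉ, ∃ (m : ℕ) (n : ℤ), x ∈ EQp p →
      fn (x - (m : Ĉ) * (ε - 1) ^ n) ≤ fn (ε - 1) * fn x ∧ fn (ε - 1) ^ n ≤ fn x ∨ x = 0 ∧ m = 0 := fun x => by
    by_cases hx : x = 0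
    · exact ⟨0, 0, fun _ => Or.inr ⟨hx, rfl⟩⟩
    by_cases hxE : x ∈ EQp p
    · obtain ⟨m, -, -, n, h2, h3⟩ := hε.lead_le hxE hx; exact ⟨m, n, fun _ => Or.inl ⟨h3, h2.ge⟩⟩
    simp_all
  choose m n hmn using step
  let r : ℕ → Ĉ := fun k => Nat.rec c (fun _ x => x - (m x : Ĉ) * (ε - 1) ^ n x) k
  have hr : ∀ k, r (k + 1) = r k - (m (r k) : Ĉ) * (ε - 1) ^ n (r k) := fun k => rfl
  have hπE : ε - 1 ∈ EQp p := sub_mem hε.eps_mem_EQp (one_mem _)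
  have hrE : ∀ k, r k ∈ EQp p := fun k => by
    induction k with
    | zero => exact hc
    | succ k ih => rw [hr]; exact sub_mem ih (mul_mem (natCast_mem _ _) (zpow_mem hπE _))
  have hrb : ∀ k, fn (r k) ≤ fn (ε - 1) ^ k * fn c := fun k => by
    induction k with
    | zero => simp [r]
    | succ k ih =>
      rcases hmn (r k) (hrE k) with ⟨h2, -⟩ | ⟨h2, h3⟩
      · rw [hr, pow_succ', mul_assoc]; exact h2.trans (mul_le_mul_of_nonneg_left ih hpos.le)
      simp_all
  let t : ℕ → Ã := fun k => (m (r k) : Ã) * ((piU hε ^ n (r k) : Ãˣ) : Ã)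
  have hU := UB_piU hε h0 h
  have ht : ∀ k, GB θ (fn (r k)) (t k) ∧ ∀ (σ : GalQp p) (δ : ℝ), 0 < δ →
      GB θ (fn (ε - 1) * δ) (galW σ (piU hε : Ã) - (piU hε : Ã)) → GB θ (fn (r k) * δ) (galW σ (t k) - t k) := fun k => by
    rcases hmn (r k) (hrE k) with ⟨-, h2⟩ | ⟨h2, h3⟩
    · refine ⟨?_, fun σ δ hδ hσ => ?_⟩
      · have := (GB_natCast h0 h1 (m (r k))).mul h0 h1 (hU.zpow h0 h1 (n (r k))).1
        rw [one_mul] at this; exact this.mono_right h2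
      · have := (GB_natCast h0 h1 (m (r k))).mul h0 h1 (GB_galW_zpow_sub h0 h1 hpos hU hσ (n (r k)))
        rw [one_mul, mul_sub] at this; simp only [t, map_mul, map_natCast]; exact this.mono_right (mul_le_mul_of_nonneg_right h2 hδ.le)
    · have h4 : t k = 0 := by simp only [t, h3]; simp
      rw [h4]; exact ⟨GB_zero (fn_nonneg _), fun σ δ hδ _ => by
        rw [map_zero, sub_self]; exact GB_zero (mul_nonneg (fn_nonneg _) hδ.le)⟩
  let x : ℕ → Ã := fun k => ∑ i ∈ range k, t i
  have hx0 : ∀ k, (x k).coeff 0 = c - r k := fun k => by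
    induction k with
    | zero => simp [x, r]
    | succ k ih =>
      have e : x (k + 1) = x k + t k := sum_range_succ _ _
      have e2 : (t k).coeff 0 = (m (r k) : Ĉ) * (ε - 1) ^ n (r k) := by
        simp only [t]; rw [coeff_zero_mul, coeff_zero_units_zpow, coeff_zero_piU]; congr 1; exact map_natCast (constantCoeff (p := p) (R := Ĉ)) _
      rw [e, coeff_zero_add, ih, hr, e2]; ring
  have hcp : 0 < fn c := fn_pos.2 hc0
  have hrc : ∀ k, fn (r k) ≤ fn c := fun k =>
    (hrb k).trans (mul_le_of_le_one_left hcp.le (pow_le_one₀ hpos.le hlt.le))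
  have hxB : ∀ k, GB θ (fn c) (x k) := fun k =>
    GB.sum h0 h1 hcp.le _ _ fun i _ => (ht i).1.mono_right (hrc i)
  have hlim0 := tendsto_pow_atTop_nhds_zero_of_lt_one hpos.le hlt
  obtain ⟨y, hxy, hyx⟩ := exists_gauss_lim h0 h1 x (fun k => fn (ε - 1) ^ k * fn c)
    (fun k => mul_pos (pow_pos hpos k) hcp)
    (fun a b hab => mul_le_mul_of_nonneg_right (pow_le_pow_of_le_one hpos.le hlt.le hab) hcp.le)
    (by simpa using hlim0.mul_const (fn c))
    (fun k => by
      have e : x (k + 1) - x k = t k := by simp only [x]; rw [sum_range_succ]; ring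
      rw [e]; exact (ht k).1.mono_right (hrb k))
  have hWx : WTendsto x atTop y := hxy
  refine ⟨y, mem_weakClosure_of_WTendsto (fun k => sum_mem fun i _ =>
    mul_mem (natCast_mem (cyclRing p) _) (piU_zpow_mem hε _)) hWx, ?_, ?_, fun σ δ hδ hσ => ?_⟩
  · have h2 : Tendsto (fun k => fn ((x k).coeff 0 - c)) atTop (𝓝 0) := by
      refine squeeze_zero (fun _ => fn_nonneg _) (fun k => ?_) (by simpa using hlim0.mul_const (fn c))
      rw [hx0, sub_sub_cancel_left, fn_neg]; exact hrb k
    have h3 : Tendsto (fun k => fn ((x k).coeff 0 - y.coeff 0) + fn ((x k).coeff 0 - c)) atTop (𝓝 0) := by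
      simpa using (hxy 0).add h2
    refine sub_eq_zero.1 (fn_eq_zero.1 (le_antisymm (ge_of_tendsto' h3 fun k => ?_) (fn_nonneg _)))
    have e : y.coeff 0 - c = ((x k).coeff 0 - c) - ((x k).coeff 0 - y.coeff 0) := by ring
    rw [e]; refine (fn_sub_le _ _).trans (max_le ?_ ?_)
    · linarith [fn_nonneg ((x k).coeff 0 - y.coeff 0)]
    · linarith [fn_nonneg ((x k).coeff 0 - c)]
  · exact GB_of_tendsto h0 hcp x y hxy hxB
  · refine GB_of_tendsto h0 (mul_pos hcp hδ) (fun k => galW σ (x k) - x k) _ ((hWx.galW σ).sub hWx) fun k => ?_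
    have e : galW σ (x k) - x k = ∑ i ∈ range k, (galW σ (t i) - t i) := by
      simp only [x, map_sum, sum_sub_distrib]
    rw [e]; exact GB.sum h0 h1 (mul_pos hcp hδ).le _ _ fun i _ =>
      ((ht i).2 σ δ hδ hσ).mono_right (mul_le_mul_of_nonneg_right (hrc i) hδ.le)

end Lifts
section Separable
instance : ExpChar (EQp p) p := (algebraMap (EQp p) Ĉ).expChar (algebraMap (EQp p) Ĉ).injective p

lemma isSeparable_mem_of_pow_mem {y : Ĉ} (hy : IsSeparable (EQp p) y) (h : y ^ p ∈ EQp p) : y ∈ EQp p := by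
  have h1 := IntermediateField.adjoin_simple_eq_adjoin_pow_expChar_of_isSeparable (EQp p) Ĉ hy p
  have h2 : adjoin (EQp p) {y ^ p} = ⊥ := by
    rw [adjoin_simple_eq_bot_iff, IntermediateField.mem_bot]; exact ⟨⟨y ^ p, h⟩, rfl⟩
  rw [h2, adjoin_simple_eq_bot_iff, IntermediateField.mem_bot] at h1
  aesop

lemma IsEps.isPBasis (hε : IsEps p ε) (L : IntermediateField (EQp p) Ĉ) (hL : ∀ x ∈ L, IsSeparable (EQp p) x) : IsPBasis L.toSubfield ε where
  mem := L.algebraMap_mem ⟨ε, hε.eps_mem_EQp⟩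
  ne_zero := hε.isPBasis_EQp.ne_zero
  gen x hx := by
    have hsep := hL x hx
    have h1 := IntermediateField.adjoin_simple_eq_adjoin_pow_expChar_of_isSeparable (EQp p) Ĉ hsep p
    have hint : IsIntegral (EQp p) (x ^ p) := hsep.isIntegral.pow p
    have hx1 : x ∈ Algebra.adjoin (EQp p) {x ^ p} := by
      have h2 := mem_adjoin_simple_self (EQp p) x
      rw [h1, ← IntermediateField.mem_toSubalgebra, IntermediateField.adjoin_simple_toSubalgebra_of_isAlgebraic hint.isAlgebraic] at h2; exact h2
    let S : AddSubgroup Ĉ := 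
      { carrier := {z | ∃ b : Fin p → Ĉ, (∀ j, b j ∈ L.toSubfield) ∧ powSum ε b = z}
        zero_mem' := ⟨0, fun _ => zero_mem _, map_zero _⟩
        add_mem' := by
          rintro _ _ ⟨b, hb, rfl⟩ ⟨c, hc, rfl⟩; exact ⟨b + c, fun j => add_mem (hb j) (hc j), map_add _ _ _⟩
        neg_mem' := by
          rintro _ ⟨b, hb, rfl⟩; exact ⟨-b, fun j => neg_mem (hb j), map_neg _ _⟩ }
    have hS : ∀ c : EQp p, ∀ y ∈ L, (c : Ĉ) * y ^ p ∈ S := fun c y hy => by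
      obtain ⟨b, hb, hbc, -⟩ := hε.exists_pow_basis c.2; refine ⟨fun j => b j * y, fun j => mul_mem (L.algebraMap_mem ⟨b j, hb j⟩) hy, ?_⟩
      rw [← hbc, powSum_apply, powSum_apply, sum_mul]; exact sum_congr rfl fun j _ => by rw [mul_pow, mul_assoc]
    obtain ⟨q, hq⟩ := (Algebra.adjoin_singleton_eq_range_aeval (EQp p) (x ^ p) ▸ hx1 : x ∈ (Polynomial.aeval (x ^ p)).range); change x ∈ S; rw [← hq]
    change Polynomial.aeval (x ^ p) q ∈ S; rw [Polynomial.aeval_eq_sum_range]; refine sum_mem fun i _ => ?_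
    rw [smul_def, ← pow_mul, mul_comm p i, pow_mul]; exact hS _ _ (pow_mem hx i)
  pow_ne y hy h := by
    refine hε.pow_ne (isSeparable_mem_of_pow_mem (hL y hy) ?_) h; rw [h]; exact hε.eps_mem_EQp

variable (p) in
/-- The separable closure of `𝔽_p((ε - 1))` in `ℂ_p^♭`. -/
def ESep : IntermediateField (EQp p) Ĉ := separableClosure (EQp p) Ĉ

lemma mem_ESep {x : Ĉ} : x ∈ ESep p ↔ IsSeparable (EQp p) x := mem_separableClosure_iff

lemma IsEps.isPBasis_ESep (hε : IsEps p ε) : IsPBasis (ESep p).toSubfield ε := hε.isPBasis _ fun _ hx => mem_ESep.1 hx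

lemma EQp_le_ESep : EQp p ≤ (ESep p).toSubfield := fun x hx => (ESep p).algebraMap_mem ⟨x, hx⟩

lemma one_mem_AQp : (1 : Ã) ∈ AQp p := mem_weakClosure_of_WTendsto (fun _ => one_mem (cyclRing p)) (WTendsto_const 1 atTop)

lemma zero_mem_AQp : (0 : Ã) ∈ AQp p := mem_weakClosure_of_WTendsto (fun _ => zero_mem (cyclRing p)) (WTendsto_const 0 atTop)

lemma IsEps.exists_section (hε : IsEps p ε) : ∃ l : EQp p → Ã, l 0 = 0 ∧ l 1 = 1 ∧ ∀ c, l c ∈ AQp p ∧ (l c).coeff 0 = c ∧ l c ∈ Odag p := by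
  classical
  have h1 : ∀ c : EQp p, ∃ x, x ∈ AQp p ∧ x.coeff 0 = c ∧ x ∈ Odag p := fun c => by
    obtain ⟨x, hx, hx0, hB, -⟩ := hε.exists_lift (θ := (p : ℝ)⁻¹) (inv_pos.2 p_pos) le_rfl c.2
    exact ⟨x, hx, hx0, _, inv_pos.2 p_pos, inv_le_one_of_one_le₀ (one_lt_p (p := p)).le, _, hB⟩
  choose l hl using h1
  refine ⟨fun c => if c = 0 then 0 else if c = 1 then 1 else l c, by simp, by simp, fun c => ?_⟩
  dsimp only
  split_ifs with h h'
  · exact ⟨zero_mem_AQp, by simp [h], zero_mem _⟩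
  · exact ⟨one_mem_AQp, by simp [h'], one_mem _⟩
  · exact hl c

lemma eq_of_root {f : Polynomial Ã} {y y' : Ã} (hy : f.eval y = 0) (hy' : f.eval y' = 0)
    (hd : (f.derivative.eval y).coeff 0 ≠ 0) (h : y'.coeff 0 = y.coeff 0) : y' = y := by
  obtain ⟨c, hc⟩ := f.binomExpansion y (y' - y)
  rw [add_sub_cancel, hy', hy, zero_add] at hc
  have h1 : (y' - y) * (f.derivative.eval y + c * (y' - y)) = 0 := by rw [hc]; ring
  rcases mul_eq_zero.1 h1 with h2 | h2
  · grind
  · refine absurd ?_ hd; have h3 := congrArg (fun z : Ã => z.coeff 0) h2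
    simpa [coeff_zero_add, coeff_zero_mul, coeff_zero_sub, h] using h3

lemma coeff_zero_eval (f : Polynomial Ã) (y : Ã) : (f.eval y).coeff 0 = (f.map (constantCoeff (p := p) (R := Ĉ))).eval (y.coeff 0) := by
  rw [eval_map]
  exact (Polynomial.eval₂_at_apply (constantCoeff (p := p) (R := Ĉ)) y).symm

lemma coeff_zero_eval_derivative (f : Polynomial Ã) (y : Ã) : (f.derivative.eval y).coeff 0 =
      (f.map (constantCoeff (p := p) (R := Ĉ))).derivative.eval (y.coeff 0) := by
  rw [coeff_zero_eval, derivative_map]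

lemma IsEps.exists_lift_ESep (hε : IsEps p ε) {x : Ĉ} (hx : x ∈ ESep p) : ∃ y ∈ AUnr p, y.coeff 0 = x ∧ y ∈ Odag p ∧
      ∀ σ : GalQp p, chi p σ = 1 → galFlat σ x = x → galW σ y = y := by
  have hsep := mem_ESep.1 hx
  obtain ⟨l, hl0, hl1, hl⟩ := hε.exists_section
  let g := minpoly (EQp p) x
  have hg : g.Monic := minpoly.monic hsep.isIntegral
  let f : Polynomial Ã := ∑ i ∈ range (g.natDegree + 1), monomial i (l (g.coeff i))
  have hfc : ∀ i, f.coeff i = l (g.coeff i) := fun i => by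
    simp only [f, finsetSum_coeff, Polynomial.coeff_monomial, Finset.sum_ite_eq', mem_range]; split_ifs with h
    · rfl
    · rw [Polynomial.coeff_eq_zero_of_natDegree_lt (by omega), hl0]
  have hfm : f.Monic := by
    refine Polynomial.monic_of_natDegree_le_of_coeff_eq_one g.natDegree ?_ ?_
    · refine Polynomial.natDegree_sum_le_of_forall_le _ _ fun i hi => ?_
      exact (Polynomial.natDegree_monomial_le _).trans (Nat.lt_succ_iff.1 (mem_range.1 hi))
    · simp_all
  have hmap : f.map (constantCoeff (p := p) (R := Ĉ)) = g.map (algebraMap (EQp p) Ĉ) := by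
    ext i
    rw [coeff_map, coeff_map, hfc]; exact (hl _).2.1
  have hev : ∀ y : Ã, y.coeff 0 = x → (f.eval y).coeff 0 = 0 := fun y hy => by
    rw [coeff_zero_eval, hmap, hy, eval_map_algebraMap, minpoly.aeval]
  have hdv : ∀ y : Ã, y.coeff 0 = x → (f.derivative.eval y).coeff 0 ≠ 0 := fun y hy => by
    rw [coeff_zero_eval_derivative, hmap, hy, derivative_map, eval_map_algebraMap]; exact hsep.aeval_derivative_ne_zero (minpoly.aeval _ _)
  have hT : (ω x).coeff 0 = x := by rfl
  obtain ⟨y, hy, hyx⟩ := HenselianRing.is_henselian (I := span {(p : Ã)}) f hfm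
    (ω x) (mem_span_singleton.2 (p_dvd_iff.2 (hev _ hT)))
    ((isUnit_of_coeff_ne_zero (hdv _ hT)).map _)
  have hy0 : y.coeff 0 = x := (coeff_zero_eq_of_dvd (mem_span_singleton.1 hyx)).trans hT
  refine ⟨y, subset_closure (Or.inr ⟨f, hfm, fun i => by simp_all, hy, isUnit_of_coeff_ne_zero (hdv y hy0)⟩), hy0,
    root_mem_Odag (fun i => by simp_all) hy (hdv y hy0), fun σ hσ hσx => ?_⟩
  have hfσ : f.map (galW σ : Ã →+* Ã) = f := by
    ext1 i
    rw [coeff_map, hfc]; exact galW_AQp hσ (hl _).1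
  refine eq_of_root hy ?_ (hdv y hy0) (by rw [coeff_galW, hy0, hσx])
  have h1 := congrArg (galW σ : Ã →+* Ã) (show f.eval y = 0 from hy)
  rw [← Polynomial.eval₂_hom, ← Polynomial.eval_map, hfσ, map_zero] at h1
  exact h1

lemma IsEps.AUnr_le_cohen (hε : IsEps p ε) : AUnr p ≤ cohen (ESep p).toSubfield ε := by
  refine Subring.closure_le.2 ?_
  rintro y (hy | ⟨f, -, hf, hy, hy'⟩)
  · exact cohen_mono EQp_le_ESep (hε.AQp_subset_cohen hy)
  · have hd : (f.derivative.eval y).coeff 0 ≠ 0 := ((hy'.map (constantCoeff (p := p) (R := Ĉ))).ne_zero)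
    refine root_mem_cohen hε.isPBasis_ESep (fun i => cohen_mono EQp_le_ESep (hε.AQp_subset_cohen (hf i))) hy hd ?_
    obtain ⟨h, hh⟩ := (Polynomial.mem_lifts (f := algebraMap (EQp p) Ĉ) _).1
      ((Polynomial.lifts_iff_coeff_lifts (f := algebraMap (EQp p) Ĉ)
        (f.map (constantCoeff (p := p) (R := Ĉ)))).2 fun i => by
          rw [coeff_map]; exact ⟨⟨_, coeff_zero_mem_of_cohen hε.isPBasis_EQp (hε.AQp_subset_cohen (hf i))⟩, rfl⟩)
    have h1 : Polynomial.aeval (y.coeff 0) h = 0 := by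
      rw [← eval_map_algebraMap, hh, ← coeff_zero_eval, hy, zero_coeff]
    have h2 : Polynomial.aeval (y.coeff 0) h.derivative ≠ 0 := by
      rw [← eval_map_algebraMap, ← derivative_map, hh, ← coeff_zero_eval_derivative]; exact hd
    have h0 : h ≠ 0 := by rintro rfl; simp at h2
    have hint : IsIntegral (EQp p) (y.coeff 0) := 
      IsAlgebraic.isIntegral ⟨h, h0, h1⟩
    refine mem_ESep.2 ((Polynomial.separable_iff_derivative_ne_zero (minpoly.irreducible hint)).2 fun h3 => h2 ?_)
    obtain ⟨q, hq⟩ := minpoly.dvd (EQp p) _ h1; simp_all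

lemma IsEps.mem_ABig (hε : IsEps p ε) {x : Ã} : x ∈ ABig p ↔ x ∈ cohen (ESep p).toSubfield ε := by
  constructor
  · intro hx; refine mem_cohen.2 fun n => ?_
    obtain ⟨y, hy, z, hz⟩ := hx (n + 1); exact mem_cohenAt_of_dvd (mem_cohen.1 (hε.AUnr_le_cohen hy) n) (Dvd.intro _ hz.symm)
  · intro hx N; have key : ∃ y ∈ AUnr p, ∃ z ∈ cohen (ESep p).toSubfield ε, x - y = (p : Ã) ^ N * z := by
      induction N with
      | zero => exact ⟨0, zero_mem _, x, hx, by simp⟩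
      | succ N ih =>
        obtain ⟨y, hy, z, hz, e⟩ := ih; obtain ⟨w, hw, hwz, -⟩ := hε.exists_lift_ESep (coeff_zero_mem_of_cohen hε.isPBasis_ESep hz)
        have h1 : (p : Ã) ∣ z - w := by rw [p_dvd_iff, coeff_zero_sub, hwz, sub_self]
        obtain ⟨q, hq⟩ := h1; refine ⟨y + (p : Ã) ^ N * w, add_mem hy (mul_mem (pow_mem (natCast_mem _ _) _) hw), q,
          mem_cohen_of_p_mul hε.isPBasis_ESep ?_, ?_⟩
        · rw [← hq]; exact sub_mem hz (hε.AUnr_le_cohen hw)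
        · rw [pow_succ, mul_assoc, ← hq, mul_sub, ← e]; ring
    obtain ⟨y, hy, z, -, e⟩ := key; exact ⟨y, hy, z, e⟩

end Separable

section AK
lemma galFlat_EQp (hε : IsEps p ε) {σ : GalQp p} (hσ : chi p σ = 1) {x : Ĉ} (hx : x ∈ EQp p) : galFlat σ x = x := by
  obtain ⟨l, -, -, hl⟩ := hε.exists_section
  have h := congrArg (fun z : Ã => z.coeff 0) (galW_AQp hσ (hl ⟨x, hx⟩).1)
  simpa only [coeff_galW, (hl ⟨x, hx⟩).2.1] using h

lemma chi_of_mem_HK {σ : GK K} (hσ : σ ∈ HK K) : chi p (σ : GalQp p) = 1 := hσ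

lemma mem_EK (hε : IsEps p ε) {x : Ĉ} : x ∈ EK K ↔ IsSeparable (EQp p) x ∧ ∀ σ ∈ HK K, galFlat (σ : GalQp p) x = x := by
  refine ⟨fun hx => ?_, fun hx => subset_adjoin _ _ hx⟩
  let M : IntermediateField (EQp p) Ĉ := 
    { (ESep p).toSubfield ⊓ ⨅ σ : HK K, RingHom.eqLocusField (galFlat ((σ : GK K) : GalQp p)) (RingHom.id _) with
      algebraMap_mem' := fun c => Subfield.mem_inf.2 ⟨(ESep p).algebraMap_mem c, by
        refine Subfield.mem_iInf.2 fun σ => ?_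
        exact galFlat_EQp hε (chi_of_mem_HK σ.2) c.2⟩ }
  have hM : ∀ y, y ∈ M ↔ IsSeparable (EQp p) y ∧ ∀ σ ∈ HK K, galFlat (σ : GalQp p) y = y := fun y => by
    refine Subfield.mem_inf.trans (and_congr mem_ESep (Subfield.mem_iInf.trans ?_)); simp
  have h1 : EK K ≤ M := adjoin_le_iff.2 fun y hy => (hM y).2 hy
  exact (hM x).1 (h1 hx)

/-- The ring `𝐀_K`. -/
def AKr (hε : IsEps p ε) (K : IntermediateField ℚ_[p] (PadicAlgCl p)) : Subring Ã where
  carrier := AK K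
  zero_mem' := ⟨hε.mem_ABig.2 (zero_mem _), fun σ _ => map_zero _⟩
  one_mem' := ⟨hε.mem_ABig.2 (one_mem _), fun σ _ => map_one _⟩
  add_mem' hx hy := ⟨hε.mem_ABig.2 (add_mem (hε.mem_ABig.1 hx.1) (hε.mem_ABig.1 hy.1)), fun σ hσ => by
    rw [map_add, hx.2 σ hσ, hy.2 σ hσ]⟩
  neg_mem' hx := ⟨hε.mem_ABig.2 (neg_mem (hε.mem_ABig.1 hx.1)), fun σ hσ => by rw [map_neg, hx.2 σ hσ]⟩
  mul_mem' hx hy := ⟨hε.mem_ABig.2 (mul_mem (hε.mem_ABig.1 hx.1) (hε.mem_ABig.1 hy.1)), fun σ hσ => by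
    rw [map_mul, hx.2 σ hσ, hy.2 σ hσ]⟩

lemma coeff_zero_mem_EK (hε : IsEps p ε) {x : Ã} (hx : x ∈ AK K) : x.coeff 0 ∈ EK K := by
  refine (mem_EK hε).2 ⟨mem_ESep.1 (coeff_zero_mem_of_cohen hε.isPBasis_ESep (hε.mem_ABig.1 hx.1)), fun σ hσ => ?_⟩
  rw [← coeff_galW, hx.2 σ hσ]

lemma mem_AK_of_p_mul (hε : IsEps p ε) {x : Ã} (hx : (p : Ã) * x ∈ AK K) : x ∈ AK K := by
  refine ⟨hε.mem_ABig.2 (mem_cohen_of_p_mul hε.isPBasis_ESep (hε.mem_ABig.1 hx.1)), fun σ hσ => ?_⟩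
  have h := hx.2 σ hσ
  rw [map_mul, map_natCast] at h
  exact mul_left_cancel₀ p_ne_zero_aTilde h

lemma mem_AK_of_padic {x : Ã} (hx : ∀ n, ∃ y ∈ AK K, (p : Ã) ^ n ∣ x - y) : x ∈ AK K := by
  refine ⟨fun N => ?_, fun σ hσ => ?_⟩
  · obtain ⟨y, hy, z, hz⟩ := hx N; obtain ⟨w, hw, t, ht⟩ := hy.1 N; exact ⟨w, hw, z + t, by grind⟩
  · ext k
    obtain ⟨y, hy, hd⟩ := hx (k + 1); rw [coeff_galW, coeff_eq_of_dvd hd (lt_succ_self k), ← coeff_galW, hy.2 σ hσ]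

lemma exists_lift_AK (hε : IsEps p ε) {t : Ĉ} (ht : t ∈ EK K) : ∃ x ∈ AK K, x.coeff 0 = t ∧ x ∈ Odag p := by
  obtain ⟨h1, h2⟩ := (mem_EK hε).1 ht
  obtain ⟨y, hy, hy0, hyO, hyσ⟩ := hε.exists_lift_ESep (mem_ESep.2 h1)
  exact ⟨y, ⟨hε.mem_ABig.2 (hε.AUnr_le_cohen hy), fun σ hσ => hyσ σ (chi_of_mem_HK hσ) (h2 σ hσ)⟩, hy0, hyO⟩

end AK
section ResidueRoots
lemma nO_sub_lt {x y : 𝓞_ℂ_[p]} {r : ℝ} (hx : nO x < r) (hy : nO y < r) : nO (x - y) < r := by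
  have h : nO (-y) = nO y := norm_neg _
  rw [sub_eq_add_neg]
  exact (nO_add_le _ _).trans_lt (max_lt hx (h.trans_lt hy))

lemma nO_one : nO (1 : 𝓞_ℂ_[p]) = 1 := norm_one

lemma nO_sub_comm (x y : 𝓞_ℂ_[p]) : nO (x - y) = nO (y - x) := norm_sub_rev _ _

lemma nO_eq_one_of_sub {x y : 𝓞_ℂ_[p]} (h : nO (x - y) < 1) (hy : nO y = 1) : nO x = 1 := by
  refine le_antisymm (nO_le_one x) ?_
  by_contra! hx
  have := nO_sub_lt hx h
  simp_all

lemma nO_natCast_sub_one {F : ℕ} (hF : 0 < F) : nO ((p ^ F - 1 : ℕ) : 𝓞_ℂ_[p]) = 1 := by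
  have h1 : nO ((p : 𝓞_ℂ_[p]) ^ F) < 1 := by
    rw [nO_pow, nO_p]; exact pow_lt_one₀ (inv_nonneg.2 p_pos.le) (inv_lt_one_of_one_lt₀ one_lt_p) hF.ne'
  rw [Nat.cast_sub (Nat.one_le_pow _ _ (prm p).pos), Nat.cast_pow, cast_one]
  refine (nO_eq_one_of_sub (y := -1) (by simp_all) ?_)
  rw [nO, NegMemClass.coe_neg, norm_neg]; exact nO_one

lemma eq_of_pow_eq_one {F : ℕ} (hF : 0 < F) {x y : 𝓞_ℂ_[p]} (hx : x ^ (p ^ F - 1) = 1) (hy : y ^ (p ^ F - 1) = 1) (h : nO (y - x) < 1) : y = x := by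
  let f : Polynomial 𝓞_ℂ_[p] := X ^ (p ^ F - 1) - 1
  have hf : ∀ z : 𝓞_ℂ_[p], z ^ (p ^ F - 1) = 1 → f.eval z = 0 := fun z hz => by simp [f, hz]
  obtain ⟨c, hc⟩ := f.binomExpansion x (y - x)
  rw [add_sub_cancel, hf x hx, hf y hy, zero_add] at hc
  have h1 : (y - x) * (f.derivative.eval x + c * (y - x)) = 0 := by rw [hc]; ring
  rcases mul_eq_zero.1 h1 with h2 | h2
  · exact sub_eq_zero.1 h2
  · exfalso
    have hx1 : nO x = 1 := by
      have := congrArg nO hx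
      rw [nO_pow, nO_one] at this; refine (pow_eq_one_iff_of_nonneg (nO_nonneg x) ?_).1 this; have := one_lt_pow hF.ne' (prm p).one_lt; omega
    have h3 : nO (f.derivative.eval x) = 1 := by
      have : f.derivative.eval x = ((p ^ F - 1 : ℕ) : 𝓞_ℂ_[p]) * x ^ (p ^ F - 1 - 1) := by
        simp [f, Polynomial.derivative_X_pow]
      rw [this, nO_mul, nO_natCast_sub_one hF, nO_pow, hx1, one_pow, one_mul]
    have h4 : nO (c * (y - x)) < 1 := by
      rw [nO_mul]; exact (mul_le_of_le_one_left (nO_nonneg _) (nO_le_one _)).trans_lt h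
    have h5 : nO (0 : 𝓞_ℂ_[p]) = 1 := by
      rw [← h2]; exact nO_eq_one_of_sub (by rw [add_sub_cancel_left]; exact h4) h3
    simp [nO] at h5

lemma evZ_algebraMap (x : OFlat p) (P : Polynomial ℤ) : evZ (algebraMap (OFlat p) Ĉ x) P = algebraMap (OFlat p) Ĉ (P.eval₂ (castRingHom _) x) := by
  change P.eval₂ _ _ = _
  simp

lemma coeff_zero_eval₂ {x : OFlat p} {α : 𝓞_ℂ_[p]} (h : coeff 0 x = Ideal.Quotient.mk _ α) (P : Polynomial ℤ) :
    coeff 0 (P.eval₂ (castRingHom _) x) = Ideal.Quotient.mk _ (P.eval₂ (castRingHom _) α) := by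
  simp_all

lemma exists_residue_root {a : Ĉ} {F : ℕ} (hF : 0 < F) (ha0 : a ≠ 0) (ha : a ^ p ^ F = a) :
    ∃ η : PadicAlgCl p, ‖η‖ = 1 ∧ (∀ σ : GalQp p, galFlat σ a = a → σ η = η) ∧
      ∀ P : Polynomial ℤ, fn (evZ a P) = 1 → ‖P.eval₂ (castRingHom _) η‖ = 1 := by
  set n := p ^ F - 1 with hn
  have hpF := one_lt_pow hF.ne' (prm p).one_lt
  have hn0 : n ≠ 0 := by omega
  have han : a ^ n = 1 := by
    refine mul_left_cancel₀ ha0 ?_; rw [← pow_succ', mul_one, hn, Nat.sub_add_cancel hpF.le, ha]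
  have hfa : fn a = 1 := (pow_eq_one_iff_of_nonneg (fn_nonneg a) hn0).1 (by rw [← fn_pow, han, fn_one])
  obtain ⟨x, rfl⟩ := exists_algebraMap_eq hfa.le
  obtain ⟨α, hα⟩ := mk_surjective (coeff 0 x)
  have hxn : x ^ n = 1 := by
    rw [← map_pow] at han; exact (IsFractionRing.injective (OFlat p) Ĉ) (han.trans (map_one _).symm)
  have hlt : ∀ {y : 𝓞_ℂ_[p]}, (Valued.v (y : ℂ_[p]) : ℝ≥0) ≤ 1 / p → nO y < 1 := fun {y} h => by
    rw [nO_eq]; refine lt_of_le_of_lt (NNReal.coe_le_coe.2 h) ?_; rw [NNReal.coe_div, NNReal.coe_one, NNReal.coe_natCast, one_div]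
    exact inv_lt_one_of_one_lt₀ one_lt_p
  have hαn : nO (α ^ n - 1) < 1 := by
    refine hlt (mk_eq_mk_iff.1 ?_); rw [map_pow, hα, ← map_pow, hxn, map_one, map_one]
  have : NeZero n := ⟨hn0⟩
  obtain ⟨ζ, hζ⟩ := exists_primitiveRoot (PadicAlgCl p) n
  have hζ' := hζ.map_of_injective (f := (coeRingHom : PadicAlgCl p →+* ℂ_[p]))
    (coeRingHom : PadicAlgCl p →+* ℂ_[p]).injective
  have hprod := congrArg (Polynomial.eval (α : ℂ_[p])) (Polynomial.X_pow_sub_one_eq_prod (Nat.pos_of_ne_zero hn0) hζ')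
  rw [eval_prod] at hprod
  simp only [eval_sub, eval_pow, eval_X, Polynomial.eval_one, eval_C] at hprod
  obtain ⟨z, hz, hz1⟩ : ∃ z ∈ Polynomial.nthRootsFinset n (1 : ℂ_[p]), ‖(α : ℂ_[p]) - z‖ < 1 := by
    by_contra! hcon
    have h1 : (1 : ℝ) ≤ ‖∏ z ∈ Polynomial.nthRootsFinset n (1 : ℂ_[p]), ((α : ℂ_[p]) - z)‖ := by
      rw [norm_prod]; exact Finset.prod_const_one.symm.trans_le (Finset.prod_le_prod (fun _ _ => zero_le_one) hcon)
    rw [← hprod] at h1; exact hαn.not_ge h1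
  rw [Polynomial.mem_nthRootsFinset (Nat.pos_of_ne_zero hn0)] at hz
  obtain ⟨i, -, hi⟩ := hζ'.eq_pow_of_pow_eq_one hz
  have hηn : (ζ ^ i) ^ n = 1 := by rw [← pow_mul, mul_comm, pow_mul, hζ.pow_eq_one, one_pow]
  have hη1 : ‖ζ ^ i‖ = 1 := (pow_eq_one_iff_of_nonneg (norm_nonneg _) hn0).1 (by rw [← norm_pow, hηn, norm_one])
  have hze : ((ζ ^ i : PadicAlgCl p) : ℂ_[p]) = z := by
    rw [← hi]; exact map_pow (coeRingHom : PadicAlgCl p →+* ℂ_[p]) ζ i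
  let zO : 𝓞_ℂ_[p] := ⟨z, by
    change (Valued.v z : ℝ≥0) ≤ 1; rw [valuation_eq_nnnorm, ← hze]; have := norm_extends p (ζ ^ i); linarith⟩
  have hzO : nO (α - zO) < 1 := hz1
  have hzOn : zO ^ n = 1 := Subtype.ext hz
  refine ⟨ζ ^ i, hη1, fun σ hσ => ?_, fun P hP => ?_⟩
  · have h1 : nO (galO σ α - α) < 1 := by
      refine hlt (mk_eq_mk_iff.1 ?_); have h2 : galOFlat σ x = x := by
        rw [galFlat_algebraMap] at hσ; exact IsFractionRing.injective (OFlat p) Ĉ hσ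
      have h3 := coeff_galOFlat σ x 0
      rw [h2, ← hα] at h3; exact h3.symm
    have h4 : nO (galO σ zO - zO) < 1 := by
      have h5 : nO (galO σ (α - zO)) < 1 := by
        rw [nO, coe_galO, norm_galC]; exact hzO
      have h6 : galO σ zO - zO = (galO σ α - α) - (galO σ (α - zO) - (α - zO)) := by rw [map_sub]; ring
      rw [h6]; exact nO_sub_lt h1 (nO_sub_lt h5 hzO)
    have h7 := eq_of_pow_eq_one hF hzOn (by rw [← hn, ← map_pow, hzOn, map_one]) h4
    have h8 : galC σ z = z := congrArg Subtype.val h7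
    rw [← hze, galC_coe] at h8; exact (coeRingHom : PadicAlgCl p →+* ℂ_[p]).injective h8
  · have h1 : nO (P.eval₂ (castRingHom _) α) = 1 := by
      rw [evZ_algebraMap, fn_algebraMap] at hP; have hP' : oFlatVal p (P.eval₂ (castRingHom _) x) = 1 := by exact_mod_cast hP
      have h2 := coeff_zero_eval₂ hα.symm P
      have h3 : (1 / p : ℝ≥0) < (Valued.v ((P.eval₂ (castRingHom _) α : 𝓞_ℂ_[p]) : ℂ_[p]) : ℝ≥0) := by
        rw [← mk_ne_zero_iff, ← h2, Ne, coeff_eq_zero_iff, hP', pow_zero, pow_one, not_le, one_div]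
        exact inv_lt_one_of_one_lt₀ (by exact_mod_cast (prm p).one_lt)
      have h4 := oFlatVal_eq h2 h3
      rw [hP', pow_zero, pow_one] at h4; rw [nO_eq, ← h4, NNReal.coe_one]
    have h2 : nO (P.eval₂ (castRingHom _) zO - P.eval₂ (castRingHom _) α) < 1 := by
      rw [← Polynomial.eval_map, ← eval_map]; obtain ⟨c, hc⟩ := Polynomial.sub_dvd_eval_sub zO α (P.map (castRingHom 𝓞_ℂ_[p]))
      rw [hc, nO_mul, nO_sub_comm]; exact (mul_le_of_le_one_right (nO_nonneg _) (nO_le_one _)).trans_lt hzO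
    have h3 := nO_eq_one_of_sub h2 h1
    have h4 : ((P.eval₂ (castRingHom _) zO : 𝓞_ℂ_[p]) : ℂ_[p]) = ((P.eval₂ (castRingHom _) (ζ ^ i) : PadicAlgCl p) : ℂ_[p]) := by
      have e1 := hom_eval₂ P (castRingHom _) (𝓞_ℂ_[p].subtype) zO
      have e2 := hom_eval₂ P (castRingHom _)
        (coeRingHom : PadicAlgCl p →+* ℂ_[p]) (ζ ^ i)
      refine e1.trans (Eq.trans ?_ e2.symm); have e3 : (coeRingHom : PadicAlgCl p →+* ℂ_[p]) (ζ ^ i) = z := hze; rw [e3]; congr 1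
      exact Subsingleton.elim _ _
    rw [nO, h4] at h3; exact (norm_extends p _).symm.trans h3

end ResidueRoots
section ResidueDegree
lemma norm_p_padicAlgCl : ‖(p : PadicAlgCl p)‖ = (p : ℝ)⁻¹ := by
  rw [← map_natCast (algebraMap ℚ_[p] (PadicAlgCl p)), norm_algebraMap', Padic.norm_p]

lemma norm_primitiveRoot_sub_one {n : ℕ} {ζ : PadicAlgCl p} (hζ : IsPrimitiveRoot ζ (p ^ (n + 1))) :
    ‖ζ - 1‖ ^ (p ^ (n + 1)).totient = (p : ℝ)⁻¹ := by
  have hp := prm p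
  have h1 := Polynomial.eval_one_cyclotomic_prime_pow (R := PadicAlgCl p) (p := p) n
  rw [Polynomial.cyclotomic_eq_prod_X_sub_primitiveRoots hζ, eval_prod] at h1
  simp only [eval_sub, eval_X, eval_C] at h1
  have hle : ∀ x y : PadicAlgCl p, IsPrimitiveRoot x (p ^ (n + 1)) → IsPrimitiveRoot y (p ^ (n + 1)) → ‖1 - y‖ ≤ ‖1 - x‖ := fun x y hx hy => by
    obtain ⟨i, -, rfl⟩ := hx.eq_pow_of_pow_eq_one hy.pow_eq_one; have hx1 : ‖x‖ = 1 :=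
      (pow_eq_one_iff_of_nonneg (norm_nonneg _) (pow_ne_zero (n + 1) hp.ne_zero)).1 (by rw [← norm_pow, hx.pow_eq_one, norm_one])
    rw [← mul_neg_geom_sum x i, norm_mul]; refine mul_le_of_le_one_right (norm_nonneg _) ?_
    refine IsUltrametricDist.norm_sum_le_of_forall_le_of_nonneg zero_le_one fun k _ => ?_
    simp_all
  have h2 : ∀ y ∈ primitiveRoots (p ^ (n + 1)) (PadicAlgCl p), ‖1 - y‖ = ‖ζ - 1‖ := fun y hy => by
    have hy' := isPrimitiveRoot_of_mem_primitiveRoots hy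
    rw [norm_sub_rev ζ]; grind
  have h3 := congrArg norm h1
  rw [norm_prod, Finset.prod_congr rfl h2, Finset.prod_const, hζ.card_primitiveRoots, norm_p_padicAlgCl] at h3
  exact h3

lemma exists_norm_sum_eq {f : ℕ} {η : PadicAlgCl p} (hη1 : ‖η‖ = 1) (hη : ∀ P : Polynomial ℤ, P.map (castRingHom (ZMod p)) ≠ 0 → P.degree < f →
      ‖P.eval₂ (castRingHom _) η‖ = 1) (c : Fin f → ℚ_[p]) (hc : c ≠ 0) :
    ∃ k : ℤ, ‖∑ i : Fin f, c i • η ^ (i : ℕ)‖ = (p : ℝ) ^ k := by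
  obtain ⟨j, hj⟩ := Function.ne_iff.1 hc
  have : Nonempty (Fin f) := ⟨j⟩
  obtain ⟨i0, hi0⟩ := Finite.exists_max fun i => ‖c i‖
  have hc0 : c i0 ≠ 0 := by aesop
  let d : Fin f → ℤ_[p] := fun i => ⟨c i / c i0, by
    rw [norm_div]; exact div_le_one_of_le₀ (hi0 i) (norm_nonneg _)⟩
  let m : Fin f → ℕ := fun i => (d i).zmodRepr
  have hdm : ∀ i, ‖c i / c i0 - m i‖ < 1 := fun i => by
    have h := (d i).sub_zmodRepr_mem
    rw [IsLocalRing.mem_maximalIdeal, PadicInt.mem_nonunits] at h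
    have e : ((d i - (m i : ℤ_[p]) : ℤ_[p]) : ℚ_[p]) = c i / c i0 - m i := by push_cast; rfl
    rw [← e]; exact h
  let P : Polynomial ℤ := ∑ i : Fin f, Polynomial.C (m i : ℤ) * X ^ (i : ℕ)
  have hPdeg : P.degree < f := by
    refine mem_degreeLT.1 (sum_mem fun i _ => mem_degreeLT.2 ?_)
    refine (Polynomial.degree_C_mul_X_pow_le _ _).trans_lt ?_; exact_mod_cast i.2
  have hPc : P.coeff i0 = m i0 := by
    simp only [P, finsetSum_coeff, Polynomial.coeff_C_mul_X_pow, Fin.val_inj, Finset.sum_ite_eq, mem_univ, if_true]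
  have hP0 : P.map (castRingHom (ZMod p)) ≠ 0 := fun h => by
    have h1 := congrArg (fun q => Polynomial.coeff q (i0 : ℕ)) h
    simp only [coeff_map, hPc, coeff_zero, eq_intCast, Int.cast_natCast] at h1; rw [ZMod.natCast_eq_zero_iff] at h1; have h2 := hdm i0
    rw [div_self hc0] at h2; have h3 : ‖((m i0 : ℕ) : ℚ_[p])‖ < 1 := (Padic.norm_natCast_lt_one_iff).2 h1; have h4 : ‖(1 : ℚ_[p])‖ < 1 := by
      rw [← sub_add_cancel (1 : ℚ_[p]) (m i0)]; exact (Padic.nonarchimedean _ _).trans_lt (max_lt h2 h3)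
    rw [norm_one] at h4; exact lt_irrefl _ h4
  have hP := hη P hP0 hPdeg
  have hPe : P.eval₂ (castRingHom (PadicAlgCl p)) η = ∑ i : Fin f, (m i : PadicAlgCl p) * η ^ (i : ℕ) := by
    simp only [P, Polynomial.eval₂_finsetSum, Polynomial.eval₂_mul, Polynomial.eval₂_X_pow]
    exact sum_congr rfl fun i _ => by simp
  have hsub : ‖∑ i : Fin f, (c i / c i0) • η ^ (i : ℕ) - P.eval₂ (castRingHom (PadicAlgCl p)) η‖ < 1 := by
    rw [hPe, ← sum_sub_distrib]; obtain ⟨i, -, hi⟩ := IsUltrametricDist.exists_norm_finsetSum_le (univ : Finset (Fin f))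
      fun i => (c i / c i0) • η ^ (i : ℕ) - (m i : PadicAlgCl p) * η ^ (i : ℕ)
    refine hi.trans_lt ?_; rw [smul_def, ← sub_mul, norm_mul, norm_pow, hη1, one_pow, mul_one,
      ← map_natCast (algebraMap ℚ_[p] (PadicAlgCl p)), ← map_sub, norm_algebraMap']
    exact hdm i
  have hone : ‖∑ i : Fin f, (c i / c i0) • η ^ (i : ℕ)‖ = 1 := by
    have h1 := IsUltrametricDist.norm_add_eq_max_of_norm_ne_norm (x := P.eval₂ (castRingHom (PadicAlgCl p)) η)
      (y := ∑ i : Fin f, (c i / c i0) • η ^ (i : ℕ) - P.eval₂ (castRingHom (PadicAlgCl p)) η) (by linarith)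
    rwa [add_sub_cancel, hP, max_eq_left hsub.le] at h1
  refine ⟨-(c i0).valuation, ?_⟩
  have e : ∑ i : Fin f, c i • η ^ (i : ℕ) = c i0 • ∑ i : Fin f, (c i / c i0) • η ^ (i : ℕ) := by
    rw [smul_sum]; refine sum_congr rfl fun i _ => ?_
    rw [smul_smul, mul_div_cancel₀ _ hc0]
  rw [e, norm_smul, hone, mul_one, Padic.norm_eq_zpow_neg_valuation hc0]

lemma linearIndependent_pow_mul_pow {f n : ℕ} {η ζ : PadicAlgCl p} (hη1 : ‖η‖ = 1)
    (hη : ∀ P : Polynomial ℤ, P.map (castRingHom (ZMod p)) ≠ 0 → P.degree < f →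
      ‖P.eval₂ (castRingHom _) η‖ = 1) (hζ : IsPrimitiveRoot ζ (p ^ (n + 1))) :
    LinearIndependent ℚ_[p] fun ij : Fin f × Fin (p ^ (n + 1)).totient => η ^ (ij.1 : ℕ) * (ζ - 1) ^ (ij.2 : ℕ) := by
  set w := ‖ζ - 1‖ with hw
  have hwt := norm_primitiveRoot_sub_one hζ
  rw [← hw] at hwt
  set T := (p ^ (n + 1)).totient with hT
  have hT0 : 0 < T := Nat.totient_pos.2 (pow_pos (prm p).pos _)
  have hw0 : 0 < w := (norm_nonneg _).lt_of_ne fun h => by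
    rw [← hw, ] at h; rw [← h, zero_pow hT0.ne'] at hwt; exact (inv_pos.2 (p_pos (p := p))).ne hwt
  have hkey : ∀ (j j' : ℕ) (k k' : ℤ), j < j' → j' < T → (p : ℝ) ^ k * w ^ j ≠ (p : ℝ) ^ k' * w ^ j' :=
    fun j j' k k' hlt hj' h => by
    obtain ⟨d, rfl⟩ := Nat.exists_eq_add_of_lt hlt; have h1 : (p : ℝ) ^ (k - k') = w ^ (d + 1) := by
      rw [zpow_sub₀ p_pos.ne', div_eq_iff (zpow_ne_zero _ p_pos.ne')]; refine mul_right_cancel₀ (pow_pos hw0 j).ne' (h.trans ?_)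
      rw [add_assoc, pow_add]; ring
    have h2 : ((p : ℝ) ^ (k - k')) ^ T = (w ^ (d + 1)) ^ T := by rw [h1]
    rw [← pow_mul, mul_comm (d + 1), pow_mul, hwt, inv_pow, ← zpow_natCast, ← zpow_natCast, ← zpow_neg, ← zpow_mul] at h2
    have h3 := zpow_right_injective₀ p_pos (one_lt_p (p := p)).ne' h2
    have h4 : (T : ℤ) ∣ ((d + 1 : ℕ) : ℤ) := by
      rw [← Int.dvd_neg, ← h3]; exact Dvd.intro_left _ rfl
    have h5 := Nat.le_of_dvd (Nat.succ_pos d) (Int.natCast_dvd_natCast.1 h4)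
    omega
  rw [Fintype.linearIndependent_iff]
  intro g hg
  by_contra! hne
  obtain ⟨⟨i1, j1⟩, h1⟩ := hne
  let x : Fin T → PadicAlgCl p := fun j => ∑ i : Fin f, g (i, j) • η ^ (i : ℕ)
  have hx : ∀ j, x j = 0 ∨ ∃ k : ℤ, ‖x j‖ = (p : ℝ) ^ k := fun j => by
    by_cases h : (fun i => g (i, j)) = 0
    · left
      simp only [x]; exact Finset.sum_eq_zero fun i _ => by rw [congrFun h i]; simp
    · exact Or.inr (exists_norm_sum_eq hη1 hη _ h)
  have hx1 : x j1 ≠ 0 := fun h => by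
    obtain ⟨k, hk⟩ := exists_norm_sum_eq hη1 hη (fun i => g (i, j1)) (fun h => h1 (congrFun h i1))
    have h2 : ‖x j1‖ = (p : ℝ) ^ k := hk
    rw [h, norm_zero] at h2; exact (zpow_pos p_pos k).ne h2
  have hsum : ∑ j : Fin T, x j * (ζ - 1) ^ (j : ℕ) = 0 := by
    rw [← hg, Fintype.sum_prod_type_right]; refine sum_congr rfl fun j _ => ?_
    simp only [x, sum_mul, smul_mul_assoc]
  have : Nonempty (Fin T) := ⟨j1⟩
  obtain ⟨j0, hj0⟩ := Finite.exists_max fun j => ‖x j‖ * w ^ (j : ℕ)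
  have hpos : 0 < ‖x j0‖ * w ^ (j0 : ℕ) :=
    (mul_pos (norm_pos_iff.2 hx1) (pow_pos hw0 _)).trans_le (hj0 j1)
  have hx0 : x j0 ≠ 0 := by simp_all
  have hlt : ∀ j, j ≠ j0 → ‖x j * (ζ - 1) ^ (j : ℕ)‖ < ‖x j0‖ * w ^ (j0 : ℕ) := fun j hj => by
    rw [norm_mul, norm_pow, ← hw]; refine (hj0 j).lt_of_ne fun h => ?_
    obtain h2 | ⟨k, hk⟩ := hx j
    · simp_all
    obtain h3 | ⟨k', hk'⟩ := hx j0
    · exact hx0 h3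
    grind
  rw [← Finset.add_sum_erase _ _ (mem_univ j0)] at hsum
  have h2 : ‖x j0 * (ζ - 1) ^ (j0 : ℕ)‖ = ‖∑ j ∈ univ.erase j0, x j * (ζ - 1) ^ (j : ℕ)‖ := by
    rw [eq_neg_of_add_eq_zero_left hsum, norm_neg]
  rw [norm_mul, norm_pow, ← hw] at h2
  obtain ⟨j, hj, hle⟩ := IsUltrametricDist.exists_norm_finsetSum_le (univ.erase j0)
    fun j => x j * (ζ - 1) ^ (j : ℕ)
  rcases (univ.erase j0).eq_empty_or_nonempty with h3 | h3
  · simp_all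
  · exact (hlt j (Finset.ne_of_mem_erase (hj h3))).not_ge (h2.trans_le hle)

lemma chi_eq_one {σ : GalQp p} (h : ∀ (n : ℕ) (t : PadicAlgCl p), t ^ p ^ n = 1 → σ t = t) : chi p σ = 1 := by
  refine Units.ext (PadicInt.ext_of_toZModPow.1 fun n => ?_)
  have : NeZero (p ^ n) := ⟨pow_ne_zero n (prm p).ne_zero⟩
  obtain ⟨η, hη⟩ := exists_primitiveRoot (PadicAlgCl p) (p ^ n)
  have h1 := cyclotomicCharacter.spec p (σ : PadicAlgCl p ≃+* PadicAlgCl p) η hη.pow_eq_one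
  have h2 : η ^ ((chi p σ : ℤ_[p]).toZModPow n).val = η ^ (1 : ℕ) :=
    h1.symm.trans ((h n η hη.pow_eq_one).trans (pow_one η).symm)
  rcases Nat.eq_zero_or_pos n with rfl | hn
  · rfl
  · have h3 := hη.pow_inj (ZMod.val_lt _) (one_lt_pow hn.ne' (prm p).one_lt) h2
    rw [val_one, map_one, ← ZMod.natCast_zmod_val (((chi p σ : ℤ_[p]ˣ) : ℤ_[p]).toZModPow n), h3, cast_one]

lemma exists_pow_eq_of_fixed (K : IntermediateField ℚ_[p] (PadicAlgCl p)) [FiniteDimensional ℚ_[p] K]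
    {a : Ĉ} {F : ℕ} (hF : 0 < F) (ha0 : a ≠ 0) (ha : a ^ p ^ F = a)
    (hfix : ∀ σ ∈ HK K, galFlat (σ : GalQp p) a = a) :
    ∃ f, 0 < f ∧ f ≤ Module.finrank ℚ_[p] K ∧ a ^ p ^ f = a := by
  have hp := prm p
  obtain ⟨η, hη1, hησ, hηP⟩ := exists_residue_root hF ha0 ha
  have hint : IsIntegral (ZMod p) a := by
    refine ⟨X ^ p ^ F - Polynomial.X, ?_, ?_⟩
    · refine Polynomial.monic_X_pow_sub ?_; rw [Polynomial.degree_X]; exact_mod_cast one_lt_pow hF.ne' hp.one_lt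
    · simp [ha]
  set f := (minpoly (ZMod p) a).natDegree with hf
  have hf0 : 0 < f := minpoly.natDegree_pos hint
  have hηf : ∀ P : Polynomial ℤ, P.map (castRingHom (ZMod p)) ≠ 0 → P.degree < f → ‖P.eval₂ (castRingHom _) η‖ = 1 := fun P hP hPf => hηP P (by
    have e : evZ a P = Polynomial.aeval a (P.map (castRingHom (ZMod p))) := by
      rw [Polynomial.aeval_def, Polynomial.eval₂_map]; change P.eval₂ _ _ = _; congr 1; exact Subsingleton.elim _ _
    have h0 : evZ a P ≠ 0 := fun h => by
      rw [e] at h; have h1 := Polynomial.degree_le_of_dvd (minpoly.dvd (ZMod p) a h) hP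
      rw [Polynomial.degree_eq_natDegree (minpoly.ne_zero hint)] at h1; exact ((h1.trans Polynomial.degree_map_le).trans_lt hPf).ne rfl
    have h1 : evZ a P ^ p ^ F = evZ a P := by
      have h2 := hom_eval₂ P (castRingHom Ĉ) (iterateFrobenius Ĉ p F) a
      rw [iterateFrobenius_def, iterateFrobenius_def, ha] at h2; refine h2.trans ?_; change _ = P.eval₂ _ _; congr 1; exact Subsingleton.elim _ _
    have hpF := one_lt_pow hF.ne' hp.one_lt
    have h2 : evZ a P ^ (p ^ F - 1) = 1 := by
      refine mul_left_cancel₀ h0 ?_; rw [← pow_succ', mul_one, Nat.sub_add_cancel hpF.le, h1]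
    refine (pow_eq_one_iff_of_nonneg (fn_nonneg _) (n := p ^ F - 1) (by omega)).1 ?_
    rw [← fn_pow, h2, fn_one])
  refine ⟨f, hf0, ?_, ?_⟩
  · let S : Set (PadicAlgCl p) := {t | ∃ n, t ^ p ^ n = 1}
    let M : IntermediateField ℚ_[p] (PadicAlgCl p) := K ⊔ adjoin ℚ_[p] S
    have hηM : η ∈ M := by
      rw [← InfiniteGalois.fixedField_fixingSubgroup M]; rintro ⟨σ, hσ⟩; have h1 : ∀ t ∈ M, σ t = t := by simp_all
      have hσK : σ ∈ GK K := fun t => h1 t (le_sup_left (a := K) t.2)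
      have hchi : chi p σ = 1 := chi_eq_one fun n t ht => h1 t
        (le_sup_right (a := K) (subset_adjoin _ _ ⟨n, ht⟩))
      exact hησ σ (hfix ⟨σ, hσK⟩ hchi)
    obtain ⟨n, ζ, hζ, hηL⟩ : ∃ (n : ℕ) (ζ : PadicAlgCl p), IsPrimitiveRoot ζ (p ^ (n + 1)) ∧ η ∈ K ⊔ adjoin ℚ_[p] {ζ} := by
      have hM : M = adjoin ℚ_[p] ((K : Set (PadicAlgCl p)) ∪ S) := by
        rw [IntermediateField.adjoin_union, IntermediateField.adjoin_self]
      rw [hM] at hηM; obtain ⟨s, hs, hηs⟩ := IntermediateField.exists_finset_of_mem_adjoin hηM; classical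
      have h1 : ∃ n, ∀ t ∈ s, t ∈ K ∨ t ^ p ^ n = 1 := by
        clear hηs
        induction s using Finset.induction_on with
        | empty => simp
        | insert t s _ ih =>
          rw [Finset.coe_insert, Set.insert_subset_iff] at hs; obtain ⟨n, hn⟩ := ih hs.2
          have hmono : ∀ (t : PadicAlgCl p) (k l : ℕ), t ^ p ^ k = 1 → t ^ p ^ (k + l) = 1 := fun t k l h => by
            rw [pow_add, pow_mul, h, one_pow]
          rcases hs.1 with h | ⟨m, h⟩
          · simp_all
          · refine ⟨n + m, fun x hx => (mem_insert.1 hx).elim (fun e => Or.inr ?_) fun hx => ?_⟩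
            · rw [e, add_comm]; simp_all
            · exact (hn x hx).imp_right fun h => hmono _ _ _ h
      obtain ⟨n, hn⟩ := h1; have : NeZero (p ^ (n + 1)) := ⟨pow_ne_zero _ hp.ne_zero⟩
      obtain ⟨ζ, hζ⟩ := exists_primitiveRoot (PadicAlgCl p) (p ^ (n + 1)); refine ⟨n, ζ, hζ, (adjoin_le_iff.2 fun t ht => ?_) hηs⟩
      rcases hn t ht with h | h
      · exact le_sup_left (a := K) h
      · obtain ⟨i, -, rfl⟩ := hζ.eq_pow_of_pow_eq_one (ξ := t) (by rw [pow_succ, pow_mul, h, one_pow])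
        exact pow_mem (le_sup_right (a := K) (mem_adjoin_simple_self _ _)) i
    have hζint : IsIntegral ℚ_[p] ζ := hζ.isIntegral (pow_pos hp.pos _) |>.tower_top
    have hfin : FiniteDimensional ℚ_[p] (adjoin ℚ_[p] {ζ}) :=
      adjoin.finiteDimensional hζint
    have hrank : Module.finrank ℚ_[p] (adjoin ℚ_[p] {ζ}) ≤ (p ^ (n + 1)).totient := by
      rw [adjoin.finrank hζint, ← Polynomial.natDegree_cyclotomic (p ^ (n + 1)) ℚ_[p]]
      refine Polynomial.natDegree_le_of_dvd (minpoly.dvd _ _ ?_) (Polynomial.cyclotomic_ne_zero _ _)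
      rw [← eval_map_algebraMap, Polynomial.map_cyclotomic]; exact hζ.isRoot_cyclotomic (pow_pos hp.pos _)
    have hind := linearIndependent_pow_mul_pow hη1 hηf hζ
    let Lf : IntermediateField ℚ_[p] (PadicAlgCl p) := K ⊔ adjoin ℚ_[p] {ζ}
    have hζL : ζ ∈ Lf := le_sup_right (a := K) (mem_adjoin_simple_self _ _)
    let v : Fin f × Fin (p ^ (n + 1)).totient → Lf := fun ij =>
      ⟨η ^ (ij.1 : ℕ) * (ζ - 1) ^ (ij.2 : ℕ), mul_mem (pow_mem hηL _) (pow_mem (sub_mem hζL (one_mem _)) _)⟩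
    have hv : LinearIndependent ℚ_[p] v := LinearIndependent.of_comp Lf.val.toLinearMap hind
    have h1 := hv.fintype_card_le_finrank
    rw [Fintype.card_prod, Fintype.card_fin, Fintype.card_fin] at h1
    have h2 := h1.trans ((IntermediateField.finrank_sup_le K _).trans (Nat.mul_le_mul_left _ hrank))
    exact Nat.le_of_mul_le_mul_right h2 (Nat.totient_pos.2 (pow_pos hp.pos _))
  · have hfin : FiniteDimensional (ZMod p) (adjoin (ZMod p) {a}) :=
      adjoin.finiteDimensional hint
    have hfin' : Finite (adjoin (ZMod p) {a}) := Module.finite_of_finite (ZMod p)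
    have := Fintype.ofFinite (adjoin (ZMod p) {a})
    have h1 := Module.card_eq_pow_finrank (K := ZMod p) (V := adjoin (ZMod p) {a})
    rw [ZMod.card, adjoin.finrank hint, ← hf] at h1; have h2 := FiniteField.pow_card (⟨a, mem_adjoin_simple_self _ _⟩ : adjoin (ZMod p) {a})
    simp_all

end ResidueDegree
section FieldEK
lemma fn_lim_unique {x : ℕ → Ĉ} {y z : Ĉ} (hy : Tendsto (fun n => fn (x n - y)) atTop (𝓝 0))
    (hz : Tendsto (fun n => fn (x n - z)) atTop (𝓝 0)) : y = z := by
  have h : Tendsto (fun n => fn (x n - y) + fn (x n - z)) atTop (𝓝 0) := by simpa using hy.add hz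
  refine sub_eq_zero.1 (fn_eq_zero.1 (le_antisymm (ge_of_tendsto' h fun n => ?_) (fn_nonneg _)))
  have e : y - z = (x n - z) - (x n - y) := by ring
  rw [e]
  refine (fn_sub_le _ _).trans (max_le ?_ ?_)
  · linarith [fn_nonneg (x n - y)]
  · linarith [fn_nonneg (x n - z)]

lemma exists_pow_eq_self {F : ℕ} (hF : 0 < F) {t : Ĉ} (ht : fn (t ^ p ^ F - t) < 1) :
    ∃ a, a ^ p ^ F = a ∧ fn (t - a) < 1 ∧ ∀ σ : GalQp p, galFlat σ t = t → galFlat σ a = a := by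
  set q := p ^ F with hq
  have hq1 : 1 < q := one_lt_pow hF.ne' (prm p).one_lt
  let x : ℕ → Ĉ := fun n => t ^ q ^ n
  have hstep : ∀ n, fn (x (n + 1) - x n) = fn (t ^ q - t) ^ q ^ n := fun n => by
    have e : x (n + 1) - x n = (t ^ q - t) ^ q ^ n := by
      have hqn : q ^ n = p ^ (F * n) := by rw [hq, ← pow_mul]
      change t ^ q ^ (n + 1) - t ^ q ^ n = (t ^ q - t) ^ q ^ n; rw [pow_succ' q, pow_mul, hqn, sub_pow_char_pow]
    rw [e, fn_pow]
  have h0 := tendsto_pow_atTop_nhds_zero_of_lt_one (fn_nonneg (t ^ q - t)) ht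
  have hlim : Tendsto (fun n => fn (x (n + 1) - x n)) atTop (𝓝 0) := by
    simp only [hstep]; exact h0.comp (tendsto_pow_atTop_atTop_of_one_lt hq1)
  obtain ⟨a, ha⟩ := exists_lim x hlim
  have hxs : ∀ n, x (n + 1) = x n ^ q := fun n =>
    (congrArg (t ^ ·) (pow_succ q n)).trans (pow_mul t (q ^ n) q)
  refine ⟨a, ?_, ?_, fun σ hσ => ?_⟩
  · have h1 : Tendsto (fun n => fn (x (n + 1) - a ^ q)) atTop (𝓝 0) := by
      have h2 := ha.pow q
      rw [zero_pow (by omega)] at h2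
      refine h2.congr fun n => ?_
      rw [hxs, ← fn_pow, hq, sub_pow_char_pow]
    exact fn_lim_unique h1 (ha.comp (tendsto_add_atTop_nat 1))
  · have h1 : ∀ n, fn (x n - t) ≤ fn (t ^ q - t) := fun n => by
      induction n with
      | zero => simp [x, fn_nonneg]
      | succ n ih =>
        rw [← sub_add_sub_cancel (x (n + 1)) (x n) t]; refine fn_add_le_of ?_ ih; rw [hstep]
        exact pow_le_of_le_one (fn_nonneg _) ht.le (pow_ne_zero n (by omega))
    have h2 : fn (a - t) ≤ fn (t ^ q - t) :=
      fn_le_of_tendsto (fn_nonneg _) h1 (ha.congr fun n => by simp)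
    rw [fn_sub_comm]; linarith
  · refine fn_lim_unique (x := x) ?_ ha; refine ha.congr fun n => ?_
    rw [← fn_galFlat σ (x n - a), map_sub, map_pow, hσ]

variable (p) in
/-- The valuation ring of `ℂ_p^♭`. -/
abbrev OV : ValuationSubring Ĉ := (flatVal p).valuationSubring

lemma mem_OV {x : Ĉ} : x ∈ OV p ↔ fn x ≤ 1 := (Valuation.mem_valuationSubring_iff _ _)

lemma residue_eq_zero_iff {x : OV p} : IsLocalRing.residue (OV p) x = 0 ↔ fn (x : Ĉ) < 1 := by
  rw [IsLocalRing.residue_eq_zero_iff, IsLocalRing.mem_maximalIdeal, mem_nonunits_iff]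
  refine ⟨fun h => (mem_OV.1 x.2).lt_of_ne fun h1 => h ?_, fun h hx => ?_⟩
  · have hx0 : (x : Ĉ) ≠ 0 := fun h0 => by simp_all
    refine IsUnit.of_mul_eq_one (⟨(x : Ĉ)⁻¹, mem_OV.2 (by rw [fn_inv, h1, inv_one])⟩ : OV p) ?_
    exact Subtype.ext (mul_inv_cancel₀ hx0)
  · obtain ⟨y, hy⟩ := hx.exists_right_inv; have h1 := congrArg (fun z : OV p => fn (z : Ĉ)) hy
    simp only [coe_mul, fn_mul, OneMemClass.coe_one, fn_one] at h1
    exact h1.not_lt (mul_lt_one_of_nonneg_of_lt_one_left (fn_nonneg _) h (mem_OV.1 y.2))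

instance : CharP (IsLocalRing.ResidueField (OV p)) p := by
  refine (CharP.charP_iff_prime_eq_zero (prm p)).2 ?_
  rw [← map_natCast (IsLocalRing.residue (OV p)), residue_eq_zero_iff]
  simp

lemma exists_natCast_sub_lt {ε : Ĉ} (hε : IsEps p ε) {c : Ĉ} (hc : c ∈ EQp p) (h : fn c ≤ 1) : ∃ m : ℕ, fn (c - (m : Ĉ)) < 1 := by
  rcases h.eq_or_lt with h1 | h1
  · have hc0 : c ≠ 0 := by aesop
    obtain ⟨m, -, -, n, h2, h3⟩ := hε.lead_le hc hc0; have hn : n = 0 := by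
      rw [h1] at h2; exact (zpow_right_strictAnti₀ (fn_pos.2 hε.sub_one_ne_zero) hε.fn_sub_one_lt).injective (h2.symm.trans (zpow_zero _).symm)
    refine ⟨m, ?_⟩; rw [hn, zpow_zero, mul_one, h1, mul_one] at h3; exact h3.trans_lt hε.fn_sub_one_lt
  · exact ⟨0, by simpa using h1⟩

lemma exists_pow_sub_lt {ε : Ĉ} (hε : IsEps p ε) {t : Ĉ} (hint : IsIntegral (EQp p) t) (ht : fn t ≤ 1) : ∃ F, 0 < F ∧ fn (t ^ p ^ F - t) < 1 := by
  let g := minpoly (EQp p) t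
  obtain ⟨i0, hi0r, hi0⟩ := Finset.exists_max_image (range (g.natDegree + 1)) (fun i => fn (g.coeff i : Ĉ)) ⟨0, by simp⟩
  have hlead : fn (g.coeff g.natDegree : Ĉ) = 1 := by
    rw [(minpoly.monic hint).coeff_natDegree]; simp
  have hg0 : 0 < fn (g.coeff i0 : Ĉ) :=
    zero_lt_one.trans_le (hlead.symm.trans_le (hi0 g.natDegree (by simp)))
  have h1 : ∀ i ∈ range (g.natDegree + 1), ∃ m : ℕ, fn ((g.coeff i : Ĉ) / (g.coeff i0 : Ĉ) - (m : Ĉ)) < 1 := fun i hi =>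
    exists_natCast_sub_lt hε (div_mem (g.coeff i).2 (g.coeff i0).2) (by
      rw [fn_div]; exact div_le_one_of_le₀ (hi0 i hi) (fn_nonneg _))
  choose! m hm using h1
  have hsum : ∑ i ∈ range (g.natDegree + 1), ((g.coeff i : Ĉ) / (g.coeff i0 : Ĉ)) * t ^ i = 0 := by
    have h2 := minpoly.aeval (EQp p) t
    rw [Polynomial.aeval_eq_sum_range] at h2; have h3 := congrArg (fun z => z / (g.coeff i0 : Ĉ)) h2
    simp only [zero_div, Finset.sum_div] at h3; rw [← h3]; refine sum_congr rfl fun i _ => ?_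
    rw [smul_def, mul_div_right_comm]; rfl
  have hlt : fn (∑ i ∈ range (g.natDegree + 1), (m i : Ĉ) * t ^ i) < 1 := by
    rw [← fn_neg, ← zero_sub, ← hsum, ← sum_sub_distrib]; refine fn_sum_lt _ _ zero_lt_one fun i hi => ?_
    rw [← sub_mul, fn_mul, fn_pow]; exact mul_lt_one_of_nonneg_of_lt_one_left (fn_nonneg _) (hm i hi) (pow_le_one₀ (fn_nonneg _) ht)
  let _ : Algebra (ZMod p) (IsLocalRing.ResidueField (OV p)) := ZMod.algebra _ p
  let tO : OV p := ⟨t, mem_OV.2 ht⟩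
  let τ := IsLocalRing.residue (OV p) tO
  have halg : IsIntegral (ZMod p) τ := by
    refine IsAlgebraic.isIntegral ⟨∑ i ∈ range (g.natDegree + 1), monomial i (m i : ZMod p), fun h => ?_, ?_⟩
    · have h2 := congrArg (fun q => Polynomial.coeff q i0) h
      simp only [finsetSum_coeff, Polynomial.coeff_monomial, Finset.sum_ite_eq', hi0r, if_true, coeff_zero] at h2; rw [ZMod.natCast_eq_zero_iff] at h2
      have h3 := hm i0 hi0r
      rw [div_self (fn_pos.1 hg0), (CharP.cast_eq_zero_iff Ĉ p (m i0)).2 h2, sub_zero, fn_one] at h3; simp_all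
    · have h2 := residue_eq_zero_iff.2 (show fn ((∑ i ∈ range (g.natDegree + 1), (m i : OV p) * tO ^ i : OV p) : Ĉ) < 1 by
        push_cast; exact hlt)
      rw [map_sum] at h2; rw [map_sum, ← h2]; refine sum_congr rfl fun i _ => ?_
      rw [Polynomial.aeval_monomial, map_natCast, map_mul, map_natCast, map_pow]
  have hfin : FiniteDimensional (ZMod p) (adjoin (ZMod p) {τ}) :=
    adjoin.finiteDimensional halg
  have hfin' : Finite (adjoin (ZMod p) {τ}) := Module.finite_of_finite (ZMod p)
  have := Fintype.ofFinite (adjoin (ZMod p) {τ})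
  have h2 := Module.card_eq_pow_finrank (K := ZMod p) (V := adjoin (ZMod p) {τ})
  rw [ZMod.card] at h2
  have h3 := FiniteField.pow_card (⟨τ, mem_adjoin_simple_self _ _⟩ : adjoin (ZMod p) {τ})
  rw [h2] at h3
  have h4 : τ ^ p ^ _ = τ := congrArg Subtype.val h3
  refine ⟨_, Module.finrank_pos (R := ZMod p) (M := adjoin (ZMod p) {τ}), ?_⟩
  have h5 := residue_eq_zero_iff (x := tO ^ p ^ Module.finrank (ZMod p) (adjoin (ZMod p) {τ}) - tO)
  rw [map_sub, map_pow, sub_eq_zero] at h5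
  exact h5.1 h4

lemma IsUniformizerEK.fn_pos (h : IsUniformizerEK K ϖ) : 0 < fn ϖ := PseudoPhiGamma.fn_pos.2 h.2.1

lemma IsUniformizerEK.fn_lt_one (h : IsUniformizerEK K ϖ) : fn ϖ < 1 := by
  have := h.2.2.1; aesop

lemma IsUniformizerEK.fn_le (h : IsUniformizerEK K ϖ) {x : Ĉ} (hx : x ∈ EK K) (hx1 : fn x < 1) : fn x ≤ fn ϖ := by
  have := h.2.2.2 x hx (by exact_mod_cast hx1); aesop

lemma IsUniformizerEK.exists_zpow (h : IsUniformizerEK K ϖ) {x : Ĉ} (hx : x ∈ EK K) (hx0 : x ≠ 0) : ∃ n : ℤ, fn x = fn ϖ ^ n := by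
  have hy : 1 < (fn ϖ)⁻¹ := (one_lt_inv₀ h.fn_pos).2 h.fn_lt_one
  obtain ⟨n, hn1, hn2⟩ := exists_mem_Ico_zpow (PseudoPhiGamma.fn_pos.2 hx0) hy
  have hϖn : 0 < fn ϖ ^ n := zpow_pos h.fn_pos n
  refine ⟨-n, ?_⟩
  have h1 : 1 ≤ fn (x * ϖ ^ n) := by
    rw [fn_mul, fn_zpow]; rw [inv_zpow] at hn1; exact (inv_le_iff_one_le_mul₀ hϖn).1 hn1
  have h2 : ¬ 1 < fn (x * ϖ ^ n) := fun h3 => by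
    have h4 := h.fn_le (inv_mem (mul_mem hx (zpow_mem h.1 n))) (by rw [fn_inv]; exact inv_lt_one_of_one_lt₀ h3)
    rw [fn_inv, fn_mul, fn_zpow, inv_le_comm₀ (mul_pos (PseudoPhiGamma.fn_pos.2 hx0) hϖn) h.fn_pos] at h4
    rw [zpow_add₀ (inv_ne_zero h.fn_pos.ne'), zpow_one, inv_zpow] at hn2; rw [lt_inv_mul_iff₀ hϖn, mul_comm] at hn2; linarith
  have h3 : fn x * fn ϖ ^ n = 1 := by rw [← fn_zpow, ← fn_mul]; exact le_antisymm (not_lt.1 h2) h1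
  rw [zpow_neg]
  exact eq_inv_of_mul_eq_one_left h3

lemma EQp_subset_EK {x : Ĉ} (hx : x ∈ EQp p) : x ∈ EK K := (EK K).algebraMap_mem ⟨x, hx⟩

lemma IsUniformizerEK.exists_pow (h : IsUniformizerEK K ϖ) (hε : IsEps p ε) : ∃ e : ℕ, 0 < e ∧ fn (ε - 1) = fn ϖ ^ e := by
  obtain ⟨n, hn⟩ := h.exists_zpow (EQp_subset_EK (sub_mem hε.eps_mem_EQp (one_mem _))) hε.sub_one_ne_zero
  have h1 : 0 < n := by
    by_contra! h2
    exact hε.fn_sub_one_lt.not_ge (hn ▸ one_le_zpow_of_nonpos₀ h.fn_pos h.fn_lt_one.le h2)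
  lift n to ℕ using h1.le
  aesop

lemma pow_pow_mul_eq {a : Ĉ} {f : ℕ} (ha : a ^ p ^ f = a) (k : ℕ) : a ^ p ^ (f * k) = a := by
  induction k with
  | zero => simp
  | succ k ih => rw [Nat.mul_succ, pow_add, pow_mul, ih, ha]

lemma mem_EK_of_pow_eq (hε : IsEps p ε) {a : Ĉ} {F : ℕ} (hF : 0 < F) (ha : a ^ p ^ F = a)
    (hσ : ∀ σ ∈ HK K, galFlat (σ : GalQp p) a = a) : a ∈ EK K := by
  refine (mem_EK hε).2 ⟨?_, hσ⟩
  have : CharP (EQp p) p := (algebraMap (EQp p) Ĉ).charP (algebraMap (EQp p) Ĉ).injective p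
  exact (galois_poly_separable (K := EQp p) p (p ^ F) (dvd_pow_self p hF.ne')).of_dvd
    (minpoly.dvd _ _ (by simp [ha]))

lemma exists_residue_field (hε : IsEps p ε) (K : IntermediateField ℚ_[p] (PadicAlgCl p)) [FiniteDimensional ℚ_[p] K] :
    ∃ F, 0 < F ∧ ∀ t ∈ EK K, fn t ≤ 1 → ∃ a ∈ EK K, a ^ p ^ F = a ∧ fn (t - a) < 1 := by
  refine ⟨(Module.finrank ℚ_[p] K).factorial, Nat.factorial_pos _, fun t ht ht1 => ?_⟩
  obtain ⟨hsep, hfix⟩ := (mem_EK hε).1 ht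
  obtain ⟨F, hF, hFt⟩ := exists_pow_sub_lt hε hsep.isIntegral ht1
  obtain ⟨a, ha, hta, haσ⟩ := exists_pow_eq_self hF hFt
  have haf : ∀ σ ∈ HK K, galFlat (σ : GalQp p) a = a := fun σ hσ => haσ σ (hfix σ hσ)
  refine ⟨a, mem_EK_of_pow_eq hε hF ha haf, ?_, hta⟩
  rcases eq_or_ne a 0 with rfl | ha0
  · exact zero_pow (pp_ne_zero _)
  obtain ⟨f, hf0, hfN, haf⟩ := exists_pow_eq_of_fixed K hF ha0 ha haf
  obtain ⟨k, hk⟩ := Nat.dvd_factorial hf0 hfN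
  rw [hk]
  exact pow_pow_mul_eq haf k

end FieldEK
section BasisEK
variable [FiniteDimensional ℚ_[p] K]

lemma pow_pow_finite {F : ℕ} (hF : 0 < F) : {a : Ĉ | a ^ p ^ F = a}.Finite := by
  classical
  have h1 : 1 < p ^ F := one_lt_pow hF.ne' (prm p).one_lt
  have h0 := FiniteField.X_pow_card_sub_X_ne_zero Ĉ h1
  refine ((X ^ p ^ F - X : Polynomial Ĉ).roots.toFinset.finite_toSet).subset fun a ha => ?_
  simp_all

lemma fn_eq_one_of_pow {F : ℕ} (hF : 0 < F) {a : Ĉ} (ha : a ^ p ^ F = a) (h0 : a ≠ 0) : fn a = 1 := by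
  have h1 : 1 < p ^ F := one_lt_pow hF.ne' (prm p).one_lt
  have h2 : a ^ (p ^ F - 1) = 1 := by
    refine mul_right_cancel₀ h0 ?_; rw [← pow_succ, Nat.sub_add_cancel h1.le, ha, one_mul]
  have h3 := congrArg fn h2
  rw [fn_pow, fn_one] at h3
  exact (pow_eq_one_iff_of_nonneg (fn_nonneg a) (by omega)).1 h3

lemma IsUniformizerEK.exists_lead (h : IsUniformizerEK K ϖ) (hε : IsEps p ε) : ∃ F, 0 < F ∧ ∀ x ∈ EK K, x ≠ 0 → ∃ a ∈ EK K, a ^ p ^ F = a ∧ a ≠ 0 ∧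
      ∃ n : ℤ, fn x = fn ϖ ^ n ∧ fn (x - a * ϖ ^ n) ≤ fn ϖ * fn x := by
  obtain ⟨F, hF, hres⟩ := exists_residue_field hε K
  refine ⟨F, hF, fun x hx hx0 => ?_⟩
  obtain ⟨n, hn⟩ := h.exists_zpow hx hx0
  have hϖn : ϖ ^ n ≠ 0 := zpow_ne_zero n h.2.1
  have hmem : x / ϖ ^ n ∈ EK K := div_mem hx (zpow_mem h.1 n)
  have h1 : fn (x / ϖ ^ n) = 1 := by
    rw [fn_div, fn_zpow, hn, div_self (zpow_pos h.fn_pos n).ne']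
  obtain ⟨a, haK, ha, hlt⟩ := hres _ hmem h1.le
  refine ⟨a, haK, ha, fun h0 => ?_, n, hn, ?_⟩
  · simp_all
  · have e : x - a * ϖ ^ n = (x / ϖ ^ n - a) * ϖ ^ n := by field_simp
    rw [e, fn_mul, fn_zpow, hn]; exact mul_le_mul_of_nonneg_right (h.fn_le (sub_mem hmem haK) hlt) (zpow_pos h.fn_pos n).le

lemma IsUniformizerEK.exists_lead_mul (h : IsUniformizerEK K ϖ) (hε : IsEps p ε) :
    ∃ F e, 0 < F ∧ ∀ y ∈ EK K, y ≠ 0 → ∃ a ∈ EK K, a ^ p ^ F = a ∧ a ≠ 0 ∧ ∃ c ∈ EQp p, ∃ j : ℕ, j < e ∧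
      fn y = fn c * fn ϖ ^ j ∧ fn (y - c * (a * ϖ ^ j)) ≤ fn ϖ * fn y := by
  obtain ⟨F, hF, hlead⟩ := h.exists_lead hε
  obtain ⟨e, he, hee⟩ := h.exists_pow hε
  refine ⟨F, e, hF, fun y hy hy0 => ?_⟩
  obtain ⟨n, hn⟩ := h.exists_zpow hy hy0
  have he' : (0 : ℤ) < e := by exact_mod_cast he
  obtain ⟨j, hje, hj⟩ : ∃ j : ℕ, j < e ∧ (j : ℤ) = n % e :=
    ⟨(n % e).toNat, by have := Int.emod_lt_of_pos n he'; omega, Int.toNat_of_nonneg (Int.emod_nonneg n he'.ne')⟩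
  have hπE : (ε - 1) ^ (n / e) ∈ EQp p := zpow_mem (sub_mem hε.eps_mem_EQp (one_mem _)) _
  have hπ0 : (ε - 1) ^ (n / e) ≠ 0 := zpow_ne_zero _ hε.sub_one_ne_zero
  have hπn : fn ((ε - 1) ^ (n / e)) = fn ϖ ^ ((e : ℤ) * (n / e)) := by rw [fn_zpow, hee, zpow_mul, zpow_natCast]
  have hzn : fn (y / (ε - 1) ^ (n / e)) = fn ϖ ^ j := by
    rw [fn_div, hn, hπn, ← zpow_sub₀ h.fn_pos.ne', ← zpow_natCast, hj]; congr 1; have := Int.emod_add_mul_ediv n e; omega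
  obtain ⟨a, haK, ha, ha0, n', hn', hyn⟩ := hlead (y / (ε - 1) ^ (n / e)) (div_mem hy (EQp_subset_EK hπE)) (div_ne_zero hy0 hπ0)
  have hnj : n' = j := by
    refine (zpow_right_strictAnti₀ h.fn_pos h.fn_lt_one).injective ?_; change fn ϖ ^ n' = fn ϖ ^ (j : ℤ); rw [← hn', hzn, zpow_natCast]
  rw [hnj, zpow_natCast] at hyn
  refine ⟨a, haK, ha, ha0, _, hπE, j, hje, ?_, ?_⟩
  · rw [← hzn, ← fn_mul, mul_div_cancel₀ _ hπ0]
  · have e1 : y - (ε - 1) ^ (n / e) * (a * ϖ ^ j) = (ε - 1) ^ (n / e) * (y / (ε - 1) ^ (n / e) - a * ϖ ^ j) := by field_simp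
    rw [e1, fn_mul]; refine (mul_le_mul_of_nonneg_left hyn (fn_nonneg _)).trans_eq ?_; rw [mul_left_comm, ← fn_mul, mul_div_cancel₀ _ hπ0]

/-- The sum `∑ c_i w_i`, as an additive map in `c`. -/
def dotSum {ι : Type} [Fintype ι] (w : ι → Ĉ) : (ι → Ĉ) →+ Ĉ where
  toFun c := ∑ i, c i * w i
  map_zero' := by simp
  map_add' c d := by simp [add_mul, sum_add_distrib]

lemma dotSum_apply {ι : Type} [Fintype ι] (w c : ι → Ĉ) : dotSum w c = ∑ i, c i * w i := rfl

lemma dotSum_single {ι : Type} [Fintype ι] [DecidableEq ι] (w : ι → Ĉ) (i : ι) (c : Ĉ) : dotSum w (single i c) = c * w i := by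
  rw [dotSum_apply, sum_eq_single i (fun b _ hb => by simp_all)
    (fun h => absurd (mem_univ i) h), Pi.single_eq_same]

lemma dotSum_tendsto {ι : Type} [Fintype ι] (w : ι → Ĉ) (a : ℕ → ι → Ĉ)
    (ha : ∀ i, Tendsto (fun n => fn (a n i)) atTop (𝓝 0)) : Tendsto (fun n => fn (dotSum w (a n))) atTop (𝓝 0) := by
  have h0 : ∀ n i, 0 ≤ fn (a n i) * fn (w i) := fun n i => mul_nonneg (fn_nonneg _) (fn_nonneg _)
  refine squeeze_zero (g := fun n => ∑ i, fn (a n i) * fn (w i)) (fun n => fn_nonneg _) (fun n => ?_) ?_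
  · rw [dotSum_apply]; refine fn_sum_le _ _ (sum_nonneg fun i _ => h0 n i) fun i hi => ?_
    rw [fn_mul]; exact single_le_sum (f := fun i => fn (a n i) * fn (w i)) (fun i _ => h0 n i) hi
  · simpa using tendsto_finsetSum univ fun i _ => (ha i).mul_const (fn (w i))

lemma IsUniformizerEK.exists_coords (h : IsUniformizerEK K ϖ) (hε : IsEps p ε) :
    ∃ (ι : Type) (_ : Fintype ι) (w : ι → Ĉ), (∀ i, w i ∈ EK K ∧ w i ≠ 0) ∧
      ∀ t, (∀ δ > 0, ∃ y ∈ EK K, fn (t - y) < δ) → ∃ c : ι → Ĉ, (∀ i, c i ∈ EQp p) ∧ dotSum w c = t ∧ ∀ i, fn (c i) ≤ (fn (w i))⁻¹ * fn t := by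
  classical
  obtain ⟨F, e, hF, hlead⟩ := h.exists_lead_mul hε
  have hfin : {a : Ĉ | (a ^ p ^ F = a) ∧ a ∈ EK K ∧ a ≠ 0}.Finite := (pow_pow_finite (p := p) hF).subset fun a ha => ha.1
  have _ := hfin.to_subtype
  let κ := {a : Ĉ | (a ^ p ^ F = a) ∧ a ∈ EK K ∧ a ≠ 0}
  obtain ⟨N, ⟨f⟩⟩ := Finite.exists_equiv_fin (κ × Fin e)
  let w : Fin N → Ĉ := fun i => ((f.symm i).1 : Ĉ) * ϖ ^ ((f.symm i).2 : ℕ)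
  have hw : ∀ i, w i ∈ EK K ∧ w i ≠ 0 := fun i =>
    ⟨mul_mem (f.symm i).1.2.2.1 (pow_mem h.1 _), mul_ne_zero (f.symm i).1.2.2.2 (pow_ne_zero _ h.2.1)⟩
  have hwf : ∀ i, fn (w i) = fn ϖ ^ ((f.symm i).2 : ℕ) := fun i => by
    rw [fn_mul, fn_eq_one_of_pow hF (f.symm i).1.2.1 (f.symm i).1.2.2.2, one_mul, fn_pow]
  have hwa : ∀ a (ha : (a ^ p ^ F = a) ∧ a ∈ EK K ∧ a ≠ 0) (j : ℕ) (hj : j < e), ∃ i, w i = a * ϖ ^ j ∧ fn (w i) = fn ϖ ^ j := fun a ha j hj =>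
    ⟨f (⟨a, ha⟩, ⟨j, hj⟩), by simp only [w, Equiv.symm_apply_apply], by simp_all⟩
  clear_value w
  refine ⟨Fin N, inferInstance, w, hw, fun t ht => ?_⟩
  have := successive_approx {t | ∀ δ > 0, ∃ y ∈ EK K, fn (t - y) < δ} (EQp p : Set Ĉ)
    (zero_mem _) (fun a ha b hb => add_mem ha hb) hε.EQp_closed (dotSum w) (dotSum_tendsto w) 1 one_ne_zero
    (fun i => (fn (w i))⁻¹) (fun i => inv_nonneg.2 (fn_nonneg _)) (fn ϖ) (fn_nonneg _) h.fn_lt_one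
    (fun s hs => ?_) t ht
  · simp only [pow_one] at this; exact this
  rcases eq_or_ne s 0 with rfl | hs0
  · exact ⟨0, fun _ => zero_mem _, by rw [map_zero, sub_zero]; exact hs, by simp, fun _ => by simp⟩
  obtain ⟨y, hy, hsy⟩ := hs (fn ϖ * fn s) (mul_pos h.fn_pos (PseudoPhiGamma.fn_pos.2 hs0))
  have hsy' : fn y = fn s := by
    refine fn_eq_of_sub_lt ?_; rw [fn_sub_comm]; exact hsy.trans_le (mul_le_of_le_one_left (fn_nonneg _) h.fn_lt_one.le)
  have hy0 : y ≠ 0 := PseudoPhiGamma.fn_pos.1 (hsy' ▸ PseudoPhiGamma.fn_pos.2 hs0)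
  obtain ⟨a, haK, ha, ha0, c, hc, j, hje, hyc, hyn⟩ := hlead y hy hy0
  obtain ⟨i0, hi0, hi0'⟩ := hwa a ⟨ha, haK, ha0⟩ j hje
  have hF1 : dotSum w (single i0 c) = c * (a * ϖ ^ j) := by rw [dotSum_single, hi0]
  refine ⟨single i0 c, fun i => ?_, fun δ hδ => ?_, ?_, fun i => ?_⟩
  · rcases eq_or_ne i i0 with rfl | hi
    · rw [Pi.single_eq_same]; exact hc
    · rw [Pi.single_eq_of_ne hi]; exact zero_mem _
  · obtain ⟨y', hy', hsy'⟩ := hs δ hδ; refine ⟨y' - c * (a * ϖ ^ j), sub_mem hy' (mul_mem (EQp_subset_EK hc) (mul_mem haK (pow_mem h.1 _))), ?_⟩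
    rwa [hF1, sub_sub_sub_cancel_right]
  · rw [hF1, ← sub_add_sub_cancel s y]; exact fn_add_le_of hsy.le (hsy' ▸ hyn)
  · rw [pow_one]; rcases eq_or_ne i i0 with rfl | hi
    · rw [Pi.single_eq_same, ← hsy', hyc, hi0', mul_comm (fn c), inv_mul_cancel_left₀ (pow_pos h.fn_pos j).ne']
    · rw [Pi.single_eq_of_ne hi, fn_zero]; exact mul_nonneg (inv_nonneg.2 (fn_nonneg _)) (fn_nonneg _)

lemma IsUniformizerEK.EK_closed (h : IsUniformizerEK K ϖ) (hε : IsEps p ε) : FlatClosed (EK K : Set Ĉ) := by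
  obtain ⟨ι, _, w, hw, hc⟩ := h.exists_coords hε
  intro t ht
  obtain ⟨c, hcE, rfl, -⟩ := hc t fun δ hδ => by
    obtain ⟨y, hy, hlt⟩ := ht (δ / 2) (half_pos hδ); exact ⟨y, hy, hlt.trans_lt (half_lt_self hδ)⟩
  exact sum_mem fun i _ => mul_mem (EQp_subset_EK (hcE i)) (hw i).1

lemma IsUniformizerEK.coords (h : IsUniformizerEK K ϖ) (hε : IsEps p ε) : ∃ (ι : Type) (_ : Fintype ι) (w : ι → Ĉ), (∀ i, w i ∈ EK K ∧ w i ≠ 0) ∧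
      ∀ t ∈ EK K, ∃ c : ι → Ĉ, (∀ i, c i ∈ EQp p) ∧ dotSum w c = t ∧ ∀ i, fn (c i) ≤ (fn (w i))⁻¹ * fn t := by
  obtain ⟨ι, _, w, hw, hc⟩ := h.exists_coords hε
  exact ⟨ι, _, w, hw, fun t ht => hc t fun δ hδ => ⟨t, ht, by simpa using hδ⟩⟩

instance : Module (EQp p) (EK K) := Algebra.toModule

instance : SMul (EQp p) (EK K) := Algebra.toSMul

lemma IsUniformizerEK.fn_trace_le (h : IsUniformizerEK K ϖ) (hε : IsEps p ε) (z : EK K) :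
    fn (trace (EQp p) (EK K) z : Ĉ) ≤ fn (z : Ĉ) := by
  obtain ⟨ι, _, w, hw, hc⟩ := h.coords hε
  let w' : ι → EK K := fun i => ⟨w i, (hw i).1⟩
  have hspan : ∀ z : EK K, ∃ c : ι → EQp p, ∑ i, c i • w' i = z ∧ ∀ i, fn (c i : Ĉ) ≤ (fn (w i))⁻¹ * fn (z : Ĉ) := fun z => by
    obtain ⟨c, hcE, hsum, hle⟩ := hc z z.2; refine ⟨fun i => ⟨c i, hcE i⟩, Subtype.ext ?_, hle⟩
    rw [AddSubmonoidClass.coe_finsetSum]; exact hsum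
  have hfd : FiniteDimensional (EQp p) (EK K) := by
    refine ⟨Submodule.fg_def.2 ⟨Set.range w', Set.finite_range w', ?_⟩⟩; refine eq_top_iff.2 fun z _ => ?_
    obtain ⟨c, rfl, -⟩ := hspan z; exact sum_mem fun i _ => smul_mem _ _ (subset_span ⟨i, rfl⟩)
  have hsep : Algebra.IsSeparable (EQp p) (EK K) := ⟨fun z =>
    (isSeparable_map_iff (EK K).val Subtype.val_injective).1 ((mem_EK hε).1 z.2).1⟩
  let C := ∑ i, (fn (w i))⁻¹ * fn (trace (EQp p) (EK K) (w' i) : Ĉ)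
  have hbound : ∀ z : EK K, fn (trace (EQp p) (EK K) z : Ĉ) ≤ C * fn (z : Ĉ) := fun z => by
    obtain ⟨c, hz, hle⟩ := hspan z; have e : trace (EQp p) (EK K) z = ∑ i, c i * trace (EQp p) (EK K) (w' i) := by
      rw [← hz, map_sum]; exact sum_congr rfl fun i _ => map_smul _ _ _
    rw [e, AddSubmonoidClass.coe_finsetSum]; have h0 : ∀ i, 0 ≤ (fn (w i))⁻¹ * fn (trace (EQp p) (EK K) (w' i) : Ĉ) := fun i =>
      mul_nonneg (inv_nonneg.2 (fn_nonneg _)) (fn_nonneg _)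
    refine fn_sum_le _ _ (mul_nonneg (sum_nonneg fun i _ => h0 i) (fn_nonneg _)) fun i hi => ?_
    rw [coe_mul, fn_mul]; refine (mul_le_mul_of_nonneg_right (hle i) (fn_nonneg _)).trans ?_; rw [mul_right_comm]
    exact mul_le_mul_of_nonneg_right (single_le_sum (f := fun i => (fn (w i))⁻¹ *
      fn (trace (EQp p) (EK K) (w' i) : Ĉ)) (fun i _ => h0 i) hi) (fn_nonneg _)
  have hpow : ∀ m : ℕ, trace (EQp p) (EK K) (z ^ p ^ m) = trace (EQp p) (EK K) z ^ p ^ m := fun m => by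
    have : CharP (EQp p) p := (algebraMap (EQp p) Ĉ).charP (algebraMap (EQp p) Ĉ).injective p
    have : CharP (AlgebraicClosure (EQp p)) p := charP_of_injective_algebraMap (algebraMap (EQp p) _).injective p
    refine (algebraMap (EQp p) (AlgebraicClosure (EQp p))).injective ?_
    rw [trace_eq_sum_embeddings, map_pow, trace_eq_sum_embeddings, sum_pow_char_pow]; simp only [map_pow]
  by_contra! hlt
  have ht0 := (fn_nonneg _).trans_lt hlt
  have h1 : fn (z : Ĉ) / fn (trace (EQp p) (EK K) z : Ĉ) < 1 := (div_lt_one ht0).2 hlt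
  have h2 := (tendsto_pow_atTop_nhds_zero_of_lt_one (div_nonneg (fn_nonneg _) (fn_nonneg _)) h1).comp
    (tendsto_pow_atTop_atTop_of_one_lt (prm p).one_lt)
  have h3 := h2.const_mul C
  rw [mul_zero] at h3
  refine (zero_lt_one (α := ℝ)).not_ge (ge_of_tendsto' h3 fun m => ?_)
  have h4 := hbound (z ^ p ^ m)
  rw [hpow, coe_pow, coe_pow, fn_pow, fn_pow] at h4
  rw [Function.comp_apply, div_pow, ← mul_div_assoc]
  exact (one_le_div (pow_pos ht0 _)).2 h4

lemma IsUniformizerEK.fn_trace_le_one (h : IsUniformizerEK K ϖ) (hε : IsEps p ε) {z : EK K}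
    (hz : fn (ε - 1) * fn (z : Ĉ) < 1) : fn (trace (EQp p) (EK K) z : Ĉ) ≤ 1 := by
  rcases eq_or_ne (trace (EQp p) (EK K) z : Ĉ) 0 with h0 | h0
  · simp_all
  obtain ⟨m, -, -, n, hn, -⟩ := hε.lead_le (trace (EQp p) (EK K) z).2 h0
  have hε0 := PseudoPhiGamma.fn_pos.2 hε.sub_one_ne_zero
  have h1 : fn (ε - 1) ^ (1 + n) < 1 := by
    rw [zpow_add₀ hε0.ne', zpow_one, ← hn]; exact (mul_le_mul_of_nonneg_left (h.fn_trace_le hε z) hε0.le).trans_lt hz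
  have h2 : 0 < 1 + n := by
    by_contra! h3
    exact h1.not_ge (one_le_zpow_of_nonpos₀ hε0 hε.fn_sub_one_lt.le h3)
  rw [hn]
  exact zpow_le_one₀ hε0 hε.fn_sub_one_lt.le (by omega)

lemma flatOrd_eq (x : Ĉ) : flatOrd p x = -Real.logb p (fn x) := rfl

lemma IsUniformizerEK.rK_le_one (h : IsUniformizerEK K ϖ) (hε : IsEps p ε) : rK K ≤ 1 := by
  rw [rK]
  split_ifs with hV
  · exact le_rfl
  have hbdd : BddAbove {t | ∃ x ∈ invDifferent K, x ≠ 0 ∧ t = - flatOrd p (x : Ĉ)} := by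
    by_contra hb
    exact hV (Real.sSup_of_not_bddAbove hb)
  have hp1 : (1 : ℝ) < p := one_lt_p
  have key : ∀ x ∈ invDifferent K, x ≠ 0 → (p : ℝ) ≤ fn (x : Ĉ) ^ 2 → (2 * vDifferent K)⁻¹ ≤ 1 := fun x hx hx0 hle => by
    have h1 : (1 / 2 : ℝ) ≤ vDifferent K := by
      refine le_trans ?_ (le_csSup hbdd ⟨x, hx, hx0, rfl⟩); have hx0' : (x : Ĉ) ≠ 0 := by simp_all
      rw [flatOrd_eq, neg_neg, Real.le_logb_iff_rpow_le hp1 (PseudoPhiGamma.fn_pos.2 hx0'), ← Real.sqrt_eq_rpow]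
      exact Real.sqrt_le_iff.2 ⟨fn_nonneg _, hle⟩
    exact inv_le_one_of_one_le₀ (by linarith)
  have hmem : ∀ x : EK K, fn (ε - 1) * fn (x : Ĉ) < 1 → x ∈ invDifferent K := fun x hx y hy => by
    have hy' : fn (y : Ĉ) ≤ 1 := hy
    refine h.fn_trace_le_one hε (z := x * y) (lt_of_le_of_lt ?_ hx); rw [coe_mul, fn_mul]
    exact mul_le_mul_of_nonneg_left (mul_le_of_le_one_right (fn_nonneg _) hy') (fn_nonneg _)
  have hεp : (p : ℝ) ≤ (fn (ε - 1))⁻¹ :=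
    (le_inv_comm₀ (PseudoPhiGamma.fn_pos.2 hε.sub_one_ne_zero) p_pos).1 (fn_cycl_sub_one_le hε.mem_cycl)
  obtain ⟨e, he, hee⟩ := h.exists_pow hε
  rcases Nat.lt_or_ge e 2 with he2 | he2
  · obtain ⟨x, hx, hx0, hx1⟩ : ∃ x ∈ invDifferent K, x ≠ 0 ∧ 1 < fn (x : Ĉ) := by
      by_contra! hall
      refine hV (le_antisymm (csSup_le ⟨0, 1, hmem 1 ?_, one_ne_zero, ?_⟩ ?_) (le_csSup hbdd ⟨1, hmem 1 ?_, one_ne_zero, ?_⟩))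
      · simpa using hε.fn_sub_one_lt
      · simp [flatOrd_eq]
      · rintro _ ⟨x, hx, hx0, rfl⟩; rw [flatOrd_eq, neg_neg]; exact Real.logb_nonpos hp1 (fn_nonneg _) (hall x hx hx0)
      · simpa using hε.fn_sub_one_lt
      · simp [flatOrd_eq]
    refine key x hx hx0 ?_; have hx0' : (x : Ĉ) ≠ 0 := fun h0 => hx0 (Subtype.ext h0)
    have h1 : fn (x : Ĉ)⁻¹ ≤ fn ϖ := h.fn_le (inv_mem x.2) (by rw [fn_inv]; exact inv_lt_one_of_one_lt₀ hx1)
    obtain rfl : e = 1 := by omega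
    rw [pow_one] at hee; rw [fn_inv, ← hee] at h1; have h2 := hεp.trans (inv_le_of_inv_le₀ (PseudoPhiGamma.fn_pos.2 hx0') h1)
    exact h2.trans (le_self_pow₀ hx1.le two_ne_zero)
  · have hϖ0 := h.fn_pos
    refine key ⟨(ϖ ^ (e - 1))⁻¹, inv_mem (pow_mem h.1 _)⟩ (hmem _ ?_) (fun h0 => ?_) ?_
    · change fn (ε - 1) * fn (ϖ ^ (e - 1))⁻¹ < 1; rw [fn_inv, fn_pow, hee, ← div_eq_mul_inv, div_lt_one (pow_pos hϖ0 _)]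
      exact pow_lt_pow_right_of_lt_one₀ hϖ0 h.fn_lt_one (by omega)
    · exact inv_ne_zero (pow_ne_zero _ h.2.1) (congrArg Subtype.val h0)
    · change (p : ℝ) ≤ fn (ϖ ^ (e - 1))⁻¹ ^ 2; rw [fn_inv, fn_pow, inv_pow, ← pow_mul]; refine hεp.trans ?_; rw [hee]
      exact inv_anti₀ (pow_pos hϖ0 _) (pow_le_pow_of_le_one hϖ0.le h.fn_lt_one.le (by omega))

end BasisEK
section Lattices
variable {θ θ' θ₁ B B' δ : ℝ} {x y : ATilde p}

/-- Gauss bounds for some radius larger than `θ`. -/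
def OC (θ : ℝ) (x : Ã) : Prop := ∃ θ', θ < θ' ∧ θ' ≤ 1 ∧ ∃ B, GB θ' B x

lemma GB.oc (hx : GB θ' B x) (h : θ < θ') (h1 : θ' ≤ 1) : OC θ x := ⟨θ', h, h1, B, hx⟩

lemma OC.common (h0 : 0 < θ) (hx : OC θ x) (hy : OC θ y) : ∃ θ', θ < θ' ∧ θ' ≤ 1 ∧ ∃ B, GB θ' B x ∧ GB θ' B y := by
  obtain ⟨θ₁, h1, h1', B₁, hx⟩ := hx
  obtain ⟨θ₂, h2, h2', B₂, hy⟩ := hy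
  have h := h0.trans (lt_min h1 h2)
  exact ⟨min θ₁ θ₂, lt_min h1 h2, (min_le_left _ _).trans h1', max B₁ B₂, (hx.mono_left h.le (min_le_left _ _)).mono_right (le_max_left _ _),
    (hy.mono_left h.le (min_le_right _ _)).mono_right (le_max_right _ _)⟩

lemma OC.sub (h0 : 0 < θ) (hx : OC θ x) (hy : OC θ y) : OC θ (x - y) := by
  obtain ⟨θ', h, h1, B, hx, hy⟩ := hx.common h0 hy
  exact (hx.sub (h0.trans h) h1 hy).oc h h1

lemma OC.mul (h0 : 0 < θ) (hx : OC θ x) (hy : OC θ y) : OC θ (x * y) := by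
  obtain ⟨θ', h, h1, B, hx, hy⟩ := hx.common h0 hy
  exact (hx.mul (h0.trans h) h1 hy).oc h h1

/-- Limits for the Gauss norm of radius `θ` of elements with larger radius. -/
def CV (θ : ℝ) (x : Ã) : Prop := ∀ δ > 0, ∃ y, OC θ y ∧ GB θ δ (x - y)

lemma OC.cv (hx : OC θ x) : CV θ x := fun δ hδ => ⟨x, hx, by rw [sub_self]; exact GB_zero hδ.le⟩

lemma CV.sub (h0 : 0 < θ) (h1 : θ ≤ 1) (hx : CV θ x) (hy : CV θ y) : CV θ (x - y) := fun δ hδ => by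
  obtain ⟨x', hx', hxx⟩ := hx δ hδ
  obtain ⟨y', hy', hyy⟩ := hy δ hδ
  exact ⟨x' - y', hx'.sub h0 hy', by rw [sub_sub_sub_comm]; exact hxx.sub h0 h1 hyy⟩

lemma CV.mul (h0 : 0 < θ) (h1 : θ ≤ 1) (hx : CV θ x) (hy : CV θ y) (hxB : GB θ B x) (hyB : GB θ B' y) : CV θ (x * y) := by
  intro δ hδ
  have hC : 0 < max B B' + 1 := by linarith [hxB.nonneg.trans (le_max_left B B')]
  obtain ⟨x', hx', hxx⟩ := hx (min 1 (δ / (max B B' + 1))) (lt_min one_pos (div_pos hδ hC))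
  obtain ⟨y', hy', hyy⟩ := hy (δ / (max B B' + 1)) (div_pos hδ hC)
  refine ⟨x' * y', hx'.mul h0 hy', ?_⟩
  have e : x * y - x' * y' = (x - x') * y + x' * (y - y') := by ring
  have hx'B : GB θ (max B B' + 1) x' := by
    rw [← sub_sub_cancel x x']; exact (hxB.mono_right (by grind)).sub h0 h1 (hxx.mono_right ((min_le_left _ _).trans (by
      linarith [hxB.nonneg.trans (le_max_left B B')])))
  rw [e]
  refine GB.add h0 h1 ((hxx.mul h0 h1 hyB).mono_right ?_) ((hx'B.mul h0 h1 hyy).mono_right (mul_div_cancel₀ δ hC.ne').le)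
  refine (mul_le_mul (min_le_right _ _) (by grind : B' ≤ max B B' + 1) hyB.nonneg (by positivity)).trans_eq ?_
  grind

/-- Convergence of a `p`-adic series to `x`. -/
def PSum (s : ℕ → Ã) (x : Ã) : Prop := ∀ N, (p : Ã) ^ N ∣ x - ∑ n ∈ range N, (p : Ã) ^ n * s n

lemma exists_PSum (s : ℕ → Ã) : ∃ x, PSum s x := by
  obtain ⟨x, hx⟩ := IsPrecomplete.prec (I := span {(p : Ã)}) inferInstance
    (f := fun N => ∑ n ∈ range N, (p : Ã) ^ n * s n) (fun {m n} hmn => by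
      rw [SModEq.comm, SModEq.sub_mem, smul_eq_mul, mul_top, Ideal.span_singleton_pow, mem_span_singleton,
        ← Finset.sum_range_add_sum_Ico _ hmn, add_sub_cancel_left]
      exact dvd_sum fun i hi => (pow_dvd_pow _ (mem_Ico.1 hi).1).mul_right _)
  refine ⟨x, fun N => ?_⟩
  have := hx N
  rwa [SModEq.comm, SModEq.sub_mem, smul_eq_mul, mul_top, Ideal.span_singleton_pow, mem_span_singleton] at this

lemma eq_of_forall_dvd (h : ∀ N, (p : Ã) ^ N ∣ x - y) : x = y := WittVector.ext fun n => coeff_eq_of_dvd (h (n + 1)) n.lt_succ_self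

lemma PSum.GB_tail {s : ℕ → Ã} (h0 : 0 < θ) (h1 : θ ≤ 1) (hδ : 0 ≤ δ) (h : PSum s x) (N : ℕ)
    (hs : ∀ n ≥ N, GB θ δ ((p : Ã) ^ n * s n)) : GB θ δ (x - ∑ n ∈ range N, (p : Ã) ^ n * s n) := by
  refine GB.of_approx fun M => ⟨∑ n ∈ Finset.Ico N (max M N), (p : Ã) ^ n * s n, GB.sum h0 h1 hδ _ _ fun n hn => hs n (mem_Ico.1 hn).1, ?_⟩
  rw [sub_sub, Finset.sum_range_add_sum_Ico _ (le_max_right M N)]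
  exact (pow_dvd_pow _ (le_max_left M N)).trans (h _)

lemma PSum.gb_cv {s : ℕ → Ã} {b : ℕ → ℝ} (h0 : 0 < θ) (h1 : θ < θ₁) (h1' : θ₁ ≤ 1) (hB : 0 ≤ B) (h : PSum s x)
    (hs : ∀ n, GB θ₁ (b n) (s n)) (hb : ∀ n, b n * θ ^ n ≤ B) (hlim : Tendsto (fun n => b n * θ ^ n) atTop (𝓝 0)) :
    GB θ B x ∧ CV θ x := by
  have hθ1 := h1.le.trans h1'
  have hs' : ∀ n, GB θ (b n * θ ^ n) ((p : Ã) ^ n * s n) := fun n => by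
    rw [mul_comm (b n)]; exact ((hs n).mono_left h0.le h1.le).p_pow_mul h0 n
  refine ⟨by simpa using h.GB_tail h0 hθ1 hB 0 fun n _ => (hs' n).mono_right (hb n), fun δ hδ => ?_⟩
  obtain ⟨N, hN⟩ := eventually_atTop.1 (hlim.eventually_le_const hδ)
  refine ⟨∑ n ∈ range N, (p : Ã) ^ n * s n, ?_, h.GB_tail h0 hθ1 hδ.le N fun n hn => (hs' n).mono_right (hN n hn)⟩
  refine GB.oc (GB.sum (h0.trans h1) h1' (sum_nonneg (f := fun n => θ₁ ^ n * b n) (s := range N)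
    fun n _ => mul_nonneg (pow_nonneg (h0.trans h1).le n) (hs n).nonneg) _ _ fun n hn => ?_) h1 h1'
  exact ((hs n).p_pow_mul (h0.trans h1) n).mono_right (single_le_sum (f := fun n => θ₁ ^ n * b n)
    (fun n _ => mul_nonneg (pow_nonneg (h0.trans h1).le n) (hs n).nonneg) hn)

lemma PSum_dg (x : Ã) : PSum (fun n => ω (dg x n)) x := fun N => by
  simpa only [mul_comm] using dvd_sub_sum x N

lemma tendsto_iff_cv (h0 : 0 < θ) (h1 : θ < 1) (hx : GB θ B x) : Tendsto (fun k => fn (dg x k) * θ ^ k) atTop (𝓝 0) ↔ CV θ x := by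
  refine ⟨fun h => ((PSum_dg x).gb_cv h0 h1 le_rfl hx.nonneg (fun n => GB_teichmuller _) hx h).2, fun h => ?_⟩
  refine tendsto_order.2 ⟨fun a ha => Eventually.of_forall fun k => ha.trans_le (mul_nonneg (fn_nonneg _) (pow_nonneg h0.le k)), fun a ha => ?_⟩
  obtain ⟨y, ⟨θ', hθ', hθ1, B', hy⟩, hxy⟩ := h (a / 2) (half_pos ha)
  have hlim := (tendsto_pow_atTop_nhds_zero_of_lt_one (div_nonneg h0.le (h0.trans hθ').le) ((div_lt_one (h0.trans hθ')).2 hθ')).const_mul B'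
  rw [mul_zero] at hlim
  filter_upwards [hlim.eventually_le_const (half_pos ha)] with k hk
  refine lt_of_le_of_lt ?_ (half_lt_self ha)
  have hθk := pow_pos h0 k
  rw [← le_div_iff₀ hθk, show x = (x - y) - (-y) by ring]
  refine fn_dg_sub_le (fun i hi => fn_dg_le_div h0 h1.le hxy hi) fun i hi => ?_
  refine (fn_dg_le_div (h0.trans hθ') hθ1 (hy.neg (h0.trans hθ') hθ1) hi).trans ?_
  rw [div_pow, mul_div_assoc', div_le_iff₀ (pow_pos (h0.trans hθ') k)] at hk
  rw [div_le_div_iff₀ (pow_pos (h0.trans hθ') k) hθk]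
  exact hk

variable (K)

/-- The elements of `𝐀_K` in the closed ball of radius `B` for the Gauss norm of radius `θ`. -/
def Lf (θ B : ℝ) : Set Ã := {x | x ∈ AK K ∧ GB θ B x ∧ CV θ x}

variable {K}

lemma mem_Fil_iff {ρ : ℝ≥0} (hρ : 0 < ρ) {c : ℝ} : x ∈ Fil K ρ c ↔ x ∈ Lf K ((p : ℝ) ^ (-(ρ : ℝ))) ((p : ℝ) ^ (-c)) := by
  have e : ∀ k, gaussTerm ρ x k = fn (dg x k) * ((p : ℝ) ^ (-(ρ : ℝ))) ^ k := fun k => by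
    rw [fn_dg_eq, ← rpow_natCast ((p : ℝ) ^ (-(ρ : ℝ))), ← rpow_mul p_pos.le, gaussTerm]; congr 2; ring
  have h0 : 0 < (p : ℝ) ^ (-(ρ : ℝ)) := Real.rpow_pos_of_pos p_pos _
  have h1 : (p : ℝ) ^ (-(ρ : ℝ)) < 1 := Real.rpow_lt_one_of_one_lt_of_neg one_lt_p (neg_lt_zero.2 (by exact_mod_cast hρ))
  have h2 : (∀ k, gaussTerm ρ x k ≤ (p : ℝ) ^ (-c)) ↔ GB ((p : ℝ) ^ (-(ρ : ℝ))) ((p : ℝ) ^ (-c)) x := by aesop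
  have h3 : gaussTerm ρ x = fun k => fn (dg x k) * ((p : ℝ) ^ (-(ρ : ℝ))) ^ k := funext e
  constructor
  · rintro ⟨ha, hb, hc⟩; rw [h3] at hb; exact ⟨ha, h2.1 hc, (tendsto_iff_cv h0 h1 (h2.1 hc)).1 hb⟩
  · rintro ⟨ha, hb, hc⟩; refine ⟨ha, ?_, h2.2 hb⟩; rw [h3]; exact (tendsto_iff_cv h0 h1 hb).2 hc

lemma Lf.mono (hx : x ∈ Lf K θ B) (h : B ≤ B') : x ∈ Lf K θ B' := ⟨hx.1, hx.2.1.mono_right h, hx.2.2⟩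

lemma GB.mem_Lf (hx : GB θ₁ B x) (hK : x ∈ AK K) (h0 : 0 < θ) (h : θ < θ₁) (h1 : θ₁ ≤ 1) : x ∈ Lf K θ B :=
  ⟨hK, hx.mono_left h0.le h.le, (hx.oc h h1).cv⟩

lemma galW_mem_Lf (σ : GK K) (hx : x ∈ Lf K θ B) : galW (σ : GalQp p) x ∈ Lf K θ B := by
  refine ⟨galW_mem_AK σ hx.1, hx.2.1.galW _, fun δ hδ => ?_⟩
  obtain ⟨y, ⟨θ', h, h1, B', hy⟩, hxy⟩ := hx.2.2 δ hδ
  exact ⟨galW (σ : GalQp p) y, ⟨θ', h, h1, B', hy.galW _⟩, by rw [← map_sub]; exact hxy.galW _⟩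

section Ring
variable (hε : IsEps p ε)
include hε

lemma Lf.sub (h0 : 0 < θ) (h1 : θ ≤ 1) (hx : x ∈ Lf K θ B) (hy : y ∈ Lf K θ B) : x - y ∈ Lf K θ B :=
  ⟨(AKr hε K).sub_mem hx.1 hy.1, hx.2.1.sub h0 h1 hy.2.1, hx.2.2.sub h0 h1 hy.2.2⟩

lemma Lf.zero (h0 : θ < 1) (hB : 0 ≤ B) : (0 : Ã) ∈ Lf K θ B := ⟨(AKr hε K).zero_mem, GB_zero hB, ((GB_zero (θ := 1) le_rfl).oc h0 le_rfl).cv⟩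

lemma Lf.add (h0 : 0 < θ) (h1 : θ < 1) (hx : x ∈ Lf K θ B) (hy : y ∈ Lf K θ B) : x + y ∈ Lf K θ B := by
  have := Lf.sub hε h0 h1.le hx (Lf.sub hε h0 h1.le (Lf.zero hε h1 hx.2.1.nonneg) hy)
  simp_all

lemma Lf.sum (h0 : 0 < θ) (h1 : θ < 1) (hB : 0 ≤ B) {ι : Type*} (s : Finset ι) (f : ι → Ã) (h : ∀ i ∈ s, f i ∈ Lf K θ B) : ∑ i ∈ s, f i ∈ Lf K θ B :=
  Finset.sum_induction _ (· ∈ Lf K θ B) (fun _ _ => Lf.add hε h0 h1) (Lf.zero hε h1 hB) h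

lemma Lf.mul (h0 : 0 < θ) (h1 : θ ≤ 1) (hx : x ∈ Lf K θ B) (hy : y ∈ Lf K θ B') : x * y ∈ Lf K θ (B * B') :=
  ⟨(AKr hε K).mul_mem hx.1 hy.1, hx.2.1.mul h0 h1 hy.2.1, hx.2.2.mul h0 h1 hy.2.2 hx.2.1 hy.2.1⟩

lemma PSum.mem_Lf {s : ℕ → Ã} {b : ℕ → ℝ} (h0 : 0 < θ) (h1 : θ < θ₁) (h1' : θ₁ ≤ 1) (hB : 0 ≤ B) (h : PSum s x)
    (hK : ∀ n, s n ∈ AK K) (hs : ∀ n, GB θ₁ (b n) (s n)) (hb : ∀ n, b n * θ ^ n ≤ B)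
    (hlim : Tendsto (fun n => b n * θ ^ n) atTop (𝓝 0)) : x ∈ Lf K θ B :=
  ⟨mem_AK_of_padic fun N => ⟨_, (AKr hε K).sum_mem fun n _ => (AKr hε K).mul_mem
    ((AKr hε K).pow_mem (natCast_mem (AKr hε K) p) n) (hK n), h N⟩, h.gb_cv h0 h1 h1' hB hs hb hlim⟩

lemma exists_digits {F : Ĉ → Ã} (hF : ∀ t ∈ EK K, F t ∈ AK K ∧ (F t).coeff 0 = t ∧ GB θ₁ (fn t) (F t))
    (h0 : 0 < θ₁) (h1 : θ₁ ≤ 1) (hx : x ∈ AK K) : ∃ t : ℕ → Ĉ, (∀ n, t n ∈ EK K) ∧ PSum (fun n => F (t n)) x ∧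
      ∀ θ B, 0 < θ → θ < θ₁ → x ∈ Lf K θ B → (∀ n, fn (t n) * θ ^ n ≤ B) ∧ Tendsto (fun n => fn (t n) * θ ^ n) atTop (𝓝 0) := by
  have hstep : ∀ y : AK K, ∃ z : AK K, (y : Ã) = F ((y : Ã).coeff 0) + (p : Ã) * z := fun y => by
    have hy := coeff_zero_mem_EK hε y.2
    obtain ⟨z, hz⟩ := p_dvd_iff.2 (show ((y : Ã) - F ((y : Ã).coeff 0)).coeff 0 = 0 by
      rw [coeff_zero_sub, (hF _ hy).2.1, sub_self])
    refine ⟨⟨z, mem_AK_of_p_mul hε ?_⟩, by rw [← hz]; ring⟩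
    rw [← hz]; exact (AKr hε K).sub_mem y.2 (hF _ hy).1
  choose z hz using hstep
  let Y : ℕ → AK K := fun n => z^[n] ⟨x, hx⟩
  have hY : ∀ n, (Y n : Ã) = F ((Y n : Ã).coeff 0) + (p : Ã) * (Y (n + 1) : Ã) := fun n => by
    rw [show Y (n + 1) = z (Y n) from iterate_succ_apply' _ _ _]; exact hz _
  have htK : ∀ n, (Y n : Ã).coeff 0 ∈ EK K := fun n => coeff_zero_mem_EK hε (Y n).2
  have hsum : ∀ n, x = ∑ k ∈ range n, (p : Ã) ^ k * F ((Y k : Ã).coeff 0) + (p : Ã) ^ n * (Y n : Ã) := fun n => by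
    induction n with
    | zero => simp [Y]
    | succ n ih =>
      rw [sum_range_succ, pow_succ, mul_assoc, add_assoc, ← mul_add, ← hY]; exact ih
  have hDB : ∀ H : ℕ → ℝ, Monotone H → (∀ k m, H k / θ₁ ^ m ≤ H (k + m)) → DB H x → ∀ n, fn ((Y n : Ã).coeff 0) ≤ H n := fun H hH hH' hx n => by
    have h2 : DB H ((p : Ã) ^ n * (Y n : Ã)) ∧ fn ((Y n : Ã).coeff 0) ≤ H n := by
      have key : ∀ n, DB H ((p : Ã) ^ n * (Y n : Ã)) → fn ((Y n : Ã).coeff 0) ≤ H n := fun n h => by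
        have := h n
        rw [dg_p_pow_mul, if_neg (lt_irrefl n), Nat.sub_self] at this; simpa [dg] using this
      induction n with
      | zero => exact ⟨by simpa [Y] using hx, key 0 (by simpa [Y] using hx)⟩
      | succ n ih =>
        have h3 : DB H ((p : Ã) ^ n * F ((Y n : Ã).coeff 0)) := fun k => by
          rw [dg_p_pow_mul]; split_ifs with hk
          · rw [fn_zero]; exact hx.nonneg k
          · have h4 := (hF _ (htK n)).2.2 (k - n)
            rw [← le_div_iff₀ (pow_pos h0 _)] at h4; refine h4.trans ((div_le_div_of_nonneg_right ih.2 (pow_pos h0 _).le).trans ?_)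
            have := hH' n (k - n)
            rwa [Nat.add_sub_cancel' (not_lt.1 hk)] at this
        have h5 : DB H ((p : Ã) ^ (n + 1) * (Y (n + 1) : Ã)) := by
          have h6 := ih.1.sub hH h3
          rwa [← mul_sub, sub_eq_iff_eq_add'.2 (hY n), ← mul_assoc, ← pow_succ] at h6
        exact ⟨h5, key _ h5⟩
    exact h2.2
  refine ⟨fun n => (Y n : Ã).coeff 0, htK, fun N => ?_, fun θ B hθ hθ1 hxθ => ?_⟩
  · rw [sub_eq_iff_eq_add'.2 (hsum N)]; simp
  have hmono : ∀ {η C : ℝ}, 0 < η → η ≤ 1 → 0 ≤ C → Monotone fun k => C / η ^ k := fun hη hη1 hC a b hab =>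
    div_le_div_of_nonneg_left hC (pow_pos hη b) (pow_le_pow_of_le_one hη.le hη1 hab)
  have hprof : ∀ {η C : ℝ}, 0 < η → η ≤ θ₁ → 0 ≤ C → ∀ k m : ℕ, C / η ^ k / θ₁ ^ m ≤ C / η ^ (k + m) := fun hη hη1 hC k m => by
    rw [div_div]; refine div_le_div_of_nonneg_left hC (by positivity) ?_
    rw [pow_add]; exact mul_le_mul_of_nonneg_left (pow_le_pow_left₀ hη.le hη1 m) (pow_nonneg hη.le k)
  have hθ1' : θ ≤ 1 := hθ1.le.trans h1
  constructor
  · intro n; have := hDB (fun k => B / θ ^ k) (hmono hθ hθ1' hxθ.2.1.nonneg) (hprof hθ hθ1.le hxθ.2.1.nonneg)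
      (fun k => (le_div_iff₀ (pow_pos hθ k)).2 (hxθ.2.1 k)) n
    exact (le_div_iff₀ (pow_pos hθ n)).1 this
  · refine tendsto_order.2 ⟨fun a ha => Eventually.of_forall fun k => ha.trans_le (mul_nonneg (fn_nonneg _) (pow_nonneg hθ.le k)), fun a ha => ?_⟩
    obtain ⟨y, ⟨η, hη, hη1, B', hy⟩, hxy⟩ := hxθ.2.2 (a / 2) (half_pos ha); set ξ := min η θ₁ with hξ; have hξθ : θ < ξ := lt_min hη hθ1
    have hξ0 := hθ.trans hξθ
    have hξ1 : ξ ≤ 1 := (min_le_left _ _).trans hη1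
    have hy' := hy.mono_left hξ0.le (min_le_left _ _)
    let H : ℕ → ℝ := fun k => max (B' / ξ ^ k) (a / 2 / θ ^ k)
    have hHm : Monotone H := (hmono hξ0 hξ1 hy.nonneg).max (hmono hθ hθ1' (half_pos ha).le)
    have hx' : DB H x := by
      rw [← sub_add_cancel x y]; exact DB.add hHm (fun k => ((le_div_iff₀ (pow_pos hθ k)).2 (hxy k)).trans (le_max_right _ _))
        (fun k => ((le_div_iff₀ (pow_pos hξ0 k)).2 (hy' k)).trans (le_max_left _ _))
    have hn := hDB H hHm (fun k m => ?_) hx'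
    · have hlim := (tendsto_pow_atTop_nhds_zero_of_lt_one (div_nonneg hθ.le hξ0.le) ((div_lt_one hξ0).2 hξθ)).const_mul B'
      rw [mul_zero] at hlim; filter_upwards [hlim.eventually_le_const (half_pos ha)] with k hk; refine lt_of_le_of_lt ?_ (half_lt_self ha)
      rw [← le_div_iff₀ (pow_pos hθ k)]; refine (hn k).trans (max_le ?_ le_rfl); rw [div_pow, mul_div_assoc', div_le_iff₀ (pow_pos hξ0 k)] at hk
      rwa [div_le_div_iff₀ (pow_pos hξ0 k) (pow_pos hθ k)]
    · rw [div_le_iff₀ (pow_pos h0 m)]; refine max_le ?_ ?_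
      · rw [← div_le_iff₀ (pow_pos h0 m)]; exact (hprof hξ0 (min_le_right _ _) hy.nonneg k m).trans (le_max_left _ _)
      · rw [← div_le_iff₀ (pow_pos h0 m)]; exact (hprof hθ hθ1.le (half_pos ha).le k m).trans (le_max_right _ _)

end Ring

end Lattices
section LiftsEK
/-- Overconvergent lifts of `𝐄_K` on a fixed annulus, with a lift `w` of the uniformizer. -/
structure Lifts (K : IntermediateField ℚ_[p] (PadicAlgCl p)) (ϖ : Ĉ) where
  θ₁ : ℝ
  pos : 0 < θ₁
  le_one : θ₁ ≤ 1
  F : Ĉ → Ã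
  spec : ∀ t ∈ EK K, F t ∈ AK K ∧ (F t).coeff 0 = t ∧ GB θ₁ (fn t) (F t)
  gal : ∀ δ, 0 < δ → δ ≤ 1 → ∀ᶠ σ : GalQp p in 𝓝 1, ∀ t ∈ EK K, GB θ₁ (fn t * δ) (galW σ (F t) - F t)
  w : Ãˣ
  w_mem : ∀ n : ℤ, ((w ^ n : Ãˣ) : Ã) ∈ AK K
  coeff_w : (w : Ã).coeff 0 = ϖ
  ub : UB θ₁ (fn ϖ) w

variable {θ B B' δ : ℝ} {x : ATilde p}

lemma zpow_mem_AK (hε : IsEps p ε) {w : Ãˣ} (hw : (w : Ã) ∈ AK K) (n : ℤ) : ((w ^ n : Ãˣ) : Ã) ∈ AK K := by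
  have hi : ((w⁻¹ : Ãˣ) : Ã) ∈ AK K := by
    refine ⟨hε.mem_ABig.2 (inv_mem_cohen hε.isPBasis_ESep (hε.mem_ABig.1 hw.1) (fun h0 => ?_) w.mul_inv), fun σ hσ => ?_⟩
    · have := congrArg (fun z : Ã => z.coeff 0) w.mul_inv
      simp only [coeff_zero_mul, h0, zero_mul, one_coeff_zero, zero_ne_one] at this
    · refine w.isUnit.mul_left_cancel ?_; conv_lhs => rw [← hw.2 σ hσ]
      rw [← map_mul, Units.mul_inv, map_one]
  rcases Int.eq_nat_or_neg n with ⟨n, rfl | rfl⟩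
  · rw [zpow_natCast, val_pow_eq_pow_val]; exact (AKr hε K).pow_mem hw n
  · rw [zpow_neg, zpow_natCast, ← inv_pow, val_pow_eq_pow_val]; exact (AKr hε K).pow_mem hi n

lemma IsUniformizerEK.exists_lifts [FiniteDimensional ℚ_[p] K] (h : IsUniformizerEK K ϖ) (hε : IsEps p ε) : Nonempty (Lifts K ϖ) := by
  obtain ⟨ι, _, v, hv, hc⟩ := h.coords hε
  have h1 : ∀ i, ∃ x ∈ AK K, x.coeff 0 = v i ∧ ∃ θ : ℝ, 0 < θ ∧ θ ≤ 1 ∧ GB θ (fn (v i)) x := fun i => by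
    obtain ⟨x, hx, hxv, hxO⟩ := exists_lift_AK hε (hv i).1; obtain ⟨θ, h0, h1, h2⟩ := exists_dominant hxO (hxv ▸ (hv i).2)
    exact ⟨x, hx, hxv, θ, h0, h1, hxv ▸ h2⟩
  choose V hVK hV0 η hη0 hη1 hVη using h1
  obtain ⟨η₁, hη₁0, hη₁1, hη₁⟩ : ∃ η₁ : ℝ, 0 < η₁ ∧ η₁ ≤ (p : ℝ)⁻¹ ∧ ∀ i, η₁ ≤ η i := by
    have hfin := Set.toFinite (insert (p : ℝ)⁻¹ (Set.range η))
    obtain ⟨m, hm, hle⟩ := hfin.exists_minimal ⟨_, Set.mem_insert _ _⟩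
    have hmin : ∀ a ∈ insert (p : ℝ)⁻¹ (Set.range η), m ≤ a := fun a ha => (le_total m a).elim id (hle ha)
    refine ⟨m, ?_, hmin _ (Set.mem_insert _ _), fun i => hmin _ (Set.mem_insert_of_mem _ ⟨i, rfl⟩)⟩
    rcases hm with rfl | ⟨i, rfl⟩
    · exact inv_pos.2 p_pos
    · exact hη0 i
  have hp1 : (p : ℝ)⁻¹ < 1 := inv_lt_one_of_one_lt₀ one_lt_p
  set θ := η₁ / 2 with hθ
  have hθ0 : 0 < θ := half_pos hη₁0
  have hθη : θ < η₁ := half_lt_self hη₁0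
  have hθ1 : θ ≤ 1 := by linarith
  have hl := fun c (hc : c ∈ EQp p) => hε.exists_lift hθ0 (hθη.le.trans hη₁1) hc
  choose! L hLA hL0 hLB hLσ using hl
  choose! c hcE hcs hcb using hc
  have hVθ : ∀ i, GB θ (fn (v i)) (V i) := fun i => (hVη i).mono_left hθ0.le (hθη.le.trans (hη₁ i))
  have hAQ : ∀ x ∈ AQp p, x ∈ AK K := fun x hx =>
    ⟨hε.mem_ABig.2 (hε.AUnr_le_cohen (subset_closure (Or.inl hx))), fun σ hσ => galW_AQp (chi_of_mem_HK hσ) hx⟩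
  have hcv : ∀ t ∈ EK K, ∀ i, fn (c t i) * fn (v i) ≤ fn t := fun t ht i =>
    (mul_le_mul_of_nonneg_right (hcb t ht i) (fn_nonneg _)).trans_eq (by
      rw [mul_right_comm, inv_mul_cancel₀ (PseudoPhiGamma.fn_pos.2 (hv i).2).ne', one_mul])
  let F : Ĉ → Ã := fun t => ∑ i, L (c t i) * V i
  have hF : ∀ t ∈ EK K, F t ∈ AK K ∧ (F t).coeff 0 = t ∧ GB θ (fn t) (F t) := fun t ht => by
    refine ⟨(AKr hε K).sum_mem fun i _ => (AKr hε K).mul_mem (hAQ _ (hLA _ (hcE t ht i))) (hVK i), ?_, ?_⟩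
    · simp only [F, coeff_zero_sum, coeff_zero_mul, hV0]; refine Eq.trans ?_ (hcs t ht); exact sum_congr rfl fun i _ => by simp_all
    · exact GB.sum hθ0 hθ1 (fn_nonneg _) _ _ fun i _ =>
        ((hLB _ (hcE t ht i)).mul hθ0 hθ1 (hVθ i)).mono_right (hcv t ht i)
  have hϖF := hF ϖ h.1
  have hu : IsUnit (F ϖ) := isUnit_of_coeff_ne_zero (by rw [hϖF.2.1]; exact h.2.1)
  obtain ⟨z, hz, hzB⟩ := exists_inv_GB hθ0 hθ1 (by rw [hϖF.2.1]; exact h.2.1) (by simp_all)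
  refine ⟨θ, hθ0, hθ1, F, hF, fun δ hδ hδ1 => ?_, hu.unit, zpow_mem_AK hε hϖF.1, hϖF.2.1, hϖF.2.2, ?_⟩
  · have e1 := eventually_GB_galW_sub hθ0 (hθη.trans (hη₁1.trans_lt hp1)) le_rfl
      (show GB 1 1 (piU hε : Ã) from (((GB_teichmuller ε).mono_right (fn_of_mem_cycl hε.mem_cycl).le).sub one_pos le_rfl GB_one))
      (mul_pos (PseudoPhiGamma.fn_pos.2 hε.sub_one_ne_zero) hδ)
    have e2 := eventually_all.2 fun i => eventually_GB_galW_sub hθ0 (hθη.trans_le (hη₁ i)) (hη1 i) (hVη i) (mul_pos (PseudoPhiGamma.fn_pos.2 (hv i).2) hδ)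
    filter_upwards [e1, e2] with σ h1 h2 t ht
    rw [map_sum, ← sum_sub_distrib]; refine GB.sum hθ0 hθ1 (mul_nonneg (fn_nonneg _) hδ.le) _ _ fun i _ => ?_
    have e : galW σ (L (c t i) * V i) - L (c t i) * V i =
        (galW σ (L (c t i)) - L (c t i)) * galW σ (V i) + L (c t i) * (galW σ (V i) - V i) := by rw [map_mul]; ring
    have h3 := mul_le_mul_of_nonneg_right (hcv t ht i) hδ.le
    rw [e]; refine GB.add hθ0 hθ1 (((hLσ _ (hcE t ht i) σ δ hδ h1).mul hθ0 hθ1 ((hVθ i).galW σ)).mono_right ?_)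
      (((hLB _ (hcE t ht i)).mul hθ0 hθ1 (h2 i)).mono_right ?_)
    · linarith
    linarith
  · rw [hϖF.2.1] at hzB; rwa [← hu.unit.inv_eq_of_mul_eq_one_right (a := z) hz] at hzB

namespace Lifts

variable (l : Lifts K ϖ)

lemma GB_zpow (n : ℤ) : GB l.θ₁ (fn ϖ ^ n) ((l.w ^ n : Ãˣ) : Ã) := (l.ub.zpow l.pos l.le_one n).1

lemma zpow_mem_Lf (h0 : 0 < θ) (h1 : θ < l.θ₁) (n : ℤ) : ((l.w ^ n : Ãˣ) : Ã) ∈ Lf K θ (fn ϖ ^ n) := (l.GB_zpow n).mem_Lf (l.w_mem n) h0 h1 l.le_one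

lemma zpow_mul_mem_Lf (hε : IsEps p ε) (h0 : 0 < θ) (h1 : θ < l.θ₁) (n : ℤ) (hx : x ∈ Lf K θ B) : ((l.w ^ n : Ãˣ) : Ã) * x ∈ Lf K θ (fn ϖ ^ n * B) :=
  Lf.mul hε h0 (h1.le.trans l.le_one) (l.zpow_mem_Lf h0 h1 n) hx

lemma eventually_galW_sub (hε : IsEps p ε) (hδ : 0 < δ) (hδ1 : δ ≤ 1) : ∀ᶠ σ : GalQp p in 𝓝 1, σ ∈ GK K → ∀ θ B x,
    0 < θ → θ < l.θ₁ → x ∈ Lf K θ B → galW σ x - x ∈ Lf K θ (B * δ) := by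
  filter_upwards [l.gal δ hδ hδ1] with σ hσ hσK θ B x h0 h1 hx
  obtain ⟨t, htK, hsum, ht⟩ := exists_digits hε l.spec l.pos l.le_one hx.1
  obtain ⟨hb, hlim⟩ := ht θ B h0 h1 hx
  refine PSum.mem_Lf hε (s := fun n => galW σ (l.F (t n)) - l.F (t n)) (b := fun n => fn (t n) * δ) h0 h1 l.le_one
    (mul_nonneg hx.2.1.nonneg hδ.le) (fun N => ?_) (fun n => ?_) (fun n => hσ _ (htK n)) (fun n => ?_) ?_
  · obtain ⟨c, hc⟩ := hsum N; refine ⟨galW σ c - c, ?_⟩; have := congrArg (galW σ) hc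
    simp only [map_sub, map_sum, map_mul, map_pow, map_natCast] at this; rw [mul_sub, ← this, ← hc]; simp only [mul_sub, sum_sub_distrib]; ring
  · exact (AKr hε K).sub_mem (galW_mem_AK ⟨σ, hσK⟩ (l.spec _ (htK n)).1) (l.spec _ (htK n)).1
  · rw [mul_right_comm]; simp_all
  · simpa [mul_right_comm] using hlim.mul_const δ

lemma exists_frob_basis [FiniteDimensional ℚ_[p] K] (h : IsUniformizerEK K ϖ) (hε : IsEps p ε) : ∃ C : ℝ, 1 ≤ C ∧ ∃ θ₂ : ℝ, 0 < θ₂ ∧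
    ∀ θ B B', 0 < θ → θ < l.θ₁ → θ ^ p < θ₂ → 0 ≤ B' → C * B ≤ B' ^ p → ∀ x ∈ Lf K (θ ^ p) B, ∃ y : Fin p → Ã,
      (∀ a, y a ∈ Lf K θ B') ∧ x = ∑ a : Fin p, ω ε ^ (a : ℕ) * frobW p (y a) := by
  have hp := prm p
  have hlead : ∀ x ∈ (EK K).toSubfield, x ≠ 0 → ∃ c ∈ (EK K).toSubfield, fn c = 1 ∧ ∃ n : ℤ, fn x = fn ϖ ^ n ∧ fn (x - c ^ p * ϖ ^ n) ≤ fn ϖ * fn x := by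
    obtain ⟨f, hf, hl⟩ := h.exists_lead hε; intro x hx hx0; obtain ⟨a, ha, haf, ha0, n, hn, hle⟩ := hl x hx hx0
    refine ⟨a ^ p ^ (f - 1), pow_mem ha _, by rw [fn_pow, fn_eq_one_of_pow hf haf ha0, one_pow], n, hn, ?_⟩
    rwa [← pow_mul, ← pow_succ, Nat.sub_add_cancel hf, haf]
  have hb := fun x (hx : x ∈ (EK K).toSubfield) => exists_powSum_eq (EK K).toSubfield (h.EK_closed hε) h.1 h.2.1 h.fn_lt_one hlead hx
  choose! b hbK hbs hbB using hb
  have hg := fun j : Fin p => (hε.isPBasis (EK K) fun x hx => ((mem_EK hε).1 hx).1).gen (ϖ ^ (j : ℕ)) (pow_mem h.1 _)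
  choose g hgK hgs using hg
  let C : ℝ := 1 + ∑ j : Fin p, ∑ a : Fin p, fn (g j a) ^ p * (fn ϖ ^ (j : ℕ))⁻¹
  have hC0 : ∀ j a : Fin p, 0 ≤ fn (g j a) ^ p * (fn ϖ ^ (j : ℕ))⁻¹ := fun j a => by
    have := h.fn_pos; have := fn_nonneg (g j a); positivity
  have hC1 : 1 ≤ C := le_add_of_nonneg_right (sum_nonneg fun j _ => sum_nonneg fun a _ => hC0 j a)
  have hCj : ∀ j a : Fin p, fn (g j a) ^ p * (fn ϖ ^ (j : ℕ))⁻¹ ≤ C := fun j a =>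
    ((single_le_sum (f := fun a => fn (g j a) ^ p * (fn ϖ ^ (j : ℕ))⁻¹) (fun a _ => hC0 j a) (mem_univ a)).trans
      (single_le_sum (f := fun j : Fin p => ∑ a : Fin p, fn (g j a) ^ p * (fn ϖ ^ (j : ℕ))⁻¹)
        (fun j _ => sum_nonneg fun a _ => hC0 j a) (mem_univ j))).trans (le_add_of_nonneg_left zero_le_one)
  let d : Ĉ → Fin p → Ĉ := fun t a => ∑ j : Fin p, b t j * g j a
  have hdK : ∀ t ∈ EK K, ∀ a, d t a ∈ EK K := fun t ht a => sum_mem fun j _ => mul_mem (hbK t ht j) (hgK j a)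
  have hds : ∀ t ∈ EK K, ∑ a : Fin p, ε ^ (a : ℕ) * d t a ^ p = t := fun t ht => by
    have e : ∀ a : Fin p, ε ^ (a : ℕ) * d t a ^ p = ∑ j : Fin p, b t j ^ p * (ε ^ (a : ℕ) * g j a ^ p) := fun a => by
      change ε ^ (a : ℕ) * (∑ j : Fin p, b t j * g j a) ^ p = _; rw [sum_pow_char, mul_sum]; exact sum_congr rfl fun j _ => by ring
    simp only [e]; rw [sum_comm]; simp only [← mul_sum, ← powSum_apply, hgs]; conv_rhs => rw [← hbs t ht, powSum_apply]
    exact sum_congr rfl fun j _ => mul_comm _ _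
  have hdB : ∀ t ∈ EK K, ∀ a, fn (d t a) ^ p ≤ C * fn t := fun t ht a => by
    rw [← fn_pow]; change fn ((∑ j : Fin p, b t j * g j a) ^ p) ≤ _; rw [sum_pow_char]
    refine fn_sum_le _ _ (mul_nonneg (zero_le_one.trans hC1) (fn_nonneg _)) fun j _ => ?_
    rw [fn_pow, fn_mul, mul_pow]; refine (mul_le_mul_of_nonneg_right (hbB t ht j) (pow_nonneg (fn_nonneg _) _)).trans ?_
    rw [mul_right_comm, mul_comm _ (fn (g j a) ^ p)]; exact mul_le_mul_of_nonneg_right (hCj j a) (fn_nonneg _)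
  let G : Ĉ → Ã := fun t => ∑ a : Fin p, ω ε ^ (a : ℕ) * frobW p (l.F (d t a))
  have hθp := pow_pos l.pos p
  have hθp1 : l.θ₁ ^ p ≤ 1 := pow_le_one₀ l.pos.le l.le_one
  have hCpos : 0 < C := one_pos.trans_le hC1
  have hG : ∀ t ∈ EK K, G t ∈ AK K ∧ (G t).coeff 0 = t ∧ GB (l.θ₁ ^ p / C) (fn t) (G t) := fun t ht => by
    have h0 : (G t).coeff 0 = t := by
      simp only [G, coeff_zero_sum, coeff_zero_mul, coeff_zero_pow, coeff_frobW, teichmuller_coeff_zero, (l.spec _ (hdK t ht _)).2.1]; exact hds t ht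
    refine ⟨(AKr hε K).sum_mem fun a _ => (AKr hε K).mul_mem ((AKr hε K).pow_mem (teichmuller_cycl_mem_AK hε.mem_cycl) _)
      (frobW_mem_AK (l.spec _ (hdK t ht a)).1), h0, ?_⟩
    have h1 : GB (l.θ₁ ^ p) (C * fn t) (G t) := GB.sum hθp hθp1 (mul_nonneg hCpos.le (fn_nonneg _)) _ _ fun a _ => by
      have h2 := (((GB_teichmuller (θ := l.θ₁ ^ p) ε).pow hθp hθp1 a).mul hθp hθp1 ((l.spec _ (hdK t ht a)).2.2.frobW l.pos.le))
      rw [fn_of_mem_cycl hε.mem_cycl, one_pow, one_mul] at h2; exact h2.mono_right (hdB t ht a)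
    have h2 := h1.exists_dominant (div_pos hθp hCpos) (div_le_self hθp.le hC1) (by
      rw [h0, div_div_cancel_left' hθp.ne', inv_mul_cancel_left₀ hCpos.ne'])
    rwa [h0] at h2
  refine ⟨C, hC1, l.θ₁ ^ p / C, div_pos hθp hCpos, fun θ B B' hθ hθ1 hθ2 hB' hBB x hx => ?_⟩
  obtain ⟨t, htK, hsum, ht⟩ := exists_digits hε hG (div_pos hθp hCpos) ((div_le_self hθp.le hC1).trans hθp1) hx.1
  obtain ⟨htB, htl⟩ := ht _ B (pow_pos hθ p) hθ2 hx
  have hpow : ∀ n a, (fn (d (t n) a) * θ ^ n) ^ p ≤ C * (fn (t n) * (θ ^ p) ^ n) := fun n a => by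
    rw [mul_pow, ← mul_assoc, ← pow_mul, ← pow_mul, mul_comm n p]; exact mul_le_mul_of_nonneg_right (hdB _ (htK n) a) (pow_nonneg hθ.le _)
  have hnn : ∀ n a, 0 ≤ fn (d (t n) a) * θ ^ n := fun n a => mul_nonneg (fn_nonneg _) (pow_nonneg hθ.le n)
  choose y hy using fun a => exists_PSum fun n => l.F (d (t n) a)
  refine ⟨y, fun a => (hy a).mem_Lf hε hθ hθ1 l.le_one hB' (fun n => (l.spec _ (hdK _ (htK n) a)).1)
    (fun n => (l.spec _ (hdK _ (htK n) a)).2.2) (fun n => ?_) ?_, eq_of_forall_dvd fun N => ?_⟩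
  · refine le_of_pow_le_pow_left₀ hp.ne_zero hB' ((hpow n a).trans (le_trans ?_ hBB)); exact mul_le_mul_of_nonneg_left (htB n) hCpos.le
  · have h2 : Tendsto (fun n => (fn (d (t n) a) * θ ^ n) ^ p) atTop (𝓝 0) :=
      squeeze_zero (fun n => pow_nonneg (hnn n a) p) (fun n => hpow n a) (by simpa using htl.const_mul C)
    have h3 := h2.rpow_const (p := (1 / p : ℝ)) (Or.inr (by positivity))
    rw [Real.zero_rpow (by have := p_pos (p := p); positivity)] at h3
    refine h3.congr fun n => ?_
    rw [one_div, Real.pow_rpow_inv_natCast (hnn n a) hp.ne_zero]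
  · have e : x - ∑ a : Fin p, ω ε ^ (a : ℕ) * frobW p (y a) = (x - ∑ n ∈ range N, (p : Ã) ^ n * G (t n)) -
        ∑ a : Fin p, ω ε ^ (a : ℕ) * frobW p (y a - ∑ n ∈ range N, (p : Ã) ^ n * l.F (d (t n) a)) := by
      simp only [map_sub, map_sum, map_mul, map_pow, map_natCast, mul_sub, sum_sub_distrib, G, mul_sum]; rw [sum_comm (s := range N)]
      simp only [mul_left_comm]; ring
    rw [e]; refine _root_.dvd_sub (hsum N) (dvd_sum fun a _ => Dvd.dvd.mul_left ?_ _)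
    have := map_dvd (frobW p) (hy a N)
    rwa [map_pow, map_natCast] at this

end Lifts

end LiftsEK
section Completion
variable {A : Type*} [CommRing A] {I : Ideal A} {t : A}

lemma of_mul (a b : A) : of I A (a * b) = of I A a * of I A b := rfl

/-- The `I`-adic topology of `A` is the `t`-adic topology, for a nonzerodivisor `t`. -/
structure IsTateBase (I : Ideal A) (t : A) : Prop where
  reg : ∀ x, t * x = 0 → x = 0
  pow_mem : ∃ a, 0 < a ∧ t ^ a ∈ I
  le_span : ∃ b, 0 < b ∧ I ^ b ≤ span {t}

namespace IsTateBase

variable (h : IsTateBase I t)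
include h

lemma dvd_of_pow_mul {k : ℕ} {x y : A} (hxy : t ^ k * x = t ^ k * y) : x = y := by
  induction k with
  | zero => simpa using hxy
  | succ k ih =>
    refine ih (sub_eq_zero.1 (h.reg _ ?_)); grind

lemma exists_le_span : ∃ b, 0 < b ∧ ∀ k, I ^ (b * k) ≤ span {t ^ k} := by
  obtain ⟨b, hb, hle⟩ := h.le_span
  exact ⟨b, hb, fun k => by rw [pow_mul, ← Ideal.span_singleton_pow]; exact Ideal.pow_right_mono hle k⟩

lemma exists_pow_mem : ∃ a, 0 < a ∧ ∀ k, t ^ (a * k) ∈ I ^ k := by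
  obtain ⟨a, ha, hm⟩ := h.pow_mem
  exact ⟨a, ha, fun k => by rw [pow_mul]; exact Ideal.pow_mem_pow hm k⟩

lemma exists_of_eval_eq_zero : ∃ b, 0 < b ∧ ∀ (k : ℕ) (x : AdicCompletion I A), evalₐ I (b * k) x = 0 → ∃ y, x = of I A t ^ k * y := by
  obtain ⟨b, hb, hbk⟩ := h.exists_le_span
  obtain ⟨a, ha, hak⟩ := h.exists_pow_mem
  refine ⟨b, hb, fun k x hx => ?_⟩
  obtain ⟨c, rfl⟩ := AdicCompletion.mk_surjective I A x
  have hc : ∀ {m n}, m ≤ n → c n - c m ∈ I ^ m := fun {m n} hmn =>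
    (mk_eq_mk_iff_sub_mem _ _).1 (AdicCompletion.Ideal.mk_eq_mk I hmn c)
  rw [evalₐ_mk, eq_zero_iff_mem] at hx
  have hdvd : ∀ n, ∃ d, c (b * (k + a * n)) = t ^ k * d := fun n => by
    have h1 : c (b * (k + a * n)) ∈ I ^ (b * k) := by
      have := add_mem (hc (show b * k ≤ b * (k + a * n) from Nat.mul_le_mul_left b (Nat.le_add_right _ _))) hx
      rwa [sub_add_cancel] at this
    exact Ideal.mem_span_singleton'.1 (hbk k h1) |>.imp fun d hd => by grind
  choose d hd using hdvd
  have hdc : ∀ {m n}, m ≤ n → d n - d m ∈ I ^ m := fun {m n} hmn => by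
    have h1 := hbk _ (hc (show b * (k + a * m) ≤ b * (k + a * n) by gcongr))
    obtain ⟨z, hz⟩ := Ideal.mem_span_singleton'.1 h1; have h2 : d n - d m = t ^ (a * m) * z := h.dvd_of_pow_mul (k := k) (by
      grind)
    rw [h2]; exact Ideal.mul_mem_right _ _ (hak m)
  let y := AdicCompletion.mk I A (AdicCompletion.AdicCauchySequence.mk I A d fun n => by
    rw [SModEq.comm, SModEq.sub_mem, smul_eq_mul, mul_top]; simp_all)
  refine ⟨y, ext_evalₐ fun n => ?_⟩
  rw [map_mul, map_pow, evalₐ_of, evalₐ_mk, evalₐ_mk, ← map_pow, ← map_mul]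
  change _ = Ideal.Quotient.mk _ (t ^ k * d n)
  rw [← hd, eq_comm, mk_eq_mk_iff_sub_mem]
  refine hc ?_
  calc n ≤ k + a * n := (Nat.le_mul_of_pos_left n ha).trans (Nat.le_add_left _ _)
    _ ≤ _ := Nat.le_mul_of_pos_left _ hb

lemma exists_eval_eq_zero : ∃ a, 0 < a ∧ ∀ (k : ℕ) (y : AdicCompletion I A), evalₐ I k (of I A t ^ (a * k) * y) = 0 := by
  obtain ⟨a, ha, hak⟩ := h.exists_pow_mem
  refine ⟨a, ha, fun k y => ?_⟩
  rw [map_mul, map_pow, evalₐ_of, ← map_pow, eq_zero_iff_mem.2 (hak k), zero_mul]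

lemma exists_approx (k : ℕ) (x : AdicCompletion I A) : ∃ a y, x = of I A a + of I A t ^ k * y := by
  obtain ⟨b, -, hb⟩ := h.exists_of_eval_eq_zero
  obtain ⟨a, ha⟩ := exists_evalₐ_eq I (b * k) x
  obtain ⟨y, hy⟩ := hb k (x - of I A a) (by simp_all)
  exact ⟨a, y, by rw [← hy]; ring⟩

lemma dvd_of_of_eq {k : ℕ} {a : A} {y : AdicCompletion I A} (hy : of I A a = of I A t ^ k * y) : t ^ k ∣ a := by
  obtain ⟨b, -, hb⟩ := h.exists_le_span
  obtain ⟨c, hc⟩ := exists_evalₐ_eq I (b * k) y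
  have h1 := congrArg (evalₐ I (b * k)) hy
  rw [map_mul, map_pow, evalₐ_of, evalₐ_of, hc, ← map_pow, ← map_mul, mk_eq_mk_iff_sub_mem] at h1
  have h2 := mem_span_singleton.1 (hb k h1)
  exact (dvd_sub_left (dvd_mul_right _ _)).1 h2

lemma eq_zero_of_forall {x : AdicCompletion I A} (hx : ∀ k, ∃ y, x = of I A t ^ k * y) : x = 0 := by
  obtain ⟨a, -, ha⟩ := h.exists_eval_eq_zero
  refine ext_evalₐ fun n => ?_
  obtain ⟨y, hy⟩ := hx (a * n)
  rw [hy, ha, map_zero]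

lemma of_reg {x : AdicCompletion I A} (hx : of I A t * x = 0) : x = 0 := by
  refine h.eq_zero_of_forall fun k => ?_
  obtain ⟨a, y, rfl⟩ := h.exists_approx k x
  have h1 : of I A (t * a) = of I A t ^ (k + 1) * (-y) := by
    rw [of_mul, pow_succ']; linear_combination hx
  obtain ⟨z, hz⟩ := h.dvd_of_of_eq h1
  have h2 : a = t ^ k * z := h.dvd_of_pow_mul (k := 1) (by grind)
  refine ⟨of I A z + y, ?_⟩
  rw [h2, of_mul, mul_add]
  rfl

lemma exists_sum (y : ℕ → AdicCompletion I A) : ∃ s, ∀ q, ∃ z, s = ∑ i ∈ range q, of I A t ^ i * y i + of I A t ^ q * z := by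
  obtain ⟨a, ha0, ha⟩ := h.exists_eval_eq_zero
  obtain ⟨b, hb0, hb⟩ := h.exists_of_eval_eq_zero
  let S : ℕ → AdicCompletion I A := fun q => ∑ i ∈ range q, of I A t ^ i * y i
  have hS : ∀ {m n}, m ≤ n → ∃ z, S n = S m + of I A t ^ m * z := fun {m n} hmn => by
    simp only [S]; rw [← Finset.sum_range_add_sum_Ico _ hmn]; obtain ⟨z, hz⟩ : of I A t ^ m ∣ ∑ i ∈ Finset.Ico m n, of I A t ^ i * y i :=
      dvd_sum fun i hi => (pow_dvd_pow _ (mem_Ico.1 hi).1).mul_right _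
    grind
  choose c hc using fun n => exists_evalₐ_eq I n (S (a * n))
  have hcc : ∀ {m n}, m ≤ n → evalₐ I m (S (a * n)) = Ideal.Quotient.mk _ (c m) := fun {m n} hmn => by
    obtain ⟨z, hz⟩ := hS (show a * m ≤ a * n by gcongr)
    rw [hz, map_add, ha, add_zero, hc]
  have hcI : ∀ n, c (n + 1) - c n ∈ I ^ n := fun n => by
    obtain ⟨d, h1, h2⟩ := exists_evalₐ_eq_of_le I n.le_succ (S (a * (n + 1))); rw [hcc n.le_succ, mk_eq_mk_iff_sub_mem] at h2
    rw [hc, mk_eq_mk_iff_sub_mem] at h1; have h3 := add_mem (Ideal.pow_le_pow_right n.le_succ h1) (neg_mem h2)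
    rwa [show c (n + 1) - d + -(c n - d) = c (n + 1) - c n by ring] at h3
  let s := AdicCompletion.mk I A (AdicCompletion.AdicCauchySequence.mk I A c fun n => by
    rw [SModEq.comm, SModEq.sub_mem, smul_eq_mul, mul_top]; exact hcI n)
  refine ⟨s, fun q => ?_⟩
  obtain ⟨z, hz⟩ := hb q (s - S (a * (b * q))) (by
    rw [map_sub, hc]; exact sub_eq_zero.2 (evalₐ_mk I _ _))
  obtain ⟨z', hz'⟩ := hS (show q ≤ a * (b * q) from (Nat.le_mul_of_pos_left q hb0).trans (Nat.le_mul_of_pos_left _ ha0))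
  exact ⟨z' + z, by grind⟩

lemma isNoetherianRing (hN : IsNoetherianRing (A ⧸ span {t})) : IsNoetherianRing (AdicCompletion I A) := by
  classical
  refine IsNoetherianRing.of_prime fun P hP => ?_
  set τ := of I A t with hτ
  let π := Ideal.Quotient.mk (span {t})
  let P' : Ideal A :=
    { carrier := {a | ∃ x ∈ P, ∃ y, x = of I A a + τ * y}
      zero_mem' := ⟨0, P.zero_mem, 0, by simp⟩
      add_mem' := by
        rintro a b ⟨x, hx, y, rfl⟩ ⟨x', hx', y', rfl⟩; exact ⟨_, P.add_mem hx hx', y + y', by rw [map_add]; ring⟩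
      smul_mem' := by
        rintro c a ⟨x, hx, y, rfl⟩; refine ⟨_, P.mul_mem_left (of I A c) hx, of I A c * y, ?_⟩; rw [smul_eq_mul, of_mul]; ring }
  obtain ⟨G, hG⟩ := (isNoetherianRing_iff_ideal_fg _).1 hN (P'.map π)
  have hlift : ∀ g ∈ G, ∃ x ∈ P, ∃ a y, x = of I A a + τ * y ∧ π a = g := fun g hg => by
    have h1 : g ∈ P'.map π := hG ▸ Ideal.subset_span hg
    obtain ⟨a, ⟨x, hx, y, hxy⟩, rfl⟩ := (Ideal.mem_map_iff_of_surjective π mk_surjective).1 h1; grind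
  choose! X hXP α Y hXY hα using hlift
  have hstep : ∀ x ∈ P, ∃ c : A ⧸ span {t} → AdicCompletion I A, ∃ x', x = ∑ g ∈ G, c g * X g + τ * x' := fun x hx => by
    obtain ⟨a, y, hy⟩ := h.exists_approx 1 x; rw [pow_one] at hy
    have h1 : π a ∈ span (G : Set (A ⧸ span {t})) := hG ▸ Ideal.mem_map_of_mem π ⟨x, hx, y, hy⟩
    obtain ⟨c, hc⟩ := Submodule.mem_span_finset.1 h1; choose d hd using fun g => mk_surjective (I := span {t}) (c g)
    have h2 : a - ∑ g ∈ G, d g * α g ∈ span {t} := by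
      rw [← eq_zero_iff_mem, map_sub, map_sum, sub_eq_zero, ← hc.2]; refine sum_congr rfl fun g hg => ?_
      rw [map_mul, hd, show (Ideal.Quotient.mk (span {t})) (α g) = g from hα g hg, smul_eq_mul]
    obtain ⟨z, hz⟩ := mem_span_singleton.1 h2; refine ⟨fun g => of I A (d g), of I A z + y - ∑ g ∈ G, of I A (d g) * Y g, ?_⟩
    have h3 : ∑ g ∈ G, of I A (d g) * X g = of I A (∑ g ∈ G, d g * α g) + τ * ∑ g ∈ G, of I A (d g) * Y g := by
      rw [map_sum, mul_sum, ← sum_add_distrib]; exact sum_congr rfl fun g hg => by rw [hXY g hg, of_mul]; ring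
    rw [hy, h3, sub_eq_iff_eq_add.1 hz, map_add, of_mul]; ring
  by_cases hτP : τ ∈ P
  · refine ⟨insert τ (G.image X), le_antisymm (Ideal.span_le.2 fun x hx => ?_) fun x hx => ?_⟩
    · rcases mem_insert.1 hx with rfl | hx
      · exact hτP
      · obtain ⟨g, hg, rfl⟩ := mem_image.1 hx; exact hXP g hg
    · obtain ⟨c, x', rfl⟩ := hstep x hx; refine Ideal.add_mem _ (Ideal.sum_mem _ fun g hg => Ideal.mul_mem_left _ _ (Ideal.subset_span ?_))
        (Ideal.mul_mem_right _ _ (Ideal.subset_span (Finset.mem_insert_self _ _)))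
      exact Finset.mem_insert_of_mem (Finset.mem_image_of_mem X hg)
  · refine ⟨G.image X, le_antisymm (Ideal.span_le.2 fun x hx => ?_) fun x hx => ?_⟩
    · obtain ⟨g, hg, rfl⟩ := mem_image.1 hx; exact hXP g hg
    · have hstep' : ∀ x : P, ∃ c : A ⧸ span {t} → AdicCompletion I A, ∃ x' : P, (x : AdicCompletion I A) = ∑ g ∈ G, c g * X g + τ * x' := fun x => by
        obtain ⟨c, x', hx'⟩ := hstep x x.2; have h1 : τ * x' ∈ P := by
          rw [← sub_eq_iff_eq_add'.2 hx']; exact P.sub_mem x.2 (P.sum_mem fun g hg => P.mul_mem_left _ (hXP g hg))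
        exact ⟨c, ⟨x', (hP.mem_or_mem h1).resolve_left hτP⟩, hx'⟩
      choose c x' hx' using hstep'
      let Z : ℕ → P := fun n => x'^[n] ⟨x, hx⟩
      have hZ : ∀ n, (Z n : AdicCompletion I A) = ∑ g ∈ G, c (Z n) g * X g + τ * (Z (n + 1) : AdicCompletion I A) := fun n => by
        rw [show Z (n + 1) = x' (Z n) from iterate_succ_apply' _ _ _]; exact hx' _
      have hsum : ∀ n, x = ∑ g ∈ G, (∑ i ∈ range n, τ ^ i * c (Z i) g) * X g + τ ^ n * (Z n : AdicCompletion I A) := fun n => by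
        induction n with
        | zero => simp [Z]
        | succ n ih =>
          rw [hZ n] at ih; rw [ih]; simp only [sum_range_succ, add_mul, sum_add_distrib, mul_add, mul_sum, pow_succ]; simp only [mul_assoc, add_assoc]
      choose s hs using fun g => h.exists_sum fun i => c (Z i) g
      choose z hz using hs
      have hxe : x = ∑ g ∈ G, s g * X g := by
        refine sub_eq_zero.1 (h.eq_zero_of_forall fun k => ⟨(Z k : AdicCompletion I A) - ∑ g ∈ G, z g k * X g, ?_⟩)
        rw [hsum k]; simp only [hz _ k, add_mul, sum_add_distrib, mul_sub, mul_sum, mul_assoc]; ring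
      rw [hxe]; exact Ideal.sum_mem _ fun g hg => Ideal.mul_mem_left _ _ (Ideal.subset_span (Finset.mem_image_of_mem X hg))

end IsTateBase

end Completion
section LamPre
/-- The absolute value of `p` on the circle with parameter `ρ`. -/
def rad (p : ℕ) (ρ : ℝ≥0) : ℝ := (p : ℝ) ^ (-(ρ : ℝ))

lemma rad_pos {ρ : ℝ≥0} : 0 < rad p ρ := Real.rpow_pos_of_pos p_pos _

lemma rad_mul_p (ρ : ℝ≥0) : rad p (ρ * p) = rad p ρ ^ p := by
  rw [rad, rad, ← rpow_natCast, ← rpow_mul p_pos.le, NNReal.coe_mul, NNReal.coe_natCast, neg_mul]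

/-- `ρ = 1/r` and `β = 1/b` are the parameters of a ring `Λ_{R₀,[0,b],K}` on which the lifts `l` are defined. -/
structure Lifts.LevelAt (l : Lifts K ϖ) (ρ β : ℝ≥0) (S : ℕ) : Prop where
  pos : 0 < ρ
  lt : rad p ρ < l.θ₁
  rpow : (p : ℝ) ^ (β : ℝ) = fn ϖ ^ (-(S : ℤ))
  unif : IsUniformizerEK K ϖ
  eps : ∃ ε, IsEps p ε

variable (u)

variable (K) in
/-- The elements of `R₀ ⊗ Ã` of valuation at least `c v(π_K)`, where `u` has the valuation of `π_K ^ S`. -/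
def LG (θ q : ℝ) (S : ℕ) (c : ℤ) : Submodule R₀ (R₀ ⊗[ℤ_[p]] Ã) :=
  Submodule.span R₀ {y | ∃ (n : ℕ) (x : Ã), x ∈ Lf K θ (q ^ (c - S * n)) ∧ y = (u ^ n) ⊗ₜ x}

variable {u} {θ q : ℝ} {S : ℕ} {c c' : ℤ} {y y' : R₀ ⊗[ℤ_[p]] ATilde p} {x : ATilde p}

lemma tmul_mem_LG (hx : x ∈ Lf K θ (q ^ c)) : 1 ⊗ₜ x ∈ LG K u θ q S c := subset_span ⟨0, x, by simpa using hx, by rw [pow_zero]⟩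

lemma LG_mul (hε : IsEps p ε) (h0 : 0 < θ) (h1 : θ ≤ 1) (hq : 0 < q) (hy : y ∈ LG K u θ q S c) (hy' : y' ∈ LG K u θ q S c') :
    y * y' ∈ LG K u θ q S (c + c') := by
  refine (?_ : LG K u θ q S c * LG K u θ q S c' ≤ _) (Submodule.mul_mem_mul hy hy')
  rw [LG, LG, Submodule.span_mul_span, Submodule.span_le]
  rintro _ ⟨_, ⟨n, x, hx, rfl⟩, _, ⟨n', x', hx', rfl⟩, rfl⟩
  refine subset_span ⟨n + n', x * x', ?_, by simp only [tmul_mul_tmul, pow_add]⟩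
  have := Lf.mul hε h0 h1 hx hx'
  rwa [← zpow_add₀ hq.ne', show c - S * n + (c' - S * n') = c + c' - S * ((n + n' : ℕ) : ℤ) by push_cast; ring] at this

namespace Lifts.LevelAt

variable {l : Lifts K ϖ} {S : ℕ} (h : l.LevelAt ρ β S)
include h

lemma lt_one : rad p ρ < 1 := h.lt.trans_le l.le_one

lemma q_pos : 0 < fn ϖ := h.unif.fn_pos

lemma zpow_mem (n : ℤ) : (1 ⊗ₜ ((l.w ^ n : Ãˣ) : Ã) : R₀ ⊗[ℤ_[p]] Ã) ∈ LG K u (rad p ρ) (fn ϖ) S n := tmul_mem_LG (l.zpow_mem_Lf rad_pos h.lt n)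

lemma mul_mem (hy : y ∈ LG K u (rad p ρ) (fn ϖ) S c) (hy' : y' ∈ LG K u (rad p ρ) (fn ϖ) S c') : y * y' ∈ LG K u (rad p ρ) (fn ϖ) S (c + c') :=
  LG_mul h.eps.choose_spec rad_pos h.lt_one.le h.q_pos hy hy'

lemma zpow_mul_mem_iff (n : ℤ) : 1 ⊗ₜ ((l.w ^ n : Ãˣ) : Ã) * y ∈ LG K u (rad p ρ) (fn ϖ) S (c + n) ↔ y ∈ LG K u (rad p ρ) (fn ϖ) S c := by
  refine ⟨fun hy => ?_, fun hy => add_comm c n ▸ h.mul_mem (h.zpow_mem n) hy⟩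
  have := h.mul_mem (h.zpow_mem (-n)) hy
  rwa [← mul_assoc, tmul_mul_tmul, ← val_mul, ← zpow_add, one_mul, neg_add_cancel, zpow_zero,
    val_one, ← one_def, one_mul, neg_add_cancel_comm_assoc] at this

lemma zpow_mul_cancel (n : ℤ) (y : R₀ ⊗[ℤ_[p]] Ã) : 1 ⊗ₜ ((l.w ^ n : Ãˣ) : Ã) * (1 ⊗ₜ ((l.w ^ (-n) : Ãˣ) : Ã) * y) = y := by
  rw [← mul_assoc, tmul_mul_tmul, ← val_mul, ← zpow_add, one_mul, add_neg_cancel, zpow_zero, val_one, ← one_def, one_mul]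

lemma mem_LG_mono (hc : c' ≤ c) (hy : y ∈ LG K u (rad p ρ) (fn ϖ) S c) : y ∈ LG K u (rad p ρ) (fn ϖ) S c' := by
  refine Submodule.span_mono ?_ hy
  rintro _ ⟨n, x, hx, rfl⟩
  exact ⟨n, x, Lf.mono hx (zpow_le_zpow_right_of_le_one₀ h.q_pos h.unif.fn_lt_one.le (by lia)), rfl⟩

lemma mem_Fil {a : ℝ} : x ∈ Fil K ρ a ↔ x ∈ Lf K (rad p ρ) ((p : ℝ) ^ (-a)) := mem_Fil_iff h.pos

lemma mem_Fil_zero : x ∈ Fil K ρ 0 ↔ x ∈ Lf K (rad p ρ) 1 := by rw [h.mem_Fil, neg_zero, Real.rpow_zero]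

lemma mem_lamPre : y ∈ ΛP ↔ y ∈ LG K u (rad p ρ) (fn ϖ) S 0 := by
  constructor
  · intro hy; refine Algebra.adjoin_induction (p := fun y _ => y ∈ LG K u (rad p ρ) (fn ϖ) S 0) (fun y hy => ?_) (fun r => ?_)
      (fun _ _ _ _ h1 h2 => Submodule.add_mem _ h1 h2) (fun _ _ _ _ h1 h2 => ?_) hy
    · rcases hy with ⟨x, hx, rfl⟩ | ⟨x, hx, rfl⟩
      · exact tmul_mem_LG (by rw [zpow_zero]; exact h.mem_Fil_zero.1 hx)
      · refine subset_span ⟨1, x, ?_, by rw [pow_one]⟩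
        rw [h.mem_Fil, neg_neg, h.rpow] at hx; simpa using hx
    · rw [Algebra.algebraMap_eq_smul_one]; refine smul_mem _ _ ?_; have := h.zpow_mem (u := u) 0; aesop
    · have := h.mul_mem h1 h2
      simp_all
  · intro hy; refine (?_ : LG K u (rad p ρ) (fn ϖ) S 0 ≤ Subalgebra.toSubmodule (ΛP)) hy; rw [LG, Submodule.span_le]
    rintro _ ⟨n, x, hx, rfl⟩; have h1 := l.zpow_mul_mem_Lf h.eps.choose_spec rad_pos h.lt (S * n) hx
    rw [← zpow_add₀ h.q_pos.ne', zero_sub, add_neg_cancel, zpow_zero, ← h.mem_Fil_zero] at h1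
    have h2 : ((l.w ^ (-(S : ℤ)) : Ãˣ) : Ã) ∈ Fil K ρ (-(β : ℝ)) := by
      rw [h.mem_Fil, neg_neg, h.rpow]; exact l.zpow_mem_Lf rad_pos h.lt _
    have h3 := (ΛP).mul_mem ((ΛP).pow_mem (Algebra.subset_adjoin (Or.inr ⟨_, h2, rfl⟩)) n)
      (Algebra.subset_adjoin (Or.inl ⟨_, h1, rfl⟩))
    rwa [tmul_pow, tmul_mul_tmul, mul_one, ← mul_assoc,
      ← val_pow_eq_pow_val, ← val_mul, ← zpow_natCast, ← zpow_mul, ← zpow_add, neg_mul, neg_add_cancel, zpow_zero, val_one, one_mul] at h3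

end Lifts.LevelAt

/-- The element `π_K` of the ring of definition before completion. -/
def Lifts.LevelAt.t {l : Lifts K ϖ} {S : ℕ} (h : l.LevelAt ρ β S) (u : R₀) : lamPre K u ρ β :=
  ⟨1 ⊗ₜ (l.w : Ã), h.mem_lamPre.2 (h.mem_LG_mono zero_le_one (by have := h.zpow_mem (u := u) 1; simp_all))⟩

namespace Lifts.LevelAt

variable {l : Lifts K ϖ} {S : ℕ} (h : l.LevelAt ρ β S)
include h

lemma coe_t_pow (n : ℕ) : ((h.t u ^ n : ΛP) : R₀ ⊗[ℤ_[p]] Ã) = 1 ⊗ₜ ((l.w ^ (n : ℤ) : Ãˣ) : Ã) := by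
  rw [coe_pow, t, tmul_pow, one_pow, zpow_natCast, val_pow_eq_pow_val]

lemma t_pow_dvd_iff {n : ℕ} {y : ΛP} : h.t u ^ n ∣ y ↔ (y : R₀ ⊗[ℤ_[p]] Ã) ∈ LG K u (rad p ρ) (fn ϖ) S n := by
  constructor
  · rintro ⟨z, rfl⟩; rw [coe_mul, coe_t_pow]; have := (h.zpow_mul_mem_iff n).2 (h.mem_lamPre.1 z.2); simp_all
  · intro hy; refine ⟨⟨1 ⊗ₜ ((l.w ^ (-n : ℤ) : Ãˣ) : Ã) * (y : R₀ ⊗[ℤ_[p]] Ã), h.mem_lamPre.2 ?_⟩, Subtype.ext ?_⟩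
    · have := (h.zpow_mul_mem_iff (-n)).2 hy
      simp_all
    · rw [coe_mul, coe_t_pow, h.zpow_mul_cancel]

lemma isTateBase : IsTateBase (ΛI) (h.t u) where
  reg x hx := Subtype.ext (by
    have h1 := congrArg (fun z : ΛP => 1 ⊗ₜ ((l.w ^ (-1 : ℤ) : Ãˣ) : Ã) * (z : R₀ ⊗[ℤ_[p]] Ã)) hx
    have h2 := h.zpow_mul_cancel (-1) (x : R₀ ⊗[ℤ_[p]] Ã)
    rw [neg_neg, zpow_one] at h2; simp only [coe_mul, ZeroMemClass.coe_zero, mul_zero] at h1; exact h2.symm.trans h1)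
  pow_mem := by
    obtain ⟨a, ha⟩ := exists_pow_lt_of_lt_one (inv_pos.2 (p_pos (p := p))) h.unif.fn_lt_one
    refine ⟨a + 1, a.succ_pos, Ideal.subset_span ⟨((l.w ^ ((a + 1 : ℕ) : ℤ) : Ãˣ) : Ã), ?_, h.coe_t_pow _⟩⟩; rw [h.mem_Fil, Real.rpow_neg_one]
    refine Lf.mono (l.zpow_mem_Lf rad_pos h.lt _) ?_; rw [zpow_natCast]
    exact (pow_le_pow_of_le_one h.q_pos.le h.unif.fn_lt_one.le a.le_succ).trans ha.le
  le_span := by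
    obtain ⟨b, hb⟩ := exists_pow_lt_of_lt_one h.q_pos (inv_lt_one_of_one_lt₀ (one_lt_p (p := p))); refine ⟨b + 1, b.succ_pos, ?_⟩
    have hk : ∀ k, ΛI ^ k ≤ span {y : ΛP | ∃ x ∈ Lf K (rad p ρ) ((p : ℝ)⁻¹ ^ k),
        (y : R₀ ⊗[ℤ_[p]] Ã) = 1 ⊗ₜ[ℤ_[p]] x} := fun k => by
      induction k with
      | zero =>
        rw [pow_zero, Ideal.one_eq_top, top_le_iff, Ideal.eq_top_iff_one]
        exact Ideal.subset_span ⟨1, by simpa using l.zpow_mem_Lf rad_pos h.lt 0, rfl⟩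
      | succ k ih =>
        rw [pow_succ]; refine (Ideal.mul_mono_left ih).trans ?_; rw [lamIdeal, Ideal.span_mul_span', Ideal.span_le]
        rintro _ ⟨y, ⟨x, hx, hy⟩, y', ⟨x', hx', hy'⟩, rfl⟩; rw [h.mem_Fil, Real.rpow_neg_one] at hx'
        refine Ideal.subset_span ⟨x * x', pow_succ (p : ℝ)⁻¹ k ▸ Lf.mul h.eps.choose_spec rad_pos h.lt_one.le hx hx', ?_⟩
        simp_all
    refine (hk _).trans (Ideal.span_le.2 ?_); rintro y ⟨x, hx, hy⟩; rw [SetLike.mem_coe, mem_span_singleton, ← pow_one (h.t u), h.t_pow_dvd_iff, hy]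
    refine tmul_mem_LG (Lf.mono hx ?_); rw [cast_one, zpow_one]
    refine (pow_le_pow_of_le_one (inv_nonneg.2 p_pos.le) (inv_le_one_of_one_le₀ one_lt_p.le) b.le_succ).trans hb.le

end Lifts.LevelAt

end LamPre
section FrobBasis
lemma lTensor_injective_of_saturated {M N : Type*} [AddCommGroup M] [AddCommGroup N] [Module ℤ_[p] M] [Module ℤ_[p] N]
    {j : M →ₗ[ℤ_[p]] N} (hj : Injective j) (hs : ∀ z, (p : ℤ_[p]) • z ∈ LinearMap.range j → z ∈ LinearMap.range j)
    (R : Type*) [AddCommGroup R] [Module ℤ_[p] R] : Injective (j.lTensor R) := by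
  have hn : ∀ n z, (p : ℤ_[p]) ^ n • z ∈ LinearMap.range j → z ∈ LinearMap.range j := fun n => by
    induction n with
    | zero => simp
    | succ n ih => intro z hz; rw [pow_succ, mul_smul] at hz; grind
  have : Module.Flat ℤ_[p] (N ⧸ LinearMap.range j) := by
    rw [IsDedekindDomain.flat_iff_torsion_eq_bot, eq_bot_iff]; rintro z ⟨⟨c, hc⟩, hcz⟩; obtain ⟨z, rfl⟩ := Submodule.mkQ_surjective _ z
    have h1 : c • z ∈ LinearMap.range j := (Submodule.Quotient.mk_eq_zero _).1 hcz
    rw [PadicInt.unitCoeff_spec (nonZeroDivisors.ne_zero hc), mul_smul] at h1; refine (Submodule.Quotient.mk_eq_zero _).2 (hn c.valuation z ?_)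
    exact (Submodule.smul_mem_iff_of_isUnit _ (Units.isUnit _)).1 h1
  exact LinearMap.lTensor_injective_of_exact_of_flat (LinearMap.range j).mkQ (Submodule.mkQ_surjective _) j hj
    (LinearMap.exact_map_mkQ_range j) R

/-- `𝐀_K` as a `ℤ_p`-module. -/
def AKs (hε : IsEps p ε) (K : IntermediateField ℚ_[p] (PadicAlgCl p)) : Submodule ℤ_[p] Ã where
  __ := (AKr hε K).toAddSubmonoid
  smul_mem' c x hx := by
    rw [smul_def]; refine (AKr hε K).mul_mem (mem_AK_of_padic (K := K) fun n => ⟨(c.appr n : Ã), natCast_mem (AKr hε K) _, ?_⟩) hx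
    obtain ⟨d, hd⟩ := mem_span_singleton.1 (PadicInt.appr_spec n c)
    exact ⟨algebraMap _ _ d, by rw [← map_natCast (algebraMap ℤ_[p] Ã), ← map_sub, hd, map_mul, map_pow, map_natCast]⟩

/-- `(x_a) ↦ ∑_a [ε]^a φ(x_a)`. -/
def frobSum (hε : IsEps p ε) (K : IntermediateField ℚ_[p] (PadicAlgCl p)) : (Fin p → AKs hε K) →ₗ[ℤ_[p]] Ã :=
  ∑ a : Fin p, mulLeft ℤ_[p] (ω ε ^ (a : ℕ)) ∘ₗ (frobW p).toLinearMap ∘ₗ (AKs hε K).subtype ∘ₗ proj a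

lemma frobSum_apply (hε : IsEps p ε) (x : Fin p → AKs hε K) : frobSum hε K x = ∑ a : Fin p, ω ε ^ (a : ℕ) * frobW p (x a : Ã) := by
  rw [frobSum, LinearMap.sum_apply]; rfl

lemma dvd_of_frobSum (hε : IsEps p ε) {x : Fin p → AKs hε K} {z : Ã} (hx : frobSum hε K x = (p : Ã) * z) :
    ∃ y : Fin p → AKs hε K, x = (p : ℤ_[p]) • y ∧ z = frobSum hε K y := by
  have h0 := congrArg (fun z : Ã => z.coeff 0) hx
  simp only [frobSum_apply, coeff_zero_sum, coeff_zero_mul, coeff_zero_pow, teichmuller_coeff_zero, coeff_frobW] at h0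
  rw [p_dvd_iff.1 ⟨(1 : Ã), (mul_one _).symm⟩, zero_mul] at h0
  have h1 := (hε.isPBasis (EK K) fun _ hx => ((mem_EK hε).1 hx).1)
  replace h1 := pow_indep h1 (fun i => if hi : i < p then (x ⟨i, hi⟩ : Ã).coeff 0 else 0) (fun i => by
      split_ifs with hi
      · exact coeff_zero_mem_EK hε (x ⟨i, hi⟩).2
      simp) (by
      rw [sum_range, ← h0]; simp)
  have h2 : ∀ a : Fin p, ∃ y : AKs hε K, x a = (p : ℤ_[p]) • y := fun a => by
    have := h1 a a.2
    rw [dif_pos a.2] at this; obtain ⟨y, hy⟩ := p_dvd_iff.2 this; refine ⟨⟨y, mem_AK_of_p_mul (K := K) hε (hy ▸ (x a).2)⟩, Subtype.ext (hy.trans ?_)⟩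
    rw [Submodule.coe_smul, smul_def, map_natCast]
  choose y hy using h2
  have hxy : x = (p : ℤ_[p]) • y := funext hy
  refine ⟨y, hxy, ?_⟩
  rw [hxy, map_smul, smul_def, map_natCast] at hx
  exact (mul_left_cancel₀ (Nat.cast_ne_zero.2 (prm p).ne_zero) hx).symm

lemma lTensor_frobSum_injective (hε : IsEps p ε) (R : Type*) [AddCommGroup R] [Module ℤ_[p] R] : Injective ((frobSum hε K).lTensor R) := by
  refine lTensor_injective_of_saturated ((injective_iff_map_eq_zero _).2 fun x hx => ?_) (fun z ⟨x, hx⟩ => ?_) R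
  · have h1 : ∀ n, ∃ y : Fin p → AKs hε K, x = (p : ℤ_[p]) ^ n • y ∧ frobSum hε K y = 0 := fun n => by
      induction n with
      | zero => simp_all
      | succ n ih =>
        obtain ⟨y, rfl, hy⟩ := ih; obtain ⟨y', rfl, hy'⟩ := dvd_of_frobSum hε (hy.trans (mul_zero _).symm)
        exact ⟨y', by rw [smul_smul, pow_succ], hy'.symm⟩
    refine funext fun a => Subtype.ext (eq_of_forall_dvd fun n => ?_)
    obtain ⟨y, hy, -⟩ := h1 n; refine ⟨(y a : Ã), ?_⟩; rw [hy, Pi.smul_apply, Submodule.coe_smul, smul_def, map_pow, map_natCast]; exact sub_zero _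
  · rw [smul_def, map_natCast] at hx; obtain ⟨y, -, hy⟩ := dvd_of_frobSum hε hx; simp_all

variable (R₀) in
/-- `(y_a) ↦ ∑_a [ε]^a φ(y_a)` on `R₀ ⊗ Ã`. -/
def frobSumT (ε : Ĉ) : (Fin p → R₀ ⊗[ℤ_[p]] Ã) →ₗ[R₀] R₀ ⊗[ℤ_[p]] Ã :=
  ∑ a : Fin p, mulLeft R₀ (1 ⊗ₜ (ω ε ^ (a : ℕ))) ∘ₗ (tensorEnd R₀ (frobW p)).toLinearMap ∘ₗ proj a

lemma frobSumT_apply (y : Fin p → R₀ ⊗[ℤ_[p]] Ã) :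
    frobSumT R₀ ε y = ∑ a : Fin p, (1 ⊗ₜ (ω ε ^ (a : ℕ))) * tensorEnd R₀ (frobW p) (y a) := by
  rw [frobSumT, LinearMap.sum_apply]; rfl

lemma frobSumT_tmul (r : R₀) (x : Fin p → Ã) : frobSumT R₀ ε (fun a => r ⊗ₜ x a) = r ⊗ₜ ∑ a : Fin p, ω ε ^ (a : ℕ) * frobW p (x a) := by
  rw [frobSumT_apply, TensorProduct.tmul_sum]
  exact sum_congr rfl fun a _ => by rw [tensorEnd_tmul, tmul_mul_tmul, one_mul]

variable {θ q : ℝ} {S : ℕ} {c : ℤ}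

lemma eq_zero_of_frobSumT (hε : IsEps p ε) {y : Fin p → R₀ ⊗[ℤ_[p]] Ã} (hy : ∀ a, y a ∈ LG K u θ q S c) (h0 : frobSumT R₀ ε y = 0) : y = 0 := by
  have h1 : ∀ a, ∃ z : R₀ ⊗[ℤ_[p]] AKs hε K, y a = (AKs hε K).subtype.lTensor R₀ z := fun a => by
    have : LG K u θ q S c ≤ LinearMap.range ((AKs hε K).subtype.baseChange R₀) := by
      rw [LG, Submodule.span_le]; rintro _ ⟨n, x, hx, rfl⟩; exact ⟨(u ^ n) ⊗ₜ ⟨x, hx.1⟩, rfl⟩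
    obtain ⟨z, hz⟩ := this (hy a); exact ⟨z, hz.symm⟩
  choose z hz using h1
  have h2 : (frobSum hε K).lTensor R₀ (∑ a, (LinearMap.single ℤ_[p] (fun _ : Fin p => AKs hε K) a).lTensor R₀ (z a)) = 0 := by
    rw [← h0, frobSumT_apply, map_sum]; refine sum_congr rfl fun a _ => ?_
    rw [hz]; induction z a using TensorProduct.induction_on with
    | zero => simp
    | add x y hx hy => simp only [map_add, mul_add, hx, hy]
    | tmul r x =>
      rw [lTensor_tmul, lTensor_tmul, lTensor_tmul, tensorEnd_tmul, tmul_mul_tmul, one_mul, frobSum_apply, sum_eq_single a]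
      · simp
      · intro b _ hb; simp [hb]
      · simp
  have h3 := lTensor_frobSum_injective hε R₀ (h2.trans (map_zero _).symm)
  funext b
  have h4 := congrArg ((proj b : (Fin p → AKs hε K) →ₗ[ℤ_[p]] AKs hε K).lTensor R₀) h3
  rw [map_sum, map_zero, sum_eq_single b, ← LinearMap.comp_apply, ← LinearMap.lTensor_comp, LinearMap.proj_comp_single_same,
    LinearMap.lTensor_id] at h4
  · rw [hz, show z b = 0 from h4, map_zero]; rfl
  · intro a _ hab; rw [← LinearMap.comp_apply, ← LinearMap.lTensor_comp, LinearMap.proj_comp_single_ne _ _ _ _ hab.symm, LinearMap.lTensor_zero]; rfl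
  · simp

lemma exists_frobSumT {N : ℕ} (hq : 0 < q) (hB : ∀ B', 0 ≤ B' → ∀ x ∈ Lf K (θ ^ p) (B' ^ p * q ^ N), ∃ y : Fin p → Ã,
      (∀ a, y a ∈ Lf K θ B') ∧ x = ∑ a : Fin p, ω ε ^ (a : ℕ) * frobW p (y a))
    {y : R₀ ⊗[ℤ_[p]] Ã} (hy : y ∈ LG K u (θ ^ p) q (p * S) (p * c + N)) :
    ∃ z, (∀ a, z a ∈ LG K u θ q S c) ∧ y = frobSumT R₀ ε z := by
  induction hy using Submodule.span_induction with
  | mem y hy =>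
    obtain ⟨n, x, hx, rfl⟩ := hy; have e : (q ^ (c - S * n)) ^ p * q ^ N = q ^ (p * c + N - (p * S : ℕ) * n) := by
      rw [← zpow_natCast (q ^ _) p, ← zpow_natCast q N, ← zpow_mul, ← zpow_add₀ hq.ne']; congr 1; push_cast; ring
    obtain ⟨z, hz, rfl⟩ := hB _ (zpow_pos hq (c - S * n)).le x (e ▸ hx)
    exact ⟨fun a => (u ^ n) ⊗ₜ z a, fun a => subset_span ⟨n, z a, hz a, rfl⟩, (frobSumT_tmul _ _).symm⟩
  | zero => exact ⟨0, fun _ => zero_mem _, (map_zero _).symm⟩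
  | add y y' _ _ h h' =>
    obtain ⟨z, hz, rfl⟩ := h; obtain ⟨z', hz', rfl⟩ := h'; exact ⟨z + z', fun a => add_mem (hz a) (hz' a), (map_add _ _ _).symm⟩
  | smul r y _ h =>
    obtain ⟨z, hz, rfl⟩ := h; exact ⟨r • z, fun a => smul_mem _ _ (hz a), (map_smul _ _ _).symm⟩

lemma galW_sub_mem_LG (hq : 0 < q) {σ : GalQp p} {C : ℤ} (hσ : ∀ B, ∀ x ∈ Lf K θ B, galW σ x - x ∈ Lf K θ (B * q ^ C))
    {y : R₀ ⊗[ℤ_[p]] Ã} (hy : y ∈ LG K u θ q S c) : tensorEnd R₀ (galW σ) y - y ∈ LG K u θ q S (c + C) := by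
  refine (?_ : LG K u θ q S c ≤ (LG K u θ q S (c + C)).comap ((tensorEnd R₀ (galW σ)).toLinearMap - LinearMap.id)) hy
  rw [LG, Submodule.span_le]
  rintro _ ⟨n, x, hx, rfl⟩
  refine subset_span ⟨n, galW σ x - x, ?_, ?_⟩
  · have := hσ _ x hx
    rwa [← zpow_add₀ hq.ne', sub_add_eq_add_sub] at this
  · rw [TensorProduct.tmul_sub]; rfl

end FrobBasis
section FiniteType
lemma isNoetherianRing_quotient {R A : Type*} [CommRing R] [IsNoetherianRing R] [CommRing A] [Algebra R A] (t : A)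
    {G : Set A} (hG : G.Finite) (h : ∀ y, ∃ a ∈ Algebra.adjoin R G, t ∣ y - a) : IsNoetherianRing (A ⧸ span {t}) := by
  have : Algebra.FiniteType R (A ⧸ span {t}) := by
    refine ⟨Subalgebra.fg_def.2 ⟨mkₐ R (span {t}) '' G, hG.image _, eq_top_iff.2 fun y _ => ?_⟩⟩
    obtain ⟨y, rfl⟩ := mk_surjective y; obtain ⟨a, ha, hd⟩ := h y; rw [← AlgHom.map_adjoin, (mk_eq_mk_iff_sub_mem _ _).2 (mem_span_singleton.2 hd)]
    exact ⟨a, ha, rfl⟩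
  exact Algebra.FiniteType.isNoetherianRing R _

/-- The elements that are congruent modulo `t` to an element of the subalgebra generated by `G`. -/
def adjoinMod (R : Type*) {A : Type*} [CommRing R] [CommRing A] [Algebra R A] (t : A) (G : Set A) : Subalgebra R A where
  carrier := {y | ∃ a ∈ Algebra.adjoin R G, t ∣ y - a}
  mul_mem' := by
    rintro y y' ⟨a, ha, b, hb⟩ ⟨a', ha', b', hb'⟩; refine ⟨a * a', mul_mem ha ha', y * b' + a' * b, ?_⟩; grind
  add_mem' := by
    rintro y y' ⟨a, ha, hb⟩ ⟨a', ha', hb'⟩; exact ⟨a + a', add_mem ha ha', by rw [add_sub_add_comm]; exact dvd_add hb hb'⟩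
  algebraMap_mem' r := ⟨_, Subalgebra.algebraMap_mem _ r, by simp⟩

lemma mem_adjoinMod_of_dvd {R A : Type*} [CommRing R] [CommRing A] [Algebra R A] {t : A} {G : Set A} {y z : A}
    (hz : z ∈ adjoinMod R t G) (h : t ∣ y - z) : y ∈ adjoinMod R t G := by
  obtain ⟨a, ha, hd⟩ := hz
  exact ⟨a, ha, by rw [← sub_add_sub_cancel y z a]; exact dvd_add h hd⟩

lemma subset_adjoinMod {R A : Type*} [CommRing R] [CommRing A] [Algebra R A] {t : A} {G : Set A} {y : A} (hy : y ∈ G) :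
    y ∈ adjoinMod R t G := ⟨y, Algebra.subset_adjoin hy, by simp⟩

lemma exists_of_add_mul {A : Type*} [CommRing A] (t : A) (x : AdicCompletion (span {t}) A) : ∃ a y, x = of _ A a + of _ A t * y := by
  obtain ⟨a, ha⟩ := mk_surjective (evalOneₐ (span {t}) x)
  have h1 : x - of _ A a ∈ RingHom.ker (evalOneₐ (span {t})).toRingHom := by
    rw [RingHom.mem_ker, map_sub]; exact sub_eq_zero.2 ha.symm
  replace h1 := (AdicCompletion.ker_evalOneₐ_eq_map (I := span {t}) (Submodule.fg_span_singleton t)).le h1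
  rw [Ideal.map_span, Set.image_singleton] at h1
  obtain ⟨y, hy⟩ := mem_span_singleton.1 h1
  exact ⟨a, y, by rw [← sub_eq_iff_eq_add']; exact hy⟩

lemma IsStrictlyTFT.exists_finite {m m' : ℕ} {R₀ : Type*} [CommRing R₀] [Algebra ℤ_[p] R₀] {u : R₀} (h : IsStrictlyTFT p m m' u) :
    ∃ G : Set R₀, G.Finite ∧ ∀ r, r ∈ adjoinMod ℤ_[p] u G := by
  obtain ⟨-, N, g, hg, hu⟩ := h
  let ι : MvPolynomial (Fin N) (DCirc p m m') →ₐ[ℤ_[p]] R₀ := g.comp (ofId (MvPolynomial (Fin N) (DCirc p m m')) (DCircTate p m m' N) |>.restrictScalars ℤ_[p])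
  let κ : MvPolynomial (Fin 2) ℤ_[p] →ₐ[ℤ_[p]] R₀ :=
    (ι.comp ((ofId (DCirc p m m') _).restrictScalars ℤ_[p])).comp
      (((ofId (DPoly p m m') (DCirc p m m')).restrictScalars ℤ_[p]).comp (mkₐ ℤ_[p] _))
  refine ⟨Set.range (fun i => κ (MvPolynomial.X i)) ∪ Set.range (fun i => ι (MvPolynomial.X i)),
    (Set.finite_range _).union (Set.finite_range _), fun r => ?_⟩
  obtain ⟨x, rfl⟩ := hg r
  obtain ⟨P, y, rfl⟩ := exists_of_add_mul _ x
  refine mem_adjoinMod_of_dvd (z := ι P) ?_ ⟨g y, ?_⟩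
  · induction P using induction_on with
    | C d =>
      obtain ⟨f, d', rfl⟩ := exists_of_add_mul _ d; obtain ⟨f, rfl⟩ := mk_surjective f
      refine mem_adjoinMod_of_dvd (z := κ f) ?_ ⟨ι (MvPolynomial.C d'), ?_⟩
      · induction f using induction_on with
        | C c => simp
        | add f f' h h' => rw [map_add]; exact add_mem h h'
        | mul_X f i h => rw [map_mul]; exact mul_mem h (subset_adjoinMod (Or.inl ⟨i, rfl⟩))
      · rw [map_add, map_add, map_mul, map_mul]; exact (add_sub_cancel_left _ _).trans (congrArg (· * _) hu)
    | add f f' h h' => rw [map_add]; exact add_mem h h'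
    | mul_X f i h => rw [map_mul]; exact mul_mem h (subset_adjoinMod (Or.inr ⟨i, rfl⟩))
  · rw [map_add, map_mul, hu]; exact add_sub_cancel_left _ _

namespace Lifts.LevelAt

variable {l : Lifts K ϖ} {S : ℕ} (h : l.LevelAt ρ β S)
include h

lemma exists_finite_inr [FiniteDimensional ℚ_[p] K] (hθ : rad p ρ ≤ l.θ₁ * fn ϖ) {m M : ℕ} (hm : 0 < m) (hM : rad p ρ ^ m = fn ϖ ^ M) :
    ∃ G : Set (ΛP), G.Finite ∧ ∀ x ∈ Lf K (rad p ρ) 1, ∃ y ∈ adjoinMod ℤ_[p] (h.t u) G, (y : R₀ ⊗[ℤ_[p]] Ã) = 1 ⊗ₜ x := by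
  obtain ⟨ε, hε⟩ := h.eps
  have h0 : 0 < rad p ρ := rad_pos
  have h1 := h.lt_one
  have hlt := h.lt
  have hq0 := h.q_pos
  have hq1 := h.unif.fn_lt_one
  set θ := rad p ρ
  set q := fn ϖ
  have hpp : ∀ n, (p : Ã) ^ n ∈ Lf K θ (θ ^ n) := fun n => by
    refine ⟨(AKr hε K).pow_mem (natCast_mem _ p) n, ?_, (GB.oc (θ' := 1) (B := 1) ?_ h1 le_rfl).cv⟩
    · simpa using (GB_one (p := p) (θ := θ)).p_pow_mul h0 n
    · simpa using (GB_one (p := p) (θ := 1)).p_pow_mul one_pos n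
  obtain ⟨f, hf, hlead⟩ := h.unif.exists_lead hε
  have hκ : ∀ r : ℕ, ∃ k : ℤ, θ ^ r ≤ q ^ k ∧ q ^ (k + 1) < θ ^ r := fun r => by
    obtain ⟨k, hk, hk'⟩ := exists_mem_Ioc_zpow (pow_pos h0 r) ((one_lt_inv₀ hq0).2 hq1)
    exact ⟨-(k + 1), by simp_all, by simp_all⟩
  choose κ hκ hκ' using hκ
  let G₀ : Set Ã := l.F '' {a | a ∈ EK K ∧ a ^ p ^ f = a} ∪
    ((fun r => (p : Ã) ^ r * ((l.w ^ (-κ r) : Ãˣ) : Ã)) '' Set.Iio m ∪ {(p : Ã) ^ m * ((l.w ^ (-(M : ℤ)) : Ãˣ) : Ã)})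
  have hG₀ : G₀.Finite := (((pow_pow_finite hf).subset fun a ha => ha.2).image _).union (((Set.finite_Iio m).image _).union (Set.finite_singleton _))
  let G : Set (ΛP) := Subtype.val ⁻¹' ((fun x => (1 : R₀) ⊗ₜ[ℤ_[p]] x) '' G₀)
  refine ⟨G, (hG₀.image _).preimage Subtype.val_injective.injOn, ?_⟩
  let Q : Subalgebra ℤ_[p] Ã := ((adjoinMod ℤ_[p] (h.t u) G).map ((ΛP).val.restrictScalars ℤ_[p])).comap Algebra.TensorProduct.includeRight
  have hF1 : ∀ a ∈ EK K, l.F a ∈ Lf K θ (fn a) := fun a ha => (l.spec a ha).2.2.mem_Lf (l.spec a ha).1 h0 hlt l.le_one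
  have hQG : ∀ x ∈ G₀, x ∈ Lf K θ 1 → x ∈ Q := fun x hx hx1 =>
    ⟨⟨1 ⊗ₜ x, h.mem_lamPre.2 (tmul_mem_LG (by rwa [zpow_zero]))⟩, subset_adjoinMod ⟨x, hx, rfl⟩, rfl⟩
  have hQd : ∀ x y, y ∈ Q → x - y ∈ Lf K θ q → x ∈ Q := fun x y ⟨z, hz, hzy⟩ hxy => by
    have h2 : (1 : R₀) ⊗ₜ[ℤ_[p]] (x - y) ∈ LG K u θ q S (1 : ℕ) := tmul_mem_LG (by simp_all)
    let v : ΛP := ⟨_, h.mem_lamPre.2 (h.mem_LG_mono (c' := 0) (by simp) h2)⟩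
    refine ⟨z + v, mem_adjoinMod_of_dvd hz ?_, ?_⟩
    · rw [add_sub_cancel_left, ← pow_one (h.t u), h.t_pow_dvd_iff]; exact h2
    · rw [map_add, show _ = (1 : R₀) ⊗ₜ[ℤ_[p]] y from hzy]; exact (TensorProduct.tmul_add _ _ _).symm.trans (congrArg _ (add_sub_cancel _ _))
  intro x hx
  suffices hxQ : x ∈ Q by
    obtain ⟨y, hy, hyx⟩ := hxQ; exact ⟨y, hy, hyx⟩
  obtain ⟨t, htK, hsum, ht⟩ := exists_digits hε l.spec l.pos l.le_one hx.1
  obtain ⟨hb, hlim⟩ := ht θ 1 h0 hlt hx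
  obtain ⟨N, hN⟩ := eventually_atTop.1 (hlim.eventually_le_const hq0)
  have hterm : ∀ n, (p : Ã) ^ n * l.F (t n) ∈ Lf K θ (fn (t n) * θ ^ n) := fun n => by
    rw [mul_comm (fn _)]; exact Lf.mul hε h0 h1.le (hpp n) (hF1 _ (htK n))
  have hs : ∑ n ∈ range N, (p : Ã) ^ n * l.F (t n) ∈ Lf K θ 1 := Lf.sum hε h0 h1 zero_le_one _ _ fun n _ => Lf.mono (hterm n) (hb n)
  refine hQd x _ (Q.sum_mem fun n _ => ?_) ⟨(AKr hε K).sub_mem hx.1 hs.1, hsum.GB_tail h0 h1.le hq0.le N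
    fun n hn => ?_, (Lf.sub hε h0 h1.le hx hs).2.2⟩
  rotate_left
  · exact ((hF1 _ (htK n)).2.1.p_pow_mul h0 n).mono_right (mul_comm (θ ^ n) _ ▸ hN n hn)
  rcases le_or_gt (fn (t n) * θ ^ n) q with hle | hgt
  · exact hQd _ 0 Q.zero_mem (by rw [sub_zero]; exact Lf.mono (hterm n) hle)
  have ht0 : t n ≠ 0 := fun h => by rw [h, fn_zero, zero_mul] at hgt; linarith
  obtain ⟨a, haK, haf, ha0, k, hk, hak⟩ := hlead _ (htK n) ht0
  have ha1 : fn a = 1 := fn_eq_one_of_pow hf haf ha0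
  have hFa := hF1 a haK
  rw [ha1] at hFa
  have hz : l.F (t n) - l.F a * ((l.w ^ k : Ãˣ) : Ã) ∈ Lf K θ (q ^ k * q) := by
    have hm := Lf.sub hε h0 h1.le (hk ▸ hF1 _ (htK n)) (one_mul (q ^ k) ▸ Lf.mul hε h0 h1.le hFa (l.zpow_mem_Lf h0 hlt k))
    have hg : GB l.θ₁ (q ^ k) (l.F (t n) - l.F a * ((l.w ^ k : Ãˣ) : Ã)) := 
      (hk ▸ (l.spec _ (htK n)).2.2).sub l.pos l.le_one (((l.spec a haK).2.2.mul l.pos l.le_one (l.GB_zpow k)).mono_right (by rw [ha1, one_mul]))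
    refine ⟨hm.1, fun j => ?_, hm.2.2⟩
    rcases Nat.eq_zero_or_pos j with rfl | hj
    · rw [pow_zero, mul_one, dg_zero_right, coeff_zero_sub, coeff_zero_mul, coeff_zero_units_zpow, l.coeff_w,
        (l.spec _ (htK n)).2.1, (l.spec a haK).2.1, ← hk, mul_comm (fn _)]
      exact hak
    · have e : θ ^ j ≤ l.θ₁ ^ j * q := (pow_le_pow_left₀ h0.le hθ j).trans (by
        rw [mul_pow]; exact mul_le_mul_of_nonneg_left (pow_le_of_le_one hq0.le hq1.le hj.ne') (pow_pos l.pos j).le)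
      calc _ ≤ fn (dg _ j) * (l.θ₁ ^ j * q) := mul_le_mul_of_nonneg_left e (fn_nonneg _)
        _ ≤ _ := by rw [← mul_assoc]; exact mul_le_mul_of_nonneg_right (hg j) hq0.le
  refine hQd _ (l.F a * ((p : Ã) ^ n * ((l.w ^ k : Ãˣ) : Ã))) (Q.mul_mem (hQG _ (Or.inl ⟨a, ⟨haK, haf⟩, rfl⟩) hFa) ?_) ?_
  · obtain ⟨d, r, hr, rfl⟩ : ∃ d r, r < m ∧ n = m * d + r := ⟨n / m, n % m, mod_lt n hm, (Nat.div_add_mod n m).symm⟩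
    have e1 : θ ^ (m * d + r) = q ^ ((M * d : ℕ) : ℤ) * θ ^ r := by rw [pow_add, pow_mul, hM, zpow_natCast, pow_mul]
    have hb' := hb (m * d + r)
    rw [e1, hk, ← mul_assoc, ← zpow_add₀ hq0.ne'] at hgt hb'; have e2 : κ r = -(k + (M * d : ℕ)) := by
      have e3 : θ ^ r ≤ q ^ (-(k + (M * d : ℕ))) := by
        rw [zpow_neg, ← one_div, le_div_iff₀ (zpow_pos hq0 _), mul_comm]; exact hb'
      have e4 : q ^ (-(k + (M * d : ℕ)) + 1) < θ ^ r := by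
        rw [zpow_add_one₀ hq0.ne', zpow_neg, inv_mul_lt_iff₀ (zpow_pos hq0 _)]; exact hgt
      have e5 := (zpow_lt_zpow_iff_right_of_lt_one₀ hq0 hq1).1 (e4.trans_le (hκ r))
      have e6 := (zpow_lt_zpow_iff_right_of_lt_one₀ hq0 hq1).1 ((hκ' r).trans_le e3)
      lia
    have e3 : (p : Ã) ^ (m * d + r) * ((l.w ^ k : Ãˣ) : Ã) =
        ((p : Ã) ^ m * ((l.w ^ (-(M : ℤ)) : Ãˣ) : Ã)) ^ d * ((p : Ã) ^ r * ((l.w ^ (-κ r) : Ãˣ) : Ã)) := by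
      rw [mul_pow, mul_mul_mul_comm, ← val_pow_eq_pow_val, ← val_mul, ← zpow_natCast, ← zpow_mul, ← zpow_add, ← pow_mul, ← pow_add, e2]; congr 4
      push_cast; ring
    have hball : ∀ (n : ℕ) (k : ℤ), θ ^ n ≤ q ^ k → (p : Ã) ^ n * ((l.w ^ (-k) : Ãˣ) : Ã) ∈ Lf K θ 1 := fun n k hk =>
      Lf.mono (Lf.mul hε h0 h1.le (hpp n) (l.zpow_mem_Lf h0 hlt (-k))) (by
        rw [zpow_neg, ← div_eq_mul_inv]; exact div_le_one_of_le₀ hk (zpow_pos hq0 _).le)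
    rw [e3]; refine Q.mul_mem (Q.pow_mem (hQG _ (Or.inr (Or.inr rfl)) (hball m M ?_)) d) (hQG _ (Or.inr (Or.inl ⟨r, hr, rfl⟩)) (hball r _ (hκ r)))
    rw [hM, zpow_natCast]
  · rw [mul_left_comm, ← mul_sub]; refine Lf.mono (Lf.mul hε h0 h1.le (hpp n) hz) ?_; rw [← hk, ← mul_assoc, mul_comm (θ ^ n)]
    exact mul_le_of_le_one_left hq0.le (hb n)

lemma isNoetherianRing [FiniteDimensional ℚ_[p] K] (hθ : rad p ρ ≤ l.θ₁ * fn ϖ) {m M m₀ m₀' : ℕ} (hm : 0 < m) (hM : rad p ρ ^ m = fn ϖ ^ M) (hS : 0 < S)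
    (hR : IsStrictlyTFT p m₀ m₀' u) : IsNoetherianRing (Lam0 K u ρ β) := by
  obtain ⟨G, hG, hx⟩ := h.exists_finite_inr (u := u) hθ hm hM
  obtain ⟨G', hG', hr⟩ := hR.exists_finite
  have hU : (u ⊗ₜ ((l.w ^ (-(S : ℤ)) : Ãˣ) : Ã)) ∈ ΛP := h.mem_lamPre.2
    (subset_span ⟨1, _, by simpa only [cast_one, mul_one, zero_sub] using l.zpow_mem_Lf rad_pos h.lt (-(S : ℤ)), by rw [pow_one]⟩)
  let U : ΛP := ⟨_, hU⟩
  refine h.isTateBase.isNoetherianRing (isNoetherianRing_quotient (R := ℤ_[p]) _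
    (G := G ∪ ({U} ∪ algebraMap R₀ _ '' G')) (hG.union ((Set.finite_singleton _).union (hG'.image _))) ?_)
  suffices hs : ∀ y, y ∈ adjoinMod ℤ_[p] (h.t u) (G ∪ ({U} ∪ algebraMap R₀ (ΛP) '' G')) from hs
  set Q := adjoinMod ℤ_[p] (h.t u) (G ∪ ({U} ∪ algebraMap R₀ (ΛP) '' G'))
  have hxQ : ∀ x ∈ Lf K (rad p ρ) 1, ∃ y ∈ Q, (y : R₀ ⊗[ℤ_[p]] Ã) = 1 ⊗ₜ x := fun x hx' => by
    obtain ⟨y, ⟨a, ha, hd⟩, hy⟩ := hx x hx'; exact ⟨y, ⟨a, Algebra.adjoin_mono Set.subset_union_left ha, hd⟩, hy⟩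
  have huQ : h.t u ∣ algebraMap R₀ (ΛP) u := by
    rw [← pow_one (h.t u), h.t_pow_dvd_iff]
    refine h.mem_LG_mono (c := S) (by exact_mod_cast hS) (subset_span ⟨1, 1, ?_, by rw [pow_one]; rfl⟩)
    simpa using l.zpow_mem_Lf rad_pos h.lt 0
  have hrQ : ∀ r, algebraMap R₀ (ΛP) r ∈ Q := fun r => by
    obtain ⟨a, ha, d, hd⟩ := hr r; refine ⟨algebraMap R₀ _ a, ?_, ?_⟩
    · have : (Algebra.adjoin ℤ_[p] G').map (IsScalarTower.toAlgHom ℤ_[p] R₀ (ΛP)) ≤ Algebra.adjoin ℤ_[p] (G ∪ ({U} ∪ algebraMap R₀ (ΛP) '' G')) := by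
        rw [AlgHom.map_adjoin]; exact Algebra.adjoin_mono (Set.subset_union_right.trans' Set.subset_union_right)
      exact this ⟨a, ha, rfl⟩
    · rw [← map_sub, hd, map_mul]; exact huQ.mul_right _
  rintro ⟨y, hy⟩
  have hy' := h.mem_lamPre.1 hy
  have key : ∀ y, y ∈ LG K u (rad p ρ) (fn ϖ) S 0 → ∃ z ∈ Q, (z : R₀ ⊗[ℤ_[p]] Ã) = y := fun y hy => by
    induction hy using Submodule.span_induction with
    | mem y hy =>
      obtain ⟨n, x, hx, rfl⟩ := hy; have h1 := l.zpow_mul_mem_Lf h.eps.choose_spec rad_pos h.lt (S * n) hx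
      rw [← zpow_add₀ h.q_pos.ne', zero_sub, add_neg_cancel, zpow_zero] at h1; obtain ⟨z, hz, hzx⟩ := hxQ _ h1
      refine ⟨U ^ n * z, Q.mul_mem (Q.pow_mem (subset_adjoinMod (Or.inr (Or.inl rfl))) n) hz, ?_⟩; rw [coe_mul, coe_pow, hzx, tmul_pow, tmul_mul_tmul,
        mul_one, ← mul_assoc, ← val_pow_eq_pow_val, ← val_mul, ← zpow_natCast, ← zpow_mul, ← zpow_add, neg_mul,
        neg_add_cancel, zpow_zero, val_one, one_mul]
    | zero => simp
    | add y y' _ _ h h' =>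
      obtain ⟨z, hz, rfl⟩ := h; obtain ⟨z', hz', rfl⟩ := h'; exact ⟨z + z', add_mem hz hz', rfl⟩
    | smul r y _ h =>
      obtain ⟨z, hz, rfl⟩ := h; exact ⟨algebraMap R₀ _ r * z, Q.mul_mem (hrQ r) hz, by rw [← smul_def]; rfl⟩
  obtain ⟨z, hz, hzy⟩ := key y hy'
  rwa [show (⟨y, hy⟩ : ΛP) = z from Subtype.ext hzy.symm]

end Lifts.LevelAt

end FiniteType
section Filtered
/-- `M` is an exhaustive, separated and complete filtration that defines the topology of `D`. -/
structure IsComplFil {D : Type*} [AddCommGroup D] [TopologicalSpace D] (M : ℤ → AddSubgroup D) : Prop where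
  topg : IsTopologicalAddGroup D
  anti : Antitone M
  basis : (𝓝 (0 : D)).HasBasis (fun _ : ℕ => True) (fun k => (M k : Set D))
  exh : ∀ x, ∃ k, x ∈ M k
  sep : ∀ x, (∀ k : ℕ, x ∈ M k) → x = 0
  sum : ∀ k (y : ℕ → D), (∀ n : ℕ, y n ∈ M (k + n)) → ∃ s, ∀ q : ℕ, s - ∑ i ∈ range q, y i ∈ M (k + q)

lemma isHomeomorph_of_approx {D D' : Type*} [AddCommGroup D] [TopologicalSpace D] [AddCommGroup D'] [TopologicalSpace D']
    {M : ℤ → AddSubgroup D} {M' : ℤ → AddSubgroup D'} (h : IsComplFil M) (h' : IsComplFil M') (T : D →+ D') (r N : ℕ) (hr : 0 < r)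
    (hT : ∀ k, ∀ x ∈ M k, T x ∈ M' (r * k)) (hT' : ∀ k, ∀ y ∈ M' (r * k + N), ∃ x ∈ M k, y - T x ∈ M' (r * (k + 1) + N))
    (hi : ∀ x, T x = 0 → x = 0) : IsHomeomorph T := by
  have := h.topg
  have := h'.topg
  have hs : ∀ k, ∀ y ∈ M' (r * k + N), ∃ x ∈ M k, T x = y := fun k y hy => by
    have h1 : ∀ (n : ℕ) (z : M' (r * (k + n) + N)), ∃ x ∈ M (k + n), (z : D') - T x ∈ M' (r * (k + (n + 1 : ℕ)) + N) := by grind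
    choose X hX hX' using h1
    let z : ∀ n : ℕ, M' (r * (k + n) + N) := fun n =>
      Nat.rec (motive := fun n : ℕ => M' (r * (k + n) + N)) ⟨y, by simpa using hy⟩ (fun n z => ⟨_, hX' n z⟩) n
    have hz : ∀ q : ℕ, (z q).1 = y - ∑ i ∈ range q, T (X i (z i)) := fun q => by
      induction q with
      | zero => simp [z]
      | succ q ih => rw [sum_range_succ, ← sub_sub, ← ih]
    obtain ⟨s, hs⟩ := h.sum k (fun n => X n (z n)) fun n => hX n (z n)
    refine ⟨s, by simpa using hs 0, (sub_eq_zero.1 (h'.sep _ fun q => ?_)).symm⟩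
    obtain ⟨n, hn⟩ : ∃ n : ℕ, (q : ℤ) ≤ k + n := ⟨(q - k).toNat, by lia⟩
    have h2 := hT _ _ (hs n)
    have hle : (q : ℤ) ≤ r * (k + n) := hn.trans (le_mul_of_one_le_left (by lia) (by lia))
    rw [map_sub, map_sum] at h2; have h3 := sub_mem (h'.anti (hle.trans (by lia)) (z n).2) (h'.anti hle h2)
    simp_all
  refine ⟨continuous_of_continuousAt_zero T ?_, IsTopologicalAddGroup.isOpenMap_iff_nhds_zero.2 ?_, (injective_iff_map_eq_zero T).2 hi, fun y => ?_⟩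
  · rw [ContinuousAt, map_zero, h.basis.tendsto_iff h'.basis]; refine fun k _ => ⟨k, trivial, fun x hx => h'.anti ?_ (hT _ x hx)⟩
    exact le_mul_of_one_le_left (by lia) (by lia)
  · intro U hU; rw [mem_map, h.basis.mem_iff] at hU; obtain ⟨k, -, hk⟩ := hU
    refine mem_of_superset (h'.basis.mem_of_mem (i := r * k + N) trivial) fun y hy => ?_
    obtain ⟨x, hx, rfl⟩ := hs k y (by exact_mod_cast hy)
    exact hk hx
  · obtain ⟨k, hk⟩ := h'.exh y; have h1 : (r : ℤ) * -(|k| + N) ≤ -(|k| + N) := by nlinarith [abs_nonneg k]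
    have h2 := neg_abs_le k
    obtain ⟨x, -, hx⟩ := hs (-(|k| + N)) y (h'.anti (by lia) hk)
    exact ⟨x, hx⟩

variable {A : Type*} [CommRing A] [TopologicalSpace A]

/-- A Tate ring with Noetherian ring of definition `L 0` and pseudo-uniformizer `τ`, where `L k = τ ^ k L 0`. -/
structure IsTateRing (L : ℤ → AddSubgroup A) (τ : Aˣ) : Prop extends IsComplFil L where
  topr : IsTopologicalRing A
  mul : ∀ {a b x y}, x ∈ L a → y ∈ L b → x * y ∈ L (a + b)
  unit : ∀ k : ℤ, ((τ ^ k : Aˣ) : A) ∈ L k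
  noeth : ∃ A₀ : Subring A, (∀ x, x ∈ A₀ ↔ x ∈ L 0) ∧ IsNoetherianRing A₀

variable {L : ℤ → AddSubgroup A} {τ : Aˣ} {D : Type*} [AddCommGroup D] [Module A D] {d : ℕ}

/-- The filtration of a finite module induced by the filtration of the ring. -/
def latt (L : ℤ → AddSubgroup A) (π : (Fin d → A) →ₗ[A] D) (k : ℤ) : AddSubgroup D := (AddSubgroup.pi Set.univ fun _ => L k).map π.toAddMonoidHom

lemma mem_latt {π : (Fin d → A) →ₗ[A] D} {k : ℤ} {x : D} : x ∈ latt L π k ↔ ∃ c, (∀ j, c j ∈ L k) ∧ π c = x := by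
  simp only [latt, AddSubgroup.mem_map, AddSubgroup.mem_pi, Set.mem_univ, forall_const]
  rfl

lemma IsTateRing.isComplFil_latt (h : IsTateRing L τ) [TopologicalSpace D] [IsModuleTopology A D] {π : (Fin d → A) →ₗ[A] D}
    (hπ : Function.Surjective π) : IsComplFil (latt L π) := by
  have := h.topr
  have hq := IsModuleTopology.isOpenQuotientMap_of_surjective hπ
  have hanti : Antitone (latt L π) := fun a b hab x hx => by
    obtain ⟨c, hc, rfl⟩ := mem_latt.1 hx; exact mem_latt.2 ⟨c, fun j => h.anti hab (hc j), rfl⟩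
  refine ⟨IsModuleTopology.topologicalAddGroup A D, hanti, ⟨fun U => ⟨fun hU => ?_, fun ⟨k, _, hk⟩ => mem_of_superset ?_ hk⟩⟩, fun x => ?_, fun x hx => ?_, fun k y hy => ?_⟩
  · have h1 : π ⁻¹' U ∈ 𝓝 (0 : Fin d → A) := hq.continuous.continuousAt.preimage_mem_nhds (by rwa [map_zero])
    rw [nhds_pi, Filter.mem_pi'] at h1; obtain ⟨I, t, ht, hI⟩ := h1; choose k hk using fun j => h.basis.mem_iff.1 (ht j)
    refine ⟨∑ j, k j, trivial, fun x hx => ?_⟩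
    obtain ⟨c, hc, rfl⟩ := mem_latt.1 hx; refine hI fun j _ => (hk j).2 (h.anti ?_ (hc j))
    exact_mod_cast single_le_sum (fun _ _ => Nat.zero_le _) (mem_univ j)
  · have h1 := hq.isOpenMap.image_mem_nhds (set_pi_mem_nhds Set.finite_univ fun (j : Fin d) _ => h.basis.mem_of_mem (i := k) trivial :
      Set.pi Set.univ (fun _ => (L k : Set A)) ∈ 𝓝 (0 : Fin d → A))
    aesop
  · obtain ⟨c, rfl⟩ := hπ x; choose k hk using fun j => h.exh (c j)
    refine ⟨-∑ j, |k j|, mem_latt.2 ⟨c, fun j => h.anti ?_ (hk j), rfl⟩⟩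
    exact (neg_le_neg (single_le_sum (f := fun j => |k j|) (fun _ _ => abs_nonneg _) (mem_univ j))).trans (neg_abs_le _)
  · obtain ⟨A₀, hA, hN⟩ := h.noeth; have hτ : (τ : A) ∈ A₀ := (hA _).2 (h.anti zero_le_one (by simpa using h.unit 1))
    let N : Submodule A₀ D := Submodule.span A₀ (Set.range fun j => π (single j 1))
    have hfin : Module.Finite A₀ N := Module.Finite.span_of_finite A₀ (Set.finite_range _)
    have hxN : ∀ k : ℕ, ∃ y ∈ N, x = (τ : A) ^ k • y := fun k => by
      obtain ⟨c, hc, rfl⟩ := mem_latt.1 (hx k); refine ⟨π fun j => ((τ ^ (-k : ℤ) : Aˣ) : A) * c j, ?_, ?_⟩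
      · rw [LinearMap.pi_apply_eq_sum_univ]; refine N.sum_mem fun j _ => N.smul_mem (⟨_, (hA _).2 ?_⟩ : A₀) (subset_span ⟨j, ?_⟩)
        · have := h.mul (h.unit (-k)) (hc j)
          simp_all
        · change π (single j 1) = _; congr 1; grind
      · rw [← map_smul]; congr 1; funext j
        rw [Pi.smul_apply, smul_eq_mul, ← mul_assoc, zpow_neg, zpow_natCast, ← val_pow_eq_pow_val, Units.mul_inv, one_mul]
    obtain ⟨y, hy, hxy⟩ := hxN 0; have hx0 : x ∈ N := by rwa [hxy, pow_zero, one_smul]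
    have h1 : (⟨x, hx0⟩ : N) ∈ (⨅ i : ℕ, span {(⟨τ, hτ⟩ : A₀)} ^ i • ⊤ : Submodule A₀ N) := by
      refine Submodule.mem_iInf _ |>.2 fun i => ?_
      obtain ⟨y, hy, hxy⟩ := hxN i; rw [show (⟨x, hx0⟩ : N) = (⟨τ, hτ⟩ : A₀) ^ i • ⟨y, hy⟩ from Subtype.ext hxy]
      exact Submodule.smul_mem_smul (Ideal.pow_mem_pow (Ideal.mem_span_singleton_self _) i) trivial
    obtain ⟨⟨r, hr⟩, hrx⟩ := (Ideal.mem_iInf_smul_pow_eq_bot_iff _ _).1 h1; obtain ⟨a, rfl⟩ := mem_span_singleton.1 hr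
    set r : A := τ * (a : A) with hrdef
    have hrL : r ∈ L 1 := by
      have := h.mul (h.unit 1) ((hA _).1 a.2)
      rwa [zpow_one, add_zero] at this
    have hrx' : r • x = x := congrArg Subtype.val hrx
    have hrL' : ∀ n : ℕ, r ^ n ∈ L n := fun n => by
      induction n with
      | zero => simpa using h.unit 0
      | succ n ih => rw [pow_succ, cast_succ]; exact h.mul ih hrL
    obtain ⟨s, hs⟩ := h.sum 0 (fun n => r ^ n) fun n => by simp_all
    have h2 : (1 - r) * s = 1 := sub_eq_zero.1 (h.sep _ fun q => by
      have h3 := h.mul (sub_mem (by simpa using h.unit 0) (h.anti zero_le_one hrL) : (1 - r) ∈ L 0) (hs q)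
      rw [zero_add, zero_add, mul_sub, mul_neg_geom_sum] at h3; rw [show (1 - r) * s - 1 = (1 - r) * s - (1 - r ^ q) - r ^ q by ring]
      exact sub_mem h3 (hrL' q))
    rw [← one_smul A x, ← h2, mul_comm, mul_smul, sub_smul, one_smul, hrx', sub_self, smul_zero]
  · choose c hc hcy using fun n => mem_latt.1 (hy n)
    choose s hs using fun j => h.sum k (fun n => c n j) fun n => hc n j
    refine ⟨π s, fun q => mem_latt.2 ⟨s - ∑ i ∈ range q, c i, fun j => ?_, ?_⟩⟩
    · simpa using hs j q
    simp_all

lemma isHomeomorph_of_sub_mem {D : Type*} [AddCommGroup D] [TopologicalSpace D] {M : ℤ → AddSubgroup D} (h : IsComplFil M) (T : D →+ D)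
    (hT : ∀ k, ∀ x ∈ M k, T x - x ∈ M (k + 1)) : IsHomeomorph T := by
  have hT1 : ∀ k, ∀ x ∈ M k, T x ∈ M k := fun k x hx => by
    have := add_mem (h.anti (le_add_of_nonneg_right zero_le_one) (hT k x hx)) hx
    simp_all
  refine isHomeomorph_of_approx h h T 1 0 one_pos (fun k x hx => by simp_all)
    (fun k y hy => ⟨y, by simpa using hy, ?_⟩) fun x hx => ?_
  · rw [← neg_sub]; exact neg_mem (by simp_all)
  · obtain ⟨k, hk⟩ := h.exh x; have h1 : ∀ n : ℕ, x ∈ M (k + n) := fun n => by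
      induction n with
      | zero => simpa using hk
      | succ n ih =>
        have := hT _ x ih
        rw [hx, zero_sub, neg_mem_iff] at this; grind
    exact h.sep x fun n => h.anti (by lia) (h1 (n - k).toNat)

end Filtered
section Rep
lemma isTopologicalRing_of_basis {A : Type*} [CommRing A] [TopologicalSpace A] (L : ℤ → AddSubgroup A) (hL : Antitone L)
    (hmul : ∀ a b x y, x ∈ L a → y ∈ L b → x * y ∈ L (a + b)) (hexh : ∀ x, ∃ k : ℕ, x ∈ L (-k))
    (hb : ∀ x, (𝓝 x).HasBasis (fun _ : ℕ => True) (fun k => {z | z - x ∈ L k})) : IsTopologicalRing A where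
  continuous_add := continuous_iff_continuousAt.2 fun ⟨x, y⟩ => by
    rw [ContinuousAt, nhds_prod_eq, ((hb x).prod (hb y)).tendsto_iff (hb _)]; refine fun k _ => ⟨(k, k), ⟨trivial, trivial⟩, fun z hz => ?_⟩
    change z.1 + z.2 - (x + y) ∈ L k; rw [add_sub_add_comm]; aesop
  continuous_neg := continuous_iff_continuousAt.2 fun x => by
    rw [ContinuousAt, (hb x).tendsto_iff (hb _)]; refine fun k _ => ⟨k, trivial, fun z hz => ?_⟩
    change -z - -x ∈ L k; rw [← neg_sub_neg, neg_neg, neg_neg, ← neg_sub]; exact neg_mem hz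
  continuous_mul := continuous_iff_continuousAt.2 fun ⟨x, y⟩ => by
    rw [ContinuousAt, nhds_prod_eq, ((hb x).prod (hb y)).tendsto_iff (hb _)]; intro k _; obtain ⟨a, ha⟩ := hexh x; obtain ⟨b, hb⟩ := hexh y
    refine ⟨(k + a + b, k + a + b), ⟨trivial, trivial⟩, fun z hz => ?_⟩
    change z.1 * z.2 - x * y ∈ L k; rw [show z.1 * z.2 - x * y = x * (z.2 - y) + (z.1 - x) * y + (z.1 - x) * (z.2 - y) by ring]
    exact add_mem (add_mem (hL (by push_cast; lia) (hmul _ _ _ _ ha hz.2)) (hL (by push_cast; lia) (hmul _ _ _ _ hz.1 hb)))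
      (hL (by push_cast; lia) (hmul _ _ _ _ hz.1 hz.2))

lemma mem_nhds_generateFrom_cosets {A : Type*} [AddCommGroup A] (V : ℕ → AddSubgroup A) (hV : Antitone V) (x : A) (U : Set A) :
    U ∈ @nhds A (generateFrom {U | ∃ (x : A) (k : ℕ), U = {z | z - x ∈ V k}}) x ↔ ∃ k, ∀ z, z - x ∈ V k → z ∈ U := by
  let _ := generateFrom {U | ∃ (x : A) (k : ℕ), U = {z | z - x ∈ V k}}
  constructor
  · intro hU; obtain ⟨O, hO, hOo, hx⟩ := mem_nhds_iff.1 hU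
    have key : ∀ O, TopologicalSpace.GenerateOpen {U | ∃ (x : A) (k : ℕ), U = {z | z - x ∈ V k}} O → ∀ x ∈ O, ∃ k, ∀ z, z - x ∈ V k → z ∈ O := fun O hO => by
      induction hO with
      | basic O hO =>
        obtain ⟨x₀, k, rfl⟩ := hO; exact fun x hx => ⟨k, fun z hz => by have := add_mem hz hx; simp_all⟩
      | univ => simp
      | inter O O' _ _ h h' =>
        intro x hx; obtain ⟨k, hk⟩ := h x hx.1; obtain ⟨k', hk'⟩ := h' x hx.2
        exact ⟨max k k', fun z hz => ⟨hk z (hV (le_max_left _ _) hz), hk' z (hV (le_max_right _ _) hz)⟩⟩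
      | sUnion S _ h =>
        rintro x ⟨O, hO, hx⟩; obtain ⟨k, hk⟩ := h O hO x hx; exact ⟨k, fun z hz => ⟨O, hO, hk z hz⟩⟩
    obtain ⟨k, hk⟩ := key O hOo x hx; aesop
  · rintro ⟨k, hk⟩; refine mem_of_superset (IsOpen.mem_nhds (TopologicalSpace.isOpen_generateFrom_of_mem ⟨x, k, rfl⟩) ?_) hk; simp

lemma zpow_mul_sub_sum {A B : Type*} [CommRing A] [CommRing B] (f : A →+* B) {t : A} {τ : Bˣ} (hτ : (τ : B) = f t) (k : ℤ) {y : ℕ → B} {z : ℕ → A}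
    (hz : ∀ n : ℕ, y n = ((τ ^ (k + n) : Bˣ) : B) * f (z n)) {s c : A} {q : ℕ} (hc : s = ∑ i ∈ range q, t ^ i * z i + t ^ q * c) :
    ((τ ^ k : Bˣ) : B) * f s - ∑ i ∈ range q, y i = ((τ ^ (k + q) : Bˣ) : B) * f c := by
  simp only [hc, hz, zpow_add, zpow_natCast, val_mul, val_pow_eq_pow_val, hτ, map_add, map_sum, map_mul, map_pow, mul_add, mul_sum, mul_assoc]
  simp

variable {l : Lifts K ϖ} {ρ' β' : ℝ≥0} {S S' : ℕ}

variable (K u ρ β) in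
/-- The map from the ring before completion. -/
def ofLam : ΛP →+* ΛR := (algebraMap (Lam0 K u ρ β) (ΛR)).comp (algebraMap (ΛP) (Lam0 K u ρ β))

namespace Lifts.LevelAt

variable (h : l.LevelAt ρ β S) (h' : l.LevelAt ρ' β' S')
include h

lemma exists_dvd_t_pow {x z : Ã} {c : ℝ} (hz : z ∈ Fil K ρ c) (hxz : x * z = 1)
    {b : ΛP} (hb : (b : R₀ ⊗[ℤ_[p]] Ã) = 1 ⊗ₜ x) : ∃ M, b ∣ h.t u ^ M := by
  rw [h.mem_Fil] at hz
  obtain ⟨M, hM⟩ := exists_pow_lt_of_lt_one (Real.rpow_pos_of_pos (p_pos (p := p)) c) h.unif.fn_lt_one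
  have h1 := l.zpow_mul_mem_Lf h.eps.choose_spec rad_pos h.lt M hz
  refine ⟨M, ⟨1 ⊗ₜ _, h.mem_lamPre.2 (tmul_mem_LG (Lf.mono h1 ?_))⟩, Subtype.ext ?_⟩
  · rw [zpow_zero, zpow_natCast, Real.rpow_neg p_pos.le, ← div_eq_mul_inv]; exact div_le_one_of_le₀ hM.le (Real.rpow_nonneg p_pos.le _)
  · rw [coe_t_pow, coe_mul, hb, tmul_mul_tmul, mul_left_comm, hxz, one_mul, mul_one]

lemma lamUnits_dvd {y : Lam0 K u ρ β} (hy : y ∈ lamUnits K u ρ β) : ∃ M, y ∣ of (ΛI) _ (h.t u) ^ M := by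
  induction hy using Submonoid.closure_induction with
  | mem y hy =>
    obtain ⟨b, x, z, c, hx, hz, hxz, hb, rfl⟩ := hy; obtain ⟨M, d, hd⟩ := h.exists_dvd_t_pow hz hxz hb
    exact ⟨M, of _ _ d, (congrArg (algebraMap (ΛP) (Lam0 K u ρ β)) hd).trans (map_mul _ _ _)⟩
  | one => simp
  | mul y y' _ _ h1 h2 =>
    obtain ⟨M, hM⟩ := h1; obtain ⟨M', hM'⟩ := h2; exact ⟨M + M', by rw [pow_add]; exact mul_dvd_mul hM hM'⟩

lemma t_mem_lamUnits : of (ΛI) _ (h.t u) ∈ lamUnits K u ρ β := by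
  obtain ⟨c, hc⟩ := exists_pow_lt_of_lt_one h.q_pos (inv_lt_one_of_one_lt₀ (one_lt_p (p := p)))
  refine Submonoid.subset_closure ⟨h.t u, l.w, ((l.w⁻¹ : Ãˣ) : Ã), -c, ?_, ?_, l.w.mul_inv, rfl, rfl⟩
  · have := Lf.mono (l.zpow_mem_Lf rad_pos h.lt 1) (zpow_one (fn ϖ) ▸ h.unif.fn_lt_one.le)
    rwa [h.mem_Fil_zero, ← zpow_one l.w]
  · have := l.zpow_mem_Lf rad_pos h.lt (-1)
    simp only [zpow_neg_one] at this; rw [h.mem_Fil, neg_neg, rpow_natCast]; refine Lf.mono this ?_; rw [inv_pow] at hc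
    exact (inv_le_comm₀ h.q_pos (pow_pos p_pos c)).2 hc.le

/-- `π_K` as a unit of `Λ_{R₀,[0,b],K}`. -/
def τ (u : R₀) : (Lam K u ρ β)ˣ := (IsLocalization.map_units (Lam K u ρ β) (⟨_, h.t_mem_lamUnits⟩ : lamUnits K u ρ β)).unit

lemma coe_τ : (h.τ u : ΛR) = ofLam K u ρ β (h.t u) := rfl

lemma coe_τ_pow (n : ℕ) : ((h.τ u ^ (n : ℤ) : (ΛR)ˣ) : ΛR) = ofLam K u ρ β (h.t u ^ n) := by
  aesop

lemma algebraMap_injective : Injective (algebraMap (Lam0 K u ρ β) (ΛR)) := by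
  refine IsLocalization.injective (M := lamUnits K u ρ β) _ fun y hy => ?_
  obtain ⟨M, d, hd⟩ := h.lamUnits_dvd hy
  have hreg : ∀ (n : ℕ) (x), of (ΛI) _ (h.t u) ^ n * x = 0 → x = 0 := fun n => by
    induction n with
    | zero => simp
    | succ n ih => intro x hx; rw [pow_succ, mul_assoc] at hx; exact h.isTateBase.of_reg (ih _ hx)
  rw [mem_nonZeroDivisors_iff_right]
  intro x hx
  exact hreg M x (by rw [hd, mul_comm, ← mul_assoc, hx, zero_mul])

lemma isUnit_ofLam {d : ΛP} {M : ℕ} (hd : d ∣ h.t u ^ M) : IsUnit (ofLam K u ρ β d) :=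
  isUnit_of_dvd_unit (map_dvd _ hd) (by rw [map_pow, ← coe_τ]; exact (Units.isUnit _).pow M)

/-- `Λ_{R₀,[0,b],K}` is filtered by the powers of `π_K`. -/
def fil (u : R₀) (k : ℤ) : AddSubgroup (Lam K u ρ β) where
  carrier := {x | ∃ z, x = ((h.τ u ^ k : (Lam K u ρ β)ˣ) : Lam K u ρ β) * algebraMap (Lam0 K u ρ β) _ z}
  zero_mem' := ⟨0, by simp⟩
  add_mem' := by rintro _ _ ⟨z, rfl⟩ ⟨z', rfl⟩; exact ⟨z + z', by rw [map_add, mul_add]⟩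
  neg_mem' := by rintro _ ⟨z, rfl⟩; exact ⟨-z, by simp⟩

lemma fil_mul {a b : ℤ} {x y : ΛR} (hx : x ∈ h.fil u a) (hy : y ∈ h.fil u b) : x * y ∈ h.fil u (a + b) := by
  obtain ⟨z, rfl⟩ := hx
  obtain ⟨z', rfl⟩ := hy
  exact ⟨z * z', by rw [zpow_add, val_mul, map_mul, mul_mul_mul_comm]⟩

lemma τ_mem (k : ℤ) : ((h.τ u ^ k : (ΛR)ˣ) : ΛR) ∈ h.fil u k := ⟨1, by simp⟩

lemma mem_fil_natCast {n : ℕ} {x : ΛR} : x ∈ h.fil u n ↔ ∃ z, x = algebraMap (Lam0 K u ρ β) _ (of _ _ (h.t u) ^ n * z) := by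
  refine exists_congr fun z => ?_
  aesop

lemma fil_anti : Antitone (h.fil u) := fun a b hab x hx => by
  obtain ⟨n, rfl⟩ := Int.le.dest hab
  have h1 : ((h.τ u ^ (n : ℤ) : (ΛR)ˣ) : ΛR) ∈ h.fil u 0 := ⟨of _ _ (h.t u ^ n), by rw [coe_τ_pow, zpow_zero, val_one, one_mul]; rfl⟩
  obtain ⟨z, rfl⟩ := hx
  rw [zpow_add, val_mul, mul_assoc]
  have := h.fil_mul (h.τ_mem a) (h.fil_mul h1 (⟨z, by simp⟩ : algebraMap _ _ z ∈ h.fil u 0))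
  simp_all

lemma fil_exh (x : ΛR) : ∃ n : ℕ, x ∈ h.fil u (-n) := by
  obtain ⟨⟨z, y⟩, hx⟩ := IsLocalization.surj (lamUnits K u ρ β) x
  obtain ⟨M, d, hd⟩ := h.lamUnits_dvd y.2
  refine ⟨M, d * z, ?_⟩
  have h1 : ofLam K u ρ β (h.t u ^ M) = algebraMap _ _ (y : Lam0 K u ρ β) * algebraMap _ _ d := by
    rw [← map_mul, ← hd, map_pow, map_pow]; rfl
  rw [zpow_neg, ← Units.mul_right_inj (h.τ u ^ (M : ℤ)), Units.mul_inv_cancel_left, coe_τ_pow, h1, map_mul, ← hx]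
  ring

lemma isTateRing (hN : IsNoetherianRing (Lam0 K u ρ β)) : IsTateRing (h.fil u) (h.τ u) := by
  have hT := h.isTateBase (u := u)
  have hsep : ∀ x, (∀ k : ℕ, x ∈ h.fil u k) → x = 0 := fun x hx => by
    choose z hz using fun k => h.mem_fil_natCast.1 (hx k)
    have h1 : ∀ k, z 0 = of _ _ (h.t u) ^ k * z k := fun k => h.algebraMap_injective (by rw [← hz k, hz 0, pow_zero, one_mul])
    rw [hz 0, pow_zero, one_mul, hT.eq_zero_of_forall fun k => ⟨_, h1 k⟩, map_zero]
  have hb : ∀ x, (𝓝 x).HasBasis (fun _ : ℕ => True) (fun k => {z | z - x ∈ h.fil u k}) := fun x => ⟨fun U => by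
    let V : ℕ → AddSubgroup (ΛR) := fun k => (RingHom.ker (evalₐ (ΛI) k)).toAddSubgroup.map (algebraMap (Lam0 K u ρ β) (ΛR)).toAddMonoidHom
    have hV : ∀ k z, z ∈ V k ↔ ∃ y, evalₐ (ΛI) k y = 0 ∧ algebraMap (Lam0 K u ρ β) (ΛR) y = z := fun k z => Iff.rfl
    have hVa : Antitone V := fun i j hij z hz => by
      obtain ⟨y, hy, rfl⟩ := (hV _ _).1 hz; obtain ⟨a, ha, ha'⟩ := exists_evalₐ_eq_of_le _ hij y; refine (hV _ _).2 ⟨y, ?_, rfl⟩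
      rw [ha, eq_zero_iff_mem] at hy; rw [ha', eq_zero_iff_mem]; exact Ideal.pow_le_pow_right hij hy
    have htop : (inferInstance : TopologicalSpace (ΛR)) = generateFrom {U | ∃ (x : ΛR) (k : ℕ), U = {z | z - x ∈ V k}} := by
      refine congrArg generateFrom (Set.ext fun U => exists_congr fun x => exists_congr fun k => ?_)
      refine Eq.congr_right (Set.ext fun z => ?_)
      rw [Set.mem_ofPred_eq, Set.mem_ofPred_eq, hV]
      exact exists_congr fun y => and_congr_right fun _ => ⟨fun e => by rw [e, add_sub_cancel_left], fun e => by rw [e, add_sub_cancel]⟩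
    have hU := mem_nhds_generateFrom_cosets V hVa x U
    rw [← htop] at hU; refine hU.trans ⟨fun ⟨k, hk⟩ => ?_, fun ⟨k, _, hk⟩ => ?_⟩
    · obtain ⟨a, ha, hak⟩ := hT.exists_eval_eq_zero; refine ⟨a * k, trivial, fun z hz => hk z ?_⟩
      obtain ⟨y, hy⟩ := h.mem_fil_natCast.1 hz; exact (hV _ _).2 ⟨_, hak k y, hy.symm⟩
    · obtain ⟨b, hb, hbk⟩ := hT.exists_of_eval_eq_zero; refine ⟨b * k, fun z hz => hk ?_⟩
      obtain ⟨y, hy, hyz⟩ := (hV _ _).1 hz; obtain ⟨y', rfl⟩ := hbk k y hy; exact h.mem_fil_natCast.2 ⟨y', hyz.symm⟩⟩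
  have htop := isTopologicalRing_of_basis _ h.fil_anti (fun _ _ _ _ => h.fil_mul) h.fil_exh hb
  refine ⟨⟨inferInstance, h.fil_anti, by simpa using hb 0, fun x => (h.fil_exh x).imp' _ fun _ => id, hsep, fun k y hy => ?_⟩, htop, h.fil_mul, h.τ_mem,
    ⟨(algebraMap (Lam0 K u ρ β) (ΛR)).range, fun x => ?_, ?_⟩⟩
  · choose z hz using hy
    obtain ⟨s, hs⟩ := hT.exists_sum z; refine ⟨((h.τ u ^ k : (ΛR)ˣ) : ΛR) * algebraMap _ _ s, fun q => ?_⟩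
    obtain ⟨c, hc⟩ := hs q; exact ⟨c, zpow_mul_sub_sum (algebraMap (Lam0 K u ρ β) (ΛR)) h.coe_τ k hz hc⟩
  · rw [RingHom.mem_range]; refine exists_congr fun z => ?_
    rw [zpow_zero, val_one, one_mul, eq_comm]
  · exact isNoetherianRing_of_surjective _ _ _ (RingHom.rangeRestrict_surjective _)

end Lifts.LevelAt

end Rep
section Rep
lemma zpow_mul_map_sub {A B : Type*} [CommRing A] [CommRing B] (f : A →+* B) {t : A} {τ : Bˣ} (hτ : (τ : B) = f t) (k : ℤ) {n : ℕ} {z a z' : A}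
    (hz : z = a + t ^ n * z') : ((τ ^ k : Bˣ) : B) * f z - ((τ ^ k : Bˣ) : B) * f a = ((τ ^ (k + n) : Bˣ) : B) * f z' := by
  rw [hz, map_add, mul_add, add_sub_cancel_left, zpow_add, val_mul, zpow_natCast, val_pow_eq_pow_val, hτ, map_mul, map_pow, mul_assoc]

variable {l : Lifts K ϖ} {ρ' β' : ℝ≥0} {S S' : ℕ}

lemma lamMap_ofLam {F : Ã →ₐ[ℤ_[p]] Ã} (hF : LamCompat K ρ β ρ' β' F) (a : ΛP) : lamMap u hF (ofLam K u ρ β a) = ofLam K u ρ' β' (lamPreMap u hF a) :=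
  (lamMap_algebraMap u hF _).trans (congrArg _ (adicMap_of _ _ _ _ a))

namespace Lifts.LevelAt

variable (h : l.LevelAt ρ β S) (h' : l.LevelAt ρ' β' S') {x : Lam K u ρ β} {y : R₀ ⊗[ℤ_[p]] ATilde p}
include h

/-- The element `x` of the completion comes from the element `y` of `R₀ ⊗ Ã`. -/
def IsRep (x : ΛR) (y : R₀ ⊗[ℤ_[p]] Ã) : Prop := ∃ (M : ℕ) (a : ΛP), (a : R₀ ⊗[ℤ_[p]] Ã) = 1 ⊗ₜ ((l.w ^ (M : ℤ) : Ãˣ) : Ã) * y ∧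
    ofLam K u ρ β (h.t u ^ M) * x = ofLam K u ρ β a

variable {h}

lemma IsRep.of_dvd {d a : ΛP} {M : ℕ} (hd : d ∣ h.t u ^ M) (h1 : (a : R₀ ⊗[ℤ_[p]] Ã) = d * y)
    (h2 : ofLam K u ρ β d * x = ofLam K u ρ β a) : h.IsRep x y := by
  obtain ⟨e, he⟩ := hd
  refine ⟨M, e * a, ?_, ?_⟩
  · rw [← h.coe_t_pow, he, coe_mul, coe_mul, h1, ← mul_assoc, mul_comm (e : R₀ ⊗[ℤ_[p]] Ã)]
  · rw [he, map_mul, map_mul, ← h2]; ring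

variable (h) in
lemma isRep_ofLam (a : ΛP) : h.IsRep (ofLam K u ρ β a) (a : R₀ ⊗[ℤ_[p]] Ã) :=
  .of_dvd (d := 1) (M := 0) (a := a) (one_dvd _) (by simp) (by simp)

lemma IsRep.exists_le (hx : h.IsRep x y) (n : ℕ) : ∃ M, n ≤ M ∧ ∃ a : ΛP, (a : R₀ ⊗[ℤ_[p]] Ã) = ((h.t u ^ M : ΛP) : R₀ ⊗[ℤ_[p]] Ã) * y ∧
    ofLam K u ρ β (h.t u ^ M) * x = ofLam K u ρ β a := by
  obtain ⟨M, a, h1, h2⟩ := hx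
  refine ⟨n + M, le_self_add, h.t u ^ n * a, ?_, ?_⟩
  · rw [pow_add, coe_mul, coe_mul, h1, h.coe_t_pow M, mul_assoc]
  · rw [pow_add, map_mul, map_mul, ← h2, mul_assoc]

variable (h) in
lemma isRep_zpow (k : ℤ) : h.IsRep ((h.τ u ^ k : (ΛR)ˣ) : ΛR) (1 ⊗ₜ ((l.w ^ k : Ãˣ) : Ã)) := by
  refine ⟨k.natAbs, h.t u ^ (k.natAbs + k).toNat, ?_, ?_⟩
  · rw [coe_t_pow, tmul_mul_tmul, ← val_mul, ← zpow_add, one_mul, Int.toNat_of_nonneg (by lia)]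
  · rw [← h.coe_τ_pow, ← h.coe_τ_pow, ← val_mul, ← zpow_add, Int.toNat_of_nonneg (by lia)]

lemma IsRep.mul {x' : ΛR} {y' : R₀ ⊗[ℤ_[p]] Ã} (hx : h.IsRep x y) (hx' : h.IsRep x' y') : h.IsRep (x * x') (y * y') := by
  obtain ⟨M, -, a, h1, h2⟩ := hx.exists_le 0
  obtain ⟨M', -, a', h1', h2'⟩ := hx'.exists_le 0
  refine .of_dvd (d := h.t u ^ M * h.t u ^ M') (a := a * a') (by rw [← pow_add]) ?_ ?_
  · rw [coe_mul, coe_mul, h1, h1', mul_mul_mul_comm]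
  · rw [map_mul, map_mul, ← h2, ← h2', mul_mul_mul_comm]

lemma IsRep.add {x' : ΛR} {y' : R₀ ⊗[ℤ_[p]] Ã} (hx : h.IsRep x y) (hx' : h.IsRep x' y') : h.IsRep (x + x') (y + y') := by
  obtain ⟨M, -, a, h1, h2⟩ := hx.exists_le 0
  obtain ⟨M', -, a', h1', h2'⟩ := hx'.exists_le 0
  refine .of_dvd (d := h.t u ^ M * h.t u ^ M') (a := h.t u ^ M' * a + h.t u ^ M * a') (by rw [← pow_add]) ?_ ?_
  · rw [AddMemClass.coe_add, coe_mul, coe_mul, coe_mul, h1, h1']; ring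
  · rw [map_add, map_mul, map_mul, map_mul, ← h2, ← h2']; ring

lemma IsRep.neg (hx : h.IsRep x y) : h.IsRep (-x) (-y) := by
  obtain ⟨M, -, a, h1, h2⟩ := hx.exists_le 0
  exact .of_dvd (d := h.t u ^ M) (a := -a) dvd_rfl (by simp_all) (by simp_all)

lemma IsRep.sub {x' : ΛR} {y' : R₀ ⊗[ℤ_[p]] Ã} (hx : h.IsRep x y) (hx' : h.IsRep x' y') : h.IsRep (x - x') (y - y') := by
  rw [sub_eq_add_neg, sub_eq_add_neg]
  exact hx.add hx'.neg

variable (h) in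
lemma isRep_zero : h.IsRep (0 : ΛR) 0 := by
  have := h.isRep_ofLam (0 : ΛP)
  simp_all

variable (h) in
lemma isRep_one : h.IsRep (1 : ΛR) 1 := by
  have := h.isRep_ofLam (1 : ΛP)
  simp_all

lemma IsRep.pow (hx : h.IsRep x y) (n : ℕ) : h.IsRep (x ^ n) (y ^ n) := by
  induction n with
  | zero => rw [pow_zero, pow_zero]; exact h.isRep_one
  | succ n ih => rw [pow_succ, pow_succ]; exact ih.mul hx

lemma IsRep.sum {ι : Type*} {s : Finset ι} {f : ι → ΛR} {g : ι → R₀ ⊗[ℤ_[p]] Ã} (hf : ∀ i, h.IsRep (f i) (g i)) :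
    h.IsRep (∑ i ∈ s, f i) (∑ i ∈ s, g i) := by
  classical
  induction s using Finset.induction_on with
  | empty => exact h.isRep_zero
  | insert i s hi ih => rw [sum_insert hi, sum_insert hi]; exact (hf i).add ih

lemma IsRep.eq {x' : ΛR} (hx : h.IsRep x y) (hx' : h.IsRep x' y) : x = x' := by
  obtain ⟨M, -, a, h1, h2⟩ := hx.sub hx' |>.exists_le 0
  have ha : a = 0 := by simp_all
  rw [ha, map_zero] at h2
  exact sub_eq_zero.1 (((h.isUnit_ofLam dvd_rfl).mul_right_eq_zero).1 h2)

variable (h) in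
lemma exists_isRep {k : ℤ} (hy : y ∈ LG K u (rad p ρ) (fn ϖ) S k) : ∃ x ∈ h.fil u k, h.IsRep x y := by
  have h1 : 1 ⊗ₜ ((l.w ^ (-k) : Ãˣ) : Ã) * y ∈ ΛP := h.mem_lamPre.2 (by simpa using (h.zpow_mul_mem_iff (-k)).2 hy)
  refine ⟨((h.τ u ^ k : (ΛR)ˣ) : ΛR) * ofLam K u ρ β ⟨_, h1⟩, ⟨_, rfl⟩, ?_⟩
  have := (h.isRep_zpow (u := u) k).mul (h.isRep_ofLam ⟨_, h1⟩)
  rwa [h.zpow_mul_cancel] at this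

lemma IsRep.mem_iff {k : ℤ} (hx : h.IsRep x y) : x ∈ h.fil u k ↔ y ∈ LG K u (rad p ρ) (fn ϖ) S k := by
  constructor
  · rintro ⟨z, rfl⟩; obtain ⟨M, hM, a, h1, h2⟩ := hx.exists_le k.natAbs; obtain ⟨n, hn⟩ : ∃ n : ℕ, (M : ℤ) + k = n := ⟨(M + k).toNat, by lia⟩
    rw [← h.coe_τ_pow, ← mul_assoc, ← val_mul, ← zpow_add, hn, coe_τ_pow] at h2
    have h3 : of (ΛI) _ a = of (ΛI) _ (h.t u) ^ n * z :=
      h.algebraMap_injective (h2.symm.trans (by rw [map_mul, map_pow, map_pow]; rfl))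
    have h4 := h.t_pow_dvd_iff.1 (h.isTateBase.dvd_of_of_eq h3)
    rw [h1, h.coe_t_pow, ← hn, add_comm] at h4; exact (h.zpow_mul_mem_iff M).1 h4
  · intro hy; obtain ⟨x', hx', h1⟩ := h.exists_isRep hy; rwa [hx.eq h1]

lemma IsRep.exists_mem (hx : h.IsRep x y) : ∃ n : ℕ, y ∈ LG K u (rad p ρ) (fn ϖ) S (-n) := (h.fil_exh x).imp fun _ => hx.mem_iff.1

variable (h) in
lemma exists_approx (x : ΛR) (k : ℤ) : ∃ x' y, h.IsRep x' y ∧ x - x' ∈ h.fil u k := by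
  obtain ⟨n, z, rfl⟩ := h.fil_exh x
  obtain ⟨a, z', rfl⟩ := h.isTateBase.exists_approx (k + n).toNat z
  refine ⟨_, _, (h.isRep_zpow (-n)).mul (h.isRep_ofLam a), h.fil_anti (show k ≤ -n + (k + n).toNat by lia) ⟨z', ?_⟩⟩
  exact zpow_mul_map_sub (algebraMap (Lam0 K u ρ β) (ΛR)) h.coe_τ _ rfl

variable {F : ATilde p →ₐ[ℤ_[p]] ATilde p}

variable (h) in
lemma exists_inv_mem_Fil : ∃ c : ℝ, ((l.w⁻¹ : Ãˣ) : Ã) ∈ Fil K ρ c := by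
  obtain ⟨c, hc⟩ := exists_pow_lt_of_lt_one h.q_pos (inv_lt_one_of_one_lt₀ (one_lt_p (p := p)))
  have := l.zpow_mem_Lf rad_pos h.lt (-1)
  simp only [zpow_neg_one] at this
  refine ⟨-c, ?_⟩
  rw [h.mem_Fil, neg_neg, rpow_natCast]
  refine Lf.mono this ?_
  rw [inv_pow] at hc
  exact (inv_le_comm₀ h.q_pos (pow_pos p_pos c)).2 hc.le

include h' in
lemma IsRep.map (hx : h.IsRep x y) (hF : LamCompat K ρ β ρ' β' F) : h'.IsRep (lamMap u hF x) (tensorEnd R₀ F y) := by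
  obtain ⟨M, -, a, h1, h2⟩ := hx.exists_le 0
  obtain ⟨c, hc⟩ := h.exists_inv_mem_Fil
  obtain ⟨c', hc'⟩ := hF.all _ _ hc
  obtain ⟨N, hN⟩ := h'.exists_dvd_t_pow (b := lamPreMap u hF (h.t u)) hc' ((map_mul F _ _).symm.trans (by simp)) rfl
  refine IsRep.of_dvd (h := h') (d := lamPreMap u hF (h.t u ^ M)) (a := lamPreMap u hF a) (M := N * M) (by rw [map_pow, pow_mul]; exact pow_dvd_pow_of_dvd hN M) ?_ ?_
  · rw [coe_lamPreMap, coe_lamPreMap, h1, map_mul]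
  · rw [← lamMap_ofLam, ← lamMap_ofLam, ← h2, map_mul]

include h' in
lemma lamMap_mem_fil (hF : LamCompat K ρ β ρ' β' F) {k k' : ℤ} (hk : F ((l.w ^ k : Ãˣ) : Ã) ∈ Lf K (rad p ρ') (fn ϖ ^ k'))
    (hx : x ∈ h.fil u k) : lamMap u hF x ∈ h'.fil u k' := by
  obtain ⟨z, rfl⟩ := hx
  have h1 : lamMap u hF ((h.τ u ^ k : (ΛR)ˣ) : ΛR) ∈ h'.fil u k' := ((h.isRep_zpow k).map h' hF).mem_iff.2 (tmul_mem_LG hk)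
  have h2 : lamMap u hF (algebraMap (Lam0 K u ρ β) _ z) ∈ h'.fil u 0 := ⟨lam0Map u hF z, by rw [zpow_zero, val_one, one_mul, lamMap_algebraMap]⟩
  rw [map_mul]
  simpa using h'.fil_mul h1 h2

end Lifts.LevelAt

end Rep
section Tower
variable {l : Lifts K ϖ} {ρ' β' : ℝ≥0} {S S' : ℕ}

lemma frobW_mem_Lf {θ B : ℝ} {x : Ã} (h0 : 0 < θ) (hx : x ∈ Lf K θ B) : frobW p x ∈ Lf K (θ ^ p) (B ^ p) := by
  have hp := prm p
  refine ⟨frobW_mem_AK hx.1, hx.2.1.frobW h0.le, fun δ hδ => ?_⟩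
  obtain ⟨y, ⟨θ', h, h1, B', hy⟩, hxy⟩ := hx.2.2 (min δ 1) (lt_min hδ one_pos)
  refine ⟨frobW p y, ⟨θ' ^ p, pow_lt_pow_left₀ h h0.le hp.ne_zero, pow_le_one₀ (h0.trans h).le h1, B' ^ p, hy.frobW (h0.trans h).le⟩, ?_⟩
  rw [← map_sub]
  exact (hxy.frobW h0.le).mono_right ((pow_le_of_le_one (le_min hδ.le zero_le_one) (min_le_right _ _) hp.ne_zero).trans (min_le_left _ _))

lemma exists_ofLam_eq_teichL (he : ε ∈ cycl p) (lam b : ℝ≥0) (n : ℕ) : ∃ a : lamPre K u (lam * p ^ n / b) (p ^ n / b),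
    (a : R₀ ⊗[ℤ_[p]] Ã) = 1 ⊗ₜ ω ε ∧ ofLam K u _ _ a = teichL K u lam b he n := ⟨_, rfl, rfl⟩

namespace Lifts.LevelAt

variable (h : l.LevelAt ρ β S) (h' : l.LevelAt ρ' β' S')
include h h'

lemma isHomeomorph_frob (hρ : ρ' = ρ * p) (hS : S' = p * S) (hT : IsTateRing (h.fil u) (h.τ u)) (hT' : IsTateRing (h'.fil u) (h'.τ u))
    (hF : LamCompat K ρ β ρ' β' (frobW p)) (hε : IsEps p ε) {E : Lam K u ρ' β'} (hE : h'.IsRep E (1 ⊗ₜ ω ε)) {N : ℕ}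
    (hB : ∀ B', 0 ≤ B' → ∀ x ∈ Lf K (rad p ρ ^ p) (B' ^ p * fn ϖ ^ N), ∃ y : Fin p → Ã,
      (∀ a, y a ∈ Lf K (rad p ρ) B') ∧ x = ∑ a : Fin p, ω ε ^ (a : ℕ) * frobW p (y a)) :
    IsHomeomorph (fun c : Fin p → ΛR => ∑ a : Fin p, E ^ (a : ℕ) * lamMap u hF (c a)) := by
  subst hρ hS
  have := hT.topr
  have hp := prm p
  let T : (Fin p → ΛR) →+ Lam K u (ρ * p) β' := AddMonoidHom.mk' (fun c => ∑ a : Fin p, E ^ (a : ℕ) * lamMap u hF (c a)) fun c c' => by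
    simp only [Pi.add_apply, map_add, mul_add, sum_add_distrib]
  have hM := hT.isComplFil_latt (D := Fin p → ΛR) (π := LinearMap.id) Function.surjective_id
  have hmem : ∀ k c, c ∈ latt (h.fil u) (LinearMap.id : (Fin p → ΛR) →ₗ[ΛR] _) k ↔ ∀ j, c j ∈ h.fil u k := fun k c =>
    mem_latt.trans ⟨by simp, fun hc => ⟨c, hc, rfl⟩⟩
  have hE0 : ∀ a : ℕ, E ^ a ∈ h'.fil u 0 := fun a => by
    have hE1 : E ∈ h'.fil u 0 := hE.mem_iff.2 (tmul_mem_LG (by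
      rw [zpow_zero, ← h'.mem_Fil_zero]; exact teichmuller_cycl_mem_Fil hε.mem_cycl _))
    induction a with
    | zero => simpa using h'.τ_mem (u := u) 0
    | succ a ih => rw [pow_succ]; simpa using h'.fil_mul ih hE1
  have hφ : ∀ {k : ℤ} {x}, x ∈ h.fil u k → lamMap u hF x ∈ h'.fil u (p * k) := fun {k x} hx => h.lamMap_mem_fil h' hF (by
    have := l.zpow_mem_Lf (rad_pos (p := p)) h.lt k
    have := frobW_mem_Lf rad_pos this
    rwa [rad_mul_p, mul_comm, zpow_mul, zpow_natCast]) hx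
  have hTrep : ∀ {c : Fin p → ΛR} {z}, (∀ a, h.IsRep (c a) (z a)) → h'.IsRep (T c) (frobSumT R₀ ε z) := fun {c z} hc => by
    rw [frobSumT_apply]; refine IsRep.sum (s := univ) fun a : Fin p => ?_
    have := (hE.pow (a : ℕ)).mul ((hc a).map h' hF)
    simp_all
  have hT0 : ∀ k c, (∀ j, c j ∈ h.fil u k) → T c ∈ h'.fil u (p * k) := fun k c hc => sum_mem (t := univ) (f := fun a : Fin p => E ^ (a : ℕ) * lamMap u hF (c a)) fun (a : Fin p) _ => by
    have := h'.fil_mul (hE0 a) (hφ (hc a))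
    simp_all
  refine isHomeomorph_of_approx hM hT'.toIsComplFil T p N hp.pos (fun k c hc => hT0 k c ((hmem k c).1 hc)) (fun k y hy => ?_) fun c hc => ?_
  · obtain ⟨y', η, hη, hyy⟩ := h'.exists_approx y (p * (k + 1) + N); have hy' : y' ∈ h'.fil u (p * k + N) := by
      have := sub_mem hy (h'.fil_anti (by nlinarith [hp.pos]) hyy)
      rwa [sub_sub_cancel] at this
    have h1 := hη.mem_iff.1 hy'
    rw [rad_mul_p] at h1; obtain ⟨z, hz, rfl⟩ := exists_frobSumT h.q_pos hB h1; choose c hc hcz using fun a => h.exists_isRep (hz a)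
    refine ⟨c, (hmem k c).2 hc, ?_⟩; rwa [(hTrep hcz).eq hη]
  · refine hM.sep c fun k => (hmem k c).2 fun j => ?_
    choose c' z hz hcc using fun a => h.exists_approx (c a) (k + N)
    have h1 : T c' ∈ h'.fil u (p * (k + N)) := by
      have := hT0 (k + N) (c - c') hcc
      rwa [map_sub, hc, zero_sub, neg_mem_iff] at this
    have h2 := (hTrep hz).mem_iff.1 (h'.fil_anti (show (p : ℤ) * k + N ≤ _ by nlinarith [hp.pos, Int.natCast_nonneg N]) h1)
    rw [rad_mul_p] at h2; obtain ⟨z', hz', he⟩ := exists_frobSumT h.q_pos hB h2; choose n hn using fun a => (hz a).exists_mem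
    have h3 : ∀ a, (z - z') a ∈ LG K u (rad p ρ) (fn ϖ) S (-(∑ a, n a : ℕ)) := fun a => by
      have : n a ≤ ∑ a, n a := single_le_sum (fun _ _ => Nat.zero_le _) (mem_univ a)
      exact sub_mem (h.mem_LG_mono (by lia) (hn a)) (h.mem_LG_mono (by lia) (hz' a))
    have h4 : z = z' := sub_eq_zero.1 (eq_zero_of_frobSumT hε h3 (by simp_all))
    have := add_mem (h.fil_anti (by lia) (hcc j)) ((hz j).mem_iff.2 (h4 ▸ hz' j))
    simp_all

end Lifts.LevelAt

namespace Lifts.LevelAt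

variable (h : l.LevelAt ρ β S)
include h

lemma lamMap_galW_sub_mem {σ : GK K} {C : ℕ} (hσ : ∀ B, ∀ x ∈ Lf K (rad p ρ) B, galW (σ : GalQp p) x - x ∈ Lf K (rad p ρ) (B * fn ϖ ^ (C : ℤ)))
    {k : ℤ} {x : ΛR} (hx : x ∈ h.fil u k) : lamMap u (lamCompat_galW σ) x - x ∈ h.fil u (k + C) := by
  obtain ⟨x', y, hy, hxx⟩ := h.exists_approx x (k + C)
  have h1 : x' ∈ h.fil u k := by
    have := sub_mem hx (h.fil_anti (by lia) hxx)
    rwa [sub_sub_cancel] at this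
  have h2 : lamMap u (lamCompat_galW σ) x' - x' ∈ h.fil u (k + C) := ((hy.map h (lamCompat_galW σ)).sub hy).mem_iff.2
    (galW_sub_mem_LG h.q_pos hσ (hy.mem_iff.1 h1))
  have h3 : lamMap u (lamCompat_galW σ) (x - x') ∈ h.fil u (k + C) :=
    h.lamMap_mem_fil h (lamCompat_galW σ) (galW_mem_Lf σ (l.zpow_mem_Lf rad_pos h.lt _)) hxx
  have := sub_mem (add_mem h2 h3) hxx
  simp_all

lemma exists_teichmuller_sub_one_mul_eq_one {e : Ĉ} (he : IsEps p e) {c₀ : ℕ} (hθ : rad p ρ < ((p : ℝ)⁻¹) ^ p ^ c₀) {c : ℕ}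
    (hc : fn ϖ ^ c ≤ (((p : ℝ)⁻¹) ^ p) ^ p ^ c₀) {E : ΛR} (hE : h.IsRep E (1 ⊗ₜ ω e)) :
    ∃ z ∈ h.fil u (-c), (E ^ p ^ c₀ - 1) * z = 1 := by
  have hp := prm p
  have hp1 : (p : ℝ)⁻¹ ≤ 1 := inv_le_one_of_one_le₀ (one_lt_p (p := p)).le
  have hp0 : 0 < (p : ℝ)⁻¹ := inv_pos.2 p_pos
  have h1 : ∀ n, GB (((p : ℝ)⁻¹) ^ p ^ n) ((fn (e - 1))⁻¹ ^ p ^ n) ((frobW p)^[n] ((piU he)⁻¹ : Ãˣ)) ∧ (frobW p)^[n] ((piU he)⁻¹ : Ãˣ) ∈ AK K ∧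
      (ω e ^ p ^ n - 1) * (frobW p)^[n] ((piU he)⁻¹ : Ãˣ) = 1 := fun n => by
    induction n with
    | zero =>
      refine ⟨by simpa using (UB_piU he hp0 le_rfl).2, ?_, by aesop⟩
      have := zpow_mem_AK (K := K) he (w := piU he) ((AKr he K).sub_mem (teichmuller_cycl_mem_AK he.mem_cycl) (AKr he K).one_mem) (-1)
      simp_all
    | succ n ih =>
      rw [iterate_succ_apply']; refine ⟨?_, frobW_mem_AK ih.2.1, ?_⟩
      · rw [pow_succ, pow_mul, pow_mul]; exact ih.1.frobW (pow_nonneg hp0.le _)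
      · have := congrArg (frobW p) ih.2.2
        rwa [map_mul, map_sub, map_one, map_pow, frobW_teichmuller, map_pow, ← pow_mul, ← pow_succ'] at this
  obtain ⟨h2, h3, h4⟩ := h1 c₀
  have h5 := Lf.mono (h2.mem_Lf h3 rad_pos hθ (pow_le_one₀ hp0.le hp1)) (B' := fn ϖ ^ (-(c : ℤ))) (by
    rw [zpow_neg, zpow_natCast, inv_pow]; have : (p : ℝ)⁻¹ ^ p ≤ fn (e - 1) := he.le_fn.trans
      (pow_le_of_le_one (fn_nonneg _) ((fn_cycl_sub_one_le he.mem_cycl).trans hp1) (by have := hp.two_le; lia))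
    exact inv_anti₀ (pow_pos h.q_pos _) (hc.trans (pow_le_pow_left₀ (pow_nonneg hp0.le _) this _)))
  obtain ⟨z, hz, hzr⟩ := h.exists_isRep (u := u) (tmul_mem_LG h5)
  refine ⟨z, hz, (((hE.pow _).sub h.isRep_one).mul hzr).eq ?_⟩
  rw [one_def, tmul_pow, one_pow, ← TensorProduct.tmul_sub, tmul_mul_tmul, h4, one_mul]
  exact h.isRep_one

end Lifts.LevelAt

/-- The properties of the rings `Λ_{R₀,[0,b/p^i],K}`, for `i ≥ c₀`, and of the maps between them that govern `φ`, `ψ` and `Γ_K`. -/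
structure IsTower (hε : IsEps p ε) (c₀ : ℕ) (L : ∀ i, ℤ → AddSubgroup (Λ i)) (τ : ∀ i, (Λ i)ˣ) : Prop where
  tate : ∀ i, c₀ ≤ i → IsTateRing (L i) (τ i)
  res_mem : ∀ {i j} (hij : i ≤ j), c₀ ≤ i → ∀ {k x}, x ∈ L i k → res K u lam b hij x ∈ L j k
  frob_homeo : ∀ i, c₀ ≤ i → IsHomeomorph (fun c : Fin p → Λ i =>
    ∑ a : Fin p, teichL K u lam b hε.mem_cycl (i + 1) ^ (a : ℕ) * frob K u lam b i (c a))
  gam_sub : ∀ C : ℕ, ∀ᶠ γ : GammaK K in 𝓝 1, ∀ i, c₀ ≤ i → ∀ k, ∀ x ∈ L i k, γΛ i γ x - x ∈ L i (k + C)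
  teich_mem : ∀ {e} (he : e ∈ cycl p) i, c₀ ≤ i → teichL K u lam b he i ∈ L i 0
  exists_inv : ∃ c : ℕ, ∀ i, c₀ ≤ i → ∀ {e} (he : IsEps p e), ∃ z ∈ L i (-c), (teichL K u lam b he.mem_cycl i ^ p ^ c₀ - 1) * z = 1

lemma eventually_GammaK {P : GammaK K → Prop} (h : ∀ᶠ σ : GalQp p in 𝓝 1, ∀ hσ : σ ∈ GK K, P (QuotientGroup.mk ⟨σ, hσ⟩)) : ∀ᶠ γ : GammaK K in 𝓝 1, P γ := by
  have h1 : ∀ᶠ σ : GK K in 𝓝 1, P (QuotientGroup.mk σ) := by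
    have := (continuous_subtype_val (p := fun σ => σ ∈ GK K)).tendsto (1 : GK K)
    filter_upwards [this.eventually h] with σ hσ using hσ σ.2
  have h2 : 𝓝 (1 : GammaK K) = Filter.map QuotientGroup.mk (𝓝 (1 : GK K)) := QuotientGroup.nhds_eq (HK K) 1
  rw [h2]
  exact h1

lemma exists_isTower [FiniteDimensional ℚ_[p] K] {m m' : ℕ} (hm : 0 < m) (hm' : 0 < m') (hR₀ : IsStrictlyTFT p m m' u) (hε : IsEps p ε) {b : ℝ≥0} (hb : 0 < b)
    (hbr : (b : ℝ) < rK K * ((m' : ℝ) / m)) (hϖ : IsUniformizerEK K ϖ) {s : ℕ} (hs : (s : ℝ) * (b * flatOrd p ϖ) = 1) :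
    ∃ (c₀ : ℕ) (L : ∀ i, ℤ → AddSubgroup (LamL K u ((m' : ℝ≥0) / m) b i)) (τ : ∀ i, (LamL K u ((m' : ℝ≥0) / m) b i)ˣ), IsTower hε c₀ L τ := by
  have hp := prm p
  have hp0 := hp.pos
  obtain ⟨l⟩ := hϖ.exists_lifts hε
  obtain ⟨C, hC, θ₂, hθ₂, hbasis⟩ := l.exists_frob_basis hϖ hε
  have hq := hϖ.fn_pos
  have hq1 := hϖ.fn_lt_one
  set lam : ℝ≥0 := (m' : ℝ≥0) / m with hlam
  have hb' : (0 : ℝ) < b := hb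
  have hlam' : (lam : ℝ) = (m' : ℝ) / m := by rw [hlam]; push_cast; rfl
  have hlam0 : (0 : ℝ) < lam := by rw [hlam']; positivity
  have hbl : (b : ℝ) < lam := by
    rw [← hlam'] at hbr; exact hbr.trans_le (mul_le_of_le_one_left hlam0.le (hϖ.rK_le_one hε))
  have hρ : ∀ i, rad p (lam * p ^ i / b) = rad p (lam / b) ^ p ^ i := fun i => by
    rw [rad, rad, ← rpow_natCast, ← rpow_mul p_pos.le]; congr 1; push_cast; ring
  have hθ0 : rad p (lam / b) < (p : ℝ)⁻¹ := by
    rw [rad, ← Real.rpow_neg_one]; refine Real.rpow_lt_rpow_of_exponent_lt one_lt_p (neg_lt_neg ?_); rw [NNReal.coe_div]; exact (one_lt_div hb').2 hbl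
  have hθ1 : rad p (lam / b) < 1 := hθ0.trans_le (inv_le_one_of_one_le₀ one_lt_p.le)
  obtain ⟨c₀, hc₀⟩ : ∃ c₀, rad p (lam / b) ^ c₀ < min (l.θ₁ * fn ϖ) θ₂ := exists_pow_lt_of_lt_one (lt_min (mul_pos l.pos hq) hθ₂) hθ1
  have hsmall : ∀ i, c₀ ≤ i → rad p (lam * p ^ i / b) < min (l.θ₁ * fn ϖ) θ₂ := fun i hi => by
    rw [hρ]; exact (pow_le_pow_of_le_one rad_pos.le hθ1.le (hi.trans (Nat.lt_pow_self hp.one_lt).le)).trans_lt hc₀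
  have hs0 : 0 < s := Nat.pos_of_ne_zero fun h0 => by simp_all
  have hfn : ∀ n : ℕ, fn ϖ ^ (-(n : ℤ)) = (p : ℝ) ^ (flatOrd p ϖ * n) := fun n => by
    rw [flatOrd_eq, ← Real.rpow_intCast, neg_mul, ← mul_neg, rpow_mul p_pos.le, Real.rpow_logb p_pos one_lt_p.ne' hq]; push_cast; rfl
  have hord : flatOrd p ϖ * s = 1 / b := by rw [eq_div_iff hb'.ne']; linarith
  have H : ∀ i, c₀ ≤ i → l.LevelAt (lam * p ^ i / b) (p ^ i / b) (s * p ^ i) := fun i hi =>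
    ⟨by positivity, (hsmall i hi).trans_le ((min_le_left _ _).trans (mul_le_of_le_one_right l.pos.le hq1.le)), by
      rw [hfn]; congr 1; push_cast; grind, hϖ, ε, hε⟩
  have hE : ∀ {e} (he : e ∈ cycl p) i (hi : c₀ ≤ i), (H i hi).IsRep (teichL K u lam b he i) (1 ⊗ₜ ω e) := fun he i hi => by
    obtain ⟨a, ha, hE⟩ := exists_ofLam_eq_teichL (K := K) (u := u) he lam b i; rw [← ha, ← hE]; exact (H i hi).isRep_ofLam a
  have hT : ∀ i (hi : c₀ ≤ i), IsTateRing ((H i hi).fil u) ((H i hi).τ u) := fun i hi => by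
    refine (H i hi).isTateRing ((H i hi).isNoetherianRing ((hsmall i hi).le.trans (min_le_left _ _)) hm (M := m' * (s * p ^ i)) ?_ (by positivity) hR₀)
    have := hfn (m' * (s * p ^ i))
    rw [zpow_neg, zpow_natCast, inv_eq_iff_eq_inv] at this; rw [this, ← Real.rpow_neg p_pos.le, rad, ← rpow_natCast, ← rpow_mul p_pos.le]; congr 1
    push_cast; rw [show flatOrd p ϖ * ((m' : ℝ) * (s * p ^ i)) = flatOrd p ϖ * s * (m' * p ^ i) by ring, hord, hlam']
    have : (m : ℝ) ≠ 0 := by positivity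
    field_simp
  obtain ⟨N, hN⟩ := exists_pow_lt_of_lt_one (inv_pos.2 (zero_lt_one.trans_le hC)) hq1
  obtain ⟨c, hc⟩ := exists_pow_lt_of_lt_one (by positivity : 0 < (((p : ℝ)⁻¹) ^ p) ^ p ^ c₀) hq1
  obtain ⟨L, τ, hL⟩ : ∃ (L : ∀ i, ℤ → AddSubgroup (LamL K u lam b i)) (τ : ∀ i, (LamL K u lam b i)ˣ), ∀ i hi, L i = (H i hi).fil u ∧ τ i = (H i hi).τ u := by
    classical
    exact ⟨fun i => if hi : c₀ ≤ i then (H i hi).fil u else fun _ => ⊥, fun i => if hi : c₀ ≤ i then (H i hi).τ u else 1, fun i hi => ⟨dif_pos hi, dif_pos hi⟩⟩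
  refine ⟨c₀, L, τ, fun i hi => ?_, fun {i j} hij hi k x hx => ?_, fun i hi => ?_, fun C => ?_, fun {e} he i hi => ?_, c, fun i hi e he => ?_⟩
  · rw [(hL i hi).1, (hL i hi).2]; exact hT i hi
  · rw [(hL i hi).1] at hx; rw [(hL j (hi.trans hij)).1]; refine (H i hi).lamMap_mem_fil (H j (hi.trans hij)) _ ?_ hx
    exact l.zpow_mem_Lf rad_pos (H j (hi.trans hij)).lt k
  · have hi1 := hi.trans i.le_succ
    have hlt := hsmall _ hi1
    rw [level_succ, rad_mul_p] at hlt
    refine (H i hi).isHomeomorph_frob (H (i + 1) hi1) (level_succ lam b i) (by rw [pow_succ]; ring) (hT i hi) (hT (i + 1) hi1) _ hε (hE hε.mem_cycl _ hi1) (N := N)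
      fun B' hB' x hx => hbasis _ _ B' rad_pos (H i hi).lt (hlt.trans_le (min_le_right _ _)) hB' ?_ x hx
    rw [mul_left_comm]; refine mul_le_of_le_one_right (pow_nonneg hB' p) ?_; have := mul_lt_mul_of_pos_left hN (zero_lt_one.trans_le hC)
    rw [mul_inv_cancel₀ (zero_lt_one.trans_le hC).ne'] at this; exact this.le
  · refine eventually_GammaK ?_; filter_upwards [l.eventually_galW_sub hε (pow_pos hq C) (pow_le_one₀ hq.le hq1.le)] with σ hσ hσK i hi k x hx
    rw [(hL i hi).1] at hx ⊢
    exact (H i hi).lamMap_galW_sub_mem (σ := ⟨σ, hσK⟩) (fun B x hx => by rw [zpow_natCast]; exact hσ hσK _ B x rad_pos (H i hi).lt hx) hx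
  · rw [(hL i hi).1]; refine (hE he i hi).mem_iff.2 (tmul_mem_LG ?_); rw [zpow_zero, ← (H i hi).mem_Fil_zero]; exact teichmuller_cycl_mem_Fil he _
  · rw [(hL i hi).1]; refine (H i hi).exists_teichmuller_sub_one_mul_eq_one he ?_ hc.le (hE he.mem_cycl i hi); rw [hρ]
    exact (pow_le_pow_of_le_one rad_pos.le hθ1.le (Nat.pow_le_pow_right hp.pos hi)).trans_lt (pow_lt_pow_left₀ hθ0 rad_pos.le (pow_ne_zero _ hp.ne_zero))

end Tower
section BaseChange
lemma BaseChange.hom_ext {A B B' : Type*} [CommRing A] [CommRing B] [CommRing B'] {f : A →+* B} {M N : Type*} [AddCommGroup M] [Module A M] [AddCommGroup N] [Module B' N]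
    {σ : B →+* B'} {F G : BaseChange f M →+ N} (hF : ∀ b x, F (b • x) = σ b • F x) (hG : ∀ b x, G (b • x) = σ b • G x)
    (h : ∀ m, F (BaseChange.mk f 1 m) = G (BaseChange.mk f 1 m)) (x : BaseChange f M) : F x = G x :=
  BaseChange.induction f (P := fun x => F x = G x) (by simp) (fun b m => by
    rw [← mul_one b, ← BaseChange.smul_mk, hF, hG, h]) (fun x y hx hy => by simp_all) x

lemma BaseChange.lift_one {A B B' : Type*} [CommRing A] [CommRing B] [CommRing B'] (f : A →+* B) {M N : Type*} [AddCommGroup M] [Module A M] [AddCommGroup N] [Module B' N]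
    (β : B →+* B') (h : M →+ N) (hh : ∀ a m, h (a • m) = β (f a) • h m) (m : M) : BaseChange.lift f β h hh (BaseChange.mk f 1 m) = h m := by
  rw [BaseChange.lift_mk, map_one, one_smul]

lemma BaseChange.lin_bijective {A₀ A₁ A A' : Type*} [CommRing A₀] [CommRing A₁] [CommRing A] [CommRing A'] {D : Type*} [AddCommGroup D] [Module A₀ D]
    {f₀ s₁ : A₀ →+* A₁} {f : A →+* A'} {r : A₀ →+* A} {s : A₀ →+* A'} {r₁ : A₁ →+* A'} (hs : ∀ a, r₁ (s₁ a) = s a) (hf : ∀ a, f (r a) = r₁ (f₀ a))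
    {φ : D → BaseChange s₁ D} {Φ : BaseChange f₀ D →ₗ[A₁] BaseChange s₁ D} (hΦ : ∀ d, Φ (BaseChange.mk f₀ 1 d) = φ d) (hΦb : Bijective Φ)
    {R : BaseChange s₁ D →ₛₗ[r₁] BaseChange s D} (hR : ∀ d, R (BaseChange.mk s₁ 1 d) = BaseChange.mk s 1 d)
    {φ' : BaseChange r D →ₛₗ[f] BaseChange s D} (hφ : ∀ d, φ' (BaseChange.mk r 1 d) = R (φ d))
    {Φ' : BaseChange f (BaseChange r D) →ₗ[A'] BaseChange s D} (hΦ' : ∀ x, Φ' (BaseChange.mk f 1 x) = φ' x) : Bijective Φ' := by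
  let e := ofBijective Φ hΦb
  let H : BaseChange f₀ D →ₛₗ[r₁] BaseChange f (BaseChange r D) := BaseChange.lift f₀ r₁
    (AddMonoidHom.mk' (fun d => BaseChange.mk f 1 (BaseChange.mk r 1 d)) fun d d' => by rw [BaseChange.mk_add, BaseChange.mk_add]) fun a d => by
      change BaseChange.mk f 1 (BaseChange.mk r 1 (a • d)) = _ • BaseChange.mk f 1 (BaseChange.mk r 1 d)
      rw [BaseChange.mk_smul, BaseChange.mk_smul, hf]
  have hH1 : ∀ d, H (BaseChange.mk f₀ 1 d) = BaseChange.mk f 1 (BaseChange.mk r 1 d) := fun d => by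
    rw [BaseChange.lift_mk, map_one, one_smul]; rfl
  let G : BaseChange s D →ₗ[A'] BaseChange f (BaseChange r D) := BaseChange.lift s (RingHom.id A')
    (AddMonoidHom.mk' (fun d => H (e.symm (BaseChange.mk s₁ 1 d))) fun d d' => by rw [BaseChange.mk_add, map_add, map_add]) fun a d => by
      change H (e.symm (BaseChange.mk s₁ 1 (a • d))) = _ • H (e.symm (BaseChange.mk s₁ 1 d))
      rw [BaseChange.mk_smul, map_smul, LinearMap.map_smulₛₗ, hs, RingHom.id_apply]
  have hG1 : ∀ d, G (BaseChange.mk s 1 d) = H (e.symm (BaseChange.mk s₁ 1 d)) := fun d => by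
    rw [BaseChange.lift_mk, map_one, one_smul]; rfl
  have hH : ∀ z, Φ' (H z) = R (e z) := BaseChange.hom_ext (σ := r₁) (F := Φ'.toAddMonoidHom.comp H.toAddMonoidHom) (G := R.toAddMonoidHom.comp Φ.toAddMonoidHom)
    (fun b x => by simp) (fun b x => by simp) fun d => by
      simp_all
  have hG : ∀ y, G (R y) = H (e.symm y) := BaseChange.hom_ext (σ := r₁) (F := G.toAddMonoidHom.comp R.toAddMonoidHom) (G := H.toAddMonoidHom.comp e.symm.toLinearMap.toAddMonoidHom)
    (fun b x => by simp) (fun b x => by simp) fun d => by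
      simp_all
  have hGφ : ∀ y, G (φ' y) = BaseChange.mk f 1 y := BaseChange.hom_ext (σ := f) (F := G.toAddMonoidHom.comp φ'.toAddMonoidHom)
    (G := AddMonoidHom.mk' (fun y => BaseChange.mk f 1 y) (BaseChange.mk_add _ 1)) (fun b x => by simp) (fun b x => BaseChange.mk_smul f b x) fun d => by
      change G (φ' _) = BaseChange.mk f 1 _; rw [hφ, hG, ← hH1]; congr 1; exact e.symm_apply_eq.2 (hΦ d).symm
  refine Function.bijective_iff_has_inverse.2 ⟨G, BaseChange.hom_ext (σ := RingHom.id A') (F := G.toAddMonoidHom.comp Φ'.toAddMonoidHom) (G := AddMonoidHom.id _)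
    (fun b x => by simp) (fun b x => rfl) fun x => ?_, BaseChange.hom_ext (σ := RingHom.id A') (F := Φ'.toAddMonoidHom.comp G.toAddMonoidHom) (G := AddMonoidHom.id _)
    (fun b x => by simp) (fun b x => rfl) fun d => ?_⟩
  · simp_all
  simp_all

/-- The `A`-linear map `c ↦ ∑ v_a f(c_a)` to an algebra. -/
def sumBasis {A B ι : Type*} [CommRing A] [CommRing B] [Algebra A B] [Fintype ι] (v : ι → B) : (ι → A) →ₗ[A] B where
  toFun c := ∑ a, v a * algebraMap A B (c a)
  map_add' c c' := by simp only [Pi.add_apply, map_add, mul_add, sum_add_distrib]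
  map_smul' r c := by
    simp only [Pi.smul_apply, smul_eq_mul, map_mul, RingHom.id_apply, smul_def, mul_sum]; grind

lemma bijective_sum_basis {A B : Type*} [CommRing A] [CommRing B] {f : A →+* B} {M : Type*} [AddCommGroup M] [Module A M] {ι : Type*} [Fintype ι] [DecidableEq ι] (v : ι → B)
    (hv : Bijective fun c : ι → A => ∑ a, v a * f (c a)) : Bijective fun c : ι → M => ∑ a, BaseChange.mk f (v a) (c a) := by
  let _ := f.toAlgebra
  let e : (ι → A) ≃ₗ[A] B := ofBijective (sumBasis v) hv
  let 𝓑 : Module.Basis ι A B := Module.Basis.ofEquivFun e.symm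
  have h𝓑 : ∀ a, 𝓑 a = v a := fun a => by
    rw [Module.Basis.coe_ofEquivFun]; change ∑ a', v a' * f ((Function.update 0 a 1 : ι → A) a') = _
    rw [sum_eq_single a (fun a' _ h => by simp_all) (fun h => (h (mem_univ a)).elim),
      Function.update_self, map_one, mul_one]
  have h1 := ((TensorProduct.equivFinsuppOfBasisLeft 𝓑 (M := B) (N := M) (R := A)).symm.bijective.comp (Finsupp.linearEquivFunOnFinite A M ι).symm.bijective)
  refine (congrArg Bijective (funext fun c => ?_)).mp h1
  refine (TensorProduct.equivFinsuppOfBasisLeft_symm_apply 𝓑 _).trans ((Finsupp.sum_fintype _ _ fun _ => TensorProduct.tmul_zero _ _).trans ?_)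
  aesop

end BaseChange

section Topology
lemma isModuleTopology_of_tower {A B M : Type*} [CommRing A] [CommRing B] [TopologicalSpace A] [TopologicalSpace B] [IsTopologicalRing A] [IsTopologicalRing B] [Algebra A B]
    [IsModuleTopology A B] [AddCommGroup M] [Module A M] [Module B M] [IsScalarTower A B M] [TopologicalSpace M] [IsModuleTopology B M] [Module.Finite B M] :
    IsModuleTopology A M := by
  obtain ⟨d, q, hq⟩ := Module.Finite.exists_fin' B M
  refine ⟨?_⟩
  rw [eq_moduleTopology B M, ModuleTopology.eq_coinduced_of_surjective hq]
  exact (ModuleTopology.eq_coinduced_of_surjective (φ := q.restrictScalars A) hq).symm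

lemma isHomeomorph_sum_basis {A B M N : Type*} [CommRing A] [CommRing B] [TopologicalSpace A] [TopologicalSpace B] [IsTopologicalRing A] [IsTopologicalRing B] {f : A →+* B}
    {ι : Type*} [Fintype ι] {v : ι → B} (hv : IsHomeomorph fun c : ι → A => ∑ a, v a * f (c a)) [AddCommGroup M] [Module A M] [TopologicalSpace M] [IsModuleTopology A M]
    [AddCommGroup N] [Module B N] [TopologicalSpace N] [IsModuleTopology B N] [Module.Finite B N] {φ : M →ₛₗ[f] N} {Φ : BaseChange f M →ₗ[B] N}
    (hΦ : ∀ x, Φ (BaseChange.mk f 1 x) = φ x) (hΦb : Bijective Φ) : IsHomeomorph fun c : ι → M => ∑ a, v a • φ (c a) := by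
  classical
  let _ := f.toAlgebra
  let _ := Module.compHom N f
  have : IsScalarTower A B N := ⟨fun a b x => mul_smul (f a) b x⟩
  let e : (ι → A) ≃ₗ[A] B := ofBijective (sumBasis v) hv.bijective
  have : IsModuleTopology A B := .iso ({ e with
    continuous_toFun := hv.continuous
    continuous_invFun := (Equiv.continuous_symm_iff e.toEquiv).2 hv.isOpenMap } : (ι → A) ≃L[A] B)
  have : IsModuleTopology A N := isModuleTopology_of_tower (B := B)
  have hb := hΦb.comp (bijective_sum_basis (M := M) v hv.bijective)
  let E : (ι → M) ≃ₗ[A] N := ofBijective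
    { toFun := fun c => ∑ a, v a • φ (c a)
      map_add' := fun c c' => by simp only [Pi.add_apply, map_add, smul_add, sum_add_distrib]
      map_smul' := fun r c => by
        change ∑ a, v a • φ (r • c a) = f r • ∑ a, v a • φ (c a); rw [smul_sum]
        exact sum_congr rfl fun a _ => by rw [LinearMap.map_smulₛₗ, smul_comm] }
    ((congrArg Bijective (funext fun c => by
      rw [Function.comp_apply, map_sum]; exact sum_congr rfl fun a _ => by rw [← mul_one (v a), ← BaseChange.smul_mk, map_smul, hΦ, mul_one])).mp hb)
  have := toContinuousAdd A N
  have := toContinuousSMul A N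
  have := toContinuousAdd A M
  exact (⟨E.toEquiv, IsModuleTopology.continuous_of_linearMap E.toLinearMap, IsModuleTopology.continuous_of_linearMap E.symm.toLinearMap⟩ : (ι → M) ≃ₜ N).isHomeomorph

end Topology

section Frob
variable {D : Type*} [AddCommGroup D] [Module (LamL K u lam b 0) D] [TopologicalSpace D] (P : PhiGammaStr K u lam b D)

instance (n : ℕ) : IsModuleTopology (Λ n) (DΛ D n) := ⟨rfl⟩

lemma resD_toDL {m n : ℕ} (h : m ≤ n) (d : D) : rD h (ιD m d) = ιD n d := BaseChange.lift_one _ _ _ _ d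

lemma phiL_toDL (n : ℕ) (d : D) : P.phiL n (ιD n d) = rD (Nat.succ_le_succ (Nat.zero_le n)) (P.phi d) :=
  BaseChange.lift_one _ _ _ _ d

/-- The linearization of `φ`. -/
def PhiGammaStr.lin (n : ℕ) : BaseChange (frob K u lam b n) (DΛ D n) →ₗ[Λ (n + 1)] DΛ D (n + 1) :=
  BaseChange.lift (frob K u lam b n) (RingHom.id _) (P.phiL n).toAddMonoidHom fun a d => (P.phiL n).map_smulₛₗ a d

lemma PhiGammaStr.lin_mk (n : ℕ) (x : DΛ D n) : P.lin n (BaseChange.mk _ 1 x) = P.phiL n x :=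
  BaseChange.lift_one _ _ (P.phiL n).toAddMonoidHom _ x

lemma PhiGammaStr.lin_bijective (n : ℕ) : Bijective (P.lin n) :=
  BaseChange.lin_bijective (res_res K u lam b _ _) (frob_res K u lam b _) (φ := P.phi) (fun d =>
    BaseChange.lift_one _ _ P.phi.toAddMonoidHom _ d) P.phi_bijective (resD_toDL _) (phiL_toDL P n) (P.lin_mk n)

end Frob
section Action
lemma evalₐ_add_adicMap {A B : Type*} [CommRing A] [CommRing B] {I : Ideal A} {J : Ideal B} {f : A →+* B} (h : I ≤ J.comap f) {k : ℕ} {x : AdicCompletion J B} {y : AdicCompletion I A}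
    (hx : evalₐ J k x = 0) (hy : evalₐ I k y = 0) : evalₐ J k (x + adicMap I J f h y) = 0 := by
  rw [map_add, hx, zero_add, evalₐ_adicMap I J f h k y 0 (by rw [hy, map_zero]), map_zero, map_zero]

lemma continuous_lamMap {ρ β ρ' β' : ℝ≥0} {F : Ã →ₐ[ℤ_[p]] Ã} (hF : LamCompat K ρ β ρ' β' F) : Continuous (lamMap u hF) := by
  refine continuous_generateFrom_iff.2 ?_
  rintro _ ⟨x, k, rfl⟩
  refine isOpen_iff_mem_nhds.2 fun x₀ hx₀ => ?_
  obtain ⟨y₀, hy₀, h₀⟩ := hx₀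
  refine mem_of_superset (IsOpen.mem_nhds (TopologicalSpace.isOpen_generateFrom_of_mem ⟨x₀, k, rfl⟩) ⟨0, map_zero _, by simp⟩) ?_
  rintro _ ⟨y, hy, rfl⟩
  refine ⟨y₀ + lam0Map u hF y, ?_, ?_⟩
  · exact evalₐ_add_adicMap _ hy₀ hy
  · rw [map_add, h₀, lamMap_algebraMap, map_add, add_assoc]

lemma continuous_gam (lam b : ℝ≥0) (n : ℕ) (γ : GammaK K) : Continuous (gam K u lam b n γ) := by
  obtain ⟨σ, rfl⟩ := QuotientGroup.mk_surjective γ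
  exact continuous_lamMap (lamCompat_galW σ)

lemma gam_frob (lam b : ℝ≥0) (n : ℕ) (γ : GammaK K) (x : LamL K u lam b n) : gam K u lam b (n + 1) γ (frob K u lam b n x) = frob K u lam b n (gam K u lam b n γ x) := by
  obtain ⟨σ, rfl⟩ := QuotientGroup.mk_surjective γ
  have hf := lamCompat_frobW (K := K) (level_succ (p := p) lam b n) (by simpa using level_succ (p := p) 1 b n : (p : ℝ≥0) ^ (n + 1) / b = p ^ n / b * p)
  have hg := lamCompat_galW (ρ := lam * p ^ n / b) (β := p ^ n / b) σ
  exact (lamMap_comp u hf (lamCompat_galW σ) (hg.comp hf) (fun x _ => galW_frobW _ x) x).trans (lamMap_comp u hg hf (hg.comp hf) (fun _ _ => rfl) x).symm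

variable {D : Type*} [AddCommGroup D] [Module (LamL K u lam b 0) D] [TopologicalSpace D] (P : PhiGammaStr K u lam b D)

lemma gammaL_toDL (n : ℕ) (γ : GammaK K) (d : D) : P.gammaL n γ (ιD n d) = ιD n (P.gamma γ d) :=
  BaseChange.lift_one _ _ _ _ d

lemma resD_gammaL {m n : ℕ} (h : m ≤ n) (γ : GammaK K) (x : DΛ D m) : rD h (P.gammaL m γ x) = P.gammaL n γ (rD h x) :=
  BaseChange.hom_ext (σ := (res K u lam b h).comp (γΛ m γ)) (F := (rD h).toAddMonoidHom.comp (P.gammaL m γ).toAddMonoidHom)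
    (G := (P.gammaL n γ).toAddMonoidHom.comp (rD h).toAddMonoidHom)
    (fun a x => by simp) (fun a x => by simp [gam_res]) (fun d => by
      change rD h (P.gammaL m γ (ιD m d)) = P.gammaL n γ (rD h (ιD m d))
      rw [resD_toDL, gammaL_toDL, gammaL_toDL, resD_toDL]) x

lemma phiL_gammaL (n : ℕ) (γ : GammaK K) (x : DΛ D n) : P.phiL n (P.gammaL n γ x) = P.gammaL (n + 1) γ (P.phiL n x) :=
  BaseChange.hom_ext (σ := (frob K u lam b n).comp (γΛ n γ)) (F := (P.phiL n).toAddMonoidHom.comp (P.gammaL n γ).toAddMonoidHom)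
    (G := (P.gammaL (n + 1) γ).toAddMonoidHom.comp (P.phiL n).toAddMonoidHom)
    (fun a x => by simp) (fun a x => by simp [gam_frob]) (fun d => by
      change P.phiL n (P.gammaL n γ (ιD n d)) = P.gammaL (n + 1) γ (P.phiL n (ιD n d))
      rw [gammaL_toDL, phiL_toDL, phiL_toDL, ← resD_gammaL]; exact congrArg _ (P.phi_gamma γ d)) x

lemma gammaL_mul (n : ℕ) (γ γ' : GammaK K) (x : DΛ D n) : P.gammaL n (γ * γ') x = P.gammaL n γ (P.gammaL n γ' x) :=
  BaseChange.hom_ext (σ := γΛ n (γ * γ')) (F := (P.gammaL n (γ * γ')).toAddMonoidHom) (G := (P.gammaL n γ).toAddMonoidHom.comp (P.gammaL n γ').toAddMonoidHom)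
    (fun a x => by simp) (fun a x => by simp) (fun d => by
      change P.gammaL n (γ * γ') (ιD n d) = P.gammaL n γ (P.gammaL n γ' (ιD n d))
      rw [gammaL_toDL, gammaL_toDL, gammaL_toDL, map_mul]; rfl) x

lemma gammaL_one (n : ℕ) (x : DΛ D n) : P.gammaL n 1 x = x :=
  BaseChange.hom_ext (σ := RingHom.id _) (F := (P.gammaL n 1).toAddMonoidHom) (G := AddMonoidHom.id _)
    (fun a x => by simp) (fun a x => rfl) (fun d => by
      change P.gammaL n 1 (ιD n d) = ιD n d; rw [gammaL_toDL, map_one]; rfl) x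

/-- The presentation of `Λ_{R₀,[0,b/p^n],K} ⊗ D` given by generators of `D`. -/
def genL {d : ℕ} (g : Fin d → D) (n : ℕ) : (Fin d → Λ n) →ₗ[Λ n] DΛ D n :=
  Fintype.linearCombination (Λ n) fun j => ιD n (g j)

lemma genL_surjective {d : ℕ} {g : Fin d → D} (hg : Submodule.span (Λ 0) (Set.range g) = ⊤) (n : ℕ) :
    Function.Surjective (genL (K := K) (u := u) (lam := lam) (b := b) g n) := by
  rw [← LinearMap.range_eq_top, genL, Fintype.range_linearCombination, Submodule.eq_top_iff']
  refine BaseChange.induction _ (zero_mem _) (fun c m => ?_) fun x y => add_mem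
  rw [← mul_one c, ← BaseChange.smul_mk]
  refine smul_mem _ _ ?_
  have hm : m ∈ Submodule.span (Λ 0) (Set.range g) := hg ▸ Submodule.mem_top
  change ιD n m ∈ _
  induction hm using Submodule.span_induction with
  | mem x hx => aesop
  | zero => simp
  | add x y _ _ hx hy => aesop
  | smul a x _ hx => rw [toDL_smul]; aesop

end Action

section Neumann
lemma IsTateRing.smul_mem_latt {A D : Type*} [CommRing A] [TopologicalSpace A] {L : ℤ → AddSubgroup A} {τ : Aˣ} [AddCommGroup D] [Module A D] (h : IsTateRing L τ)
    {d : ℕ} {π : (Fin d → A) →ₗ[A] D} {a : A} {x : D} {k k' : ℤ} (ha : a ∈ L k) (hx : x ∈ latt L π k') : a • x ∈ latt L π (k + k') := by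
  obtain ⟨c, hc, rfl⟩ := mem_latt.1 hx
  exact mem_latt.2 ⟨a • c, fun j => h.mul ha (hc j), map_smul _ _ _⟩

variable {D : Type*} [AddCommGroup D] [Module (LamL K u lam b 0) D] [TopologicalSpace D] (P : PhiGammaStr K u lam b D) {hε : IsEps p ε} {c₀ : ℕ} {L : ∀ i, ℤ → AddSubgroup (LamL K u lam b i)} {τ : ∀ i, (LamL K u lam b i)ˣ} (T : IsTower hε c₀ L τ)
  {d : ℕ} {g : Fin d → D}
include T

lemma IsTower.toDL_mem_latt {i : ℕ} (hi : c₀ ≤ i) (j : Fin d) : ιD i (g j) ∈ latt (L i) (genL g i) 0 := by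
  classical
  refine mem_latt.2 ⟨single j 1, fun j' => ?_, ?_⟩
  · rw [Pi.single_apply]; split_ifs
    · simpa using (T.tate i hi).unit 0
    simp
  · rw [genL, Fintype.linearCombination_apply_single, one_smul]

lemma IsTower.resD_mem_latt {i j : ℕ} (hij : i ≤ j) (hi : c₀ ≤ i) {k : ℤ} {x : DΛ D i} (hx : x ∈ latt (L i) (genL g i) k) :
    rD hij x ∈ latt (L j) (genL g j) k := by
  obtain ⟨c, hc, rfl⟩ := mem_latt.1 hx
  refine mem_latt.2 ⟨fun a => res K u lam b hij (c a), fun a => T.res_mem hij hi (hc a), ?_⟩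
  rw [genL, genL, Fintype.linearCombination_apply, Fintype.linearCombination_apply, map_sum]
  exact sum_congr rfl fun a _ => by rw [LinearMap.map_smulₛₗ, resD_toDL]

lemma IsTower.eventually_gammaL_sub [IsModuleTopology (Λ 0) D] (hg : Submodule.span (Λ 0) (Set.range g) = ⊤) (C : ℕ) :
    ∀ᶠ γ : GammaK K in 𝓝 1, ∀ i, c₀ ≤ i → ∀ k, ∀ x ∈ latt (L i) (genL g i) k, P.gammaL i γ x - x ∈ latt (L i) (genL g i) (k + C) := by
  have := (T.tate c₀ le_rfl).topr
  have hM := (T.tate c₀ le_rfl).isComplFil_latt (genL_surjective hg c₀)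
  have := hM.topg
  have hcont : Continuous (ιD c₀ : D → DΛ D c₀) := by
    have := toContinuousAdd (Λ c₀) (DΛ D c₀)
    have := toContinuousSMul (Λ c₀) (DΛ D c₀)
    exact IsModuleTopology.continuous_of_linearMapₛₗ (σ := res K u lam b (Nat.zero_le c₀)) (continuous_lamMap _)
      { ιD c₀ with map_smul' := toDL_smul K u lam b c₀ }
  have h1 : ∀ j, ∀ᶠ γ : GammaK K in 𝓝 1, P.gammaL c₀ γ (ιD c₀ (g j)) - ιD c₀ (g j) ∈ latt (L c₀) (genL g c₀) C := fun j => by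
    have h2 : Continuous fun γ : GammaK K => P.gammaL c₀ γ (ιD c₀ (g j)) - ιD c₀ (g j) := by
      simp only [gammaL_toDL]; exact (hcont.comp (P.continuous_gamma.comp (Continuous.prodMk_left (g j)))).sub continuous_const
    refine (h2.tendsto' 1 0 (by rw [gammaL_one, sub_self])).eventually_mem ?_
    exact hM.basis.mem_of_mem trivial
  filter_upwards [T.gam_sub C, eventually_all.2 h1] with γ hγ hγ' i hi k x hx
  obtain ⟨c, hc, rfl⟩ := mem_latt.1 hx
  have hT := T.tate i hi
  have h3 : ∀ j, P.gammaL i γ (ιD i (g j)) - ιD i (g j) ∈ latt (L i) (genL g i) C := fun j => by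
    have := T.resD_mem_latt hi le_rfl (hγ' j)
    rwa [map_sub, resD_gammaL, resD_toDL] at this
  have hMi := (hT.isComplFil_latt (genL_surjective hg i)).anti
  rw [show genL g i c = ∑ j, c j • ιD i (g j) from Fintype.linearCombination_apply .., map_sum, ← sum_sub_distrib]
  refine sum_mem fun j _ => ?_
  rw [LinearMap.map_smulₛₗ, show ∀ (a a' : Λ i) (x x' : DΛ D i), a' • x' - a • x = (a' - a) • (x' - x) + ((a' - a) • x + a • (x' - x)) from
    fun a a' x x' => by rw [sub_smul, sub_smul, smul_sub, smul_sub]; abel]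
  refine add_mem (hMi (by lia) (hT.smul_mem_latt (hγ i hi k _ (hc j)) (h3 j))) (add_mem ?_ (hT.smul_mem_latt (hc j) (h3 j)))
  simpa using hT.smul_mem_latt (hγ i hi k _ (hc j)) (T.toDL_mem_latt hi j)

lemma IsTower.eventually_isHomeomorph [IsModuleTopology (Λ 0) D] (hg : Submodule.span (Λ 0) (Set.range g) = ⊤) :
    ∀ᶠ γ : GammaK K in 𝓝 1, ∀ i, c₀ ≤ i → ∀ {e} (he : IsEps p e),
      IsHomeomorph fun x : DΛ D i => teichL K u lam b he.mem_cycl i ^ p ^ c₀ • P.gammaL i γ x - x := by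
  obtain ⟨c, hc⟩ := T.exists_inv
  filter_upwards [T.eventually_gammaL_sub P hg (c + 1)] with γ hγ i hi e he
  obtain ⟨z, hz, hzu⟩ := hc i hi he
  set E := teichL K u lam b he.mem_cycl i ^ p ^ c₀ with hEdef
  have hT := T.tate i hi
  have := hT.topr
  have hM := hT.isComplFil_latt (genL_surjective hg i)
  have hE : E ∈ L i 0 := by
    have : ∀ n : ℕ, teichL K u lam b he.mem_cycl i ^ n ∈ L i 0 := fun n => by
      induction n with
      | zero => simpa using hT.unit 0
      | succ n ih => rw [pow_succ]; simpa using hT.mul ih (T.teich_mem he.mem_cycl i hi)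
    exact this _
  have h1 : IsHomeomorph (AddMonoidHom.id (DΛ D i) + AddMonoidHom.mk' (fun x => (z * E) • (P.gammaL i γ x - x)) fun x y => by
      rw [map_add, ← smul_add]; congr 1; abel) := isHomeomorph_of_sub_mem hM _ fun k x hx => by
    have := hT.smul_mem_latt (hT.mul hz hE) (hγ i hi k x hx)
    rw [AddMonoidHom.add_apply, AddMonoidHom.id_apply, add_sub_cancel_left]; exact hM.anti (by push_cast; lia) this
  have := toContinuousSMul (Λ i) (DΛ D i)
  let U : (Λ i)ˣ := ⟨E - 1, z, hzu, (mul_comm _ _).trans hzu⟩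
  have h2 := (Homeomorph.smul (α := DΛ D i) U).isHomeomorph.comp h1
  refine (congrArg IsHomeomorph (funext fun x => ?_)).mp h2
  change (E - 1) • (x + (z * E) • (P.gammaL i γ x - x)) = _
  rw [smul_add, smul_smul, ← mul_assoc, hzu, one_mul, sub_smul, smul_sub, one_smul]
  abel

end Neumann
section Systems
/-- The element of `𝒪_{ℂ_p}^♭` given by a system of `p`-power roots. -/
def sysO (ζ : Perfection 𝓞_ℂ_[p] p) : OFlat p :=
  (⟨fun n => Ideal.Quotient.mk _ (ζ.1 n), fun n => by rw [← map_pow, ζ.2]⟩ : Perfection (ModP 𝓞_ℂ_[p] p) p)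

/-- The element of `ℂ_p^♭` given by a system of `p`-power roots. -/
def sysE (ζ : Perfection 𝓞_ℂ_[p] p) : Ĉ := algebraMap (OFlat p) Ĉ (sysO ζ)

lemma sysE_mul (ζ ζ' : Perfection 𝓞_ℂ_[p] p) : sysE (ζ * ζ') = sysE ζ * sysE ζ' := by
  have h : sysO (ζ * ζ') = sysO ζ * sysO ζ' := by rfl
  exact (congrArg (algebraMap (OFlat p) Ĉ) h).trans (map_mul _ _ _)

lemma sysE_one : sysE (1 : Perfection 𝓞_ℂ_[p] p) = 1 := by
  have h : sysO (1 : Perfection 𝓞_ℂ_[p] p) = 1 := by rfl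
  exact (congrArg (algebraMap (OFlat p) Ĉ) h).trans (map_one _)

lemma sysE_pow (ζ : Perfection 𝓞_ℂ_[p] p) (n : ℕ) : sysE (ζ ^ n) = sysE ζ ^ n := by
  induction n with
  | zero => rw [pow_zero, pow_zero, sysE_one]
  | succ n ih => rw [pow_succ, pow_succ, sysE_mul, ih]

lemma mem_cycl_iff {e : Ĉ} : e ∈ cycl p ↔ ∃ ζ : Perfection 𝓞_ℂ_[p] p, ζ.1 0 = 1 ∧ sysE ζ = e := by
  constructor
  · rintro ⟨x, rfl, ζ, h0, h1, h2⟩; exact ⟨⟨ζ, h1⟩, h0, congrArg (algebraMap (OFlat p) Ĉ) (Perfection.ext fun n => (h2 n).symm)⟩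
  · rintro ⟨ζ, h0, rfl⟩; exact ⟨_, rfl, ζ.1, h0, ζ.2, fun n => rfl⟩

lemma isEps_iff {e : Ĉ} : IsEps p e ↔ ∃ ζ : Perfection 𝓞_ℂ_[p] p, ζ.1 0 = 1 ∧ ζ.1 1 ≠ 1 ∧ sysE ζ = e := by
  constructor
  · rintro ⟨x, rfl, ζ, h0, h, h1, h2⟩; exact ⟨⟨ζ, h1⟩, h0, h, congrArg (algebraMap (OFlat p) Ĉ) (Perfection.ext fun n => (h2 n).symm)⟩
  · rintro ⟨ζ, h0, h, rfl⟩; exact ⟨_, rfl, ζ.1, h0, h, ζ.2, fun n => rfl⟩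

lemma exists_sysE_eq_mul_pow {ζ ζ' : Perfection 𝓞_ℂ_[p] p} (h0 : ζ.1 0 = 1) {k : ℕ} (hk : ζ'.1 k = ζ.1 k) :
    ∃ ξ : Perfection 𝓞_ℂ_[p] p, ξ.1 0 = 1 ∧ (ξ.1 1 = 1 → ζ'.1 (k + 1) = ζ.1 (k + 1)) ∧ sysE ζ' = sysE ζ * sysE ξ ^ p ^ k := by
  have hp := prm p
  have hr := sysroot_pow h0 ζ.2
  have hpos : ∀ n, 0 < p ^ n := fun n => pow_pos hp.pos n
  have hmul : ∀ n, ζ.1 n ^ (p ^ n - 1) * ζ.1 n = 1 := fun n => by rw [← pow_succ, Nat.sub_add_cancel (hpos n), hr]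
  have hinv : ∀ n, (ζ.1 (n + 1) ^ (p ^ (n + 1) - 1)) ^ p = ζ.1 n ^ (p ^ n - 1) := fun n => by
    have h1 : (ζ.1 (n + 1) ^ (p ^ (n + 1) - 1)) ^ p * ζ.1 n = 1 := by rw [← ζ.2 n, ← mul_pow, hmul, one_pow]
    rw [← one_mul (ζ.1 n ^ _), ← h1, mul_assoc, mul_comm (ζ.1 n), hmul, mul_one]
  let ξ : Perfection 𝓞_ℂ_[p] p := ⟨fun n => ζ'.1 n * ζ.1 n ^ (p ^ n - 1), fun n => by rw [mul_pow, ζ'.2, hinv]⟩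
  have hξ : ζ * ξ = ζ' := Subtype.ext (funext fun n => by
    change ζ.1 n * (ζ'.1 n * ζ.1 n ^ (p ^ n - 1)) = ζ'.1 n; rw [mul_left_comm, mul_comm (ζ.1 n), hmul, mul_one])
  refine ⟨⟨fun n => ξ.1 (n + k), fun n => ?_⟩, ?_, fun h1 => ?_, ?_⟩
  · change ξ.1 (n + 1 + k) ^ p = ξ.1 (n + k); rw [show n + 1 + k = n + k + 1 by ring]; exact ξ.2 _
  · change ζ'.1 (0 + k) * ζ.1 (0 + k) ^ (p ^ (0 + k) - 1) = 1; rw [zero_add, hk, mul_comm, hmul]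
  · change ζ'.1 (1 + k) * ζ.1 (1 + k) ^ (p ^ (1 + k) - 1) = 1 at h1; rw [add_comm 1] at h1
    rw [← one_mul (ζ.1 (k + 1)), ← h1, mul_assoc, hmul, mul_one]
  · refine (congrArg sysE hξ.symm).trans ((sysE_mul _ _).trans (congrArg (sysE ζ * ·) ((congrArg sysE ?_).trans (sysE_pow _ _))))
    exact Subtype.ext (funext fun n => (sysroot_pow_sub ξ.2 n k).symm)

lemma mul_mem_cycl {e e' : Ĉ} (he : e ∈ cycl p) (he' : e' ∈ cycl p) : e * e' ∈ cycl p := by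
  obtain ⟨ζ, h0, rfl⟩ := mem_cycl_iff.1 he
  obtain ⟨ζ', h0', rfl⟩ := mem_cycl_iff.1 he'
  exact mem_cycl_iff.2 ⟨ζ * ζ', (congrArg₂ _ h0 h0').trans (one_mul 1), sysE_mul _ _⟩

variable (p) in
/-- The group `ε ^ ℤ_p`. -/
def cyclM : Submonoid Ĉ where
  carrier := cycl p
  mul_mem' := mul_mem_cycl
  one_mem' := mem_cycl_iff.2 ⟨1, rfl, sysE_one⟩

lemma IsEps.mul_pow {e θ : Ĉ} (he : IsEps p e) (hθ : θ ∈ cycl p) {k : ℕ} (hk : k ≠ 0) : IsEps p (e * θ ^ p ^ k) := by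
  obtain ⟨ζ, h0, h, rfl⟩ := isEps_iff.1 he
  obtain ⟨ξ, h0', rfl⟩ := mem_cycl_iff.1 hθ
  have h1 : ∀ n, n ≤ 1 → ξ.1 n ^ p ^ k = 1 := fun n hn => by
    obtain ⟨j, rfl⟩ := Nat.exists_eq_add_of_le (hn.trans (Nat.one_le_iff_ne_zero.2 hk)); rw [pow_add, pow_mul, sysroot_pow h0' ξ.2, one_pow]
  refine isEps_iff.2 ⟨ζ * ξ ^ p ^ k, ?_, ?_, by rw [sysE_mul, sysE_pow]⟩
  · exact (congrArg₂ _ h0 (h1 0 zero_le_one)).trans (one_mul 1)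
  · exact fun h2 => h ((mul_one _).symm.trans ((congrArg (ζ.1 1 * ·) (h1 1 le_rfl)).symm.trans h2))

lemma IsEps.pow {e : Ĉ} (he : IsEps p e) {a : ℕ} (h0a : a ≠ 0) (hap : a < p) : IsEps p (e ^ a) := by
  obtain ⟨ζ, h0, h, rfl⟩ := isEps_iff.1 he
  have hζ := sysroot_primitive h0 ζ.2 h 1
  rw [pow_one] at hζ
  exact isEps_iff.2 ⟨ζ ^ a, (congrArg (· ^ a) h0).trans (one_pow a), hζ.pow_ne_one_of_pos_of_lt h0a hap, sysE_pow _ _⟩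

lemma IsEps.exists_eq_pow_mul {e : Ĉ} (hε : IsEps p e) {e' : Ĉ} (he : IsEps p e') : ∃ a, a ≠ 0 ∧ a < p ∧ ∃ θ ∈ cycl p, e' = e ^ a * θ ^ p := by
  obtain ⟨ζ, h0, h, rfl⟩ := isEps_iff.1 hε
  obtain ⟨ζ', h0', h', rfl⟩ := isEps_iff.1 he
  have hζ := sysroot_primitive h0 ζ.2 h 1
  have : NeZero (p ^ 1) := ⟨pp_ne_zero 1⟩
  obtain ⟨a, ha, haζ⟩ := hζ.eq_pow_of_pow_eq_one (sysroot_pow h0' ζ'.2 1)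
  obtain ⟨ξ, hξ, -, hξe⟩ := exists_sysE_eq_mul_pow (ζ := ζ ^ a) (ζ' := ζ') (k := 1) ((congrArg (· ^ a) h0).trans (one_pow a)) haζ.symm
  refine ⟨a, fun ha0 => h' (by simp_all), by simp_all, sysE ξ, mem_cycl_iff.2 ⟨ξ, hξ, rfl⟩, ?_⟩
  rwa [sysE_pow, pow_one] at hξe

/-- The Galois action on systems of roots. -/
def galSys (σ : GalQp p) (ζ : Perfection 𝓞_ℂ_[p] p) : Perfection 𝓞_ℂ_[p] p := ⟨fun n => galO σ (ζ.1 n), fun n => by rw [← map_pow, ζ.2]⟩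

lemma galFlat_sysE (σ : GalQp p) (ζ : Perfection 𝓞_ℂ_[p] p) : galFlat σ (sysE ζ) = sysE (galSys σ ζ) :=
  (galFlat_algebraMap σ _).trans (congrArg (algebraMap (OFlat p) Ĉ) (Perfection.ext fun _ => rfl))

lemma galO_eq_self_iff (σ : GalQp p) {n : ℕ} {z : 𝓞_ℂ_[p]} (hz : IsPrimitiveRoot z (p ^ n)) : galO σ z = z ↔ (p : ℤ_[p]) ^ n ∣ (chi p σ : ℤ_[p]) - 1 := by
  have : NeZero (p ^ n) := ⟨pp_ne_zero n⟩
  obtain ⟨η, hη⟩ := exists_primitiveRoot (PadicAlgCl p) (p ^ n)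
  have hη' := hη.map_of_injective (f := (coeRingHom : PadicAlgCl p →+* ℂ_[p])) (coeRingHom : PadicAlgCl p →+* ℂ_[p]).injective
  obtain ⟨i, -, hi⟩ := hη'.eq_pow_of_pow_eq_one (congrArg Subtype.val hz.pow_eq_one)
  have h1 : galO σ z = z ^ ((chi p σ : ℤ_[p]).toZModPow n).val := Subtype.ext (by
    change galC σ (z : ℂ_[p]) = (z : ℂ_[p]) ^ _; rw [← hi, map_pow, ← pow_mul, mul_comm, pow_mul]; congr 1
    refine (galC_coe σ η).trans ((congrArg _ (cyclotomicCharacter.spec p (σ : PadicAlgCl p ≃+* PadicAlgCl p) η hη.pow_eq_one)).trans ?_)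
    exact map_pow (coeRingHom : PadicAlgCl p →+* ℂ_[p]) η _)
  rw [h1, ← mem_span_singleton, ← PadicInt.ker_toZModPow, RingHom.mem_ker, map_sub, map_one, sub_eq_zero]
  nth_rw 2 [← pow_one z]
  have h2 : IsUnit z := hz.isUnit (NeZero.ne _)
  obtain ⟨w, rfl⟩ := h2
  have h3 := IsPrimitiveRoot.coe_units_iff.1 hz
  rw [← val_pow_eq_pow_val, ← val_pow_eq_pow_val, Units.val_inj, pow_eq_pow_iff_modEq, ← h3.eq_orderOf, ← ZMod.natCast_eq_natCast_iff, ZMod.natCast_zmod_val, cast_one]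

lemma IsEps.gal {e : Ĉ} (he : IsEps p e) (σ : GalQp p) : IsEps p (galFlat σ e) := by
  obtain ⟨ζ, h0, h, rfl⟩ := isEps_iff.1 he
  refine isEps_iff.2 ⟨galSys σ ζ, (congrArg _ h0).trans (map_one _), fun h1 => h (Subtype.ext ((galC σ).injective ?_)), (galFlat_sysE _ _).symm⟩
  exact (congrArg Subtype.val h1).trans (map_one (galC σ)).symm

/-- `z ∈ 1 + p ^ d ℤ_p^×`. -/
def HasDepth (z : ℤ_[p]) (d : ℕ) : Prop := (p : ℤ_[p]) ^ d ∣ z - 1 ∧ ¬ (p : ℤ_[p]) ^ (d + 1) ∣ z - 1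

lemma IsEps.exists_galFlat_eq {e : Ĉ} (he : IsEps p e) {σ : GalQp p} {k : ℕ} (hk : HasDepth (chi p σ : ℤ_[p]) k) :
    ∃ η, IsEps p η ∧ galFlat σ e = e * η ^ p ^ k := by
  obtain ⟨ζ, h0, h, rfl⟩ := isEps_iff.1 he
  have hζ := sysroot_primitive h0 ζ.2 h
  obtain ⟨ξ, hξ, hξ1, hξe⟩ := exists_sysE_eq_mul_pow (ζ' := galSys σ ζ) h0 ((galO_eq_self_iff σ (hζ k)).2 hk.1)
  exact ⟨_, isEps_iff.2 ⟨ξ, hξ, fun h1 => hk.2 ((galO_eq_self_iff σ (hζ (k + 1))).1 (hξ1 h1)), rfl⟩, (galFlat_sysE _ _).trans hξe⟩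

end Systems

section Depth
lemma HasDepth.pow_p {z : ℤ_[p]} {d : ℕ} (h : HasDepth z d) (hd : 0 < d) (h2 : p = 2 → 2 ≤ d) : HasDepth (z ^ p) (d + 1) := by
  have hp := prm p
  have hP := PadicInt.prime_p (p := p)
  obtain ⟨⟨w, hw⟩, h'⟩ := h
  obtain ⟨t, ht⟩ : ∃ t, ∑ i ∈ range p, z ^ i = p * (1 + p * t) := by
    rcases hp.eq_two_or_odd' with h0 | ho
    · obtain ⟨j, rfl⟩ := Nat.exists_eq_add_of_le (h2 h0); subst h0; refine ⟨2 ^ j * w, ?_⟩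
      rw [sum_range_succ, Finset.sum_range_one, pow_zero, pow_one, ← sub_add_cancel z 1, hw]; push_cast; ring
    · obtain ⟨j, rfl⟩ := Nat.exists_eq_add_of_le hd; obtain ⟨t, ht⟩ := odd_sq_dvd_geom_sum₂_sub (1 : ℤ_[p]) ((p : ℤ_[p]) ^ j * w) ho; refine ⟨t, ?_⟩
      rw [show z = 1 + p * (p ^ j * w) by grind]
      simp only [one_pow, mul_one] at ht; grind
  have hz : z ^ p - 1 = p ^ (d + 1) * (w * (1 + p * t)) := by rw [← geom_sum_mul, ht, hw]; ring
  refine ⟨⟨_, hz⟩, fun h1 => ?_⟩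
  rw [hz, pow_succ _ (d + 1), mul_dvd_mul_iff_left (pow_ne_zero _ hP.ne_zero)] at h1
  rcases hP.dvd_or_dvd h1 with h3 | h3
  · exact h' (by rw [hw, pow_succ]; exact mul_dvd_mul_left _ h3)
  · exact hP.not_isUnit (isUnit_of_dvd_one ((dvd_add_left (dvd_mul_right _ _)).1 h3))

lemma HasDepth.pow_p_pow {z : ℤ_[p]} {d : ℕ} (h : HasDepth z d) (hd : 0 < d) (h2 : p = 2 → 2 ≤ d) (j : ℕ) : HasDepth (z ^ p ^ j) (d + j) := by
  induction j with
  | zero => simpa using h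
  | succ j ih => rw [pow_succ, pow_mul]; exact ih.pow_p (by lia) fun h => (h2 h).trans (by lia)

lemma hasDepth_depth {γ : GammaK K} (h : chiK K γ ≠ 1) : HasDepth (chiK K γ : ℤ_[p]) (depth K γ) := by
  have h0 : (chiK K γ : ℤ_[p]) - 1 ≠ 0 := fun h1 => h (Units.ext (sub_eq_zero.1 h1))
  have := fun n => PadicInt.mem_span_pow_iff_le_valuation _ h0 n
  simp only [mem_span_singleton] at this
  exact ⟨(this _).2 le_rfl, fun h1 => Nat.not_succ_le_self _ ((this _).1 h1)⟩

lemma chiK_injective : Injective (chiK K) := QuotientGroup.kerLift_injective _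

lemma pos_of_hasDepth {z : ℤ_[p]ˣ} {d : ℕ} (h : HasDepth (((z ^ (2 * (p - 1)) : ℤ_[p]ˣ) : ℤ_[p])) d) : 0 < d ∧ (p = 2 → 2 ≤ d) := by
  have hp := prm p
  have h1 : (p : ℤ_[p]) ∣ ((z ^ (p - 1) : ℤ_[p]ˣ) : ℤ_[p]) - 1 := by
    rw [← mem_span_singleton, ← PadicInt.maximalIdeal_eq_span_p, ← PadicInt.ker_toZMod, RingHom.mem_ker, map_sub, map_one, sub_eq_zero, val_pow_eq_pow_val, map_pow]
    exact ZMod.pow_card_sub_one_eq_one ((z.isUnit.map PadicInt.toZMod).ne_zero)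
  have h2 : ∀ n, (p : ℤ_[p]) ^ n ∣ ((z ^ (2 * (p - 1)) : ℤ_[p]ˣ) : ℤ_[p]) - 1 → n ≤ d := fun n hn => by
    by_contra h0
    exact h.2 ((pow_dvd_pow _ (by lia)).trans hn)
  have h3 : ((z ^ (2 * (p - 1)) : ℤ_[p]ˣ) : ℤ_[p]) - 1 = (((z ^ (p - 1) : ℤ_[p]ˣ) : ℤ_[p]) - 1) * (((z ^ (p - 1) : ℤ_[p]ˣ) : ℤ_[p]) - 1 + 2) := by
    rw [mul_comm 2, pow_mul, val_pow_eq_pow_val _ 2]; ring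
  refine ⟨h2 1 (by rw [pow_one, h3]; exact h1.mul_right _), fun h0 => h2 2 ?_⟩
  rw [h3, pow_two]
  exact mul_dvd_mul h1 (dvd_add h1 (by simp_all))

lemma continuous_chiK : Continuous (chiK K) := by
  refine continuous_quot_lift _ ?_
  exact (cyclotomicCharacter.continuous p ℚ_[p] (PadicAlgCl p)).comp continuous_subtype_val

lemma exists_depth_of_eventually [FiniteDimensional ℚ_[p] K] {Q : GammaK K → Prop} (hQ : ∀ᶠ γ in 𝓝 1, Q γ) :
    ∃ k : ℕ, ∀ γ : GammaK K, (p : ℤ_[p]) ^ k ∣ (chiK K γ : ℤ_[p]) - 1 → Q γ := by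
  have : CompactSpace (GK K) := isCompact_iff_compactSpace.1 (IntermediateField.fixingSubgroup_isClosed K).isCompact
  let V : ℕ → Set (GammaK K) := fun k => {γ | (p : ℤ_[p]) ^ k ∣ (chiK K γ : ℤ_[p]) - 1}
  have hV : ∀ k, IsClosed (V k) := fun k => by
    have h1 : V k = (fun γ => ‖(chiK K γ : ℤ_[p]) - 1‖) ⁻¹' Set.Iic ((p : ℝ) ^ (-(k : ℤ))) := Set.ext fun γ => by
      change (p : ℤ_[p]) ^ k ∣ (chiK K γ : ℤ_[p]) - 1 ↔ ‖(chiK K γ : ℤ_[p]) - 1‖ ≤ (p : ℝ) ^ (-(k : ℤ))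
      rw [PadicInt.norm_le_pow_iff_mem_span_pow, mem_span_singleton]
    rw [h1]; exact isClosed_Iic.preimage ((Units.continuous_val.comp continuous_chiK).sub continuous_const).norm
  obtain ⟨k, hk⟩ := exists_subset_nhds_of_isCompact' (V := V) (directed_of_isDirected_le fun i j hij γ hγ => (pow_dvd_pow _ hij).trans hγ) (fun k => (hV k).isCompact) hV (U := {γ | Q γ})
    fun γ hγ => by
      have h1 : γ = 1 := chiK_injective (Units.ext (by
        rw [map_one, val_one, ← sub_eq_zero]; by_contra h0
        have := PadicInt.mem_span_pow_iff_le_valuation _ h0 (((chiK K γ : ℤ_[p]) - 1).valuation + 1)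
        rw [mem_span_singleton] at this; exact Nat.not_succ_le_self _ (this.1 (Set.mem_iInter.1 hγ _))))
      rw [h1]; exact hQ
  exact ⟨k, fun γ hγ => hk hγ⟩

end Depth
lemma HasContinuousInverseOn.of_pow {X : Type*} [AddCommGroup X] [TopologicalSpace X] [ContinuousAdd X] {f : AddMonoid.End X} (hf : Continuous f) {S : Set X} (S' : AddSubgroup X)
    (hS' : S' = S) (hfS : ∀ x ∈ S', f x ∈ S') (N : ℕ) (h : HasContinuousInverseOn (fun x => (f ^ N) x - x) S) : HasContinuousInverseOn (fun x => f x - x) S := by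
  subst hS'
  obtain ⟨-, g, hg, ⟨hl, hr⟩, hgc⟩ := h
  let s : AddMonoid.End X := ∑ i ∈ range N, f ^ i
  have hs : ∀ x, s x = ∑ i ∈ range N, (f ^ i) x := fun x => AddMonoidHom.finsetSum_apply _ _ _
  have hfs : ∀ i : ℕ, ∀ x ∈ S', (f ^ i) x ∈ S' := fun i => by
    induction i with
    | zero => simp
    | succ i ih => simp_all
  have hfc : ∀ i : ℕ, Continuous ((f ^ i : AddMonoid.End X) : X → X) := fun i => by
    induction i with
    | zero => exact continuous_id
    | succ i ih => rw [pow_succ]; exact ih.comp hf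
  have hsS : ∀ x ∈ S', s x ∈ S' := fun x hx => by rw [hs]; exact sum_mem fun i _ => hfs i x hx
  have hsc : Continuous s := by
    rw [show (s : X → X) = fun x => ∑ i ∈ range N, (f ^ i) x from funext hs]
    exact continuous_finsetSum _ fun i _ => hfc i
  have h1 : ∀ x, f (s x) - s x = (f ^ N) x - x := fun x => DFunLike.congr_fun (mul_geom_sum f N) x
  have h2 : ∀ x, s (f x - x) = (f ^ N) x - x := fun x => DFunLike.congr_fun (geom_sum_mul f N) x
  have hm : ∀ x ∈ S', f x - x ∈ S' := fun x hx => sub_mem (hfS x hx) hx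
  refine ⟨hm, s ∘ g, fun x hx => hsS _ (hg hx), ⟨fun x hx => ?_, fun x hx => (h1 _).trans (hr hx)⟩, hsc.comp_continuousOn hgc⟩
  have hy := hg (hm x hx)
  refine hl.injOn (hsS _ hy) hx ?_
  rw [← h2, h1, ← h2 x]
  exact congrArg s (hr (hm x hx))

lemma IsHomeomorph.of_conj {X Y ι : Type*} [TopologicalSpace X] [TopologicalSpace Y] {Ψ : (ι → Y) → X} (hΨ : IsHomeomorph Ψ) {G : ι → Y → Y} (hG : ∀ a, IsHomeomorph (G a)) {F : X → X}
    (h : ∀ c, F (Ψ c) = Ψ fun a => G a (c a)) : IsHomeomorph F := by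
  have h1 := ((hΨ.homeomorph.symm.trans (Homeomorph.piCongrRight fun a => (hG a).homeomorph)).trans hΨ.homeomorph).isHomeomorph
  refine (congrArg IsHomeomorph (funext fun x => ?_)).mp h1
  obtain ⟨c, rfl⟩ := hΨ.surjective x
  exact (congrArg (fun c' => Ψ fun a => G a (c' a)) (hΨ.homeomorph.symm_apply_apply c)).trans (h c).symm

variable (K u lam b)

/-- The homomorphism `e ↦ [e]` into the units of `Λ_{R₀,[0,b/p^n],K}`. -/
def tL (n : ℕ) : cyclM p →* Λ n where
  toFun e := teichL K u lam b e.2 n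
  map_one' := by
    refine (congrArg (ofLam K u _ _) (Subtype.ext ?_)).trans (map_one _); aesop
  map_mul' e e' := by
    refine (congrArg (ofLam K u _ _) (Subtype.ext ?_)).trans (map_mul _ _ _)
    simp

variable {K u lam b}

local notation "tΛ" => tL K u lam b

lemma frob_tL (n : ℕ) (e : cyclM p) : frob K u lam b n (tΛ n e) = tΛ (n + 1) (e ^ p) := by
  refine (lamMap_ofLam _ _).trans (congrArg (ofLam K u _ _) (Subtype.ext ?_))
  exact congrArg ((1 : R₀) ⊗ₜ[ℤ_[p]] ·) (frobW_teichmuller (e : Ĉ))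

lemma gam_tL (n : ℕ) (σ : GK K) (e : cyclM p) : γΛ n (QuotientGroup.mk σ) (tΛ n e) = tΛ n ⟨galFlat σ e, galFlat_mem_cycl _ e.2⟩ := by
  refine (lamMap_ofLam (lamCompat_galW σ) _).trans (congrArg (ofLam K u _ _) (Subtype.ext ?_))
  exact congrArg ((1 : R₀) ⊗ₜ[ℤ_[p]] ·) (galW_teichmuller _ (e : Ĉ))

variable {D : Type*} [AddCommGroup D] [Module (LamL K u lam b 0) D] [TopologicalSpace D] (P : PhiGammaStr K u lam b D)

/-- The map `c ↦ ∑_a [ε]^a φ(c_a)`. -/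
def sumL (ε : cyclM p) (n : ℕ) : (Fin p → DΛ D n) →+ DΛ D (n + 1) where
  toFun c := ∑ a : Fin p, tΛ (n + 1) ε ^ (a : ℕ) • P.phiL n (c a)
  map_zero' := Finset.sum_eq_zero fun a _ => by rfl
  map_add' c c' := by
    rw [← sum_add_distrib]; simp

lemma sumL_apply (ε : cyclM p) (n : ℕ) (c : Fin p → DΛ D n) : sumL P ε n c = ∑ a : Fin p, tΛ (n + 1) ε ^ (a : ℕ) • P.phiL n (c a) := rfl

lemma smul_gammaL_sumL_sub {ε η : cyclM p} {γ : GammaK K} {r t n : ℕ} (hη : γΛ (n + 1) γ (tΛ (n + 1) ε) = tΛ (n + 1) (ε * η ^ p ^ (r + 1 + t))) (e : cyclM p)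
    (c : Fin p → DΛ D n) : tΛ (n + 1) (e ^ p ^ (r + 1)) • P.gammaL (n + 1) γ (sumL P ε n c) - sumL P ε n c =
      sumL P ε n fun a => tΛ n ((e * (η ^ (a : ℕ)) ^ p ^ t) ^ p ^ r) • P.gammaL n γ (c a) - c a := by
  simp only [sumL_apply]
  rw [map_sum, smul_sum, ← sum_sub_distrib]
  refine sum_congr rfl fun a _ => ?_
  rw [map_sub, LinearMap.map_smulₛₗ, LinearMap.map_smulₛₗ, frob_tL, map_pow (γΛ (n + 1) γ), hη, phiL_gammaL, smul_sub, smul_smul, smul_smul]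
  congr 2
  rw [← map_pow, ← map_pow, ← map_mul, ← map_mul]
  congr 1
  rw [mul_pow ε, mul_pow e, mul_pow, ← pow_mul, ← pow_mul, ← pow_mul, ← pow_mul, ← pow_mul, ← pow_succ, mul_left_comm]
  congr 3
  rw [pow_add, pow_succ]
  ring

lemma psi_sumL {ε : Ĉ} (hε : IsEps p ε) {n : ℕ} (h : Injective (sumL P ⟨ε, hε.mem_cycl⟩ n)) (c : Fin p → DΛ D n) :
    P.psi hε n (sumL P ⟨ε, hε.mem_cycl⟩ n c) = c ⟨0, (prm p).pos⟩ := by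
  have h1 : ∃ c' : Fin p → DΛ D n, sumL P ⟨ε, hε.mem_cycl⟩ n c = ∑ j : Fin p, teichL K u lam b hε.mem_cycl (n + 1) ^ (j : ℕ) • P.phiL n (c' j) := ⟨c, rfl⟩
  rw [PhiGammaStr.psi, dif_pos h1, ← h h1.choose_spec]

section Tower
variable {hε : IsEps p ε} {c₀ : ℕ} {L : ∀ i, ℤ → AddSubgroup (LamL K u lam b i)} {τ : ∀ i, (LamL K u lam b i)ˣ} (T : IsTower hε c₀ L τ) [Module.Finite (LamL K u lam b 0) D]
include T

lemma IsTower.isHomeomorph_sumL {n : ℕ} (hn : c₀ ≤ n) : IsHomeomorph (sumL P ⟨ε, hε.mem_cycl⟩ n) := by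
  obtain ⟨d, g, hg⟩ := Module.Finite.exists_fin (R := Λ 0) (M := D)
  have := (T.tate n hn).topr
  have := (T.tate (n + 1) (by lia)).topr
  have : Module.Finite (Λ (n + 1)) (DΛ D (n + 1)) := Module.Finite.of_surjective _ (genL_surjective hg (n + 1))
  exact isHomeomorph_sum_basis (T.frob_homeo n hn) (Φ := P.lin n) (P.lin_mk n) (P.lin_bijective n)

lemma IsTower.isHomeomorph_smul_gammaL_sub {η : cyclM p} {γ : GammaK K} {k : ℕ} (hη : ∀ n, γΛ n γ (tΛ n ⟨ε, hε.mem_cycl⟩) = tΛ n (⟨ε, hε.mem_cycl⟩ * η ^ p ^ k))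
    (hγ : ∀ n, c₀ ≤ n → ∀ {e} (he : IsEps p e), IsHomeomorph fun x : DΛ D n => teichL K u lam b he.mem_cycl n ^ p ^ c₀ • P.gammaL n γ x - x) {r : ℕ} (hr : c₀ ≤ r) (hrk : r < k) :
    ∀ n, r ≤ n → ∀ e : cyclM p, IsEps p (e : Ĉ) → IsHomeomorph fun x : DΛ D n => tΛ n (e ^ p ^ r) • P.gammaL n γ x - x := by
  induction r, hr using Nat.le_induction with
  | base => exact fun n hn e he => by simp only [map_pow]; exact hγ n hn he
  | succ r hr ih =>
    intro n hn e he; obtain ⟨n, rfl⟩ : ∃ n', n = n' + 1 := ⟨n - 1, by lia⟩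
    obtain ⟨t, rfl⟩ : ∃ t, k = r + 1 + t := ⟨k - (r + 1), by lia⟩
    exact IsHomeomorph.of_conj (T.isHomeomorph_sumL P (n := n) (by lia)) (fun a => ih (by lia) n (by lia) _ (he.mul_pow (η ^ (a : ℕ)).2 (by lia)))
      (smul_gammaL_sumL_sub P (hη (n + 1)) e)

lemma IsTower.exists_psi_ker {n : ℕ} (hn : c₀ ≤ n) : ∃ S : AddSubgroup (DΛ D (n + 1)), (S = {x | P.psi hε n x = 0}) ∧ ∀ γ, ∀ x ∈ S, P.gammaL (n + 1) γ x ∈ S := by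
  classical
  have hp := prm p
  have hS := T.isHomeomorph_sumL P hn
  let S := AddSubgroup.map (sumL P ⟨ε, hε.mem_cycl⟩ n) (Pi.evalAddMonoidHom _ ⟨0, hp.pos⟩).ker
  refine ⟨S, Set.ext fun x => ?_, fun γ x hx => ?_⟩
  · obtain ⟨c, rfl⟩ := hS.surjective x; change sumL P _ n c ∈ S ↔ P.psi hε n _ = 0
    rw [psi_sumL P hε hS.injective, AddSubgroup.mem_map_iff_mem hS.injective]; rfl
  · obtain ⟨c, hc, rfl⟩ := hx; obtain ⟨σ, rfl⟩ := QuotientGroup.mk_surjective γ; rw [sumL_apply, map_sum]; refine sum_mem fun a _ => ?_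
    rw [LinearMap.map_smulₛₗ, ← phiL_gammaL, map_pow, gam_tL]; rcases eq_or_ne (a : ℕ) 0 with ha | ha
    · simp_all
    · obtain ⟨a', ha', ha'p, θ, hθ, h⟩ := hε.exists_eq_pow_mul ((hε.gal (σ : GalQp p)).pow ha a.2)
      refine ⟨single ⟨a', ha'p⟩ (tΛ n ⟨θ, hθ⟩ • P.gammaL n (QuotientGroup.mk σ) (c a)), Pi.single_eq_of_ne (fun h0 => ha' (congrArg Fin.val h0).symm) _, ?_⟩
      rw [sumL_apply, sum_eq_single ⟨a', ha'p⟩ (fun i _ hi => by simp_all) (fun h0 => absurd (mem_univ _) h0), Pi.single_eq_same,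
        LinearMap.map_smulₛₗ, frob_tL, smul_smul, ← map_pow, ← map_pow, ← map_mul]
      congr 2
      exact Subtype.ext h.symm

lemma IsTower.hasContinuousInverseOn {η : cyclM p} (he : IsEps p (η : Ĉ)) {γ : GammaK K} {r : ℕ} (hη : ∀ n, γΛ n γ (tΛ n ⟨ε, hε.mem_cycl⟩) = tΛ n (⟨ε, hε.mem_cycl⟩ * η ^ p ^ (r + 1)))
    (hγ : ∀ n, c₀ ≤ n → ∀ {e} (he : IsEps p e), IsHomeomorph fun x : DΛ D n => teichL K u lam b he.mem_cycl n ^ p ^ c₀ • P.gammaL n γ x - x) (hr : c₀ ≤ r) {n : ℕ} (hn : r ≤ n) :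
    HasContinuousInverseOn (fun x => P.gammaL (n + 1) γ x - x) {x : DΛ D (n + 1) | P.psi hε n x = 0} := by
  have hp := prm p
  have hS := T.isHomeomorph_sumL P (hr.trans hn)
  let i₀ : Fin p := ⟨0, hp.pos⟩
  have hG : ∀ a : Fin p, ∃ h : DΛ D n ≃ₜ DΛ D n, (a = i₀ → h = Homeomorph.refl _) ∧ (a ≠ i₀ → ∀ x, h x = tΛ n ((η ^ (a : ℕ)) ^ p ^ r) • P.gammaL n γ x - x) := fun a => by
    rcases eq_or_ne a i₀ with ha | ha
    · exact ⟨_, fun _ => rfl, fun h => absurd ha h⟩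
    · exact ⟨(T.isHomeomorph_smul_gammaL_sub P hη hγ hr (lt_succ_self r) n hn (η ^ (a : ℕ)) (he.pow (fun h => ha (Fin.ext h)) a.2)).homeomorph, fun h => absurd h ha, fun _ x => rfl⟩
  choose G hG0 hG1 using hG
  let Φ := hS.homeomorph
  have hpsi : ∀ c, Φ c ∈ {x | P.psi hε n x = 0} ↔ c i₀ = 0 := fun c => Eq.to_iff (congrArg (· = 0) (psi_sumL P hε hS.injective c))
  have h0 : ∀ a (h : a = i₀) x, G a x = x := fun a h x => by rw [hG0 a h]; rfl
  have h0' : ∀ a (h : a = i₀) x, (G a).symm x = x := fun a h x => by rw [hG0 a h]; rfl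
  have hF : ∀ c, c i₀ = 0 → P.gammaL (n + 1) γ (Φ c) - Φ c = Φ fun a => G a (c a) := fun c hc => by
    have h1 := smul_gammaL_sumL_sub P (t := 0) (hη (n + 1)) 1 c
    rw [one_pow, map_one, one_smul] at h1; refine h1.trans (congrArg _ (funext fun a => ?_))
    rcases eq_or_ne a i₀ with rfl | ha
    · rw [h0 _ rfl, hc, map_zero, smul_zero, sub_zero]
    · rw [hG1 a ha, show 1 * (η ^ (a : ℕ)) ^ p ^ 0 = η ^ (a : ℕ) by simp]
  refine ⟨fun x hx => ?_, fun x => Φ fun a => (G a).symm (Φ.symm x a), fun x hx => ?_, ⟨fun x hx => ?_, fun x hx => ?_⟩, ?_⟩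
  · obtain ⟨c, rfl⟩ := Φ.surjective x; rw [hpsi] at hx; exact Set.mem_of_eq_of_mem (hF c hx) ((hpsi _).2 (by rw [h0 _ rfl, hx]))
  · obtain ⟨c, rfl⟩ := Φ.surjective x; rw [hpsi] at hx ⊢; rw [h0' _ rfl, Φ.symm_apply_apply, hx]
  · obtain ⟨c, rfl⟩ := Φ.surjective x; rw [hpsi] at hx; simp only [hF c hx, Φ.symm_apply_apply, Homeomorph.symm_apply_apply]
  · obtain ⟨c, rfl⟩ := Φ.surjective x; rw [hpsi] at hx; refine (hF _ (by rw [h0' _ rfl, Φ.symm_apply_apply, hx])).trans ?_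
    simp
  · exact (Φ.continuous.comp (continuous_pi fun a => (G a).symm.continuous.comp ((continuous_apply a).comp Φ.symm.continuous))).continuousOn

variable (D) in
/-- The action of `Γ_K` as a homomorphism. -/
def gammaHom (n : ℕ) : GammaK K →* AddMonoid.End (DΛ D n) where
  toFun γ := (P.gammaL n γ).toAddMonoidHom
  map_one' := AddMonoidHom.ext (gammaL_one P n)
  map_mul' γ γ' := AddMonoidHom.ext (gammaL_mul P n γ γ')

lemma IsTower.exists_bound [FiniteDimensional ℚ_[p] K] [IsModuleTopology (Λ 0) D] : ∃ n₀ : ℕ, ∀ γ : GammaK K, ¬ IsOfFinOrder γ → ∀ n : ℕ, n₀ ≤ n →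
    depth K (γ ^ (2 * (p - 1))) ≤ n + 1 → HasContinuousInverseOn (fun x => P.gammaL (n + 1) γ x - x) {x : DΛ D (n + 1) | P.psi hε n x = 0} := by
  have hp := prm p
  obtain ⟨d, g, hg⟩ := Module.Finite.exists_fin (R := Λ 0) (M := D)
  obtain ⟨k, hk⟩ := exists_depth_of_eventually (T.eventually_isHomeomorph P hg)
  refine ⟨max k (c₀ + 1), fun γ hγ n hn hd => ?_⟩
  have h1 : chiK K (γ ^ (2 * (p - 1))) ≠ 1 := fun h => hγ (isOfFinOrder_iff_pow_eq_one.2 ⟨_, by have := hp.two_le; lia, chiK_injective (h.trans (map_one _).symm)⟩)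
  have h2 := hasDepth_depth h1
  set δ := depth K (γ ^ (2 * (p - 1)))
  obtain ⟨h3, h4⟩ := pos_of_hasDepth (z := chiK K γ) (by rwa [← map_pow])
  have h5 := h2.pow_p_pow h3 h4 (max k (c₀ + 1) - δ)
  obtain ⟨r, hr⟩ : ∃ r, δ + (max k (c₀ + 1) - δ) = r + 1 := ⟨δ + (max k (c₀ + 1) - δ) - 1, by lia⟩
  rw [hr, ← val_pow_eq_pow_val, ← map_pow, ← pow_mul] at h5
  set N := 2 * (p - 1) * p ^ (max k (c₀ + 1) - δ)
  obtain ⟨σ, hσ⟩ := QuotientGroup.mk_surjective (γ ^ N)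
  obtain ⟨η, hη, hση⟩ := hε.exists_galFlat_eq (σ := (σ : GalQp p)) (k := r + 1) (by rw [← hσ] at h5; exact h5)
  obtain ⟨S, hS, hSγ⟩ := T.exists_psi_ker P (n := n) (by lia)
  have h6 : HasContinuousInverseOn (fun x => P.gammaL (n + 1) (γ ^ N) x - x) {x : DΛ D (n + 1) | P.psi hε n x = 0} := by
    refine T.hasContinuousInverseOn P (η := ⟨η, hη.mem_cycl⟩) (r := r) hη (fun i => ?_) (fun i hi e he => hk _ ((pow_dvd_pow _ (by lia)).trans h5.1) i hi he) (by lia) (by lia)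
    rw [← hσ, gam_tL]; exact congrArg _ (Subtype.ext hση)
  have := (T.tate (n + 1) (by lia)).topr
  have := toContinuousAdd (Λ (n + 1)) (DΛ D (n + 1))
  refine HasContinuousInverseOn.of_pow (f := gammaHom D P (n + 1) γ) (IsModuleTopology.continuous_of_linearMapₛₗ (continuous_gam lam b (n + 1) γ) (P.gammaL (n + 1) γ)) S hS (hSγ γ) N ?_
  rw [← map_pow]
  exact h6

end Tower

end PseudoPhiGamma

end

/-- Let `R₀` be strictly topologically of finite type over `D_λ^∘`, `λ = m' / m`, with
pseudo-uniformizer `u`, and let `b > 0` satisfy `b < r_K λ` and `1 / (b v(ϖ)) = s ∈ ℕ`, where `ϖ` is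
a uniformizer of `𝐄_K`. For a `(φ, Γ_K)`-module structure `P` on a finite `Λ_{R₀,[0,b],K}`-module
`D` there is `n₀` such that for all `γ ∈ Γ_K` of infinite order and all `n ≥ n₀` (written `n + 1`
below) with `v_p(χ(γ)^(2(p-1)) - 1) ≤ n`, the operator `γ - 1` acts with continuous inverse on
`(Λ_{R₀,[0,b/p^n],K} ⊗ D)^{ψ = 0}`. -/
theorem mainTheorem8 {p : ℕ} [Fact p.Prime]
    (K : IntermediateField ℚ_[p] (PadicAlgCl p)) [FiniteDimensional ℚ_[p] K]
    {R₀ : Type*} [CommRing R₀] [Algebra ℤ_[p] R₀]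
    (u : R₀) (hu : u ∈ nonZeroDivisors R₀)
    (m m' : ℕ) (hm : 0 < m) (hm' : 0 < m') (hmm' : m.Coprime m') (hR₀ : IsStrictlyTFT p m m' u)
    (ε : CFlat p) (hε : IsEps p ε)
    (b : ℝ≥0) (hb : 0 < b) (hbr : (b : ℝ) < rK K * ((m' : ℝ) / m))
    (ϖ : CFlat p) (hϖ : IsUniformizerEK K ϖ) (s : ℕ) (hs : (s : ℝ) * (b * flatOrd p ϖ) = 1)
    {D : Type*} [AddCommGroup D] [Module (LamL K u ((m' : ℝ≥0) / m) b 0) D]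
    [Module.Finite (LamL K u ((m' : ℝ≥0) / m) b 0) D]
    [TopologicalSpace D] [IsModuleTopology (LamL K u ((m' : ℝ≥0) / m) b 0) D]
    (P : PhiGammaStr K u ((m' : ℝ≥0) / m) b D) :
    ∃ n₀ : ℕ, ∀ γ : GammaK K, ¬ IsOfFinOrder γ → ∀ n : ℕ, n₀ ≤ n →
      depth K (γ ^ (2 * (p - 1))) ≤ n + 1 →
        HasContinuousInverseOn (fun x => P.gammaL (n + 1) γ x - x)
          {x : DL K u ((m' : ℝ≥0) / m) b D (n + 1) | P.psi hε n x = 0} := by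
  obtain ⟨c₀, L, τ, T⟩ := exists_isTower (u := u) hm hm' hR₀ hε hb hbr hϖ hs
  exact T.exists_bound P
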